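/- Let $\nabla$ be the set of sequences $\lambda=(\lambda_1\ge\lambda_2\ge\cdots)$ in $[0,1]$ with $\sum_j\lambda_j\le 1$, and let $p$ be a probability measure on $\nabla$ with exponential decay: there is $r\in(0,1)$ such that for $p$-almost every $\lambda$ there is $C>0$ with $\lambda_j\le Cr^j$ for all $j\ge1$. Let $y=(y_j)_{j\ge1}$ be a random vector with law $p$ and put $y_0:=\sum_{j\ge1}y_j$. Conditionally on $y$, let $x_1,x_2,\dots$ be i.i.d. uniform points on the disjoint union of circles $\mathcal C_j$ of perimeters $y_j$ ($j\ge1$) and of a segment $S$ of length $1-y_0$. For $n\ge1$ let $\sigma_n$ be the permutation of $\{1,\dots,n\}$ such that $\sigma_n(k)=k$ if $x_k\in S$, and, if $x_k\in\mathcal C_j$, $\sigma_n(k)$ is the index of the first of the points $x_1,\dots,x_n$ on $\mathcal C_j$ that is met after $x_k$ when one follows $\mathcal C_j$ counterclockwise. Let $M_n$ be the permutation matrix $(M_n)_{i,k}=\mathbf 1_{i=\sigma_n(k)}$, and let $\widetilde M_n$ be obtained from $M_n$ by replacing its non-zero entries by random variables that are, conditionally on $\sigma_n$, i.i.d. uniform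 on the unit circle. With $Z_n(z)=\det(zI-M_n)$ and $\widetilde Z_n(z)=\det(zI-\widetilde M_n)$, put $$\widetilde\xi_n(z)=\frac{\widetilde Z_n(e^{2i\pi z/n})}{\widetilde Z_n(1)},\qquad \xi_{n,\alpha}(z)=\frac{Z_n(e^{2i\pi(z/n+\alpha)})}{Z_n(e^{2i\pi\alpha})}.$$ Let $(u_j)_{j\ge1}$ be i.i.d. uniform on the unit circle and independent of $y$. Conditionally on $(y,(u_j)_j)$ let $\{w_k:k\in\mathbb Z\}$ be the points of a Poisson process on $\mathbb R$ with intensity $1-y_0$, labelled so that $\cdots<w_{-1}<0\le w_0<w_1<\cdots$. The product $\prod_{k\in\mathbb Z}(1-z/w_k)$ means $(1-z/w_0)\prod_{k\ge1}(1-z/w_k)(1-z/w_{-k})$, and it is $1$ by convention if $y_0=1$. Then, almost surely, this product and the product $\prod_{j\ge1}\frac{e^{2i\pi zy_j}-u_j}{1-u_j}$ converge locally uniformly in $z\in\mathbb C$, and the following convergences hold in law on the space of continuous functions $\mathbb C\to\mathbb C$ with the topology of uniform convergence on compact sets, as $n\to\infty$. (i) $$\widetilde\xi_n(z)\Longrightarrow\Bigl(\prod_{j\ge1}\frac{e^{2i\pi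 zy_j}-u_j}{1-u_j}\Bigr)\,e^{i\pi z(1-y_0)}\prod_{k\in\mathbb Z}\Bigl(1-\frac z{w_k}\Bigr).$$ (ii) Assume moreover that almost surely $y_1+\dots+y_k<1$ for every $k\ge1$ (that is, almost surely $y$ is not a finite sequence of total mass $1$). Then for every irrational $\alpha$ of finite type, that is, such that $\sup\{\gamma\in\mathbb R:\liminf_{n\to\infty}n^\gamma\|n\alpha\|=0\}<\infty$ with $\|\cdot\|$ the distance to the nearest integer, $$\xi_{n,\alpha}(z)\Longrightarrow\Bigl(\prod_{j\ge1}\frac{e^{2i\pi zy_j}-u_j}{1-u_j}\Bigr)\,e^{i\pi z(1-y_0)\left(1-\frac{i}{\tan(\pi\alpha)}\right)}.$$ -/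

import Mathlib

open MeasureTheory ProbabilityTheory Filter Topology

noncomputable section

namespace RandomPerm

/-! ### The simplex of mass partitions and exponential decay

Sequences indexed by `j ≥ 1` on paper are indexed by `ℕ` (that is, by `j - 1`) here. -/

/-- Non-increasing sequences in `[0,1]` of total sum at most `1`. -/
def nabla : Set (ℕ → ℝ) :=
  {l | (∀ j, l j ∈ Set.Icc (0 : ℝ) 1) ∧ Antitone l ∧ Summable l ∧ ∑' j, l j ≤ 1}

/-- There is a deterministic rate `r ∈ (0,1)` such that almost every sequence is bounded by
`C r ^ j` (`j ≥ 1`) for some constant `C > 0` which may depend on the sequence. -/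
def HasExponentialDecay (p : Measure (ℕ → ℝ)) : Prop :=
  ∃ r ∈ Set.Ioo (0 : ℝ) 1, ∀ᵐ l ∂p, ∃ C > 0, ∀ j, l j ≤ C * r ^ (j + 1)

/-! ### Points on the disjoint union of circles and of a segment -/

/-- `Sum.inl (j, t)` is the point at arc length `t` (measured counterclockwise from an origin) on
the `j`-th circle; `Sum.inr t` is the point at position `t` of the segment. -/
abbrev Point : Type := (ℕ × ℝ) ⊕ ℝ

/-- The uniform distribution on the disjoint union `E_l` of circles of perimeters `l j`, the
`j`-th one being parametrized by `[0, l j)`, and of a segment of length `1 - ∑ l j`. -/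
def uniformPoint (l : ℕ → ℝ) : Measure Point :=
  Measure.sum (fun j ↦ (volume.restrict (Set.Ico 0 (l j))).map fun t ↦ (Sum.inl (j, t) : Point))
    + (volume.restrict (Set.Ico 0 (1 - ∑' j, l j))).map fun t ↦ (Sum.inr t : Point)

/-- Length of the counterclockwise path from position `s` until the first visit of position `t`
on a circle of perimeter `L`; it is a full turn `L` if `s = t`. -/
def ccwDist (L s t : ℝ) : ℝ := if s < t then t - s else t - s + L

/-- `i` is the image of `k` under the permutation induced by the points `x 0, …, x (n-1)`: if `x k`
is on the segment then `i = k`, and otherwise `x i` is the first of these points that is met after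
`x k` when one follows the circle of `x k` counterclockwise. -/
def IsNextPoint (l : ℕ → ℝ) (x : ℕ → Point) {n : ℕ} (k i : Fin n) : Prop :=
  match x k with
  | Sum.inr _ => i = k
  | Sum.inl (j, s) => ∃ t, x i = Sum.inl (j, t) ∧
      ∀ (m : Fin n) (t' : ℝ), x m = Sum.inl (j, t') → ccwDist (l j) s t ≤ ccwDist (l j) s t'

open Classical in
/-- The permutation of `{0, …, n-1}` induced by the points `x 0, …, x (n-1)` of `E_l`. It is well
defined as soon as these points are pairwise distinct, which is almost surely the case. -/
def circlePerm (l : ℕ → ℝ) (x : ℕ → Point) (n : ℕ) : Equiv.Perm (Fin n) :=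
  if h : ∃ σ : Equiv.Perm (Fin n), ∀ k, IsNextPoint l x k (σ k) then h.choose else 1

/-- `y` has law `p` and, conditionally on `y`, the points `x 0, x 1, …` are independent and
uniformly distributed on `E_y`. -/
structure IsCoupling {Ω : Type*} [MeasurableSpace Ω] (μ : Measure Ω) (p : Measure (ℕ → ℝ))
    (y : Ω → ℕ → ℝ) (x : Ω → ℕ → Point) : Prop where
  measurable_y : Measurable y
  measurable_x : Measurable x
  law : ∀ A : Set (ℕ → ℝ), MeasurableSet A → ∀ (n : ℕ) (B : ℕ → Set Point),
    (∀ k, MeasurableSet (B k)) →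
      μ {ω | y ω ∈ A ∧ ∀ k < n, x ω k ∈ B k}
        = ∫⁻ l in A, ∏ k ∈ Finset.range n, uniformPoint l (B k) ∂p

/-! ### Permutation matrices and their modifications -/

/-- The matrix with entry `v k` in position `(σ k, k)`, and zeros elsewhere. -/
def weightedPermMatrix {n : ℕ} (σ : Equiv.Perm (Fin n)) (v : Fin n → ℂ) :
    Matrix (Fin n) (Fin n) ℂ :=
  Matrix.of fun i k ↦ if i = σ k then v k else 0

/-- The permutation matrix of `σ`, with entry `1` in position `(σ k, k)`. -/
def permMatrix {n : ℕ} (σ : Equiv.Perm (Fin n)) : Matrix (Fin n) (Fin n) ℂ :=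
  weightedPermMatrix σ fun _ ↦ 1

/-- The uniform distribution on the unit circle of `ℂ`. -/
def uniformCircle : Measure ℂ :=
  (volume.restrict (Set.Ico (0 : ℝ) 1)).map fun t : ℝ ↦ Complex.exp (2 * Complex.I * Real.pi * t)

/-- The random matrix `M` is a random modified permutation matrix corresponding to the random
permutation `σ`: its non-zero entries are, conditionally on `σ`, independent and uniformly
distributed on the unit circle. -/
def IsRandomModifiedPermMatrix {Ω : Type*} [MeasurableSpace Ω] (μ : Measure Ω) {n : ℕ}
    (σ : Ω → Equiv.Perm (Fin n)) (M : Ω → Matrix (Fin n) (Fin n) ℂ) : Prop :=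
  ∃ v : Ω → Fin n → ℂ, Measurable v ∧ (∀ᵐ ω ∂μ, M ω = weightedPermMatrix (σ ω) (v ω)) ∧
    ∀ (τ : Equiv.Perm (Fin n)) (B : Fin n → Set ℂ), (∀ k, MeasurableSet (B k)) →
      μ {ω | σ ω = τ ∧ ∀ k, v ω k ∈ B k} = μ {ω | σ ω = τ} * ∏ k, uniformCircle (B k)

/-- The characteristic polynomial `det (z I - M)`. -/
def charDet {n : ℕ} (M : Matrix (Fin n) (Fin n) ℂ) (z : ℂ) : ℂ :=
  (z • (1 : Matrix (Fin n) (Fin n) ℂ) - M).det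

lemma continuous_charDet {n : ℕ} (M : Matrix (Fin n) (Fin n) ℂ) : Continuous (charDet M) :=
  Continuous.matrix_det (by fun_prop)

/-- `z ↦ Z (e^{2iπz/n}) / Z 1`, where `Z` is the characteristic polynomial of `M`. -/
def xiTilde {n : ℕ} (M : Matrix (Fin n) (Fin n) ℂ) : C(ℂ, ℂ) where
  toFun z := charDet M (Complex.exp (2 * Complex.I * Real.pi * (z / n))) / charDet M 1
  continuous_toFun := ((continuous_charDet M).comp (by fun_prop)).div_const _

/-- `z ↦ Z (e^{2iπ(z/n+α)}) / Z (e^{2iπα})`, where `Z` is the characteristic polynomial of `M`. -/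
def xiShift (α : ℝ) {n : ℕ} (M : Matrix (Fin n) (Fin n) ℂ) : C(ℂ, ℂ) where
  toFun z := charDet M (Complex.exp (2 * Complex.I * Real.pi * (z / n + α))) /
    charDet M (Complex.exp (2 * Complex.I * Real.pi * α))
  continuous_toFun := ((continuous_charDet M).comp (by fun_prop)).div_const _

/-! ### Irrational numbers of finite type -/

/-- Distance to the nearest integer. -/
def distInt (x : ℝ) : ℝ := |x - round x|

/-- The type of a real number: the supremum of the real `γ` such that
`liminf n ^ γ * ‖n x‖ = 0`. -/
def diophantineType (x : ℝ) : EReal :=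
  sSup {g : EReal | ∃ γ : ℝ, g = γ ∧
    liminf (fun n : ℕ ↦ ENNReal.ofReal ((n : ℝ) ^ γ * distInt (n * x))) atTop = 0}

/-- The type is finite. -/
def IsFiniteType (x : ℝ) : Prop := diophantineType x < ⊤

/-! ### The limiting objects -/

/-- `C(ℂ, ℂ)` carries the topology of uniform convergence on compact sets; we endow it with the
Borel σ-algebra. -/
instance : MeasurableSpace C(ℂ, ℂ) := borel _

instance : BorelSpace C(ℂ, ℂ) := ⟨rfl⟩

/-- `y` has law `p`, the `u j` are independent and uniform on the unit circle, and `y` is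
independent of `(u j)_j`. -/
structure IsLimitData {Ω : Type*} [MeasurableSpace Ω] (μ : Measure Ω) (p : Measure (ℕ → ℝ))
    (y : Ω → ℕ → ℝ) (u : Ω → ℕ → ℂ) : Prop where
  measurable_y : Measurable y
  measurable_u : Measurable u
  law_y : μ.map y = p
  law_u : ∀ j, μ.map (fun ω ↦ u ω j) = uniformCircle
  indep_u : iIndepFun (fun j ω ↦ u ω j) μ
  indep_yu : IndepFun y u μ

/-- Conditionally on the random element `G`, of which the intensity `c` is a function, the `w k`,
`k ∈ ℤ`, are the points of a homogeneous Poisson process on `ℝ` with intensity `c`, labelled so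
that `⋯ < w (-2) < w (-1) < 0 ≤ w 0 < w 1 < ⋯`. Nothing is required where `c = 0`, as there are no
points then. -/
structure IsPoissonPoints {Ω γ : Type*} [MeasurableSpace Ω] [MeasurableSpace γ] (μ : Measure Ω)
    (G : Ω → γ) (c : γ → ℝ) (w : Ω → ℤ → ℝ) : Prop where
  measurable_w : Measurable w
  labelling : ∀ᵐ ω ∂μ, 0 < c (G ω) → StrictMono (w ω) ∧ w ω (-1) < 0 ∧ 0 ≤ w ω 0
  counts : ∀ A : Set γ, MeasurableSet A → A ⊆ {g | 0 < c g} →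
    ∀ (m : ℕ) (B : Fin m → Set ℝ) (N : Fin m → ℕ), (∀ i, MeasurableSet (B i)) →
      (∀ i, Bornology.IsBounded (B i)) → Pairwise (Function.onFun Disjoint B) →
      μ {ω | G ω ∈ A ∧ ∀ i, (w ω ⁻¹' B i).encard = N i}
        = ∫⁻ ω in G ⁻¹' A,
            ∏ i, poissonMeasure ((c (G ω)).toNNReal * (volume (B i)).toNNReal) {N i} ∂μ

/-- Partial products of `∏_j (e^{2iπ z y_j} - u_j) / (1 - u_j)`. -/
def circlePartialProd (y : ℕ → ℝ) (u : ℕ → ℂ) (J : ℕ) (z : ℂ) : ℂ :=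
  ∏ j ∈ Finset.range J,
    (Complex.exp (2 * Complex.I * Real.pi * z * y j) - u j) / (1 - u j)

/-- Symmetric partial products of `∏_{k ∈ ℤ} (1 - z / w_k)`. -/
def poissonPartialProd (w : ℤ → ℝ) (K : ℕ) (z : ℂ) : ℂ :=
  (1 - z / w 0) * ∏ k ∈ Finset.Icc 1 K, (1 - z / w k) * (1 - z / w (-(k : ℤ)))

/-- The function `z ↦ e^{a z}`. -/
def expMul (a : ℂ) : C(ℂ, ℂ) where
  toFun z := Complex.exp (a * z)

end RandomPerm

end

open MeasureTheory ProbabilityTheory Filter Topology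

namespace RandomPerm

/-! ### Characteristic polynomials of weighted permutation matrices -/

/-! The circles that carry points are the cycles of the permutation, and the points of the segment
are its fixed points. Hence the characteristic polynomial factorizes. Let N_j be the number of
points on the j-th circle, W_j the product of the non-zero entries v_k over these points. Then
Z(e^{2iπz/n}) / Z(1) is the product over j of 1 + (e^{2iπzN_j/n} - 1) / (1 - W_j), times the product
over the points of the segment of 1 + (e^{2iπz/n} - 1) / (1 - v_k) (`charDet_div_charDet_one`,
`GoodPoints.circlePerm_isCycleOn`). Both assertions concern this formula in one `model`, where v_k =
e^{2iπθ_k} with i.i.d. angles independent of the points: uniform on [-1/2, 1/2) for (i), constant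
equal to -α for (ii), because a shift by α of the argument is a multiplication of the matrix by
e^{-2iπα} (`xiTilde_weighted_eq_xiShift`).

For finitely many circles, the proportions N_j / n, the weights W_j, the proportion of points on the
segment and the numbers of rescaled angles n θ_k in given cells converge jointly
(`tendstoInDistribution_modelObs`). Indeed a character of these data is multiplicative over the
points, so that conditionally on the perimeters its mean is the n-th power of a one-point mean. If
the character tests the weight of a circle of positive length, the one-point mean has a limit of
modulus less than one and the power vanishes, which makes the limiting weights uniform and
independent; otherwise the one-point mean is 1 + O(1/n) and the power tends to an exponential, which
is where the Poisson law comes from.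

The passage to infinitely many circles is a small divisor problem: the sum over j ≥ m of (N_j / n)
|1 - W_j|⁻¹ has to be small uniformly in n (`HasSmallDivisors`). A Fejér kernel bounds the
probability that an occupied circle has |1 - W_j| ≤ 1/H by 4/H plus Fourier terms
(`measure_circleWeight_near_one_le`). With H = (j+1)² this is summable, while the loss (j+1)² is
absorbed by the exponential decay of the perimeters. For uniform angles the Fourier terms vanish.
For a constant angle they are exponentially small on circles with many points, thanks to the
Diophantine bound |1 - e^{2iπdα}| ≥ c / |d|^γ; on circles with few points this bound is applied to
W_j itself (`tail_dirac`).

On the segment, with b = 1 / (1 - v), a factor is e^{bw} up to second order, where w = 2iπz/n. For a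
constant angle this gives the exponential of (ii). For uniform angles, Re b = 1/2 and Im b is odd in
the angle: the points with |n θ| ≥ m contribute e^{w/2} each, up to fluctuations that are small for
large m (`segProd_approx`), and those in the window [-m, m) contribute 1 - z / (n θ) in the limit,
apart from the same e^{w/2}. Cutting the window into cells makes this product a continuous function
of counts (`cell_product_approx`).

The limiting products exist by Borel–Cantelli arguments: |1 - u_j| ≥ 4 / (j+1)² eventually, and the
counts of the Poisson points up to distance m⁴ deviate from their means by at most m³, so that 1/w_k
= c/k + O(k^{-5/4}) for the intensity c and symmetric pairs of factors are 1 + O(k^{-5/4})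
(`exists_tendsto_poissonWindow`). The approximations are glued by an iterated limit theorem that
allows relative errors (`tendstoInDistribution_of_approx_mul`). -/

theorem det_smul_one_sub_of_isCycleOn_univ {ι : Type*} [Fintype ι] [DecidableEq ι] [Nonempty ι]
    (σ : Equiv.Perm ι) (hσ : σ.IsCycleOn Set.univ) (v : ι → ℂ) (z : ℂ) :
    (z • (1 : Matrix ι ι ℂ) - Matrix.of fun i k ↦ if i = σ k then v k else 0).det
      = z ^ Fintype.card ι - ∏ k, v k := by
  rcases subsingleton_or_nontrivial ι with h | h
  · obtain ⟨i⟩ := ‹Nonempty ι›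
    have : Unique ι := ⟨⟨i⟩, fun a ↦ Subsingleton.elim _ _⟩
    rw [Matrix.det_unique]
    simp [Matrix.sub_apply, Subsingleton.elim (σ default) default]
  · have hne : ∀ i, σ i ≠ i := fun i ↦ hσ.apply_ne Set.nontrivial_univ (Set.mem_univ i)
    have h1σ : (1 : Equiv.Perm ι) ≠ σ := by
      intro h
      obtain ⟨i⟩ := ‹Nonempty ι›
      exact hne i (by rw [← h]; rfl)
    have hcyc : σ.IsCycle := by
      obtain ⟨i⟩ := ‹Nonempty ι›
      exact ⟨i, hne i, fun j _ ↦ hσ.2 (Set.mem_univ i) (Set.mem_univ j)⟩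
    have hsupp : σ.support = Finset.univ := by
      ext i; simp [hne i]
    -- In the Leibniz expansion only the identity (diagonal entries z) and σ (entries -v k)
    -- contribute.
    rw [Matrix.det_apply, Finset.sum_eq_add (1 : Equiv.Perm ι) σ h1σ]
    · have e1 : ∀ k, (z • (1 : Matrix ι ι ℂ) - Matrix.of fun i k ↦ if i = σ k then v k else 0)
          ((1 : Equiv.Perm ι) k) k = z := by
        intro k
        simp [Matrix.sub_apply, (hne k).symm]
      have e2 : ∀ k, (z • (1 : Matrix ι ι ℂ) - Matrix.of fun i k ↦ if i = σ k then v k else 0)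
          (σ k) k = - v k := by
        intro k
        simp [Matrix.sub_apply, hne k]
      simp only [e1, e2, Finset.prod_neg, hcyc.sign, hsupp]
      simp only [Equiv.Perm.sign_one, one_smul, Finset.prod_const, Finset.card_univ,
        Units.smul_def, Units.val_neg, Units.val_pow_eq_pow_val, Units.val_one]
      -- The sign of the cycle is -(-1)^card and the entries bring (-1)^card, so the product is -∏
      -- v. The two powers, in ℤ and in ℂ, agree, which excludes the mixed cases.
      rcases neg_one_pow_eq_or ℂ (Fintype.card ι) with h | h <;>
        rcases neg_one_pow_eq_or ℤ (Fintype.card ι) with h' | h'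
      · rw [h, h']; simp; ring
      · exfalso
        have := congrArg (Int.cast : ℤ → ℂ) h'
        push_cast at this
        rw [h] at this; norm_num at this
      · exfalso
        have := congrArg (Int.cast : ℤ → ℂ) h'
        push_cast at this
        rw [h] at this; norm_num at this
      · rw [h, h']; simp; ring
    · intro τ _ hτ
      have : ∃ i, τ i ≠ i ∧ τ i ≠ σ i := by
        by_contra! hcon
        -- A contributing τ has τ i ∈ {i, σ i} everywhere. Once τ i = σ i, injectivity forbids τ (σ
        -- i) = σ i, so agreement with σ spreads along the whole cycle and τ is either the identity
        -- or σ.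
        have key : ∀ i, τ i = σ i → τ (σ i) = σ (σ i) := by
          intro i hi
          apply hcon
          intro h'
          exact hne i (τ.injective (h'.trans hi.symm))
        by_cases hex : ∃ i, τ i = σ i
        · obtain ⟨i, hi⟩ := hex
          have hall : ∀ m : ℕ, τ ((σ ^ m) i) = σ ((σ ^ m) i) := by
            intro m
            induction m with
            | zero => simpa using hi
            | succ m ih => rw [pow_succ', Equiv.Perm.mul_apply]; exact key _ ih
          apply hτ.2
          ext j
          obtain ⟨m, hm⟩ := hcyc.exists_pow_eq (hne i) (hne j)
          rw [← hm]; exact hall m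
        · push Not at hex
          apply hτ.1
          ext j
          by_contra hj
          exact hex j (hcon j hj)
      obtain ⟨i, hi1, hi2⟩ := this
      rw [Finset.prod_eq_zero (Finset.mem_univ i), smul_zero]
      simp [Matrix.sub_apply, hi1, hi2]
    · simp
    · simp

/-- As σ preserves the fibres of `b`, no entry joins distinct fibres: the matrix is block diagonal.
The order on `α` serves only to see it as block triangular. -/
theorem det_smul_one_sub_of_isCycleOn_fibers {ι α : Type*} [Fintype ι] [DecidableEq ι]
    [LinearOrder α] (b : ι → α) (σ : Equiv.Perm ι)
    (hσ : ∀ a, σ.IsCycleOn {k | b k = a}) (v : ι → ℂ) (z : ℂ) :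
    (z • (1 : Matrix ι ι ℂ) - Matrix.of fun i k ↦ if i = σ k then v k else 0).det
      = ∏ a ∈ Finset.univ.image b,
        (z ^ (Finset.univ.filter fun k ↦ b k = a).card -
          ∏ k ∈ Finset.univ.filter fun k ↦ b k = a, v k) := by
  have hb : ∀ k, b (σ k) = b k := fun k ↦ (hσ (b k)).1.mapsTo (rfl : k ∈ {k' | b k' = b k})
  rw [Matrix.BlockTriangular.det (b := b)]
  · refine Finset.prod_congr rfl fun a ha ↦ ?_
    obtain ⟨k₀, -, hk₀⟩ := Finset.mem_image.1 ha
    have hne : Nonempty {k // b k = a} := ⟨⟨k₀, hk₀⟩⟩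
    let τ : Equiv.Perm {k // b k = a} := σ.subtypePerm fun k ↦ by rw [hb]
    have hτ : τ.IsCycleOn Set.univ := by
      have := (hσ a).subtypePerm
      exact this
    have := det_smul_one_sub_of_isCycleOn_univ τ hτ (fun k ↦ v k) z
    rw [Fintype.card_subtype] at this
    rw [Finset.prod_subtype (p := fun k ↦ b k = a) (Finset.univ.filter fun k ↦ b k = a)
      (by simp) v, ← this]
    congr 1
    ext i k
    simp [Matrix.toSquareBlock, Matrix.toSquareBlockProp, Matrix.sub_apply, Matrix.one_apply,
      τ, Subtype.ext_iff]
  · intro i k hik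
    have h1 : i ≠ k := by rintro rfl; exact lt_irrefl _ hik
    have h2 : i ≠ σ k := by rintro rfl; rw [hb] at hik; exact lt_irrefl _ hik
    simp [Matrix.sub_apply, h1, h2]

/-- Number of indices with a given label. -/
def labelCount {n : ℕ} (a : Fin n → Option ℕ) (c : Option ℕ) : ℕ :=
  (Finset.univ.filter fun k ↦ a k = c).card

/-- Product of the weights of the indices with a given label. -/
def labelProd {M : Type*} [CommMonoid M] {n : ℕ} (a : Fin n → Option ℕ) (v : Fin n → M)
    (c : Option ℕ) : M :=
  ∏ k ∈ Finset.univ.filter fun k ↦ a k = c, v k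

/-- Position of an index with respect to the blocks of a permutation of which the indices with
label `some j` form a cycle and the indices with label `none` are fixed points. -/
def blockOf {n : ℕ} (a : Fin n → Option ℕ) (k : Fin n) : Lex (ℕ ⊕ Fin n) :=
  toLex (match a k with
    | some j => Sum.inl j
    | none => Sum.inr k)

theorem blockOf_eq_inl {n : ℕ} (a : Fin n → Option ℕ) (k : Fin n) (j : ℕ) :
    blockOf a k = toLex (Sum.inl j) ↔ a k = some j := by
  unfold blockOf
  cases h : a k <;> simp

theorem blockOf_eq_inr {n : ℕ} (a : Fin n → Option ℕ) (k i : Fin n) :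
    blockOf a k = toLex (Sum.inr i) ↔ a k = none ∧ k = i := by
  unfold blockOf
  cases h : a k <;> simp

/-- A cycle of length N and weight V contributes (w ^ N - V) / (1 - V) = 1 + (w ^ N - 1) / (1 - V).
In this second form a label that no index carries contributes 1 + 0 / 0 = 1, so the product can run
over any range containing the labels that occur. -/
theorem charDet_div_charDet_one {n : ℕ} (a : Fin n → Option ℕ) (σ : Equiv.Perm (Fin n))
    (h0 : ∀ k, a k = none → σ k = k) (h1 : ∀ j, σ.IsCycleOn {k | a k = some j})
    (v : Fin n → ℂ) (hv0 : ∀ k, a k = none → v k ≠ 1)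
    (hv1 : ∀ k j, a k = some j → labelProd a v (some j) ≠ 1) (w : ℂ) (B : ℕ)
    (hB : ∀ k j, a k = some j → j < B) :
    charDet (weightedPermMatrix σ v) w / charDet (weightedPermMatrix σ v) 1
      = (∏ j ∈ Finset.range B,
          (1 + (w ^ labelCount a (some j) - 1) / (1 - labelProd a v (some j)))) *
        ∏ k, if a k = none then 1 + (w - 1) / (1 - v k) else 1 := by
  classical
  have hcyc : ∀ c, σ.IsCycleOn {k | blockOf a k = c} := by
    intro c
    induction c using Lex.rec with | _ c =>
    rcases c with j | i
    · simpa only [blockOf_eq_inl] using h1 j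
    · have : {k | blockOf a k = toLex (Sum.inr i)} ⊆ {i} := by
        intro k hk
        simp only [blockOf_eq_inr, Set.mem_ofPred_eq] at hk
        exact hk.2
      rcases Set.subset_singleton_iff_eq.1 this with h | h
      · rw [h]; simp
      · rw [h]
        have : blockOf a i = toLex (Sum.inr i) := by
          have : i ∈ {k | blockOf a k = toLex (Sum.inr i)} := by rw [h]; rfl
          exact this
        rw [Equiv.Perm.isCycleOn_singleton]
        exact h0 i ((blockOf_eq_inr a i i).1 this).1
  have key := fun w ↦ det_smul_one_sub_of_isCycleOn_fibers (blockOf a) σ hcyc v w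
  simp only [charDet, weightedPermMatrix]
  rw [key, key, ← Finset.prod_div_distrib]
  let S : Finset (Lex (ℕ ⊕ Fin n)) :=
    ((Finset.range B).disjSum (Finset.univ : Finset (Fin n))).map toLex.toEmbedding
  have hS : Finset.univ.image (blockOf a) ⊆ S := by
    intro c hc
    obtain ⟨k, -, rfl⟩ := Finset.mem_image.1 hc
    simp only [S, Finset.mem_map, Equiv.coe_toEmbedding]
    refine ⟨_, ?_, rfl⟩
    cases h : a k with
    | none => simp
    | some j => simp [hB k j h]
  trans ∏ c ∈ S, (1 + (w ^ (Finset.univ.filter fun k ↦ blockOf a k = c).card - 1) /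
          (1 - ∏ k ∈ Finset.univ.filter fun k ↦ blockOf a k = c, v k))
  · rw [← Finset.prod_subset hS]
    · refine Finset.prod_congr rfl fun c hc ↦ ?_
      obtain ⟨k, -, rfl⟩ := Finset.mem_image.1 hc
      have : (1 - ∏ k' ∈ Finset.univ.filter fun k' ↦ blockOf a k' = blockOf a k, v k') ≠ 0 := by
        rw [sub_ne_zero]
        apply Ne.symm
        cases h : a k with
        | none =>
          have h' : blockOf a k = toLex (Sum.inr k) := (blockOf_eq_inr a k k).2 ⟨h, rfl⟩
          have : (Finset.univ.filter fun k' ↦ blockOf a k' = blockOf a k) = {k} := by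
            ext k'
            simp only [h', blockOf_eq_inr, Finset.mem_filter, Finset.mem_univ, true_and,
              Finset.mem_singleton]
            exact ⟨fun h ↦ h.2, fun h'' ↦ by subst h''; exact ⟨h, rfl⟩⟩
          rw [this, Finset.prod_singleton]
          exact hv0 k h
        | some j =>
          have h' : blockOf a k = toLex (Sum.inl j) := (blockOf_eq_inl a k j).2 h
          simp only [h', blockOf_eq_inl]
          exact hv1 k j h
      rw [one_pow, one_add_div this]
      rw [sub_add_sub_cancel']
      congr!
    · intro c _ hc
      have : (Finset.univ.filter fun k ↦ blockOf a k = c) = ∅ := by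
        rw [Finset.filter_eq_empty_iff]
        intro k _ hk
        exact hc (Finset.mem_image.2 ⟨k, Finset.mem_univ _, hk⟩)
      rw [this]
      simp
  · rw [Finset.prod_map, Finset.prod_disjSum]
    congr 1
    · refine Finset.prod_congr rfl fun j _ ↦ ?_
      simp only [Equiv.coe_toEmbedding, blockOf_eq_inl, labelCount, labelProd]
    · refine Finset.prod_congr rfl fun i _ ↦ ?_
      simp only [Equiv.coe_toEmbedding, blockOf_eq_inr]
      split_ifs with h
      · have : (Finset.univ.filter fun k ↦ a k = none ∧ k = i) = {i} := by
          ext k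
          simp only [Finset.mem_filter, Finset.mem_univ, true_and, Finset.mem_singleton]
          exact ⟨fun h ↦ h.2, fun h'' ↦ by subst h''; exact ⟨h, rfl⟩⟩
        rw [this]; simp
      · have : (Finset.univ.filter fun k ↦ a k = none ∧ k = i) = ∅ := by
          rw [Finset.filter_eq_empty_iff]
          rintro k _ ⟨hk, rfl⟩
          exact h hk
        rw [this]; simp

/-! ### Structure of the permutation induced by points on circles -/

/-- The component of a point: `some j` on the `j`-th circle, `none` on the segment. -/
def label : Point → Option ℕ
  | Sum.inl (j, _) => some j
  | Sum.inr _ => none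

/-- The points `x 0, …, x (n-1)` lie on the circles of perimeters `l j`, parametrized by
`(0, l j]`, or on the segment, and no two of them are at the same place of a circle. -/
structure GoodPoints (l : ℕ → ℝ) (x : ℕ → Point) : Prop where
  pos : ∀ k j t, x k = Sum.inl (j, t) → 0 < t
  le : ∀ k j t, x k = Sum.inl (j, t) → t ≤ l j
  inj : ∀ k m j t, x k = Sum.inl (j, t) → x m = Sum.inl (j, t) → k = m

theorem label_eq_some {q : Point} {j : ℕ} : label q = some j ↔ ∃ t, q = Sum.inl (j, t) := by
  rcases q with ⟨j', t⟩ | t <;> simp [label]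

theorem label_eq_none {q : Point} : label q = none ↔ ∃ t, q = Sum.inr t := by
  rcases q with ⟨j', t⟩ | t <;> simp [label]

theorem exists_isNextPoint (l : ℕ → ℝ) (x : ℕ → Point) {n : ℕ} (k : Fin n) :
    ∃ i : Fin n, IsNextPoint l x k i := by
  classical
  unfold IsNextPoint
  rcases hk : x k with ⟨j, s⟩ | s
  · simp only
    let S : Finset (Fin n) := Finset.univ.filter fun m ↦ ∃ t, x m = Sum.inl (j, t)
    have hS : S.Nonempty := ⟨k, by simp [S, hk]⟩
    let pos : Fin n → ℝ := fun m ↦ match x m with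
      | Sum.inl (_, t) => t
      | Sum.inr _ => 0
    obtain ⟨i, hi, hmin⟩ := S.exists_min_image (fun m ↦ ccwDist (l j) s (pos m)) hS
    obtain ⟨t, ht⟩ := (Finset.mem_filter.1 hi).2
    refine ⟨i, t, ht, fun m t' hm ↦ ?_⟩
    have := hmin m (Finset.mem_filter.2 ⟨Finset.mem_univ _, t', hm⟩)
    simpa [pos, ht, hm] using this
  · exact ⟨k, rfl⟩

namespace GoodPoints

/-- A common successor of two positions s ≠ s' of a circle would lie on both counterclockwise arcs
(s, s'] and (s', s], which are disjoint. -/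
theorem isNextPoint_injective {l : ℕ → ℝ} {x : ℕ → Point} (hx : GoodPoints l x) {n : ℕ}
    {k k' i : Fin n} (h : IsNextPoint l x k i)
    (h' : IsNextPoint l x k' i) : k = k' := by
  unfold IsNextPoint at h h'
  rcases hk : x k with ⟨j, s⟩ | s <;> rcases hk' : x k' with ⟨j', s'⟩ | s' <;>
    simp only [hk, hk'] at h h'
  · obtain ⟨t, ht, hmin⟩ := h
    obtain ⟨t', ht', hmin'⟩ := h'
    rw [ht] at ht'
    simp only [Sum.inl.injEq, Prod.mk.injEq] at ht'
    obtain ⟨rfl, rfl⟩ := ht'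
    have a1 := hmin k' s' hk'
    have a2 := hmin' k s hk
    have b1 := hx.pos _ _ _ hk
    have b2 := hx.pos _ _ _ hk'
    have b3 := hx.pos _ _ _ ht
    have c1 := hx.le _ _ _ hk
    have c2 := hx.le _ _ _ hk'
    have c3 := hx.le _ _ _ ht
    have hs : s = s' := by
      unfold ccwDist at a1 a2
      by_contra hne
      rcases lt_or_gt_of_ne hne with h | h <;> split_ifs at a1 a2 <;> linarith
    subst hs
    exact Fin.ext (hx.inj _ _ _ _ hk hk')
  · obtain ⟨t, ht, -⟩ := h
    subst h'
    rw [hk'] at ht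
    simp at ht
  · obtain ⟨t, ht, -⟩ := h'
    subst h
    rw [hk] at ht
    simp at ht
  · exact h.symm.trans h'

theorem isNextPoint_circlePerm {l : ℕ → ℝ} {x : ℕ → Point} (hx : GoodPoints l x)
    (n : ℕ) (k : Fin n) :
    IsNextPoint l x k (circlePerm l x n k) := by
  have h : ∃ σ : Equiv.Perm (Fin n), ∀ k, IsNextPoint l x k (σ k) := by
    choose f hf using fun k : Fin n ↦ exists_isNextPoint l x k
    have hinj : Function.Injective f := by
      intro k k' h
      refine hx.isNextPoint_injective (hf k) ?_
      rw [h]; exact hf k'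
    exact ⟨Equiv.ofBijective f (Finite.injective_iff_bijective.1 hinj), hf⟩
  rw [circlePerm, dif_pos h]
  exact h.choose_spec k

theorem circlePerm_eq_self {l : ℕ → ℝ} {x : ℕ → Point} (hx : GoodPoints l x)
    (n : ℕ) (k : Fin n) (hk : label (x k) = none) :
    circlePerm l x n k = k := by
  obtain ⟨t, ht⟩ := label_eq_none.1 hk
  have := hx.isNextPoint_circlePerm n k
  unfold IsNextPoint at this
  simpa only [ht] using this

/-- To see that every orbit reaches a given point k', consider among the points of the circle whose
orbit misses k' the one with the shortest counterclockwise way to k'. Its successor lies on this way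
and also misses k', hence would be strictly closer, unless it is k' itself, which is absurd. -/
theorem circlePerm_isCycleOn {l : ℕ → ℝ} {x : ℕ → Point} (hx : GoodPoints l x) (n : ℕ) (j : ℕ) :
    (circlePerm l x n).IsCycleOn {k : Fin n | label (x k) = some j} := by
  classical
  set σ := circlePerm l x n with hσ
  have hmaps : ∀ k : Fin n, label (x k) = some j → label (x (σ k)) = some j := by
    intro k hk
    obtain ⟨s, hs⟩ := label_eq_some.1 hk
    have := hx.isNextPoint_circlePerm n k
    unfold IsNextPoint at this
    simp only [hs] at this
    obtain ⟨t, ht, -⟩ := this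
    exact label_eq_some.2 ⟨t, ht⟩
  have hreach : ∀ k k' : Fin n, label (x k) = some j → label (x k') = some j →
      ∃ m : ℕ, (σ ^ m) k = k' := by
    intro k k' hk hk'
    by_contra hcon
    obtain ⟨s', hs'⟩ := label_eq_some.1 hk'
    let pos : Fin n → ℝ := fun m ↦ match x m with
      | Sum.inl (_, t) => t
      | Sum.inr _ => 0
    let S : Finset (Fin n) := Finset.univ.filter fun m ↦
      label (x m) = some j ∧ ¬ ∃ i : ℕ, (σ ^ i) m = k'
    obtain ⟨m, hm, hmin⟩ := S.exists_min_image (fun m ↦ ccwDist (l j) (pos m) s')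
      ⟨k, by simp [S, hk]; simpa using hcon⟩
    obtain ⟨hm1, hm2⟩ := (Finset.mem_filter.1 hm).2
    have hσm : σ m ∈ S := by
      refine Finset.mem_filter.2 ⟨Finset.mem_univ _, hmaps m hm1, ?_⟩
      rintro ⟨i, hi⟩
      exact hm2 ⟨i + 1, by rw [pow_succ, Equiv.Perm.mul_apply]; exact hi⟩
    have h1 := hmin _ hσm
    obtain ⟨s, hs⟩ := label_eq_some.1 hm1
    have hnext := hx.isNextPoint_circlePerm n m
    unfold IsNextPoint at hnext
    simp only [hs] at hnext
    obtain ⟨t, ht, hnx⟩ := hnext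
    have h2 := hnx k' s' hs'
    have h3 := hnx m s hs
    have hp1 : pos m = s := by simp [pos, hs]
    have hp2 : pos (σ m) = t := by
      have : x (σ m) = Sum.inl (j, t) := ht
      simp [pos, this]
    rw [hp1, hp2] at h1
    have b1 := hx.pos _ _ _ hs
    have b2 := hx.pos _ _ _ hs'
    have b3 := hx.pos _ _ _ ht
    have c1 := hx.le _ _ _ hs
    have c2 := hx.le _ _ _ hs'
    have c3 := hx.le _ _ _ ht
    have hts : t = s' := by
      unfold ccwDist at h1 h2 h3
      by_contra hne
      rcases lt_or_gt_of_ne hne with h | h <;> split_ifs at h1 h2 h3 <;> linarith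
    subst hts
    apply hm2
    refine ⟨1, ?_⟩
    rw [pow_one]
    exact Fin.ext (hx.inj _ _ _ _ ht hs')
  refine ⟨⟨fun k hk ↦ hmaps k hk, σ.injective.injOn, ?_⟩, ?_⟩
  · intro k' hk'
    have hfin : Set.SurjOn σ {k : Fin n | label (x k) = some j}
        {k : Fin n | label (x k) = some j} := by
      have := Finset.surjOn_of_injOn_of_card_le σ
        (s := Finset.univ.filter fun k : Fin n ↦ label (x k) = some j)
        (t := Finset.univ.filter fun k : Fin n ↦ label (x k) = some j)
        (by intro k hk; simpa using hmaps k (by simpa using hk)) σ.injective.injOn le_rfl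
      simpa using this
    exact hfin hk'
  · intro k hk k' hk'
    obtain ⟨m, hm⟩ := hreach k k' hk hk'
    exact ⟨m, by simpa using hm⟩

end GoodPoints

/-! ### Convergence in distribution of random continuous functions -/

/-- Compact convergence is uniform convergence on compact sets, and every compact set is contained
in a ball: a uniformly continuous functional only feels the values on some ball, up to ε. -/
theorem exists_ball_of_uniformContinuous {f : C(ℂ, ℂ) → ℝ} (hf : UniformContinuous f) {ε : ℝ}
    (hε : 0 < ε) : ∃ A δ : ℝ, 0 < δ ∧ ∀ g h : C(ℂ, ℂ),
      (∀ z, ‖z‖ ≤ A → ‖g z - h z‖ ≤ δ) → |f g - f h| ≤ ε := by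
  have h1 := hf (Metric.dist_mem_uniformity hε)
  rw [Filter.mem_map, ContinuousMap.mem_compactConvergence_entourage_iff] at h1
  obtain ⟨K, V, hK, hV, hsub⟩ := h1
  obtain ⟨A, hA⟩ := hK.isBounded.subset_closedBall 0
  obtain ⟨δ, hδ, hδV⟩ := Metric.mem_uniformity_dist.1 hV
  refine ⟨A, δ / 2, by positivity, fun g h hgh ↦ ?_⟩
  have : (g, h) ∈ {fg : C(ℂ, ℂ) × C(ℂ, ℂ) | ∀ x ∈ K, (fg.1 x, fg.2 x) ∈ V} := by
    intro x hx
    apply hδV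
    have h2 := hgh x (by simpa using hA hx)
    rw [dist_eq_norm]
    show ‖g x - h x‖ < δ
    linarith
  have h3 := hsub this
  simp only [Set.mem_preimage, Set.mem_ofPred_eq, Real.dist_eq] at h3
  exact h3.le

section Approximation

variable {Ω : ℕ → Type*} [∀ n, MeasurableSpace (Ω n)] {μ : ∀ n, Measure (Ω n)}
  [∀ n, IsProbabilityMeasure (μ n)] {Ω' : Type*} [MeasurableSpace Ω'] {μ' : Measure Ω'}
  [IsProbabilityMeasure μ']

theorem abs_integral_sub_integral_le {Ω : Type*} [MeasurableSpace Ω] {μ : Measure Ω}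
    [IsProbabilityMeasure μ] {f g : Ω → ℝ} {C ε : ℝ} (hf : Integrable f μ) (hg : Integrable g μ)
    (hC : ∀ ω, |f ω - g ω| ≤ C) (hε : 0 ≤ ε) (hbad : μ {ω | ε < |f ω - g ω|} ≤ ENNReal.ofReal ε) :
    |∫ ω, f ω ∂μ - ∫ ω, g ω ∂μ| ≤ ε + C * ε := by
  have hC0 : 0 ≤ C := by
    obtain ⟨ω⟩ : Nonempty Ω := μ.nonempty_of_neZero
    exact (abs_nonneg _).trans (hC ω)
  -- The bad event need not be measurable, hence the measurable hull.
  set S := toMeasurable μ {ω | ε < |f ω - g ω|}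
  rw [← integral_sub hf hg]
  calc |∫ ω, (f ω - g ω) ∂μ| ≤ ∫ ω, |f ω - g ω| ∂μ := abs_integral_le_integral_abs
    _ ≤ ∫ ω, (ε + S.indicator (fun _ ↦ C) ω) ∂μ := by
        refine integral_mono (hf.sub hg).abs ((integrable_const _).add
          ((integrable_const _).indicator (measurableSet_toMeasurable _ _))) fun ω ↦ ?_
        by_cases h : ω ∈ S
        · simp only [h, Set.indicator_of_mem]
          have := hC ω
          linarith
        · simp only [h, not_false_eq_true, Set.indicator_of_notMem, add_zero]
          by_contra! h'
          exact h (subset_toMeasurable _ _ h')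
    _ = ε + μ.real S * C := by
        rw [integral_add (integrable_const _)
          ((integrable_const _).indicator (measurableSet_toMeasurable _ _)),
          integral_indicator_const _ (measurableSet_toMeasurable _ _)]
        simp [S]
    _ ≤ ε + C * ε := by
        have : μ.real S ≤ ε := by
          rw [measureReal_def, measure_toMeasurable]
          exact ENNReal.toReal_le_of_le_ofReal hε hbad
        nlinarith

/-- Iterated limit theorem: n → ∞ at fixed m, and m → ∞ afterwards. The probability spaces may
depend on n, and the exceptional events are measured by outer measure, so that quantification over
all z in a ball costs no measurability argument. Convergence is tested on bounded Lipschitz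
functions for a metric inducing the uniformity of compact convergence. -/
theorem tendstoInDistribution_of_approx {X : ∀ n, Ω n → C(ℂ, ℂ)}
    {Xm : ℕ → ∀ n, Ω n → C(ℂ, ℂ)} {Z : Ω' → C(ℂ, ℂ)} {Zm : ℕ → Ω' → C(ℂ, ℂ)}
    (hX : ∀ n, AEMeasurable (X n) (μ n))
    (hm : ∀ m, TendstoInDistribution (Xm m) atTop (Zm m) μ μ')
    (hZ : ∀ᵐ ω ∂μ', Tendsto (fun m ↦ Zm m ω) atTop (𝓝 (Z ω)))
    (happ : ∀ A δ ε : ℝ, 0 < δ → 0 < ε → ∀ᶠ m in atTop, ∀ᶠ n in atTop,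
      μ n {ω | ¬ ∀ z, ‖z‖ ≤ A → ‖X n ω z - Xm m n ω z‖ ≤ δ} ≤ ENNReal.ofReal ε) :
    TendstoInDistribution X atTop Z μ μ' := by
  have hZm : AEMeasurable Z μ' :=
    aemeasurable_of_tendsto_metrizable_ae atTop (fun m ↦ (hm m).aemeasurable_limit) hZ
  refine ⟨hX, hZm, ?_⟩
  let : PseudoMetricSpace C(ℂ, ℂ) := UniformSpace.pseudoMetricSpace _
  refine tendsto_iff_forall_lipschitz_integral_tendsto.2 ?_
  rintro f ⟨C, hC⟩ ⟨L, hL⟩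
  have hfc : Continuous f := hL.continuous
  have hbound : ∀ g, ‖f g‖ ≤ ‖f 0‖ + C := fun g ↦ by
    have h1 := hC g 0
    have h2 := norm_sub_norm_le (f g) (f 0)
    rw [dist_eq_norm] at h1
    linarith
  have hmeas : Measurable f := hfc.measurable
  simp only [ProbabilityMeasure.coe_mk]
  rw [integral_map hZm hmeas.aestronglyMeasurable]
  have e1 : ∀ n, ∫ g, f g ∂(μ n).map (X n) = ∫ ω, f (X n ω) ∂μ n := fun n ↦
    integral_map (hX n) hmeas.aestronglyMeasurable
  simp only [e1]
  have hC0 : 0 ≤ C := dist_nonneg.trans (hC 0 0)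
  rw [Metric.tendsto_atTop]
  intro ε hε
  -- The error committed in the approximation is at most η + C η, which is ε / 4.
  set η : ℝ := ε / (4 * (C + 1)) with hη
  have hη0 : 0 < η := by positivity
  obtain ⟨A, δ, hδ, hAδ⟩ := exists_ball_of_uniformContinuous hL.uniformContinuous hη0
  have hlimZ : Tendsto (fun m ↦ ∫ ω, f (Zm m ω) ∂μ') atTop (𝓝 (∫ ω, f (Z ω) ∂μ')) := by
    refine tendsto_integral_of_dominated_convergence (fun _ ↦ ‖f 0‖ + C)
      (fun m ↦ (hmeas.comp_aemeasurable (hm m).aemeasurable_limit).aestronglyMeasurable)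
      (integrable_const _) (fun m ↦ ae_of_all _ fun ω ↦ hbound _) ?_
    filter_upwards [hZ] with ω hω
    exact (hfc.tendsto _).comp hω
  obtain ⟨m, hm1, hm2⟩ := ((happ A δ η hδ hη0).and
    (Metric.tendsto_nhds.1 hlimZ (ε / 4) (by positivity))).exists
  have hlimX : Tendsto (fun n ↦ ∫ ω, f (Xm m n ω) ∂μ n) atTop (𝓝 (∫ ω, f (Zm m ω) ∂μ')) := by
    have := (tendsto_iff_forall_lipschitz_integral_tendsto.1 (hm m).tendsto) f ⟨C, hC⟩ ⟨L, hL⟩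
    simp only [ProbabilityMeasure.coe_mk] at this
    rw [integral_map (hm m).aemeasurable_limit hmeas.aestronglyMeasurable] at this
    refine this.congr fun n ↦ ?_
    rw [integral_map ((hm m).forall_aemeasurable n) hmeas.aestronglyMeasurable]
  obtain ⟨N, hN⟩ := eventually_atTop.1 (hm1.and
    (Metric.tendsto_nhds.1 hlimX (ε / 4) (by positivity)))
  refine ⟨N, fun n hn ↦ ?_⟩
  obtain ⟨h1, h2⟩ := hN n hn
  have h3 : |∫ ω, f (X n ω) ∂μ n - ∫ ω, f (Xm m n ω) ∂μ n| ≤ η + C * η := by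
    refine abs_integral_sub_integral_le ?_ ?_ (fun ω ↦ ?_) hη0.le ?_
    · exact Integrable.of_bound (hmeas.comp_aemeasurable (hX n)).aestronglyMeasurable _
        (ae_of_all _ fun ω ↦ hbound _)
    · exact Integrable.of_bound
        (hmeas.comp_aemeasurable ((hm m).forall_aemeasurable n)).aestronglyMeasurable _
        (ae_of_all _ fun ω ↦ hbound _)
    · exact hC _ _
    · refine (measure_mono fun ω hω hcon ↦ ?_).trans h1
      exact absurd (hAδ _ _ hcon) (not_le.2 hω)
  have h4 : η + C * η = ε / 4 := by
    rw [hη]; field_simp; ring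
  rw [h4] at h3
  rw [Real.dist_eq] at *
  calc |∫ ω, f (X n ω) ∂μ n - ∫ ω, f (Z ω) ∂μ'|
      = |(∫ ω, f (X n ω) ∂μ n - ∫ ω, f (Xm m n ω) ∂μ n)
          + (∫ ω, f (Xm m n ω) ∂μ n - ∫ ω, f (Zm m ω) ∂μ')
          + (∫ ω, f (Zm m ω) ∂μ' - ∫ ω, f (Z ω) ∂μ')| := by ring_nf
    _ ≤ _ := abs_add_three _ _ _
    _ < ε := by linarith

/-- Closedness is what allows the portmanteau theorem to bound the limsup of the probabilities that
a random function is large on a ball. -/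
theorem isClosed_exists_le_norm (A M : ℝ) :
    IsClosed {g : C(ℂ, ℂ) | ∃ z, ‖z‖ ≤ A ∧ M ≤ ‖g z‖} := by
  rw [← isOpen_compl_iff]
  convert ContinuousMap.isOpen_setOfPred_mapsTo (isCompact_closedBall (0 : ℂ) A)
    (Metric.isOpen_ball (x := (0 : ℂ)) (ε := M)) using 1
  ext g
  simp [Set.MapsTo]

theorem exists_measure_exists_le_norm_le (A : ℝ) {Z : Ω' → C(ℂ, ℂ)} (hZ : AEMeasurable Z μ')
    {ε : ENNReal} (hε : 0 < ε) :
    ∃ M : ℝ, 0 < M ∧ μ'.map Z {g : C(ℂ, ℂ) | ∃ z, ‖z‖ ≤ A ∧ M ≤ ‖g z‖} < ε := by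
  have : IsProbabilityMeasure (μ'.map Z) := Measure.isProbabilityMeasure_map hZ
  have hlim : Tendsto (fun M : ℕ ↦ μ'.map Z {g : C(ℂ, ℂ) | ∃ z, ‖z‖ ≤ A ∧ (M : ℝ) ≤ ‖g z‖})
      atTop (𝓝 (μ'.map Z (⋂ M : ℕ, {g : C(ℂ, ℂ) | ∃ z, ‖z‖ ≤ A ∧ (M : ℝ) ≤ ‖g z‖}))) := by
    refine tendsto_measure_iInter_atTop
      (fun M ↦ (isClosed_exists_le_norm A M).measurableSet.nullMeasurableSet) ?_
      ⟨0, measure_ne_top _ _⟩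
    intro M M' hM g ⟨z, hz, hg⟩
    exact ⟨z, hz, (Nat.cast_le.2 hM).trans hg⟩
  have hempty : (⋂ M : ℕ, {g : C(ℂ, ℂ) | ∃ z, ‖z‖ ≤ A ∧ (M : ℝ) ≤ ‖g z‖}) = ∅ := by
    rw [Set.eq_empty_iff_forall_notMem]
    intro g hg
    obtain ⟨B, hB⟩ := ((isCompact_closedBall (0 : ℂ) A).image
      (g.continuous.norm)).isBounded.subset_closedBall 0
    obtain ⟨M, hM⟩ := exists_nat_gt B
    obtain ⟨z, hz, hgz⟩ := Set.mem_iInter.1 hg M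
    have := hB ⟨z, by simpa using hz, rfl⟩
    simp only [mem_closedBall_zero_iff, norm_norm] at this
    linarith
  rw [hempty, measure_empty] at hlim
  obtain ⟨M, hM1, hM2⟩ := ((hlim.eventually_lt_const hε).and (eventually_gt_atTop 0)).exists
  exact ⟨M, by exact_mod_cast hM2, hM1⟩

/-- A relative error suffices because the limit is almost bounded on balls: it stays below some M
with high probability, and by the portmanteau theorem so do the approximations, for m and then n
large. A relative error δ / M is then an absolute error δ. -/
theorem tendstoInDistribution_of_approx_mul {X : ∀ n, Ω n → C(ℂ, ℂ)}
    {Xm : ℕ → ∀ n, Ω n → C(ℂ, ℂ)} {Z : Ω' → C(ℂ, ℂ)} {Zm : ℕ → Ω' → C(ℂ, ℂ)}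
    (hX : ∀ n, AEMeasurable (X n) (μ n))
    (hm : ∀ m, TendstoInDistribution (Xm m) atTop (Zm m) μ μ')
    (hZ : ∀ᵐ ω ∂μ', Tendsto (fun m ↦ Zm m ω) atTop (𝓝 (Z ω)))
    (happ : ∀ A δ ε : ℝ, 0 < δ → 0 < ε → ∀ᶠ m in atTop, ∀ᶠ n in atTop,
      μ n {ω | ¬ ∀ z, ‖z‖ ≤ A → ∃ T : ℂ, ‖T - 1‖ ≤ δ ∧ X n ω z = Xm m n ω z * T}
        ≤ ENNReal.ofReal ε) :
    TendstoInDistribution X atTop Z μ μ' := by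
  refine tendstoInDistribution_of_approx hX hm hZ fun A δ ε hδ hε ↦ ?_
  have hZm : AEMeasurable Z μ' :=
    aemeasurable_of_tendsto_metrizable_ae atTop (fun m ↦ (hm m).aemeasurable_limit) hZ
  have hdist : TendstoInDistribution Zm atTop Z (fun _ ↦ μ') μ' :=
    tendstoInDistribution_of_ae_tendsto (fun m ↦ (hm m).aemeasurable_limit) hZm hZ
  obtain ⟨M, hM0, hM⟩ := exists_measure_exists_le_norm_le (μ' := μ') A hZm
    (ε := ENNReal.ofReal (ε / 2)) (by simpa using hε)
  have h1 : ∀ᶠ m in atTop, μ'.map (Zm m) {g : C(ℂ, ℂ) | ∃ z, ‖z‖ ≤ A ∧ M ≤ ‖g z‖}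
      < ENNReal.ofReal (ε / 2) :=
    eventually_lt_of_limsup_lt ((ProbabilityMeasure.limsup_measure_closed_le_of_tendsto
      hdist.tendsto (isClosed_exists_le_norm A M)).trans_lt hM)
  filter_upwards [h1, happ A (δ / M) (ε / 2) (by positivity) (by positivity)] with m hm1 hm2
  have h2 : ∀ᶠ n in atTop, (μ n).map (Xm m n) {g : C(ℂ, ℂ) | ∃ z, ‖z‖ ≤ A ∧ M ≤ ‖g z‖}
      < ENNReal.ofReal (ε / 2) :=
    eventually_lt_of_limsup_lt ((ProbabilityMeasure.limsup_measure_closed_le_of_tendsto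
      (hm m).tendsto (isClosed_exists_le_norm A M)).trans_lt hm1)
  filter_upwards [h2, hm2] with n hn1 hn2
  rw [Measure.map_apply_of_aemeasurable ((hm m).forall_aemeasurable n)
    (isClosed_exists_le_norm A M).measurableSet] at hn1
  calc _ ≤ μ n ((Xm m n ⁻¹' {g : C(ℂ, ℂ) | ∃ z, ‖z‖ ≤ A ∧ M ≤ ‖g z‖}) ∪
        {ω | ¬ ∀ z, ‖z‖ ≤ A → ∃ T : ℂ, ‖T - 1‖ ≤ δ / M ∧ X n ω z = Xm m n ω z * T}) := by
        refine measure_mono fun ω hω ↦ ?_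
        by_contra hcon
        simp only [Set.mem_union, Set.mem_preimage, Set.mem_ofPred_eq, not_or, not_not,
          not_exists, not_and, not_le] at hcon
        refine hω fun z hz ↦ ?_
        obtain ⟨T, hT, hXT⟩ := hcon.2 z hz
        have h5 := hcon.1 z hz
        rw [hXT, show Xm m n ω z * T - Xm m n ω z = Xm m n ω z * (T - 1) by ring, norm_mul]
        calc ‖Xm m n ω z‖ * ‖T - 1‖ ≤ M * (δ / M) := by gcongr
          _ = δ := by field_simp
    _ ≤ _ := measure_union_le _ _
    _ ≤ ENNReal.ofReal (ε / 2) + ENNReal.ofReal (ε / 2) := add_le_add hn1.le hn2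
    _ = ENNReal.ofReal ε := by rw [← ENNReal.ofReal_add (by positivity) (by positivity)]; simp

end Approximation

/-! ### Convergence in distribution from characters -/

noncomputable instance : MeasurableSpace Circle := borel _

instance : BorelSpace Circle := ⟨rfl⟩

/-- Frequencies, proportion of points on the segment, counts in cells, and angles. -/
abbrev Observables (ι κ : Type*) : Type _ := (ι → ℝ) × ℝ × (κ → ℕ) × (ι → Circle)

section Characters

variable {ι κ : Type*} [Fintype ι] [Fintype κ]

/-- Unitary characters on `Observables`. -/
noncomputable def observableChar (a : ι → ℝ) (b : ℝ) (c : κ → ℝ) (m : ι → ℤ)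
    (e : Observables ι κ) : Circle :=
  Circle.exp (∑ i, a i * e.1 i + b * e.2.1 + ∑ k, c k * e.2.2.1 k) * ∏ i, e.2.2.2 i ^ m i

theorem continuous_observableChar (a : ι → ℝ) (b : ℝ) (c : κ → ℝ) (m : ι → ℤ) :
    Continuous (observableChar a b c m) := by
  have h : Continuous fun n : ℕ ↦ (n : ℝ) := continuous_of_discreteTopology
  have h' : ∀ k, Continuous fun e : Observables ι κ ↦ (e.2.2.1 k : ℝ) := fun k ↦
    h.comp (by fun_prop)
  unfold observableChar
  fun_prop

/-- The characters as bounded continuous functions. -/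
noncomputable def observableCharBCF (a : ι → ℝ) (b : ℝ) (c : κ → ℝ) (m : ι → ℤ) :
    BoundedContinuousFunction (Observables ι κ) ℂ :=
  BoundedContinuousFunction.ofNormedAddCommGroup (fun e ↦ (observableChar a b c m e : ℂ))
    (continuous_subtype_val.comp (continuous_observableChar a b c m)) 1 fun _ ↦
      (Circle.norm_coe _).le

theorem observableChar_mul (a a' : ι → ℝ) (b b' : ℝ) (c c' : κ → ℝ) (m m' : ι → ℤ)
    (e : Observables ι κ) :
    observableChar a b c m e * observableChar a' b' c' m' e
      = observableChar (a + a') (b + b') (c + c') (m + m') e := by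
  unfold observableChar
  rw [mul_mul_mul_comm, ← Circle.exp_add, ← Finset.prod_mul_distrib]
  congr 2
  · simp only [Pi.add_apply, add_mul, Finset.sum_add_distrib]
    ring
  · exact funext fun i ↦ (zpow_add (e.2.2.2 i) (m i) (m' i)).symm

theorem observableCharBCF_mul (a a' : ι → ℝ) (b b' : ℝ) (c c' : κ → ℝ) (m m' : ι → ℤ) :
    observableCharBCF a b c m * observableCharBCF a' b' c' m'
      = observableCharBCF (a + a') (b + b') (c + c') (m + m') := by
  ext e
  exact congrArg (fun z : Circle ↦ (z : ℂ)) (observableChar_mul a a' b b' c c' m m' e)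

theorem star_observableCharBCF (a : ι → ℝ) (b : ℝ) (c : κ → ℝ) (m : ι → ℤ) :
    star (observableCharBCF a b c m) = observableCharBCF (-a) (-b) (-c) (-m) := by
  ext e
  simp only [BoundedContinuousFunction.star_apply, observableCharBCF,
    BoundedContinuousFunction.coe_ofNormedAddCommGroup, observableChar]
  rw [← starRingEnd_apply, ← Circle.coe_inv_eq_conj]
  congr 1
  rw [mul_inv, ← Circle.exp_neg, ← Finset.prod_inv_distrib]
  congr 2
  · simp only [Pi.neg_apply, neg_mul, Finset.sum_neg_distrib]; ring
  · simp

theorem observableCharBCF_zero :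
    observableCharBCF (0 : ι → ℝ) 0 (0 : κ → ℝ) 0 = 1 := by
  ext e
  simp [observableCharBCF, observableChar]

variable (ι κ) in
/-- The linear span of the characters. -/
noncomputable def observableSubalgebra :
    StarSubalgebra ℂ (BoundedContinuousFunction (Observables ι κ) ℂ) where
  carrier := Submodule.span ℂ (Set.range fun q : (ι → ℝ) × ℝ × (κ → ℝ) × (ι → ℤ) ↦
    observableCharBCF q.1 q.2.1 q.2.2.1 q.2.2.2)
  add_mem' := Submodule.add_mem _
  mul_mem' {f g} hf hg := by
    have := Submodule.mul_mem_mul hf hg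
    rw [Submodule.span_mul_span] at this
    refine Submodule.span_mono ?_ this
    rintro _ ⟨_, ⟨q, rfl⟩, _, ⟨q', rfl⟩, rfl⟩
    exact ⟨(q.1 + q'.1, q.2.1 + q'.2.1, q.2.2.1 + q'.2.2.1, q.2.2.2 + q'.2.2.2),
      (observableCharBCF_mul ..).symm⟩
  algebraMap_mem' z := by
    rw [Algebra.algebraMap_eq_smul_one]
    exact Submodule.smul_mem _ _ (Submodule.subset_span ⟨(0, 0, 0, 0), observableCharBCF_zero⟩)
  star_mem' {f} hf := by
    refine Submodule.span_induction (p := fun f _ ↦ star f ∈ Submodule.span ℂ _) ?_ ?_ ?_ ?_ hf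
    · rintro _ ⟨q, rfl⟩
      exact Submodule.subset_span ⟨(-q.1, -q.2.1, -q.2.2.1, -q.2.2.2),
        (star_observableCharBCF ..).symm⟩
    · simp
    · intro f g _ _ hf hg
      rw [star_add]; exact Submodule.add_mem _ hf hg
    · intro z f _ hf
      rw [star_smul]; exact Submodule.smul_mem _ _ hf

theorem exists_circleExp_mul_ne {x y : ℝ} (h : x ≠ y) :
    ∃ t : ℝ, Circle.exp (t * x) ≠ Circle.exp (t * y) := by
  -- At this frequency the two values differ by the factor e^{iπ} = -1.
  refine ⟨Real.pi / (x - y), fun hcon ↦ ?_⟩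
  have hxy : x - y ≠ 0 := sub_ne_zero.2 h
  have : Real.pi / (x - y) * x = Real.pi / (x - y) * y + Real.pi := by field_simp; ring
  rw [this, Circle.exp_add, mul_eq_left] at hcon
  have h2 := congrArg (fun z : Circle ↦ (z : ℂ)) hcon
  simp only [Circle.coe_exp, Complex.exp_pi_mul_I, Circle.coe_one] at h2
  norm_num at h2

theorem observableSubalgebra_separatesPoints [DecidableEq ι] [DecidableEq κ] :
    ((observableSubalgebra ι κ).map
      (BoundedContinuousFunction.toContinuousMapStarₐ ℂ)).SeparatesPoints := by
  intro e e' hne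
  suffices ∃ a b c m, observableChar a b c m e ≠ observableChar (ι := ι) (κ := κ) a b c m e' by
    obtain ⟨a, b, c, m, h⟩ := this
    refine ⟨_, ⟨_, ⟨observableCharBCF a b c m, Submodule.subset_span ⟨(a, b, c, m), rfl⟩, rfl⟩,
      rfl⟩, ?_⟩
    intro hcon
    exact h (Circle.ext hcon)
  by_contra! hcon
  apply hne
  obtain ⟨x, s, N, u⟩ := e
  obtain ⟨x', s', N', u'⟩ := e'
  simp only [Prod.mk.injEq]
  refine ⟨?_, ?_, ?_, ?_⟩
  · ext i
    by_contra hi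
    obtain ⟨t, ht⟩ := exists_circleExp_mul_ne hi
    have := hcon (Pi.single i t) 0 0 0
    simp [observableChar, Pi.single_apply] at this
    exact ht this
  · by_contra hi
    obtain ⟨t, ht⟩ := exists_circleExp_mul_ne hi
    have := hcon 0 t 0 0
    simp [observableChar] at this
    exact ht this
  · ext k
    by_contra hi
    obtain ⟨t, ht⟩ := exists_circleExp_mul_ne (x := (N k : ℝ)) (y := N' k)
      (fun h ↦ hi (Nat.cast_injective h))
    have := hcon 0 0 (Pi.single k t) 0
    simp [observableChar, Pi.single_apply] at this
    exact ht this
  · ext i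
    have := hcon 0 0 0 (Pi.single i 1)
    have hp : ∀ u : ι → Circle, ∏ i', u i' ^ (Pi.single i 1 : ι → ℤ) i' = u i := fun u ↦ by
      rw [Finset.prod_eq_single i (fun i' _ h ↦ by simp [h]) (by simp)]
      simp
    simp only [observableChar, hp] at this
    exact congrArg _ (by simpa using this)

/-- A version of Lévy's continuity theorem. Frequencies and angles live in compact sets and the
counts have bounded means, so the laws are tight by Markov's inequality; the span of the characters
is a star subalgebra that separates points, hence convergence of their integrals identifies the
limit. -/
theorem tendstoInDistribution_of_observableChar {Ω : ℕ → Type*} [∀ n, MeasurableSpace (Ω n)]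
    {μ : ∀ n, Measure (Ω n)} [∀ n, IsProbabilityMeasure (μ n)] {Ω' : Type*} [MeasurableSpace Ω']
    {μ' : Measure Ω'} [IsProbabilityMeasure μ'] {X : ∀ n, Ω n → Observables ι κ}
    {Z : Ω' → Observables ι κ} (hX : ∀ n, Measurable (X n)) (hZ : AEMeasurable Z μ')
    (h1 : ∀ n ω i, (X n ω).1 i ∈ Set.Icc (0 : ℝ) 1)
    (h2 : ∀ n ω, (X n ω).2.1 ∈ Set.Icc (0 : ℝ) 1)
    (C : NNReal) (h3 : ∀ n k, ∫⁻ ω, ((X n ω).2.2.1 k : ENNReal) ∂μ n ≤ C)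
    (h4 : ∀ a b c m, Tendsto (fun n ↦ ∫ ω, (observableChar a b c m (X n ω) : ℂ) ∂μ n) atTop
      (𝓝 (∫ ω, (observableChar a b c m (Z ω) : ℂ) ∂μ'))) :
    TendstoInDistribution X atTop Z μ μ' := by
  classical
  refine ⟨fun n ↦ (hX n).aemeasurable, hZ, ?_⟩
  refine ProbabilityMeasure.tendsto_of_tight_of_separatesPoints ℂ ?_
    observableSubalgebra_separatesPoints ?_
  · rw [isTightMeasureSet_iff_exists_isCompact_measure_compl_le]
    intro ε hε
    obtain ⟨R, hR⟩ : ∃ R : ℕ, Fintype.card κ * (C / (R + 1 : ENNReal)) ≤ ε := by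
      rcases eq_or_ne ε ⊤ with rfl | hεt
      · exact ⟨0, le_top⟩
      have hlim : Tendsto (fun R : ℕ ↦ (Fintype.card κ * (C * ((R + 1 : ℕ) : ENNReal)⁻¹)))
          atTop (𝓝 ((Fintype.card κ : ENNReal) * (C * 0))) := by
        refine ENNReal.Tendsto.const_mul (ENNReal.Tendsto.const_mul ?_ (by simp)) (by simp)
        exact (tendsto_add_atTop_iff_nat 1).2 ENNReal.tendsto_inv_nat_nhds_zero
      simp only [mul_zero] at hlim
      obtain ⟨R, hR⟩ := (hlim.eventually_lt_const hε).exists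
      refine ⟨R, le_of_eq_of_le ?_ hR.le⟩
      rw [div_eq_mul_inv]; push_cast; rfl
    let K : Set (Observables ι κ) := (Set.univ.pi fun _ ↦ Set.Icc (0 : ℝ) 1) ×ˢ
      (Set.Icc (0 : ℝ) 1 ×ˢ ((Set.univ.pi fun _ ↦ Set.Iic R) ×ˢ Set.univ))
    have hK : IsCompact K := by
      refine IsCompact.prod (isCompact_univ_pi fun _ ↦ isCompact_Icc) (isCompact_Icc.prod
        (IsCompact.prod (isCompact_univ_pi fun _ ↦ ?_) isCompact_univ))
      exact (Set.finite_Iic R).isCompact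
    refine ⟨K, hK, ?_⟩
    rintro _ ⟨n, rfl⟩
    simp only [ProbabilityMeasure.coe_mk]
    rw [Measure.map_apply (hX n) hK.isClosed.isOpen_compl.measurableSet]
    calc μ n (X n ⁻¹' Kᶜ) ≤ μ n (⋃ k : κ, {ω | (R + 1 : ENNReal) ≤ ((X n ω).2.2.1 k)}) := by
          refine measure_mono fun ω hω ↦ ?_
          by_contra hcon
          apply hω
          simp only [Set.mem_iUnion, Set.mem_ofPred_eq, not_exists, not_le] at hcon
          refine ⟨fun i _ ↦ h1 n ω i, h2 n ω, fun k _ ↦ ?_, Set.mem_univ _⟩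
          have := hcon k
          simp only [Set.mem_Iic]
          exact Nat.lt_succ_iff.1 (by exact_mod_cast this)
      _ ≤ ∑ k : κ, μ n {ω | (R + 1 : ENNReal) ≤ ((X n ω).2.2.1 k)} := measure_iUnion_fintype_le _ _
      _ ≤ ∑ k : κ, (C / (R + 1 : ENNReal)) := by
          refine Finset.sum_le_sum fun k _ ↦ ?_
          have hmeas : Measurable fun ω ↦ ((X n ω).2.2.1 k : ENNReal) := by
            have : Measurable fun ω ↦ (X n ω).2.2.1 k := by
              have := hX n
              fun_prop
            exact (measurable_from_top (f := fun i : ℕ ↦ (i : ENNReal))).comp this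
          exact (meas_ge_le_lintegral_div hmeas.aemeasurable (by simp) (by
            finiteness)).trans (by gcongr; exact h3 n k)
      _ ≤ ε := by simpa using hR
  · intro g hg
    refine Submodule.span_induction (p := fun g _ ↦ Tendsto
      (fun n ↦ ∫ x, g x ∂((μ n).map (X n))) atTop (𝓝 (∫ x, g x ∂(μ'.map Z)))) ?_ ?_ ?_ ?_ hg
    · rintro _ ⟨q, rfl⟩
      have hm : ∀ (ν : Measure (Observables ι κ)), AEStronglyMeasurable
          (observableCharBCF q.1 q.2.1 q.2.2.1 q.2.2.2) ν := fun ν ↦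
        (observableCharBCF q.1 q.2.1 q.2.2.1 q.2.2.2).continuous.aestronglyMeasurable
      rw [integral_map hZ (hm _)]
      refine (h4 q.1 q.2.1 q.2.2.1 q.2.2.2).congr fun n ↦ ?_
      rw [integral_map (hX n).aemeasurable (hm _)]
      rfl
    · simp
    · intro f g _ _ hf hg
      have : IsProbabilityMeasure (μ'.map Z) := Measure.isProbabilityMeasure_map hZ
      have h' : ∀ n, IsProbabilityMeasure ((μ n).map (X n)) := fun n ↦
        Measure.isProbabilityMeasure_map (hX n).aemeasurable
      simp only [BoundedContinuousFunction.coe_add, Pi.add_apply]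
      rw [integral_add (f.integrable _) (g.integrable _)]
      refine (hf.add hg).congr fun n ↦ ?_
      rw [integral_add (f.integrable _) (g.integrable _)]
    · intro z f _ hf
      simp only [BoundedContinuousFunction.coe_smul]
      rw [integral_smul]
      refine (hf.const_smul z).congr fun n ↦ ?_
      rw [integral_smul]

end Characters

/-! ### The law of the labels -/

instance : MeasurableSpace (Option ℕ) := ⊤

instance : DiscreteMeasurableSpace (Option ℕ) := ⟨fun _ ↦ trivial⟩

theorem measurable_label : Measurable label := by
  refine measurable_fun_sum ?_ ?_
  · exact (measurable_from_top (f := fun j : ℕ ↦ (some j : Option ℕ))).comp measurable_fst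
  · exact measurable_const

/-- A measurable set of the product is a countable disjoint union of sets A × {d}, on which the two
measures agree. -/
theorem map_eq_compProd_of_countable {γ D : Type*} [MeasurableSpace γ] [MeasurableSpace D]
    [Countable D] [MeasurableSingletonClass D] {ν : Measure γ} [SFinite ν] {κ : Kernel γ D}
    [IsSFiniteKernel κ] {ρ : Measure (γ × D)}
    (h : ∀ A, MeasurableSet A → ∀ d, ρ (A ×ˢ {d}) = ∫⁻ g in A, κ g {d} ∂ν) : ρ = ν ⊗ₘ κ := by
  ext S hS
  have hS' : S = ⋃ d : D, ((fun g ↦ (g, d)) ⁻¹' S) ×ˢ {d} := by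
    ext ⟨g, d⟩
    simp
  have hm : ∀ d : D, MeasurableSet ((fun g : γ ↦ (g, d)) ⁻¹' S) := fun d ↦
    measurable_prodMk_right hS
  have hd : Pairwise (Function.onFun Disjoint fun d : D ↦ ((fun g ↦ (g, d)) ⁻¹' S) ×ˢ {d}) := by
    intro d d' hdd
    simp only [Function.onFun, Set.disjoint_left, Set.mem_prod, Set.mem_singleton_iff]
    rintro ⟨g, e⟩ ⟨-, rfl⟩ ⟨-, h⟩
    exact hdd h
  rw [hS', measure_iUnion hd fun d ↦ (hm d).prod (measurableSet_singleton d),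
    measure_iUnion hd fun d ↦ (hm d).prod (measurableSet_singleton d)]
  refine tsum_congr fun d ↦ ?_
  rw [h _ (hm d), Measure.compProd_apply_prod (hm d) (measurableSet_singleton d)]

theorem uniformPoint_apply (l : ℕ → ℝ) {S : Set Point} (hS : MeasurableSet S) :
    uniformPoint l S = ∑' j, volume ({t | Sum.inl (j, t) ∈ S} ∩ Set.Ico 0 (l j)) +
      volume ({t | Sum.inr t ∈ S} ∩ Set.Ico 0 (1 - ∑' j, l j)) := by
  have h1 : ∀ j : ℕ, Measurable fun t : ℝ ↦ (Sum.inl (j, t) : Point) := fun j ↦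
    measurable_inl.comp measurable_prodMk_left
  have h2 : Measurable fun t : ℝ ↦ (Sum.inr t : Point) := measurable_inr
  rw [uniformPoint, Measure.add_apply, Measure.sum_apply _ hS, Measure.map_apply h2 hS,
    Measure.restrict_apply (h2 hS)]
  congr 1
  refine tsum_congr fun j ↦ ?_
  rw [Measure.map_apply (h1 j) hS, Measure.restrict_apply (h1 j hS)]
  rfl

/-- For nonnegative terms, the countably many conditions that partial sums are at most 1 encode both
summability and the bound on the total sum. -/
theorem measurableSet_nabla : MeasurableSet nabla := by
  have : nabla = (⋂ j, {l : ℕ → ℝ | l j ∈ Set.Icc (0 : ℝ) 1}) ∩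
      ((⋂ j, {l : ℕ → ℝ | l (j + 1) ≤ l j}) ∩
        ⋂ k, {l : ℕ → ℝ | ∑ j ∈ Finset.range k, l j ≤ 1}) := by
    ext l
    simp only [nabla, Set.mem_ofPred_eq, Set.mem_inter_iff, Set.mem_iInter]
    constructor
    · rintro ⟨h1, h2, h3, h4⟩
      exact ⟨h1, fun j ↦ h2 (Nat.le_succ j), fun k ↦
        (h3.sum_le_tsum _ fun j _ ↦ (h1 j).1).trans h4⟩
    · rintro ⟨h1, h2, h3⟩
      have hs := summable_of_sum_range_le (fun j ↦ (h1 j).1) h3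
      exact ⟨h1, antitone_nat_of_succ_le h2, hs, hs.tsum_le_of_sum_range_le h3⟩
  rw [this]
  refine (MeasurableSet.iInter fun j ↦ ?_).inter ((MeasurableSet.iInter fun j ↦ ?_).inter
    (MeasurableSet.iInter fun k ↦ ?_))
  · exact measurableSet_Icc.preimage (measurable_pi_apply j)
  · exact measurableSet_le (measurable_pi_apply _) (measurable_pi_apply _)
  · exact measurableSet_le (by fun_prop) measurable_const

theorem measurable_tsum_nat : Measurable fun l : ℕ → ℝ ↦ ∑' j, l j := by
  fun_prop

/-- The probability of each label, for given perimeters. -/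
noncomputable def labelWeight (l : ℕ → ℝ) : Option ℕ → ℝ
  | some j => l j
  | none => 1 - ∑' j, l j

theorem uniformPoint_label (l : ℕ → ℝ) (c : Option ℕ) :
    uniformPoint l (label ⁻¹' {c}) = ENNReal.ofReal (labelWeight l c) := by
  rw [uniformPoint_apply l (measurable_label (measurableSet_singleton c))]
  cases c with
  | none => simp [label, labelWeight]
  | some j =>
    simp only [Set.mem_preimage, label, Set.mem_singleton_iff, Option.some.injEq, reduceCtorEq,
      Set.ofPred_false, Set.empty_inter, measure_empty, add_zero, labelWeight]
    rw [tsum_eq_single j]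
    · simp
    · intro j' hj'
      simp [hj']

theorem hasSum_labelWeight {l : ℕ → ℝ} (hl : l ∈ nabla) : HasSum (labelWeight l) 1 := by
  have h1 : HasSum (fun j ↦ labelWeight l (some j)) (∑' j, l j) := hl.2.2.1.hasSum
  have h2 : HasSum (fun c : Option ℕ ↦ if c = none then 0 else labelWeight l c) (∑' j, l j) := by
    rw [← (Option.some_injective ℕ).hasSum_iff]
    · simpa [Function.comp_def] using h1
    · intro c hc
      cases c with
      | none => simp
      | some j => exact absurd ⟨j, rfl⟩ hc
  have h3 := h2.add (hasSum_ite_eq (none : Option ℕ) (1 - ∑' j, l j))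
  convert h3 using 1
  · ext c
    cases c <;> simp [labelWeight]
  · ring

theorem labelWeight_nonneg {l : ℕ → ℝ} (hl : l ∈ nabla) (c : Option ℕ) : 0 ≤ labelWeight l c := by
  cases c with
  | none => simpa [labelWeight] using hl.2.2.2
  | some j => exact (hl.1 j).1

open Classical in
/-- The law of a label, for given perimeters. -/
noncomputable def labelLaw (l : ℕ → ℝ) : Measure (Option ℕ) :=
  -- The default value outside of `nabla` makes this a probability for every `l`, as a Markov kernel
  -- requires.
  if l ∈ nabla then (uniformPoint l).map label else Measure.dirac none

theorem labelLaw_singleton {l : ℕ → ℝ} (hl : l ∈ nabla) (c : Option ℕ) :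
    labelLaw l {c} = ENNReal.ofReal (labelWeight l c) := by
  rw [labelLaw, if_pos hl, Measure.map_apply measurable_label (measurableSet_singleton c),
    uniformPoint_label]

instance (l : ℕ → ℝ) : IsProbabilityMeasure (labelLaw l) := by
  by_cases hl : l ∈ nabla
  · constructor
    have hc : (Set.univ : Set (Option ℕ)) = ⋃ c : Option ℕ, {c} := by ext; simp
    rw [hc, measure_iUnion (by
      intro c c' h
      simpa [Function.onFun] using h) (fun c ↦ measurableSet_singleton c)]
    simp only [labelLaw_singleton hl]
    rw [← ENNReal.ofReal_tsum_of_nonneg (labelWeight_nonneg hl) (hasSum_labelWeight hl).summable,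
      (hasSum_labelWeight hl).tsum_eq, ENNReal.ofReal_one]
  · rw [labelLaw, if_neg hl]
    infer_instance

theorem measurable_labelWeight (c : Option ℕ) : Measurable fun l ↦ labelWeight l c := by
  cases c with
  | none => exact measurable_const.sub measurable_tsum_nat
  | some j => exact measurable_pi_apply j

theorem measurable_labelLaw_singleton (c : Option ℕ) : Measurable fun l ↦ labelLaw l {c} := by
  classical
  have : (fun l ↦ labelLaw l {c}) = fun l ↦ if l ∈ nabla then ENNReal.ofReal (labelWeight l c)
      else Measure.dirac none {c} := by
    ext l
    split_ifs with h
    · exact labelLaw_singleton h c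
    · rw [labelLaw, if_neg h]
  rw [this]
  exact Measurable.ite measurableSet_nabla (measurable_labelWeight c).ennreal_ofReal
    measurable_const

theorem uniformPoint_univ {l : ℕ → ℝ} (hl : l ∈ nabla) : uniformPoint l Set.univ = 1 := by
  have h := measure_univ (μ := labelLaw l)
  rwa [labelLaw, if_pos hl, Measure.map_apply measurable_label MeasurableSet.univ,
    Set.preimage_univ] at h

/-- The law of the labels of `n` independent points, as a kernel. -/
noncomputable def labelKernel (n : ℕ) : Kernel (ℕ → ℝ) (Fin n → Option ℕ) where
  toFun l := Measure.pi fun _ ↦ labelLaw l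
  measurable' := by
    refine Measure.measurable_of_measurable_coe _ fun S _ ↦ ?_
    have hS : S = ⋃ a : S, {(a : Fin n → Option ℕ)} := by ext; simp
    have : (fun l ↦ (Measure.pi fun _ : Fin n ↦ labelLaw l) S)
        = fun l ↦ ∑' a : S, ∏ k, labelLaw l {(a : Fin n → Option ℕ) k} := by
      ext l
      conv_lhs => rw [hS]
      rw [measure_iUnion]
      · exact tsum_congr fun a ↦ Measure.pi_singleton _ _
      · intro a a' h
        simpa [Function.onFun, Subtype.ext_iff] using h
      · exact fun a ↦ measurableSet_singleton _
    rw [this]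
    exact Measurable.tsum fun a ↦ Finset.measurable_prod _ fun k _ ↦
      measurable_labelLaw_singleton _

theorem labelKernel_apply (n : ℕ) (l : ℕ → ℝ) :
    labelKernel n l = Measure.pi (fun _ : Fin n ↦ labelLaw l) := rfl

instance (n : ℕ) : IsMarkovKernel (labelKernel n) :=
  ⟨fun l ↦ by rw [labelKernel_apply]; infer_instance⟩

/-- The labels of the first points. -/
def labels (x : ℕ → Point) (n : ℕ) (k : Fin n) : Option ℕ := label (x k)

namespace IsCoupling

variable {Ω : Type*} [MeasurableSpace Ω] {μ : Measure Ω} {p : Measure (ℕ → ℝ)}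
  {Y : Ω → ℕ → ℝ} {x : Ω → ℕ → Point}

theorem map_eq (hc : IsCoupling μ p Y x) : μ.map Y = p := by
  ext A hA
  have := hc.law A hA 0 (fun _ ↦ Set.univ) (fun _ ↦ MeasurableSet.univ)
  rw [Measure.map_apply hc.measurable_y hA]
  simpa [Set.preimage] using this

theorem isProbabilityMeasure [IsProbabilityMeasure μ] (hc : IsCoupling μ p Y x) :
    IsProbabilityMeasure p := by
  rw [← hc.map_eq]
  exact Measure.isProbabilityMeasure_map hc.measurable_y.aemeasurable

theorem ae_mem_nabla (hc : IsCoupling μ p Y x) (hp : ∀ᵐ l ∂p, l ∈ nabla) :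
    ∀ᵐ ω ∂μ, Y ω ∈ nabla := by
  rw [← hc.map_eq] at hp
  exact ae_of_ae_map hc.measurable_y.aemeasurable hp

theorem measurable_labels (hc : IsCoupling μ p Y x) (n : ℕ) :
    Measurable fun ω ↦ labels (x ω) n := by
  refine measurable_pi_lambda _ fun k ↦ measurable_label.comp ?_
  exact (measurable_pi_apply _).comp hc.measurable_x

theorem map_labels [IsProbabilityMeasure μ] (hc : IsCoupling μ p Y x)
    (hp : ∀ᵐ l ∂p, l ∈ nabla) (n : ℕ) :
    μ.map (fun ω ↦ (Y ω, labels (x ω) n)) = p ⊗ₘ labelKernel n := by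
  have := hc.isProbabilityMeasure
  refine map_eq_compProd_of_countable fun A hA a ↦ ?_
  rw [Measure.map_apply (hc.measurable_y.prodMk (hc.measurable_labels n))
    (hA.prod (measurableSet_singleton a))]
  let B : ℕ → Set Point := fun k ↦ if h : k < n then label ⁻¹' {a ⟨k, h⟩} else Set.univ
  have hB : ∀ k, MeasurableSet (B k) := by
    intro k
    simp only [B]
    split_ifs
    · exact measurable_label (measurableSet_singleton _)
    · exact MeasurableSet.univ
  have h := hc.law A hA n B hB
  have e : {ω | Y ω ∈ A ∧ ∀ k < n, x ω k ∈ B k}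
      = (fun ω ↦ (Y ω, labels (x ω) n)) ⁻¹' (A ×ˢ {a}) := by
    ext ω
    simp only [Set.mem_ofPred_eq, Set.mem_preimage, Set.mem_prod, Set.mem_singleton_iff]
    refine and_congr_right fun _ ↦ ⟨fun h ↦ ?_, fun h k hk ↦ ?_⟩
    · ext1 k
      have := h k k.2
      simpa [B, labels] using this
    · have := congrFun h ⟨k, hk⟩
      simpa [B, hk, labels] using this
  rw [← e, h]
  refine lintegral_congr_ae (ae_restrict_of_ae ?_)
  filter_upwards [hp] with l hl
  rw [labelKernel_apply, Measure.pi_singleton, Finset.prod_range]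
  refine Finset.prod_congr rfl fun k _ ↦ ?_
  simp [B, labelLaw_singleton hl, ← uniformPoint_label]

/-- Conditionally on the perimeters the labels are i.i.d., so the mean of a product over the points
is the n-th power of a one-point mean. All the probabilistic estimates on circles rest on this
identity. -/
theorem integral_prod_label [IsProbabilityMeasure μ] (hc : IsCoupling μ p Y x)
    (hp : ∀ᵐ l ∂p, l ∈ nabla) (n : ℕ) {ψ : (ℕ → ℝ) → ℂ} (hψ : Measurable ψ)
    {C : ℝ} (hψC : ∀ l, ‖ψ l‖ ≤ C) {g : Option ℕ → ℂ} {C' : ℝ} (hg : ∀ c, ‖g c‖ ≤ C') :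
    ∫ ω, ψ (Y ω) * ∏ k : Fin n, g (label (x ω k)) ∂μ
      = ∫ l, ψ l * (∫ c, g c ∂labelLaw l) ^ n ∂p := by
  have := hc.isProbabilityMeasure
  have hm := hc.measurable_y.prodMk (hc.measurable_labels n)
  let Φ : (ℕ → ℝ) × (Fin n → Option ℕ) → ℂ := fun q ↦ ψ q.1 * ∏ k, g (q.2 k)
  have hΦ : Measurable Φ := by
    refine (hψ.comp measurable_fst).mul (Finset.measurable_prod _ fun k _ ↦ ?_)
    exact (Measurable.of_discrete (f := g)).comp ((measurable_pi_apply k).comp measurable_snd)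
  have hΦb : ∀ q, ‖Φ q‖ ≤ C * C' ^ n := fun q ↦ by
    have h0 : 0 ≤ C := (norm_nonneg _).trans (hψC 0)
    rw [norm_mul, norm_prod]
    refine mul_le_mul (hψC _) ?_ (by positivity) h0
    calc ∏ k, ‖g (q.2 k)‖ ≤ ∏ k : Fin n, C' := Finset.prod_le_prod (fun _ _ ↦ norm_nonneg _)
          fun k _ ↦ hg _
      _ = C' ^ n := by simp
  calc ∫ ω, ψ (Y ω) * ∏ k : Fin n, g (label (x ω k)) ∂μ
      = ∫ q, Φ q ∂(μ.map (fun ω ↦ (Y ω, labels (x ω) n))) :=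
        (integral_map hm.aemeasurable hΦ.aestronglyMeasurable).symm
    _ = ∫ l, ∫ a, Φ (l, a) ∂labelKernel n l ∂p := by
        rw [hc.map_labels hp]
        exact Measure.integral_compProd (Integrable.of_bound hΦ.aestronglyMeasurable _
          (ae_of_all _ hΦb))
    _ = _ := by
        refine integral_congr_ae (ae_of_all _ fun l ↦ ?_)
        simp only [Φ, labelKernel_apply]
        rw [integral_const_mul, integral_fintype_prod_eq_pow, Fintype.card_fin]

theorem measure_label_eq (hc : IsCoupling μ p Y x) (hp : ∀ᵐ l ∂p, l ∈ nabla) {A : Set (ℕ → ℝ)}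
    (hA : MeasurableSet A) (k : ℕ) (c : Option ℕ) :
    μ {ω | Y ω ∈ A ∧ label (x ω k) = c} = ∫⁻ l in A, ENNReal.ofReal (labelWeight l c) ∂p := by
  have h := hc.law A hA (k + 1) (fun i ↦ if i = k then label ⁻¹' {c} else Set.univ) (fun i ↦ by
    split_ifs
    · exact measurable_label (measurableSet_singleton _)
    · exact MeasurableSet.univ)
  have e : {ω | Y ω ∈ A ∧ label (x ω k) = c} = {ω | Y ω ∈ A ∧ ∀ i < k + 1, x ω i ∈
      (if i = k then label ⁻¹' {c} else Set.univ : Set Point)} := by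
    ext ω
    refine and_congr_right fun _ ↦ ⟨fun h i _ ↦ ?_, fun h ↦ ?_⟩
    · split_ifs with hi
      · subst hi; exact h
      · trivial
    · simpa using h k (Nat.lt_succ_self k)
  rw [e, h]
  refine lintegral_congr_ae (ae_restrict_of_ae ?_)
  filter_upwards [hp] with l hl
  rw [Finset.prod_eq_single k]
  · simp [uniformPoint_label]
  · intro i _ hi
    simp [hi, uniformPoint_univ hl]
  · simp

theorem measure_mem_le (hc : IsCoupling μ p Y x) (hp : ∀ᵐ l ∂p, l ∈ nabla) {A : Set (ℕ → ℝ)}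
    (hA : MeasurableSet A) {k m : ℕ} (hkm : k ≠ m) {B B' : Set Point} (hB : MeasurableSet B)
    (hB' : MeasurableSet B') :
    μ {ω | Y ω ∈ A ∧ x ω k ∈ B ∧ x ω m ∈ B'}
      = ∫⁻ l in A, uniformPoint l B * uniformPoint l B' ∂p := by
  have h := hc.law A hA (max k m + 1)
    (fun i ↦ if i = k then B else if i = m then B' else Set.univ) (fun i ↦ by
    split_ifs
    · exact hB
    · exact hB'
    · exact MeasurableSet.univ)
  have e : {ω | Y ω ∈ A ∧ x ω k ∈ B ∧ x ω m ∈ B'} = {ω | Y ω ∈ A ∧ ∀ i < max k m + 1, x ω i ∈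
      (if i = k then B else if i = m then B' else Set.univ : Set Point)} := by
    ext ω
    refine and_congr_right fun _ ↦ ⟨fun h i _ ↦ ?_, fun h ↦ ⟨?_, ?_⟩⟩
    · split_ifs with hi hi'
      · subst hi; exact h.1
      · subst hi'; exact h.2
      · trivial
    · simpa using h k (by omega)
    · simpa [hkm.symm] using h m (by omega)
  rw [e, h]
  refine lintegral_congr_ae (ae_restrict_of_ae ?_)
  filter_upwards [hp] with l hl
  rw [Finset.prod_eq_mul k m hkm]
  · simp [hkm.symm]
  · intro i _ hi
    simp [hi.1, hi.2, uniformPoint_univ hl]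
  · intro hk
    exact absurd (Finset.mem_range.2 (by omega)) hk
  · intro hk
    exact absurd (Finset.mem_range.2 (by omega)) hk

/-! ### Almost surely, the points are at distinct places -/

theorem measurableSet_circle_points (j : ℕ) {T : Set ℝ} (hT : MeasurableSet T) :
    MeasurableSet {q : Point | ∃ t ∈ T, q = Sum.inl (j, t)} := by
  have : {q : Point | ∃ t ∈ T, q = Sum.inl (j, t)} = Sum.inl '' ({j} ×ˢ T) := by
    ext q
    simp only [Set.mem_ofPred_eq, Set.mem_image, Set.mem_prod, Set.mem_singleton_iff, Prod.exists]
    constructor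
    · rintro ⟨t, ht, rfl⟩; exact ⟨j, t, ⟨rfl, ht⟩, rfl⟩
    · rintro ⟨j', t, ⟨rfl, ht⟩, rfl⟩; exact ⟨t, ht, rfl⟩
  rw [this]
  exact ((measurableSet_singleton j).prod hT).inl_image

theorem uniformPoint_circle (l : ℕ → ℝ) (j : ℕ) {T : Set ℝ} (hT : MeasurableSet T) :
    uniformPoint l {q : Point | ∃ t ∈ T, q = Sum.inl (j, t)} = volume (T ∩ Set.Ico 0 (l j)) := by
  rw [uniformPoint_apply l (measurableSet_circle_points j hT), tsum_eq_single j]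
  · simp
  · intro j' hj'
    simp [hj']

theorem ae_pos (hc : IsCoupling μ p Y x) (hp : ∀ᵐ l ∂p, l ∈ nabla) :
    ∀ᵐ ω ∂μ, ∀ k j t, x ω k = Sum.inl (j, t) → 0 < t := by
  rw [ae_all_iff]; intro k
  rw [ae_all_iff]; intro j
  have hm := measurableSet_circle_points j (measurableSet_Iic (a := (0 : ℝ)))
  have h := hc.measure_mem_le hp MeasurableSet.univ (Nat.succ_ne_self k).symm hm
    MeasurableSet.univ
  have h0 : ∀ l : ℕ → ℝ, volume (Set.Iic (0 : ℝ) ∩ Set.Ico 0 (l j)) = 0 := fun l ↦ by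
    refine measure_mono_null (t := {0}) ?_ (by simp)
    rintro t ⟨h1, h2, -⟩
    exact le_antisymm h1 h2
  simp only [uniformPoint_circle _ _ measurableSet_Iic, h0, zero_mul, lintegral_zero] at h
  rw [ae_iff]
  refine measure_mono_null (fun ω hω ↦ ?_) h
  simp only [Set.mem_ofPred_eq, not_forall, not_lt] at hω
  obtain ⟨t, ht, ht0⟩ := hω
  exact ⟨trivial, ⟨t, ht0, ht⟩, trivial⟩

theorem ae_le (hc : IsCoupling μ p Y x) (hp : ∀ᵐ l ∂p, l ∈ nabla) :
    ∀ᵐ ω ∂μ, ∀ k j t, x ω k = Sum.inl (j, t) → t ≤ Y ω j := by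
  rw [ae_all_iff]; intro k
  rw [ae_all_iff]; intro j
  -- The law of the coupling only speaks of rectangles, while the bound Y ω j is random: a rational
  -- between Y ω j and t turns the event into a countable union of rectangles.
  have h : ∀ q : ℚ, μ {ω | Y ω ∈ {l : ℕ → ℝ | l j < (q : ℝ)} ∧
      x ω k ∈ {z : Point | ∃ t ∈ Set.Ioi (q : ℝ), z = Sum.inl (j, t)} ∧
      x ω (k + 1) ∈ Set.univ} = 0 := by
    intro q
    have hA : MeasurableSet {l : ℕ → ℝ | l j < q} :=
      measurableSet_lt (measurable_pi_apply j) measurable_const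
    rw [hc.measure_mem_le hp hA (Nat.succ_ne_self k).symm
      (measurableSet_circle_points j measurableSet_Ioi) MeasurableSet.univ]
    rw [setLIntegral_congr_fun (g := fun _ ↦ 0) hA]
    · simp
    · intro l hl
      have : Set.Ioi (q : ℝ) ∩ Set.Ico 0 (l j) = ∅ := by
        rw [Set.eq_empty_iff_forall_notMem]
        rintro t ⟨h1, -, h2⟩
        exact lt_irrefl _ ((h1.trans h2).trans hl)
      simp only [uniformPoint_circle _ _ measurableSet_Ioi, this, measure_empty, zero_mul]
  rw [ae_iff]
  refine measure_mono_null (fun ω hω ↦ ?_) (measure_iUnion_null h)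
  simp only [Set.mem_ofPred_eq, not_forall, not_le] at hω
  obtain ⟨t, ht, ht0⟩ := hω
  obtain ⟨q, hq1, hq2⟩ := exists_rat_btwn ht0
  exact Set.mem_iUnion.2 ⟨q, hq1, ⟨t, hq2, ht⟩, trivial⟩

/-- Cut (0, 1] into M intervals of length 1/M: two distinct points at the same place of the circle
fall into the same interval, which has probability at most M · M⁻². Let M tend to infinity. -/
theorem ae_inj [IsProbabilityMeasure μ] (hc : IsCoupling μ p Y x) (hp : ∀ᵐ l ∂p, l ∈ nabla) :
    ∀ᵐ ω ∂μ, ∀ k m j t, x ω k = Sum.inl (j, t) → x ω m = Sum.inl (j, t) → k = m := by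
  have := hc.isProbabilityMeasure
  rw [ae_all_iff]; intro k
  rw [ae_all_iff]; intro m
  rw [ae_all_iff]; intro j
  by_cases hkm : k = m
  · exact ae_of_all _ fun _ _ _ _ ↦ hkm
  have hb : ∀ M : ℕ, 0 < M →
      μ {ω | ∃ t ∈ Set.Ioc (0 : ℝ) 1, x ω k = Sum.inl (j, t) ∧ x ω m = Sum.inl (j, t)}
        ≤ ENNReal.ofReal (1 / M) := by
    intro M hM
    have hM' : (0 : ℝ) < M := Nat.cast_pos.2 hM
    let T : ℕ → Set ℝ := fun i ↦ Set.Ioc ((i : ℝ) / M) ((i + 1 : ℝ) / M)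
    have hT : ∀ i, MeasurableSet (T i) := fun i ↦ measurableSet_Ioc
    calc _ ≤ μ (⋃ i ∈ Finset.range M, {ω | Y ω ∈ Set.univ ∧
            x ω k ∈ {z : Point | ∃ t ∈ T i, z = Sum.inl (j, t)} ∧
            x ω m ∈ {z : Point | ∃ t ∈ T i, z = Sum.inl (j, t)}}) := by
          refine measure_mono ?_
          rintro ω ⟨t, ⟨ht0, ht1⟩, h1, h2⟩
          have hc0 : 0 < ⌈t * M⌉₊ := Nat.ceil_pos.2 (by positivity)
          have hc1 : ⌈t * M⌉₊ ≤ M := Nat.ceil_le.2 (by nlinarith)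
          have hTt : t ∈ T (⌈t * M⌉₊ - 1) := by
            have e : ((⌈t * M⌉₊ - 1 : ℕ) : ℝ) = (⌈t * M⌉₊ : ℝ) - 1 := by
              rw [Nat.cast_sub hc0]; simp
            refine ⟨?_, ?_⟩
            · rw [e, div_lt_iff₀ hM']
              have := Nat.ceil_lt_add_one (show 0 ≤ t * M by positivity)
              linarith
            · rw [e, le_div_iff₀ hM']
              have := Nat.le_ceil (t * M)
              linarith
          simp only [Set.mem_iUnion]
          exact ⟨⌈t * M⌉₊ - 1, Finset.mem_range.2 (by omega), trivial, ⟨t, hTt, h1⟩, ⟨t, hTt, h2⟩⟩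
      _ ≤ ∑ i ∈ Finset.range M, _ := measure_biUnion_finset_le _ _
      _ ≤ ∑ i ∈ Finset.range M, ENNReal.ofReal (1 / M) * ENNReal.ofReal (1 / M) := by
          refine Finset.sum_le_sum fun i _ ↦ ?_
          rw [hc.measure_mem_le hp MeasurableSet.univ hkm (measurableSet_circle_points j (hT i))
            (measurableSet_circle_points j (hT i))]
          have hv : ∀ l : ℕ → ℝ, volume (T i ∩ Set.Ico 0 (l j)) ≤ ENNReal.ofReal (1 / M) := by
            intro l
            refine (measure_mono Set.inter_subset_left).trans ?_
            simp only [T, Real.volume_Ioc]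
            apply le_of_eq
            congr 1
            ring
          calc _ ≤ ∫⁻ l in Set.univ, ENNReal.ofReal (1 / M) * ENNReal.ofReal (1 / M) ∂p := by
                refine lintegral_mono fun l ↦ ?_
                simp only [uniformPoint_circle _ _ (hT i)]
                exact mul_le_mul' (hv l) (hv l)
            _ = _ := by simp
      _ = ENNReal.ofReal (1 / M) := by
          rw [Finset.sum_const, Finset.card_range, nsmul_eq_mul, ← ENNReal.ofReal_mul
            (by positivity), ← ENNReal.ofReal_natCast, ← ENNReal.ofReal_mul (by positivity)]
          congr 1
          field_simp
  have hz : μ {ω | ∃ t ∈ Set.Ioc (0 : ℝ) 1, x ω k = Sum.inl (j, t) ∧ x ω m = Sum.inl (j, t)}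
      = 0 := by
    refine le_antisymm (ge_of_tendsto (f := fun M : ℕ ↦ ENNReal.ofReal (1 / M)) (x := atTop)
      ?_ ?_) bot_le
    · simpa using ENNReal.tendsto_ofReal tendsto_one_div_atTop_nhds_zero_nat
    · filter_upwards [eventually_gt_atTop 0] with M hM using hb M hM
  filter_upwards [hc.ae_pos hp, hc.ae_le hp, hc.ae_mem_nabla hp,
    measure_eq_zero_iff_ae_notMem.1 hz] with ω h1 h2 h3 h4 t htk htm
  exact absurd ⟨t, ⟨h1 _ _ _ htk, (h2 _ _ _ htk).trans (h3.1 j).2⟩, htk, htm⟩ h4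

theorem ae_goodPoints [IsProbabilityMeasure μ] (hc : IsCoupling μ p Y x)
    (hp : ∀ᵐ l ∂p, l ∈ nabla) : ∀ᵐ ω ∂μ, GoodPoints (Y ω) (x ω) := by
  filter_upwards [hc.ae_pos hp, hc.ae_le hp, hc.ae_inj hp] with ω h1 h2 h3
  exact ⟨h1, h2, h3⟩

end IsCoupling

/-! ### Weights on labelled points -/

/-- The point of the unit circle with angle `2 π t`. -/
noncomputable def rot (t : ℝ) : Circle := Circle.exp (2 * Real.pi * t)

theorem continuous_circle_coe : Continuous fun u : Circle ↦ (u : ℂ) := continuous_subtype_val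

theorem measurable_circle_coe : Measurable fun u : Circle ↦ (u : ℂ) :=
  continuous_circle_coe.measurable

theorem circle_coe_prod {ι : Type*} (s : Finset ι) (f : ι → Circle) :
    ((∏ i ∈ s, f i : Circle) : ℂ) = ∏ i ∈ s, (f i : ℂ) :=
  map_prod Circle.coeHom f s

theorem continuous_rot : Continuous rot := by
  unfold rot; fun_prop

theorem measurable_rot : Measurable rot := continuous_rot.measurable

theorem coe_rot (t : ℝ) : (rot t : ℂ) = Complex.exp (2 * Complex.I * Real.pi * t) := by
  rw [rot, Circle.coe_exp]
  push_cast
  ring_nf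

/-- Only finitely many labels carry a value of g other than 1, so g - 1 is a finite combination of
indicators of labels. -/
theorem integral_labelLaw {l : ℕ → ℝ} (hl : l ∈ nabla) {g : Option ℕ → ℂ} (J : ℕ)
    (hg : ∀ j, J ≤ j → g (some j) = 1) :
    ∫ c, g c ∂labelLaw l = 1 + ∑ j ∈ Finset.range J, (l j : ℂ) * (g (some j) - 1) +
      ((1 - ∑' j, l j : ℝ) : ℂ) * (g none - 1) := by
  have e : ∀ c, g c = 1 + ∑ j ∈ Finset.range J,
      (({some j} : Set (Option ℕ)).indicator (fun _ ↦ g (some j) - 1) c) +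
      ({none} : Set (Option ℕ)).indicator (fun _ ↦ g none - 1) c := by
    intro c
    cases c with
    | none => simp [Set.indicator]
    | some i =>
      simp only [Set.indicator, Set.mem_singleton_iff, Option.some.injEq, reduceCtorEq, if_false,
        add_zero, Finset.sum_ite_eq, Finset.mem_range]
      split_ifs with h
      · ring
      · simpa using hg i (not_lt.1 h)
  have hi : ∀ (c : Option ℕ) (z : ℂ), Integrable (({c} : Set (Option ℕ)).indicator fun _ ↦ z)
      (labelLaw l) := fun c z ↦ (integrable_const z).indicator (measurableSet_singleton c)
  have hv : ∀ (c : Option ℕ) (z : ℂ), ∫ c', ({c} : Set (Option ℕ)).indicator (fun _ ↦ z) c'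
      ∂labelLaw l = (labelWeight l c : ℂ) * z := fun c z ↦ by
    rw [integral_indicator_const _ (measurableSet_singleton c), measureReal_def,
      labelLaw_singleton hl, ENNReal.toReal_ofReal (labelWeight_nonneg hl c)]
    simp
  calc ∫ c, g c ∂labelLaw l = ∫ c, (1 + ∑ j ∈ Finset.range J,
      (({some j} : Set (Option ℕ)).indicator (fun _ ↦ g (some j) - 1) c) +
      ({none} : Set (Option ℕ)).indicator (fun _ ↦ g none - 1) c) ∂labelLaw l :=
        integral_congr_ae (ae_of_all _ e)
    _ = _ := by
      have i1 : Integrable (fun c ↦ ∑ j ∈ Finset.range J,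
          (({some j} : Set (Option ℕ)).indicator (fun _ ↦ g (some j) - 1) c)) (labelLaw l) :=
        integrable_finsetSum _ fun j _ ↦ hi _ _
      have i2 : Integrable (fun c ↦ 1 + ∑ j ∈ Finset.range J,
          (({some j} : Set (Option ℕ)).indicator (fun _ ↦ g (some j) - 1) c)) (labelLaw l) :=
        (integrable_const _).add i1
      rw [integral_add i2 (hi _ _), integral_add (integrable_const _) i1,
        integral_finsetSum _ fun j _ ↦ hi _ _]
      simp only [hv, labelWeight]
      simp

theorem labelCount_eq_sum {n : ℕ} (a : Fin n → Option ℕ) (c : Option ℕ) :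
    labelCount a c = ∑ k, if a k = c then 1 else 0 := by
  rw [labelCount, Finset.card_filter]

theorem labelCount_le {n : ℕ} (a : Fin n → Option ℕ) (c : Option ℕ) : labelCount a c ≤ n := by
  unfold labelCount
  exact (Finset.card_le_univ _).trans (by simp)

theorem labelCount_div_mem {n : ℕ} (a : Fin n → Option ℕ) (c : Option ℕ) :
    (labelCount a c : ℝ) / n ∈ Set.Icc (0 : ℝ) 1 :=
  ⟨by positivity, div_le_one_of_le₀ (Nat.cast_le.2 (labelCount_le a c)) (by positivity)⟩

theorem labelProd_eq_prod {M : Type*} [CommMonoid M] {n : ℕ} (a : Fin n → Option ℕ)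
    (v : Fin n → M) (c : Option ℕ) : labelProd a v c = ∏ k, if a k = c then v k else 1 := by
  rw [labelProd, Finset.prod_filter]

theorem labelProd_of_labelCount_eq_zero {M : Type*} [CommMonoid M] {n : ℕ}
    {a : Fin n → Option ℕ} {v : Fin n → M} {c : Option ℕ} (h : labelCount a c = 0) :
    labelProd a v c = 1 := by
  rw [labelCount, Finset.card_eq_zero] at h
  rw [labelProd, h, Finset.prod_empty]

/-- The Fourier coefficients of a distribution on the circle, parametrized by angles. -/
noncomputable def fourierCoeffOf (ν : Measure ℝ) (d : ℤ) : ℂ := ∫ t, ((rot t ^ d : Circle) : ℂ) ∂ν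

theorem norm_fourierCoeffOf_le (ν : Measure ℝ) [IsProbabilityMeasure ν] (d : ℤ) :
    ‖fourierCoeffOf ν d‖ ≤ 1 := by
  refine (norm_integral_le_integral_norm _).trans ?_
  simp only [Circle.norm_coe]
  simp

section Weights

variable {Ω : Type*} {x : Ω → ℕ → Point}

/-- The product of the weights on the `j`-th circle. -/
noncomputable def circleWeight (x : Ω → ℕ → Point) (n j : ℕ) (q : Ω × (Fin n → ℝ)) : Circle :=
  labelProd (labels (x q.1) n) (fun k ↦ rot (q.2 k)) (some j)

/-- The number of points on the `j`-th circle, or on the segment. -/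
def pointCount (x : Ω → ℕ → Point) (n : ℕ) (c : Option ℕ) (ω : Ω) : ℕ :=
  labelCount (labels (x ω) n) c

theorem circleWeight_of_pointCount_eq_zero {n j : ℕ} {q : Ω × (Fin n → ℝ)}
    (h : pointCount x n (some j) q.1 = 0) : circleWeight x n j q = 1 :=
  labelProd_of_labelCount_eq_zero h

end Weights

/-! ### The model: points with independent angles -/

section Model

variable {Ω : Type*} [MeasurableSpace Ω] {μ : Measure Ω}
  {p : Measure (ℕ → ℝ)} {Y : Ω → ℕ → ℝ} {x : Ω → ℕ → Point}

/-- The probability that carries the points and independent angles with law `ν`. -/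
noncomputable abbrev model (μ : Measure Ω) (ν : Measure ℝ) (n : ℕ) : Measure (Ω × (Fin n → ℝ)) :=
  μ.prod (Measure.pi fun _ ↦ ν)

theorem measurable_apply_label (hc : IsCoupling μ p Y x) (n : ℕ) {E : Type*} [MeasurableSpace E]
    {γ : Option ℕ → ℝ → E} (hγ : ∀ c, Measurable (γ c)) (k : Fin n) :
    Measurable fun q : Ω × (Fin n → ℝ) ↦ γ (label (x q.1 k)) (q.2 k) := by
  have h1 : Measurable fun q : Option ℕ × ℝ ↦ γ q.1 q.2 :=
    measurable_from_prod_countable_right hγ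
  have h2 : Measurable fun ω ↦ label (x ω k) := (measurable_pi_apply k).comp (hc.measurable_labels n)
  exact h1.comp ((h2.comp measurable_fst).prodMk ((measurable_pi_apply k).comp measurable_snd))

theorem measurable_circleWeight (hc : IsCoupling μ p Y x) (n j : ℕ) :
    Measurable (circleWeight x n j) := by
  have : circleWeight x n j = fun q ↦ ∏ k : Fin n,
      (if label (x q.1 k) = some j then rot (q.2 k) else 1) := by
    ext1 q
    rw [circleWeight, labelProd_eq_prod]
    rfl
  rw [this]
  refine Finset.measurable_prod _ fun k _ ↦ ?_
  refine measurable_apply_label hc n (γ := fun c t ↦ if c = some j then rot t else 1)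
    (fun c ↦ ?_) k
  split_ifs
  · exact measurable_rot
  · exact measurable_const

theorem measurable_pointCount (hc : IsCoupling μ p Y x) (n : ℕ) (c : Option ℕ) :
    Measurable (pointCount x n c) :=
  (Measurable.of_discrete (f := fun a : Fin n → Option ℕ ↦ labelCount a c)).comp
    (hc.measurable_labels n)

variable [IsProbabilityMeasure μ] (ν : Measure ℝ) [IsProbabilityMeasure ν]

/-- By Fubini, the independent angles can be integrated at fixed points. What remains is a product
of functions of the labels. -/
theorem integral_model_prod (hc : IsCoupling μ p Y x) (hp : ∀ᵐ l ∂p, l ∈ nabla) (n : ℕ)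
    {ψ : (ℕ → ℝ) → ℂ} (hψ : Measurable ψ) {C : ℝ} (hψC : ∀ l, ‖ψ l‖ ≤ C)
    {γ : Option ℕ → ℝ → ℂ} (hγ : ∀ c, Measurable (γ c)) (hγ1 : ∀ c t, ‖γ c t‖ ≤ 1) :
    ∫ q, ψ (Y q.1) * ∏ k : Fin n, γ (label (x q.1 k)) (q.2 k) ∂model μ ν n
      = ∫ l, ψ l * (∫ c, (∫ t, γ c t ∂ν) ∂labelLaw l) ^ n ∂p := by
  have hm : Measurable fun q : Ω × (Fin n → ℝ) ↦
      ψ (Y q.1) * ∏ k : Fin n, γ (label (x q.1 k)) (q.2 k) :=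
    (hψ.comp (hc.measurable_y.comp measurable_fst)).mul
      (Finset.measurable_prod _ fun k _ ↦ measurable_apply_label hc n hγ k)
  have hb : ∀ q : Ω × (Fin n → ℝ),
      ‖ψ (Y q.1) * ∏ k : Fin n, γ (label (x q.1 k)) (q.2 k)‖ ≤ C := fun q ↦ by
    rw [norm_mul, norm_prod]
    calc _ ≤ C * 1 := mul_le_mul (hψC _) (Finset.prod_le_one (fun _ _ ↦ norm_nonneg _)
          fun _ _ ↦ hγ1 _ _) (Finset.prod_nonneg fun _ _ ↦ norm_nonneg _)
          ((norm_nonneg _).trans (hψC 0))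
      _ = C := mul_one C
  rw [integral_prod _ (Integrable.of_bound hm.aestronglyMeasurable C (ae_of_all _ hb))]
  have e : ∀ ω, ∫ θ : Fin n → ℝ, ψ (Y ω) * ∏ k : Fin n, γ (label (x ω k)) (θ k)
      ∂(Measure.pi fun _ ↦ ν) = ψ (Y ω) * ∏ k : Fin n, (∫ t, γ (label (x ω k)) t ∂ν) := fun ω ↦ by
    rw [integral_const_mul, integral_fintype_prod_eq_prod]
  simp only [e]
  refine hc.integral_prod_label hp n hψ hψC (g := fun c ↦ ∫ t, γ c t ∂ν) (C' := 1) fun c ↦ ?_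
  refine (norm_integral_le_integral_norm _).trans ?_
  calc ∫ t, ‖γ c t‖ ∂ν ≤ ∫ t, 1 ∂ν := integral_mono_of_nonneg (ae_of_all _ fun _ ↦ norm_nonneg _)
        (integrable_const _) (ae_of_all _ (hγ1 c))
    _ = 1 := by simp

theorem integral_circleWeight_zpow (hc : IsCoupling μ p Y x) (hp : ∀ᵐ l ∂p, l ∈ nabla) (n j : ℕ)
    {A : Set (ℕ → ℝ)} (hA : MeasurableSet A) (d : ℤ) :
    ∫ q, A.indicator (fun _ ↦ (1 : ℂ)) (Y q.1) * ((circleWeight x n j q ^ d : Circle) : ℂ)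
      ∂model μ ν n = ∫ l in A, (1 + (l j : ℂ) * (fourierCoeffOf ν d - 1)) ^ n ∂p := by
  have h := integral_model_prod ν hc hp n (ψ := A.indicator fun _ ↦ (1 : ℂ))
    (measurable_const.indicator hA) (C := 1) (fun l ↦ by
      by_cases h : l ∈ A <;> simp [h])
    (γ := fun c t ↦ if c = some j then ((rot t ^ d : Circle) : ℂ) else 1)
    (fun c ↦ by
      split_ifs
      · exact (continuous_circle_coe.comp (continuous_rot.zpow d)).measurable
      · exact measurable_const)
    (fun c t ↦ by
      split_ifs
      · exact (Circle.norm_coe _).le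
      · simp)
  have e : ∀ q : Ω × (Fin n → ℝ), ((circleWeight x n j q ^ d : Circle) : ℂ) = ∏ k : Fin n,
      if label (x q.1 k) = some j then ((rot (q.2 k) ^ d : Circle) : ℂ) else 1 := by
    intro q
    rw [circleWeight, labelProd_eq_prod, ← Finset.prod_zpow, circle_coe_prod]
    refine Finset.prod_congr rfl fun k _ ↦ ?_
    by_cases h : label (x q.1 k) = some j <;> simp [labels, h]
  simp only [e]
  rw [h, ← integral_indicator hA]
  refine integral_congr_ae ?_
  filter_upwards [hp] with l hl
  by_cases hlA : l ∈ A
  · simp only [hlA, Set.indicator_of_mem, one_mul]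
    congr 1
    have e2 : ∀ c : Option ℕ, ∫ t, (if c = some j then ((rot t ^ d : Circle) : ℂ) else 1) ∂ν
        = if c = some j then fourierCoeffOf ν d else 1 := by
      intro c
      split_ifs
      · rfl
      · simp
    simp only [e2]
    rw [integral_labelLaw hl (j + 1) (fun i hi ↦ by
      rw [if_neg]
      simp only [Option.some.injEq]
      omega), Finset.sum_eq_single j]
    · simp
    · intro i _ hi
      simp [hi]
    · simp
  · simp [hlA]

/-- The probability that a circle is empty. It has to be subtracted from the Fourier coefficients of
the weight, since an empty circle has weight exactly one without being a small divisor. -/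
theorem integral_pointCount_eq_zero (hc : IsCoupling μ p Y x) (hp : ∀ᵐ l ∂p, l ∈ nabla)
    (n j : ℕ) {A : Set (ℕ → ℝ)} (hA : MeasurableSet A) :
    ∫ q, A.indicator (fun _ ↦ (1 : ℂ)) (Y q.1) *
      (if pointCount x n (some j) q.1 = 0 then 1 else 0)
      ∂model μ ν n = ∫ l in A, (1 - (l j : ℂ)) ^ n ∂p := by
  have h := integral_model_prod ν hc hp n (ψ := A.indicator fun _ ↦ (1 : ℂ))
    (measurable_const.indicator hA) (C := 1) (fun l ↦ by
      by_cases h : l ∈ A <;> simp [h])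
    (γ := fun c _ ↦ if c = some j then 0 else 1)
    (fun c ↦ measurable_const)
    (fun c t ↦ by split_ifs <;> simp)
  have e : ∀ q : Ω × (Fin n → ℝ), (if pointCount x n (some j) q.1 = 0 then (1 : ℂ) else 0)
      = ∏ k : Fin n, if label (x q.1 k) = some j then (0 : ℂ) else 1 := by
    intro q
    simp only [pointCount, labelCount, Finset.card_eq_zero, Finset.filter_eq_empty_iff]
    split_ifs with h
    · refine (Finset.prod_eq_one fun k _ ↦ if_neg (h (Finset.mem_univ k))).symm
    · push Not at h
      obtain ⟨k, -, hk⟩ := h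
      symm
      apply Finset.prod_eq_zero (Finset.mem_univ k)
      exact if_pos hk
  simp only [e]
  rw [h, ← integral_indicator hA]
  refine integral_congr_ae ?_
  filter_upwards [hp] with l hl
  by_cases hlA : l ∈ A
  · simp only [hlA, Set.indicator_of_mem, one_mul]
    congr 1
    simp only [integral_const, probReal_univ, one_smul]
    rw [integral_labelLaw hl (j + 1) (fun i hi ↦ by
      rw [if_neg]
      simp only [Option.some.injEq]
      omega), Finset.sum_eq_single j]
    · simp
      ring
    · intro i _ hi
      simp [hi]
    · simp
  · simp [hlA]

/-! ### Fejér kernel and weights close to one -/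

theorem quarter_sq_le_norm_sum_sq (H : ℕ) (u : Circle) (hu : ‖(1 : ℂ) - u‖ ≤ 1 / H) :
    ((H : ℝ) / 2) ^ 2 ≤ ‖∑ h ∈ Finset.range H, (u : ℂ) ^ h‖ ^ 2 := by
  have h1 : ∀ h : ℕ, ‖(u : ℂ) ^ h - 1‖ ≤ h * ‖(1 : ℂ) - u‖ := by
    intro h
    induction h with
    | zero => simp
    | succ h ih =>
      calc ‖(u : ℂ) ^ (h + 1) - 1‖ = ‖((u : ℂ) ^ h - 1) * u + (u - 1)‖ := by ring_nf
        _ ≤ ‖((u : ℂ) ^ h - 1) * u‖ + ‖(u : ℂ) - 1‖ := norm_add_le _ _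
        _ ≤ h * ‖(1 : ℂ) - u‖ + ‖(1 : ℂ) - u‖ := by
            rw [norm_mul, Circle.norm_coe, mul_one, norm_sub_rev (u : ℂ) 1]
            gcongr
        _ = _ := by push_cast; ring
  -- Each term satisfies |u^h - 1| ≤ h / H, and these bounds add up to at most H / 2: the geometric
  -- sum keeps at least half of its maximal size.
  have h2 : (H : ℝ) - ‖∑ h ∈ Finset.range H, (u : ℂ) ^ h‖ ≤ H / 2 := by
    calc (H : ℝ) - ‖∑ h ∈ Finset.range H, (u : ℂ) ^ h‖
        = ‖(H : ℂ)‖ - ‖∑ h ∈ Finset.range H, (u : ℂ) ^ h‖ := by simp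
      _ ≤ ‖(H : ℂ) - ∑ h ∈ Finset.range H, (u : ℂ) ^ h‖ := norm_sub_norm_le _ _
      _ = ‖∑ h ∈ Finset.range H, ((u : ℂ) ^ h - 1)‖ := by
          rw [Finset.sum_sub_distrib, norm_sub_rev]; simp
      _ ≤ ∑ h ∈ Finset.range H, ‖(u : ℂ) ^ h - 1‖ := norm_sum_le _ _
      _ ≤ ∑ h ∈ Finset.range H, (h : ℝ) * (1 / H) :=
          Finset.sum_le_sum fun h _ ↦ (h1 h).trans (by gcongr)
      _ = (∑ h ∈ Finset.range H, (h : ℝ)) * (1 / H) := by rw [Finset.sum_mul]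
      _ ≤ H / 2 := by
          rcases Nat.eq_zero_or_pos H with rfl | hH
          · simp
          have hs : (∑ h ∈ Finset.range H, (h : ℝ)) * 2 = H * (H - 1) := by
            have := Finset.sum_range_id_mul_two H
            have h' : ((∑ h ∈ Finset.range H, h : ℕ) : ℝ) * 2 = H * ((H - 1 : ℕ) : ℝ) := by
              exact_mod_cast this
            rw [Nat.cast_sub hH] at h'
            push_cast at h'
            exact h'
          have hH' : (0 : ℝ) < H := Nat.cast_pos.2 hH
          rw [mul_one_div, div_le_iff₀ hH']
          nlinarith
  gcongr
  linarith

/-- On the event, the Fejér kernel |∑_{h<H} W^h|² is at least (H/2)². Expanded as ∑ W^(h-h'), it has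
mean at most H from the diagonal plus H² D from the other terms; the quotient by (H/2)² is 4/H + 4D.
The function `f` below restricts to occupied circles, whence the power of 1 - l j in the hypothesis.
-/
theorem measure_circleWeight_near_one_le (hc : IsCoupling μ p Y x) (hp : ∀ᵐ l ∂p, l ∈ nabla)
    (n j : ℕ) {A : Set (ℕ → ℝ)} (hA : MeasurableSet A) {H : ℕ} (hH : 0 < H) {D : ℝ}
    (hD0 : 0 ≤ D)
    (hD : ∀ d : ℤ, d ≠ 0 → |d| < H → ‖∫ l in A, ((1 + (l j : ℂ) * (fourierCoeffOf ν d - 1)) ^ n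
      - (1 - (l j : ℂ)) ^ n) ∂p‖ ≤ D) :
    (model μ ν n).real {q | Y q.1 ∈ A ∧ 0 < pointCount x n (some j) q.1 ∧
      ‖(1 : ℂ) - circleWeight x n j q‖ ≤ 1 / H} ≤ 4 / H + 4 * D := by
  have := hc.isProbabilityMeasure
  set S := {q : Ω × (Fin n → ℝ) | Y q.1 ∈ A ∧ 0 < pointCount x n (some j) q.1 ∧
      ‖(1 : ℂ) - circleWeight x n j q‖ ≤ 1 / H} with hSdef
  have hmY : Measurable fun q : Ω × (Fin n → ℝ) ↦ Y q.1 := hc.measurable_y.comp measurable_fst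
  have hmN : Measurable fun q : Ω × (Fin n → ℝ) ↦ pointCount x n (some j) q.1 :=
    (measurable_pointCount hc n _).comp measurable_fst
  have hmU : Measurable fun q : Ω × (Fin n → ℝ) ↦ (circleWeight x n j q : ℂ) :=
    measurable_circle_coe.comp (measurable_circleWeight hc n j)
  have hS : MeasurableSet S :=
    (hmY hA).inter ((hmN (measurableSet_Ioi (a := 0))).inter
      (measurableSet_le ((measurable_const.sub hmU).norm) measurable_const))
  let f : Ω × (Fin n → ℝ) → ℂ := fun q ↦ A.indicator (fun _ ↦ (1 : ℂ)) (Y q.1) *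
    (1 - if pointCount x n (some j) q.1 = 0 then 1 else 0)
  have hfm : Measurable f := ((measurable_const.indicator hA).comp hmY).mul
    (measurable_const.sub (Measurable.ite (hmN (measurableSet_singleton 0)) measurable_const
      measurable_const))
  have hfb : ∀ q, ‖f q‖ ≤ 1 := by
    intro q
    simp only [f]
    by_cases h : Y q.1 ∈ A <;> by_cases h' : pointCount x n (some j) q.1 = 0 <;> simp [h, h']
  have hcoef : ∀ h h' : ℕ, h ∈ Finset.range H → h' ∈ Finset.range H → h ≠ h' →
      ‖∫ q, f q * ((circleWeight x n j q ^ ((h : ℤ) - h') : Circle) : ℂ) ∂model μ ν n‖ ≤ D := by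
    intro h h' hh hh' hne
    have hd : ((h : ℤ) - h') ≠ 0 := by omega
    have hd' : |((h : ℤ) - h')| < H := by
      rw [Finset.mem_range] at hh hh'
      rw [abs_lt]; omega
    refine le_of_eq_of_le ?_ (hD _ hd hd')
    congr 1
    have e : ∀ q, f q * ((circleWeight x n j q ^ ((h : ℤ) - h') : Circle) : ℂ)
        = A.indicator (fun _ ↦ (1 : ℂ)) (Y q.1) *
          ((circleWeight x n j q ^ ((h : ℤ) - h') : Circle) : ℂ)
        - A.indicator (fun _ ↦ (1 : ℂ)) (Y q.1) *
          (if pointCount x n (some j) q.1 = 0 then 1 else 0) := by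
      intro q
      simp only [f]
      -- On an empty circle the weight is one, so the two terms on the right cancel, as does `f`.
      split_ifs with h0
      · rw [circleWeight_of_pointCount_eq_zero h0]; simp
      · simp
    simp only [e]
    have hb1 : ∀ᵐ l ∂p.restrict A,
        ‖(1 + (l j : ℂ) * (fourierCoeffOf ν ((h : ℤ) - h') - 1)) ^ n‖ ≤ 1 := by
      refine ae_restrict_of_ae ?_
      filter_upwards [hp] with l hl
      rw [norm_pow]
      refine pow_le_one₀ (norm_nonneg _) ?_
      have h1 := (hl.1 j).1
      have h2 := (hl.1 j).2
      calc ‖1 + (l j : ℂ) * (fourierCoeffOf ν ((h : ℤ) - h') - 1)‖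
          = ‖((1 - l j : ℝ) : ℂ) + (l j : ℂ) * fourierCoeffOf ν ((h : ℤ) - h')‖ := by
            push_cast; ring_nf
        _ ≤ (1 - l j) + l j * 1 := by
            refine (norm_add_le _ _).trans (add_le_add ?_ ?_)
            · rw [Complex.norm_real, Real.norm_eq_abs, abs_of_nonneg (by linarith)]
            · rw [norm_mul, Complex.norm_real, Real.norm_eq_abs, abs_of_nonneg h1]
              exact mul_le_mul_of_nonneg_left (norm_fourierCoeffOf_le ν _) h1
        _ = 1 := by ring
    have hb2 : ∀ᵐ l ∂p.restrict A, ‖(1 - (l j : ℂ)) ^ n‖ ≤ 1 := by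
      refine ae_restrict_of_ae ?_
      filter_upwards [hp] with l hl
      rw [norm_pow]
      refine pow_le_one₀ (norm_nonneg _) ?_
      have h1 := (hl.1 j).1
      have h2 := (hl.1 j).2
      rw [show (1 - (l j : ℂ)) = ((1 - l j : ℝ) : ℂ) by push_cast; rfl, Complex.norm_real,
        Real.norm_eq_abs, abs_of_nonneg (by linarith)]
      linarith
    have hml : Measurable fun l : ℕ → ℝ ↦ (l j : ℂ) :=
      Complex.measurable_ofReal.comp (measurable_pi_apply j)
    have hmf : Measurable fun q ↦ A.indicator (fun _ ↦ (1 : ℂ)) (Y (q : Ω × (Fin n → ℝ)).1) :=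
      (measurable_const.indicator hA).comp hmY
    have hi1 : ∀ q : Ω × (Fin n → ℝ), ‖A.indicator (fun _ ↦ (1 : ℂ)) (Y q.1)‖ ≤ 1 := fun q ↦ by
      by_cases h : Y q.1 ∈ A <;> simp [h]
    rw [integral_sub, integral_circleWeight_zpow ν hc hp n j hA,
      integral_pointCount_eq_zero ν hc hp n j hA, integral_sub]
    · exact Integrable.of_bound ((measurable_const.add
        (hml.mul measurable_const)).pow_const n).aestronglyMeasurable 1 hb1
    · exact Integrable.of_bound ((measurable_const.sub hml).pow_const n).aestronglyMeasurable 1 hb2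
    · refine Integrable.of_bound (hmf.mul (measurable_circle_coe.comp
        ((continuous_zpow _).measurable.comp (measurable_circleWeight hc n j)))).aestronglyMeasurable
        1 (ae_of_all _ fun q ↦ ?_)
      rw [norm_mul, Circle.norm_coe, mul_one]
      exact hi1 q
    · refine Integrable.of_bound (hmf.mul (Measurable.ite (hmN (measurableSet_singleton 0))
        measurable_const measurable_const)).aestronglyMeasurable 1 (ae_of_all _ fun q ↦ ?_)
      rw [norm_mul]
      have := hi1 q
      split_ifs
      · simpa using this
      · simp
  let g : Ω × (Fin n → ℝ) → ℝ := fun q ↦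
    (f q).re * ‖∑ h ∈ Finset.range H, (circleWeight x n j q : ℂ) ^ h‖ ^ 2
  have hfre : ∀ q, f q = ((f q).re : ℂ) := by
    intro q
    simp only [f]
    by_cases h : Y q.1 ∈ A <;> by_cases h' : pointCount x n (some j) q.1 = 0 <;> simp [h, h']
  have hgc : ∀ q, (g q : ℂ) = ∑ h ∈ Finset.range H, ∑ h' ∈ Finset.range H,
      f q * ((circleWeight x n j q ^ ((h : ℤ) - h') : Circle) : ℂ) := by
    intro q
    simp only [g]
    rw [Complex.ofReal_mul, ← hfre, Complex.ofReal_pow, ← Complex.mul_conj', map_sum,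
      Finset.sum_mul_sum, Finset.mul_sum]
    refine Finset.sum_congr rfl fun h _ ↦ ?_
    rw [Finset.mul_sum]
    refine Finset.sum_congr rfl fun h' _ ↦ ?_
    rw [zpow_sub, zpow_natCast, zpow_natCast, map_pow, ← Circle.coe_inv_eq_conj, Circle.coe_mul,
      Circle.coe_inv, Circle.coe_pow, Circle.coe_inv, Circle.coe_pow, inv_pow]
  have hfint : ∀ h h' : ℕ, Integrable
      (fun q ↦ f q * ((circleWeight x n j q ^ ((h : ℤ) - h') : Circle) : ℂ)) (model μ ν n) :=
    fun h h' ↦ Integrable.of_bound (hfm.mul (measurable_circle_coe.comp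
      ((continuous_zpow _).measurable.comp (measurable_circleWeight hc n j)))).aestronglyMeasurable
      1 (ae_of_all _ fun q ↦ by rw [norm_mul, Circle.norm_coe, mul_one]; exact hfb q)
  have hgint : ∫ q, g q ∂model μ ν n ≤ H + H ^ 2 * D := by
    have e1 : ((∫ q, g q ∂model μ ν n : ℝ) : ℂ) = ∑ h ∈ Finset.range H, ∑ h' ∈ Finset.range H,
        ∫ q, f q * ((circleWeight x n j q ^ ((h : ℤ) - h') : Circle) : ℂ) ∂model μ ν n := by
      rw [← integral_complex_ofReal]
      simp only [hgc]
      rw [integral_finsetSum _ fun h _ ↦ integrable_finsetSum _ fun h' _ ↦ hfint h h']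
      refine Finset.sum_congr rfl fun h _ ↦ ?_
      rw [integral_finsetSum _ fun h' _ ↦ hfint h h']
    calc ∫ q, g q ∂model μ ν n ≤ ‖((∫ q, g q ∂model μ ν n : ℝ) : ℂ)‖ := by
          rw [Complex.norm_real]; exact Real.le_norm_self _
      _ ≤ ∑ h ∈ Finset.range H, ∑ h' ∈ Finset.range H, ((if h = h' then 1 else 0) + D) := by
          rw [e1]
          refine (norm_sum_le _ _).trans (Finset.sum_le_sum fun h hh ↦ ?_)
          refine (norm_sum_le _ _).trans (Finset.sum_le_sum fun h' hh' ↦ ?_)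
          split_ifs with heq
          · calc _ ≤ ∫ q, ‖f q * ((circleWeight x n j q ^ ((h : ℤ) - h') : Circle) : ℂ)‖
                  ∂model μ ν n := norm_integral_le_integral_norm _
              _ ≤ ∫ q, (1 : ℝ) ∂model μ ν n := by
                  refine integral_mono (hfint h h').norm (integrable_const _) fun q ↦ ?_
                  simp only [norm_mul, Circle.norm_coe, mul_one]
                  exact hfb q
              _ ≤ 1 + D := by simp [hD0]
          · simpa using hcoef h h' hh hh' heq
      _ = H + H ^ 2 * D := by
          simp only [Finset.sum_add_distrib, Finset.sum_ite_eq, Finset.sum_const,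
            Finset.card_range, nsmul_eq_mul]
          rw [Finset.sum_congr rfl fun h hh ↦ if_pos hh]
          simp
          ring
  have hlow : ((H : ℝ) / 2) ^ 2 * (model μ ν n).real S ≤ ∫ q, g q ∂model μ ν n := by
    have hgi : Integrable g (model μ ν n) := by
      have h1 : Integrable (fun q ↦ ∑ h ∈ Finset.range H, ∑ h' ∈ Finset.range H,
          f q * ((circleWeight x n j q ^ ((h : ℤ) - h') : Circle) : ℂ)) (model μ ν n) :=
        integrable_finsetSum _ fun h _ ↦ integrable_finsetSum _ fun h' _ ↦ hfint h h'
      refine h1.re.congr (ae_of_all _ fun q ↦ ?_)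
      simp only [← hgc]
      simp
    have e : ((H : ℝ) / 2) ^ 2 * (model μ ν n).real S
        = ∫ q, S.indicator (fun _ ↦ ((H : ℝ) / 2) ^ 2) q ∂model μ ν n := by
      rw [integral_indicator_const _ hS, smul_eq_mul, mul_comm]
    rw [e]
    refine integral_mono ((integrable_const _).indicator hS) hgi fun q ↦ ?_
    have hfnn : 0 ≤ (f q).re := by
      simp only [f]
      by_cases h : Y q.1 ∈ A <;> by_cases h' : pointCount x n (some j) q.1 = 0 <;> simp [h, h']
    by_cases hq : q ∈ S
    · have : (f q).re = 1 := by
        simp [f, hq.1, hq.2.1.ne']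
      simp only [hq, Set.indicator_of_mem, g, this, one_mul]
      exact quarter_sq_le_norm_sum_sq H _ hq.2.2
    · simp only [hq, not_false_eq_true, Set.indicator_of_notMem, g]
      positivity
  have hH' : (0 : ℝ) < H := Nat.cast_pos.2 hH
  have hfin : ((H : ℝ) / 2) ^ 2 * (model μ ν n).real S ≤ H + H ^ 2 * D := hlow.trans hgint
  have : (model μ ν n).real S ≤ (H + H ^ 2 * D) / ((H : ℝ) / 2) ^ 2 := by
    rw [le_div_iff₀ (by positivity)]
    linarith
  refine this.trans (le_of_eq ?_)
  field_simp
  ring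

end Model

/-! ### Irrational numbers of finite type -/

theorem distInt_pos_of_irrational {α : ℝ} (hα : Irrational α) {m : ℕ} (hm : m ≠ 0) :
    0 < distInt (m * α) := by
  rw [distInt, abs_pos, sub_ne_zero]
  exact (hα.natCast_mul hm).ne_int _

/-- An integer exponent γ above the type does not belong to the set of which the type is the
supremum, so the liminf is positive and the bound holds for large m. Irrationality gives a positive
lower bound for the finitely many others. -/
theorem IsFiniteType.exists_le_distInt {α : ℝ} (h : IsFiniteType α) (hα : Irrational α) :
    ∃ c > 0, ∃ γ : ℕ, ∀ m : ℕ, m ≠ 0 → c / (m : ℝ) ^ γ ≤ distInt (m * α) := by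
  obtain ⟨γ, hγ⟩ : ∃ γ : ℕ, diophantineType α < (γ : ℝ) := by
    obtain ⟨q, hq⟩ := EReal.lt_iff_exists_real_btwn.1 h
    obtain ⟨γ, hγ⟩ := exists_nat_gt q
    exact ⟨γ, hq.1.trans (by exact_mod_cast hγ)⟩
  have h1 : liminf (fun n : ℕ ↦ ENNReal.ofReal ((n : ℝ) ^ (γ : ℝ) * distInt (n * α))) atTop ≠ 0 := by
    intro h0
    refine absurd ?_ (not_le.2 hγ)
    exact le_sSup (a := ((γ : ℝ) : EReal)) ⟨γ, rfl, h0⟩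
  obtain ⟨b, hb0, hb⟩ := exists_between (pos_iff_ne_zero.2 h1)
  obtain ⟨N, hN⟩ := eventually_atTop.1 (eventually_lt_of_lt_liminf hb)
  have hbt : b ≠ ⊤ := (hN N le_rfl).ne_top
  have hb' : 0 < b.toReal := ENNReal.toReal_pos hb0.ne' hbt
  obtain ⟨c', hc', hc''⟩ : ∃ c' > 0, ∀ m ∈ Finset.Ico 1 (N + 1),
      c' ≤ (m : ℝ) ^ γ * distInt (m * α) := by
    -- One more index than necessary, so that the range is nonempty when N = 0.
    refine ⟨(Finset.Ico 1 (N + 2)).inf' (by simp) fun m : ℕ ↦ (m : ℝ) ^ γ * distInt (m * α), ?_, ?_⟩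
    · rw [gt_iff_lt, Finset.lt_inf'_iff]
      intro m hm
      have : m ≠ 0 := by have := (Finset.mem_Ico.1 hm).1; omega
      exact mul_pos (by positivity) (distInt_pos_of_irrational hα this)
    · intro m hm
      exact Finset.inf'_le _ (Finset.mem_Ico.2 (by have := Finset.mem_Ico.1 hm; omega))
  refine ⟨min b.toReal c', lt_min hb' hc', γ, fun m hm ↦ ?_⟩
  have hmp : (0 : ℝ) < (m : ℝ) ^ γ := by positivity
  rw [div_le_iff₀ hmp, mul_comm]
  rcases lt_or_ge m N with hmN | hmN
  · exact (min_le_right _ _).trans (hc'' m (Finset.mem_Ico.2 (by omega)))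
  · refine (min_le_left _ _).trans ?_
    have := (hN m hmN).le
    rw [Real.rpow_natCast] at this
    exact (ENNReal.le_ofReal_iff_toReal_le hbt
      (mul_nonneg hmp.le (abs_nonneg _))).1 this

theorem rot_add (s t : ℝ) : rot (s + t) = rot s * rot t := by
  rw [rot, rot, rot, mul_add, Circle.exp_add]

theorem rot_intCast (m : ℤ) : rot m = 1 := by
  refine Circle.ext ?_
  rw [coe_rot, Circle.coe_one, Complex.exp_eq_one_iff]
  exact ⟨m, by push_cast; ring⟩

theorem rot_natCast_mul (m : ℕ) (t : ℝ) : rot (m * t) = rot t ^ m := by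
  rw [rot, rot, ← Circle.exp_nsmul, nsmul_eq_mul]
  ring_nf

theorem rot_intCast_mul (m : ℤ) (t : ℝ) : rot (m * t) = rot t ^ m := by
  rw [rot, rot, ← Circle.exp_zsmul, zsmul_eq_mul]
  ring_nf

theorem rot_neg (t : ℝ) : rot (-t) = (rot t)⁻¹ := by
  rw [rot, rot, ← Circle.exp_neg]; ring_nf

theorem norm_one_sub_rot (t : ℝ) : ‖(1 : ℂ) - rot t‖ = 2 * |Real.sin (Real.pi * t)| := by
  rw [norm_sub_rev, coe_rot, show (2 * Complex.I * Real.pi * t : ℂ)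
    = Complex.I * ((2 * Real.pi * t : ℝ) : ℂ) by push_cast; ring,
    Complex.norm_exp_I_mul_ofReal_sub_one, Real.norm_eq_abs, abs_mul, abs_two]
  ring_nf

/-- Jordan's inequality for the sine, after a reduction modulo the integers; it would even give a
factor 4. -/
theorem distInt_le_norm_one_sub_rot (t : ℝ) : distInt t ≤ ‖(1 : ℂ) - rot t‖ := by
  have e : rot t = rot (t - round t) := by
    conv_lhs => rw [show t = (t - round t) + (round t : ℤ) by ring, rot_add, rot_intCast, mul_one]
  have h := abs_sub_round t
  have hpi := Real.pi_pos
  rw [e, norm_one_sub_rot, distInt]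
  have := Real.mul_abs_le_abs_sin (x := Real.pi * (t - round t)) (by
    rw [abs_mul, abs_of_pos hpi]; nlinarith)
  rw [abs_mul, abs_of_pos hpi] at this
  have e2 : 2 / Real.pi * (Real.pi * |t - round t|) = 2 * |t - round t| := by field_simp
  rw [e2] at this
  have := abs_nonneg (t - round t)
  linarith

theorem IsFiniteType.exists_le_norm {α : ℝ} (h : IsFiniteType α) (hα : Irrational α) :
    ∃ c > 0, ∃ γ : ℕ, ∀ m : ℕ, m ≠ 0 → c / (m : ℝ) ^ γ ≤ ‖(1 : ℂ) - (rot (-α) : ℂ) ^ m‖ := by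
  obtain ⟨c, hc, γ, hγ⟩ := h.exists_le_distInt hα
  refine ⟨c, hc, γ, fun m hm ↦ (hγ m hm).trans ?_⟩
  have := distInt_le_norm_one_sub_rot (m * α)
  rw [rot_natCast_mul] at this
  refine this.trans (le_of_eq ?_)
  rw [rot_neg, Circle.coe_inv, Circle.coe_pow]
  set w := rot α with hw
  rw [← Circle.coe_pow, inv_pow, ← Circle.coe_pow, ← Circle.coe_inv, Circle.coe_inv_eq_conj]
  rw [← Complex.norm_conj, map_sub, map_one]

theorem rot_zpow_ne_one_of_irrational {α : ℝ} (hα : Irrational α) {d : ℤ} (hd : d ≠ 0) :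
    rot (-α) ^ d ≠ 1 := by
  rw [← rot_intCast_mul, Ne, ← Circle.coe_inj, coe_rot, Circle.coe_one, Complex.exp_eq_one_iff]
  rintro ⟨m, hm⟩
  have hpi := Real.pi_pos
  have : (d : ℝ) * α = (-m : ℤ) := by
    have h2 : (2 * Complex.I * Real.pi) * ((d * -α : ℝ) : ℂ) = (2 * Complex.I * Real.pi) * m := by
      rw [hm]; ring
    have h3 := mul_left_cancel₀ Complex.two_pi_I_ne_zero (mul_right_comm (2 : ℂ) _ _ ▸ h2)
    have h4 : (d * -α : ℝ) = (m : ℝ) := by exact_mod_cast h3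
    push_cast; linarith
  exact (hα.intCast_mul hd).ne_int _ this

/-! ### Exponential decay and counts -/

/-- Sequences dominated by a given geometric sequence. -/
def decaySet (r M : ℝ) : Set (ℕ → ℝ) := {l | ∀ j, l j ≤ M * r ^ (j + 1)}

theorem measurableSet_decaySet (r M : ℝ) : MeasurableSet (decaySet r M) := by
  have : decaySet r M = ⋂ j, {l : ℕ → ℝ | l j ≤ M * r ^ (j + 1)} := by
    ext l; simp [decaySet]
  rw [this]
  exact MeasurableSet.iInter fun j ↦ measurableSet_le (measurable_pi_apply j) measurable_const

/-- The constant in the exponential decay is random. Up to an event of small probability it can be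
replaced by a deterministic one, by continuity of the measure along increasing M. -/
theorem exists_measure_decaySet_compl_le {p : Measure (ℕ → ℝ)} [IsFiniteMeasure p] {r : ℝ}
    (hr : 0 < r) (h : ∀ᵐ l ∂p, ∃ C > 0, ∀ j, l j ≤ C * r ^ (j + 1)) {ε : ENNReal} (hε : 0 < ε) :
    ∃ M : ℕ, p (decaySet r M)ᶜ ≤ ε := by
  have hanti : Antitone fun M : ℕ ↦ (decaySet r M)ᶜ := by
    intro M M' hM
    rw [Set.compl_subset_compl]
    intro l hl j
    refine (hl j).trans ?_
    gcongr
  have h1 := tendsto_measure_iInter_atTop (μ := p)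
    (fun M : ℕ ↦ (measurableSet_decaySet r M).compl.nullMeasurableSet) hanti
    ⟨0, measure_ne_top _ _⟩
  have h2 : p (⋂ M : ℕ, (decaySet r M)ᶜ) = 0 := by
    rw [← Set.compl_iUnion]
    refine mem_ae_iff.1 ?_
    filter_upwards [h] with l ⟨C, _, hl⟩
    obtain ⟨M, hM⟩ := exists_nat_ge C
    refine Set.mem_iUnion.2 ⟨M, fun j ↦ (hl j).trans ?_⟩
    gcongr
  rw [h2] at h1
  obtain ⟨M, hM⟩ := (h1.eventually (gt_mem_nhds hε)).exists
  exact ⟨M, hM.le⟩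

section Counts

variable {Ω : Type*} [MeasurableSpace Ω] {μ : Measure Ω}
  {p : Measure (ℕ → ℝ)} {Y : Ω → ℕ → ℝ} {x : Ω → ℕ → Point}

theorem lintegral_pointCount (hc : IsCoupling μ p Y x) (hp : ∀ᵐ l ∂p, l ∈ nabla)
    {A : Set (ℕ → ℝ)} (hA : MeasurableSet A) (n : ℕ) (c : Option ℕ) :
    ∫⁻ ω in Y ⁻¹' A, (pointCount x n c ω : ENNReal) ∂μ
      = n * ∫⁻ l in A, ENNReal.ofReal (labelWeight l c) ∂p := by
  have hm : ∀ k : Fin n, MeasurableSet {ω | label (x ω k) = c} := fun k ↦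
    (measurable_pi_apply k).comp (hc.measurable_labels n) (measurableSet_singleton c)
  have e : ∀ ω, (pointCount x n c ω : ENNReal)
      = ∑ k : Fin n, {ω | label (x ω k) = c}.indicator (fun _ ↦ 1) ω := by
    intro ω
    rw [pointCount, labelCount_eq_sum]
    push_cast
    refine Finset.sum_congr rfl fun k _ ↦ ?_
    simp only [Set.indicator, labels, Set.mem_ofPred_eq]
    split_ifs with h <;> simp [h]
  simp only [e]
  rw [lintegral_finsetSum _ fun k _ ↦ measurable_const.indicator (hm k)]
  have : ∀ k : Fin n, ∫⁻ ω in Y ⁻¹' A, {ω | label (x ω k) = c}.indicator (fun _ ↦ 1) ω ∂μ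
      = ∫⁻ l in A, ENNReal.ofReal (labelWeight l c) ∂p := by
    intro k
    rw [lintegral_indicator_const (hm k), one_mul, Measure.restrict_apply (hm k),
      ← hc.measure_label_eq hp hA k c, Set.inter_comm]
    rfl
  simp [this]

theorem lintegral_pointCount_le [IsProbabilityMeasure μ] (hc : IsCoupling μ p Y x)
    (hp : ∀ᵐ l ∂p, l ∈ nabla)
    {A : Set (ℕ → ℝ)} (hA : MeasurableSet A) (n j : ℕ) {b : ℝ} (hb : ∀ l ∈ A, l j ≤ b) :
    ∫⁻ ω in Y ⁻¹' A, (pointCount x n (some j) ω : ENNReal) ∂μ ≤ n * ENNReal.ofReal b := by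
  have := hc.isProbabilityMeasure
  rw [lintegral_pointCount hc hp hA]
  gcongr
  calc ∫⁻ l in A, ENNReal.ofReal (labelWeight l (some j)) ∂p
      ≤ ∫⁻ l in A, ENNReal.ofReal b ∂p :=
        setLIntegral_mono measurable_const fun l hl ↦ ENNReal.ofReal_le_ofReal (hb l hl)
    _ ≤ ENNReal.ofReal b := by
        rw [setLIntegral_const]
        exact mul_le_of_le_one_right' prob_le_one

theorem measure_le_pointCount_le [IsProbabilityMeasure μ] (hc : IsCoupling μ p Y x)
    (hp : ∀ᵐ l ∂p, l ∈ nabla)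
    {A : Set (ℕ → ℝ)} (hA : MeasurableSet A) (n j : ℕ) {b : ℝ} (hb : ∀ l ∈ A, l j ≤ b) {K : ℕ}
    (hK : 0 < K) :
    μ {ω | Y ω ∈ A ∧ K ≤ pointCount x n (some j) ω} ≤ ENNReal.ofReal (n * b / K) := by
  have h := lintegral_pointCount_le hc hp hA n j hb
  have hm : Measurable fun ω ↦ (pointCount x n (some j) ω : ENNReal) :=
    measurable_from_nat.comp (measurable_pointCount hc n (some j))
  have h2 := meas_ge_le_lintegral_div (μ := μ.restrict (Y ⁻¹' A)) hm.aemeasurable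
    (ε := (K : ENNReal)) (by positivity) (ENNReal.natCast_ne_top K)
  rw [Measure.restrict_apply (measurableSet_le measurable_const hm)] at h2
  have e : {ω | Y ω ∈ A ∧ K ≤ pointCount x n (some j) ω}
      = {ω | (K : ENNReal) ≤ pointCount x n (some j) ω} ∩ Y ⁻¹' A := by
    ext ω
    simp only [Set.mem_ofPred_eq, Nat.cast_le, Set.mem_inter_iff, Set.mem_preimage]
    tauto
  rw [e]
  refine h2.trans ?_
  rw [ENNReal.ofReal_div_of_pos (by positivity), ENNReal.ofReal_natCast,
    ENNReal.ofReal_mul (by positivity), ENNReal.ofReal_natCast]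
  gcongr

theorem model_preimage_fst [IsProbabilityMeasure μ] (ν : Measure ℝ) [IsProbabilityMeasure ν]
    (n : ℕ) {S : Set Ω} (hS : MeasurableSet S) :
    model μ ν n {q | q.1 ∈ S} = μ S :=
  measurePreserving_fst.measure_preimage hS.nullMeasurableSet

end Counts

/-! ### Small divisors -/

section

variable {Ω : Type*} [MeasurableSpace Ω]

/-- The products of the weights on the circles which carry points are not too close to one. -/
structure HasSmallDivisors (μ : Measure Ω) (ν : Measure ℝ) (x : Ω → ℕ → Point) : Prop where
  tail : ∀ δ > 0, ∀ ε > 0, ∀ᶠ m in atTop, ∀ᶠ n in atTop, model μ ν n {q | ¬ ∀ B,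
    ∑ j ∈ Finset.Ico m B, (pointCount x n (some j) q.1 : ℝ) / n * ‖(1 : ℂ) - circleWeight x n j q‖⁻¹
      ≤ δ} ≤ ENNReal.ofReal ε
  -- The exponent 3 makes the sum of m probabilities of order (m + 1)⁻³ tend to zero. The same level
  -- is used for clipping in `circleClip`.
  head : ∀ ε > 0, ∀ᶠ m : ℕ in atTop, ∀ᶠ n in atTop, model μ ν n {q | ∃ j < m,
    0 < pointCount x n (some j) q.1 ∧ ‖(1 : ℂ) - circleWeight x n j q‖ ≤ 1 / ((m + 1) ^ 3 : ℕ)}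
      ≤ ENNReal.ofReal ε
  ne_one : ∀ n, ∀ᵐ q ∂model μ ν n, ∀ j, 0 < pointCount x n (some j) q.1 → circleWeight x n j q ≠ 1
  rot_ne_one : ∀ n, ∀ᵐ q ∂model μ ν n, ∀ k, rot (q.2 k) ≠ 1

variable {μ : Measure Ω} [IsProbabilityMeasure μ]
  {p : Measure (ℕ → ℝ)} {Y : Ω → ℕ → ℝ} {x : Ω → ℕ → Point}

theorem summable_sq_mul_geometric {r : ℝ} (hr : 0 < r) (hr1 : r < 1) (M : ℝ) :
    Summable fun j : ℕ ↦ ((j : ℝ) + 1) ^ 2 * (M * r ^ (j + 1)) := by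
  have h := summable_pow_mul_geometric_of_norm_lt_one 2 (r := r) (by
    rwa [Real.norm_eq_abs, abs_of_pos hr])
  have h2 := ((summable_nat_add_iff 1).2 h).mul_left M
  refine h2.congr fun j ↦ ?_
  push_cast
  ring

theorem summable_four_div_sq : Summable fun j : ℕ ↦ 4 / ((j : ℝ) + 1) ^ 2 := by
  have h := (summable_nat_add_iff 1).2 (Real.summable_one_div_nat_pow.2 (one_lt_two))
  refine (h.mul_left 4).congr fun j ↦ ?_
  push_cast
  ring

theorem measure_biUnion_le_ofReal_tsum {E : Type*} [MeasurableSpace E] {P : Measure E}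
    {S : ℕ → Set E} {b : ℕ → ℝ} (hb0 : ∀ j, 0 ≤ b j) (hb : Summable b) {m : ℕ}
    (hS : ∀ j, m ≤ j → P (S j) ≤ ENNReal.ofReal (b j)) :
    P {q | ∃ j, m ≤ j ∧ q ∈ S j} ≤ ENNReal.ofReal (∑' j, b (j + m)) := by
  have h1 : {q | ∃ j, m ≤ j ∧ q ∈ S j} ⊆ ⋃ j, S (j + m) := by
    rintro q ⟨j, hj, hq⟩
    exact Set.mem_iUnion.2 ⟨j - m, by rwa [Nat.sub_add_cancel hj]⟩
  refine (measure_mono h1).trans ((measure_iUnion_le _).trans ?_)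
  rw [ENNReal.ofReal_tsum_of_nonneg (fun j ↦ hb0 _) ((summable_nat_add_iff m).2 hb)]
  exact ENNReal.tsum_le_tsum fun j ↦ hS _ (Nat.le_add_left _ _)

theorem eventually_tsum_nat_add_le {b : ℕ → ℝ} {ε : ℝ} (hε : 0 < ε) :
    ∀ᶠ m in atTop, ∑' j, b (j + m) ≤ ε :=
  ((tendsto_sum_nat_add b).eventually (gt_mem_nhds hε)).mono fun _ h ↦ h.le

/-- Markov's inequality: on `decaySet r M` the mean of N_j / n is at most M r^(j+1), so that the
polynomial weights (j+1)² leave a summable series, uniformly in n. -/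
theorem measure_weighted_counts_le (hc : IsCoupling μ p Y x) (hp : ∀ᵐ l ∂p, l ∈ nabla)
    {r : ℝ} (hr : 0 < r) (hr1 : r < 1) (M : ℕ) {n : ℕ} (hn : 0 < n) (m : ℕ) {δ : ℝ} (hδ : 0 < δ) :
    μ {ω | Y ω ∈ decaySet r M ∧ ¬ ∀ B, ∑ j ∈ Finset.Ico m B,
      ((j : ℝ) + 1) ^ 2 * ((pointCount x n (some j) ω : ℝ) / n) ≤ δ}
      ≤ ENNReal.ofReal ((∑' j : ℕ, (((j + m : ℕ) : ℝ) + 1) ^ 2 * (M * r ^ (j + m + 1))) / δ) := by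
  set f : Ω → ENNReal := fun ω ↦ ∑' j : ℕ, ENNReal.ofReal ((((j + m : ℕ) : ℝ) + 1) ^ 2 / n) *
    (pointCount x n (some (j + m)) ω : ENNReal) with hf
  have hmN : ∀ j, Measurable fun ω ↦ (pointCount x n (some j) ω : ENNReal) := fun j ↦
    measurable_from_nat.comp (measurable_pointCount hc n (some j))
  have hfm : Measurable f := Measurable.tsum fun j ↦ measurable_const.mul (hmN _)
  have hsub : {ω | Y ω ∈ decaySet r M ∧ ¬ ∀ B, ∑ j ∈ Finset.Ico m B,
      ((j : ℝ) + 1) ^ 2 * ((pointCount x n (some j) ω : ℝ) / n) ≤ δ}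
      ⊆ {ω | ENNReal.ofReal δ ≤ f ω} ∩ Y ⁻¹' decaySet r M := by
    rintro ω ⟨hω, hB⟩
    push Not at hB
    obtain ⟨B, hB⟩ := hB
    refine ⟨?_, hω⟩
    show ENNReal.ofReal δ ≤ f ω
    calc ENNReal.ofReal δ ≤ ENNReal.ofReal (∑ j ∈ Finset.Ico m B,
          ((j : ℝ) + 1) ^ 2 * ((pointCount x n (some j) ω : ℝ) / n)) :=
          ENNReal.ofReal_le_ofReal hB.le
      _ = ∑ j ∈ Finset.range (B - m), ENNReal.ofReal ((((j + m : ℕ) : ℝ) + 1) ^ 2 / n) *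
          (pointCount x n (some (j + m)) ω : ENNReal) := by
          rw [Finset.sum_Ico_eq_sum_range, ENNReal.ofReal_sum_of_nonneg fun j _ ↦ by positivity]
          refine Finset.sum_congr rfl fun j _ ↦ ?_
          rw [← ENNReal.ofReal_natCast, ← ENNReal.ofReal_mul (by positivity), add_comm m j]
          congr 1
          ring
      _ ≤ f ω := ENNReal.sum_le_tsum _
  have hint : ∫⁻ ω in Y ⁻¹' decaySet r M, f ω ∂μ
      ≤ ENNReal.ofReal (∑' j : ℕ, (((j + m : ℕ) : ℝ) + 1) ^ 2 * (M * r ^ (j + m + 1))) := by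
    simp only [hf]
    rw [lintegral_tsum fun j ↦ ((hmN (j + m)).const_mul _).aemeasurable,
      ENNReal.ofReal_tsum_of_nonneg (fun j ↦ by positivity)
        ((summable_nat_add_iff m).2 (summable_sq_mul_geometric hr hr1 M))]
    refine ENNReal.tsum_le_tsum fun j ↦ ?_
    rw [lintegral_const_mul _ (hmN _)]
    refine (mul_le_mul_right (lintegral_pointCount_le hc hp (measurableSet_decaySet r M) n (j + m)
      fun l hl ↦ hl (j + m)) _).trans (le_of_eq ?_)
    rw [← ENNReal.ofReal_natCast n, ← ENNReal.ofReal_mul (by positivity),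
      ← ENNReal.ofReal_mul (by positivity)]
    congr 1
    field_simp
  refine (measure_mono hsub).trans ?_
  rw [← Measure.restrict_apply (measurableSet_le measurable_const hfm)]
  refine (meas_ge_le_lintegral_div hfm.aemeasurable (ENNReal.ofReal_pos.2 hδ).ne'
    ENNReal.ofReal_ne_top).trans ?_
  rw [ENNReal.ofReal_div_of_pos hδ]
  gcongr

variable {ν : Measure ℝ} [IsProbabilityMeasure ν]

theorem measurableSet_weighted_counts (hc : IsCoupling μ p Y x) (r M : ℝ) (n m : ℕ) (δ : ℝ) :
    MeasurableSet {ω | Y ω ∈ decaySet r M ∧ ¬ ∀ B, ∑ j ∈ Finset.Ico m B,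
      ((j : ℝ) + 1) ^ 2 * ((pointCount x n (some j) ω : ℝ) / n) ≤ δ} := by
  refine (hc.measurable_y (measurableSet_decaySet r M)).inter (MeasurableSet.compl ?_)
  have : {ω | ∀ B, ∑ j ∈ Finset.Ico m B,
      ((j : ℝ) + 1) ^ 2 * ((pointCount x n (some j) ω : ℝ) / n) ≤ δ} = ⋂ B,
      {ω | ∑ j ∈ Finset.Ico m B,
        ((j : ℝ) + 1) ^ 2 * ((pointCount x n (some j) ω : ℝ) / n) ≤ δ} := by
    ext; simp
  change MeasurableSet {ω | ∀ B, ∑ j ∈ Finset.Ico m B,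
      ((j : ℝ) + 1) ^ 2 * ((pointCount x n (some j) ω : ℝ) / n) ≤ δ}
  rw [this]
  refine MeasurableSet.iInter fun B ↦ measurableSet_le ?_ measurable_const
  exact Finset.measurable_sum _ fun j _ ↦ measurable_const.mul
    ((measurable_from_nat.comp (measurable_pointCount hc n (some j))).div_const _)

/-- The condition on the tail follows from a comparison with weighted counts. -/
theorem tail_of_compare (hc : IsCoupling μ p Y x) (hp : ∀ᵐ l ∂p, l ∈ nabla) {r : ℝ} (hr : 0 < r)
    (hr1 : r < 1) (hdec : ∀ᵐ l ∂p, ∃ C > 0, ∀ j, l j ≤ C * r ^ (j + 1))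
    (h : ∀ M : ℕ, ∀ ε > 0, ∃ e : ℕ → ℝ, Tendsto e atTop (𝓝 0) ∧ ∀ᶠ m in atTop, ∀ᶠ n in atTop,
      model μ ν n {q | Y q.1 ∈ decaySet r M ∧ ¬ ∀ B, ∑ j ∈ Finset.Ico m B,
        (pointCount x n (some j) q.1 : ℝ) / n * ‖(1 : ℂ) - circleWeight x n j q‖⁻¹
        ≤ ∑ j ∈ Finset.Ico m B, ((j : ℝ) + 1) ^ 2 * ((pointCount x n (some j) q.1 : ℝ) / n) + e n}
        ≤ ENNReal.ofReal ε) :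
    ∀ δ > 0, ∀ ε > 0, ∀ᶠ m in atTop, ∀ᶠ n in atTop, model μ ν n {q | ¬ ∀ B,
    ∑ j ∈ Finset.Ico m B, (pointCount x n (some j) q.1 : ℝ) / n * ‖(1 : ℂ) - circleWeight x n j q‖⁻¹
      ≤ δ} ≤ ENNReal.ofReal ε := by
  intro δ hδ ε hε
  have := hc.isProbabilityMeasure
  obtain ⟨M, hM⟩ := exists_measure_decaySet_compl_le hr hdec
    (ENNReal.ofReal_pos.2 (show 0 < ε / 3 by positivity))
  obtain ⟨e, he, hbad⟩ := h M (ε / 3) (by positivity)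
  filter_upwards [hbad, eventually_tsum_nat_add_le (b := fun j : ℕ ↦ ((j : ℝ) + 1) ^ 2 *
    (M * r ^ (j + 1))) (show 0 < ε / 3 * (δ / 2) by positivity)] with m hm1 hm2
  filter_upwards [hm1, eventually_gt_atTop 0,
    he.eventually (gt_mem_nhds (show 0 < δ / 2 by positivity))] with n hn1 hn hen
  have h2 := measure_weighted_counts_le hc hp hr hr1 M hn m (δ := δ / 2) (by positivity)
  have hsub : {q : Ω × (Fin n → ℝ) | ¬ ∀ B, ∑ j ∈ Finset.Ico m B,
      (pointCount x n (some j) q.1 : ℝ) / n * ‖(1 : ℂ) - circleWeight x n j q‖⁻¹ ≤ δ} ⊆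
      ({q | q.1 ∈ Y ⁻¹' (decaySet r M)ᶜ} ∪
      {q | q.1 ∈ {ω | Y ω ∈ decaySet r M ∧ ¬ ∀ B, ∑ j ∈ Finset.Ico m B,
        ((j : ℝ) + 1) ^ 2 * ((pointCount x n (some j) ω : ℝ) / n) ≤ δ / 2}}) ∪
      {q | Y q.1 ∈ decaySet r M ∧ ¬ ∀ B, ∑ j ∈ Finset.Ico m B,
        (pointCount x n (some j) q.1 : ℝ) / n * ‖(1 : ℂ) - circleWeight x n j q‖⁻¹
        ≤ ∑ j ∈ Finset.Ico m B, ((j : ℝ) + 1) ^ 2 *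
          ((pointCount x n (some j) q.1 : ℝ) / n) + e n} := by
    intro q hq
    by_cases hA : Y q.1 ∈ decaySet r M
    · simp only [Set.mem_union, Set.mem_ofPred_eq, hA, true_and]
      by_contra! hcon
      refine hq fun B ↦ ?_
      have h1 := hcon.2 B
      have h2 := hcon.1.2 B
      linarith
    · exact Or.inl (Or.inl hA)
  refine (measure_mono hsub).trans ((measure_union_le _ _).trans ?_)
  refine (add_le_add_left (measure_union_le _ _) _).trans ?_
  rw [model_preimage_fst ν n (hc.measurable_y (measurableSet_decaySet r M).compl),
    model_preimage_fst ν n (measurableSet_weighted_counts hc r M n m (δ / 2)),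
    ← Measure.map_apply hc.measurable_y (measurableSet_decaySet r M).compl, hc.map_eq]
  calc _ ≤ ENNReal.ofReal (ε / 3) + ENNReal.ofReal (ε / 3) + ENNReal.ofReal (ε / 3) := by
        refine add_le_add (add_le_add hM (h2.trans (ENNReal.ofReal_le_ofReal ?_))) hn1
        rw [div_le_iff₀ (by positivity)]
        exact hm2
    _ = ENNReal.ofReal ε := by
        rw [← ENNReal.ofReal_add (by positivity) (by positivity),
          ← ENNReal.ofReal_add (by positivity) (by positivity)]
        congr 1; ring

theorem measure_near_one_le (hc : IsCoupling μ p Y x) (hp : ∀ᵐ l ∂p, l ∈ nabla)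
    (n j : ℕ) {A : Set (ℕ → ℝ)} (hA : MeasurableSet A) {H : ℕ} (hH : 0 < H) {D : ℝ}
    (hD0 : 0 ≤ D)
    (hD : ∀ d : ℤ, d ≠ 0 → |d| < H → ‖∫ l in A, ((1 + (l j : ℂ) * (fourierCoeffOf ν d - 1)) ^ n
      - (1 - (l j : ℂ)) ^ n) ∂p‖ ≤ D) :
    model μ ν n {q | Y q.1 ∈ A ∧ 0 < pointCount x n (some j) q.1 ∧
      ‖(1 : ℂ) - circleWeight x n j q‖ ≤ 1 / H} ≤ ENNReal.ofReal (4 / H + 4 * D) := by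
  rw [← ofReal_measureReal]
  exact ENNReal.ofReal_le_ofReal (measure_circleWeight_near_one_le ν hc hp n j hA hH hD0 hD)

/-! ### Uniform angles -/

/-- The uniform distribution on `[-1/2, 1/2)`. -/
noncomputable def uniformAngle : Measure ℝ := volume.restrict (Set.Ico (-(1 / 2)) (1 / 2))

instance : IsProbabilityMeasure uniformAngle := ⟨by
  rw [uniformAngle, Measure.restrict_apply_univ, Real.volume_Ico]; norm_num⟩

instance : NullSingletonClass uniformAngle := by unfold uniformAngle; infer_instance

theorem fourierCoeffOf_uniformAngle {d : ℤ} (hd : d ≠ 0) : fourierCoeffOf uniformAngle d = 0 := by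
  have hdc : (d : ℂ) ≠ 0 := Int.cast_ne_zero.2 hd
  have e : ∀ t : ℝ, ((rot t ^ d : Circle) : ℂ) = Complex.exp (2 * Real.pi * Complex.I * d * t) := by
    intro t
    rw [← rot_intCast_mul, coe_rot]
    push_cast; ring_nf
  have hne : (2 * Real.pi * Complex.I * d : ℂ) ≠ 0 := mul_ne_zero Complex.two_pi_I_ne_zero hdc
  rw [fourierCoeffOf, uniformAngle, integral_Ico_eq_integral_Ioc,
    ← intervalIntegral.integral_of_le (by norm_num)]
  simp only [e]
  rw [integral_exp_mul_complex hne, div_eq_zero_iff]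
  left
  rw [sub_eq_zero, Complex.exp_eq_exp_iff_exists_int]
  exact ⟨d, by push_cast; ring⟩

theorem ae_rot_ne_one : ∀ᵐ t ∂uniformAngle, rot t ≠ 1 := by
  have : {t : ℝ | ¬ rot t ≠ 1} ⊆ Set.range (fun m : ℤ ↦ (m : ℝ)) := by
    intro t ht
    simp only [ne_eq, not_not, Set.mem_ofPred_eq] at ht
    rw [← Circle.coe_inj, coe_rot, Circle.coe_one, Complex.exp_eq_one_iff] at ht
    obtain ⟨m, hm⟩ := ht
    refine ⟨m, ?_⟩
    have h2 : (2 * Real.pi * Complex.I) * (t : ℂ) = (2 * Real.pi * Complex.I) * m := by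
      rw [mul_comm _ (m : ℂ), ← hm]; ring
    have h3 := mul_left_cancel₀ Complex.two_pi_I_ne_zero h2
    exact_mod_cast h3.symm
  exact measure_mono_null this ((Set.countable_range _).measure_zero _)

/-- The non-zero Fourier coefficients of a uniform angle vanish, so the two powers in the Fejér
estimate are equal and D = 0. -/
theorem measure_near_one_uniformAngle_le (hc : IsCoupling μ p Y x) (hp : ∀ᵐ l ∂p, l ∈ nabla)
    (n j : ℕ) {H : ℕ} (hH : 0 < H) :
    model μ uniformAngle n {q | 0 < pointCount x n (some j) q.1 ∧
      ‖(1 : ℂ) - circleWeight x n j q‖ ≤ 1 / H} ≤ ENNReal.ofReal (4 / H) := by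
  have h := measure_near_one_le (ν := uniformAngle) hc hp n j MeasurableSet.univ hH le_rfl
    fun d hd _ ↦ by
      rw [fourierCoeffOf_uniformAngle hd]
      simp [sub_eq_add_neg]
  simpa using h

theorem hasSmallDivisors_uniformAngle (hc : IsCoupling μ p Y x) (hp : ∀ᵐ l ∂p, l ∈ nabla)
    (hdecay : HasExponentialDecay p) : HasSmallDivisors μ uniformAngle x where
  tail := by
    obtain ⟨r, ⟨hr, hr1⟩, hdec⟩ := hdecay
    -- Off an event of probability at most ∑_{j ≥ m} 4 / (j+1)², every occupied circle j ≥ m has |1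
    -- - W_j|⁻¹ ≤ (j+1)², so the comparison holds without error term.
    refine tail_of_compare hc hp hr hr1 hdec fun M ε hε ↦ ⟨fun _ ↦ 0, tendsto_const_nhds, ?_⟩
    filter_upwards [eventually_tsum_nat_add_le (b := fun j : ℕ ↦ 4 / ((j : ℝ) + 1) ^ 2) hε]
      with m hm
    refine Eventually.of_forall fun n ↦ ?_
    refine le_trans (measure_mono ?_) ((measure_biUnion_le_ofReal_tsum (m := m)
      (S := fun j ↦ {q | 0 < pointCount x n (some j) q.1 ∧
        ‖(1 : ℂ) - circleWeight x n j q‖ ≤ 1 / ((j + 1) ^ 2 : ℕ)})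
      (fun j ↦ by positivity) summable_four_div_sq fun j _ ↦ ?_).trans
      (ENNReal.ofReal_le_ofReal hm))
    · rintro q ⟨-, hq⟩
      by_contra hcon
      simp only [Set.mem_ofPred_eq, not_exists, not_and, not_le] at hcon
      refine hq fun B ↦ ?_
      rw [add_zero]
      refine Finset.sum_le_sum fun j hj ↦ ?_
      rcases Nat.eq_zero_or_pos (pointCount x n (some j) q.1) with h0 | h0
      · simp [h0]
      · have h1 := hcon j (Finset.mem_Ico.1 hj).1 h0
        rw [mul_comm]
        gcongr
        rw [inv_le_comm₀ (lt_trans (by positivity) h1) (by positivity)]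
        refine le_trans (le_of_eq ?_) h1.le
        push_cast; rw [one_div]
    · have := measure_near_one_uniformAngle_le hc hp n j (H := (j + 1) ^ 2) (by positivity)
      push_cast at this ⊢
      exact this
  head := by
    intro ε hε
    have h0 : Tendsto (fun m : ℕ ↦ 4 / ((m : ℝ) + 1) ^ 2) atTop (𝓝 0) :=
      summable_four_div_sq.tendsto_atTop_zero
    filter_upwards [h0.eventually (gt_mem_nhds hε)] with m hm
    refine Eventually.of_forall fun n ↦ ?_
    have hsub : {q : Ω × (Fin n → ℝ) | ∃ j < m, 0 < pointCount x n (some j) q.1 ∧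
        ‖(1 : ℂ) - circleWeight x n j q‖ ≤ 1 / ((m + 1) ^ 3 : ℕ)} ⊆ ⋃ j ∈ Finset.range m,
        {q | 0 < pointCount x n (some j) q.1 ∧
        ‖(1 : ℂ) - circleWeight x n j q‖ ≤ 1 / ((m + 1) ^ 3 : ℕ)} := by
      rintro q ⟨j, hj, hq⟩
      exact Set.mem_biUnion (Finset.mem_coe.2 (Finset.mem_range.2 hj)) hq
    refine (measure_mono hsub).trans ((measure_biUnion_finset_le _ _).trans ?_)
    refine (Finset.sum_le_sum fun j _ ↦ measure_near_one_uniformAngle_le hc hp n j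
      (H := (m + 1) ^ 3) (by positivity)).trans ?_
    rw [Finset.sum_const, Finset.card_range, nsmul_eq_mul, ← ENNReal.ofReal_natCast,
      ← ENNReal.ofReal_mul (by positivity)]
    refine ENNReal.ofReal_le_ofReal (le_trans ?_ hm.le)
    push_cast
    rw [mul_div_assoc', div_le_div_iff₀ (by positivity) (by positivity)]
    have : (0 : ℝ) ≤ m := by positivity
    nlinarith [pow_pos (show (0 : ℝ) < m + 1 by positivity) 2]
  ne_one := by
    intro n
    rw [ae_all_iff]
    intro j
    -- A weight equal to one is within 1/H of one for all H, so the estimate is used with H → ∞.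
    have h : ∀ H : ℕ, model μ uniformAngle n
        {q | ¬ (0 < pointCount x n (some j) q.1 → circleWeight x n j q ≠ 1)}
        ≤ ENNReal.ofReal (4 / (H + 1 : ℕ)) := fun H ↦ by
      refine (measure_mono ?_).trans (measure_near_one_uniformAngle_le hc hp n j H.succ_pos)
      intro q hq
      simp only [ne_eq, Classical.not_imp, not_not, Set.mem_ofPred_eq] at hq ⊢
      refine ⟨hq.1, ?_⟩
      rw [hq.2]; simp; positivity
    have h0 : Tendsto (fun H : ℕ ↦ ENNReal.ofReal (4 / (H + 1 : ℕ))) atTop (𝓝 0) := by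
      rw [← ENNReal.ofReal_zero]
      refine ENNReal.tendsto_ofReal ?_
      exact (tendsto_const_div_atTop_nhds_zero_nat 4).comp (tendsto_add_atTop_nat 1)
    exact le_antisymm (ge_of_tendsto' h0 h) zero_le
  rot_ne_one := by
    intro n
    rw [ae_all_iff]
    intro k
    have h1 : ∀ᵐ θ ∂Measure.pi (fun _ : Fin n ↦ uniformAngle), rot (θ k) ≠ 1 :=
      (measurePreserving_eval (fun _ : Fin n ↦ uniformAngle) k).quasiMeasurePreserving.ae
        ae_rot_ne_one
    exact Measure.quasiMeasurePreserving_snd.ae h1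

end

/-! ### Small divisors for a constant angle of finite type -/

theorem norm_one_add_mul_sub_one_sq (l : ℝ) {w : ℂ} (hw : ‖w‖ = 1) :
    ‖1 + (l : ℂ) * (w - 1)‖ ^ 2 = 1 - l * (1 - l) * ‖1 - w‖ ^ 2 := by
  have h : w.re * w.re + w.im * w.im = 1 := by
    rw [← Complex.normSq_apply, Complex.normSq_eq_norm_sq, hw, one_pow]
  rw [← Complex.normSq_eq_norm_sq, ← Complex.normSq_eq_norm_sq, Complex.normSq_apply,
    Complex.normSq_apply]
  simp only [Complex.add_re, Complex.one_re, Complex.mul_re, Complex.ofReal_re, Complex.sub_re,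
    Complex.ofReal_im, Complex.sub_im, Complex.one_im, Complex.add_im, Complex.mul_im]
  linear_combination l * h

/-- In the identity for the squared norm, 1 - l ≥ 1/2 and 1 + x ≤ e^x. The restriction to l ≤ 1/2 is
harmless for all circles but the largest. -/
theorem norm_one_add_mul_sub_one_le {l : ℝ} (h0 : 0 ≤ l) (h1 : l ≤ 1 / 2) {w : ℂ} (hw : ‖w‖ = 1) :
    ‖1 + (l : ℂ) * (w - 1)‖ ≤ Real.exp (-(l * ‖1 - w‖ ^ 2 / 4)) := by
  refine abs_le_of_sq_le_sq' ?_ (Real.exp_pos _).le |>.2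
  rw [norm_one_add_mul_sub_one_sq l hw, ← Real.exp_nat_mul]
  have h2 := Real.add_one_le_exp ((2 : ℕ) * -(l * ‖1 - w‖ ^ 2 / 4))
  refine le_trans ?_ h2
  have := mul_nonneg h0 (sq_nonneg ‖1 - w‖)
  push_cast
  nlinarith

theorem norm_one_add_mul_sub_one_lt {l : ℝ} (h0 : 0 < l) (h1 : l < 1) {w : ℂ} (hw : ‖w‖ = 1)
    (hne : w ≠ 1) : ‖1 + (l : ℂ) * (w - 1)‖ < 1 := by
  refine lt_of_pow_lt_pow_left₀ 2 zero_le_one ?_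
  rw [norm_one_add_mul_sub_one_sq l hw, one_pow]
  have : 0 < ‖1 - w‖ := norm_pos_iff.2 (sub_ne_zero.2 hne.symm)
  have := mul_pos (mul_pos h0 (sub_pos.2 h1)) (pow_pos this 2)
  linarith

/-- The integer part of n^(1/K) provides an integer scale with respect to which n is polynomial, up
to replacing t by t + 1. -/
theorem exists_root_floor {K : ℕ} (hK : 0 < K) : ∃ t : ℕ → ℕ, Tendsto t atTop atTop ∧
    ∀ n, (t n) ^ K ≤ n ∧ n < (t n + 1) ^ K := by
  refine ⟨fun n ↦ ⌊(n : ℝ) ^ (1 / K : ℝ)⌋₊, ?_, fun n ↦ ?_⟩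
  · exact tendsto_nat_floor_atTop.comp
      ((tendsto_rpow_atTop (by positivity)).comp tendsto_natCast_atTop_atTop)
  · have e : ((n : ℝ) ^ (1 / K : ℝ)) ^ K = n := by
      rw [one_div, Real.rpow_inv_natCast_pow (by positivity) hK.ne']
    have h0 : (0 : ℝ) ≤ (n : ℝ) ^ (1 / K : ℝ) := by positivity
    constructor
    · have h := pow_le_pow_left₀ (by positivity) (Nat.floor_le h0) K
      rw [e] at h
      exact_mod_cast h
    · have h := pow_lt_pow_left₀ (Nat.lt_floor_add_one ((n : ℝ) ^ (1 / K : ℝ))) h0 hK.ne'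
      rw [e] at h
      exact_mod_cast h

theorem fourierCoeffOf_dirac (a : ℝ) (d : ℤ) :
    fourierCoeffOf (Measure.dirac a) d = ((rot a ^ d : Circle) : ℂ) := by
  rw [fourierCoeffOf, integral_dirac]

section

variable {Ω : Type*} [MeasurableSpace Ω] {μ : Measure Ω} [IsProbabilityMeasure μ]
  {p : Measure (ℕ → ℝ)} {Y : Ω → ℕ → ℝ} {x : Ω → ℕ → Point}

theorem ae_model_dirac (a : ℝ) (n : ℕ) :
    ∀ᵐ q ∂model μ (Measure.dirac a) n, ∀ k, q.2 k = a := by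
  rw [ae_all_iff]
  intro k
  have h1 : ∀ᵐ θ ∂Measure.pi (fun _ : Fin n ↦ Measure.dirac a), θ k = a :=
    (measurePreserving_eval (fun _ : Fin n ↦ Measure.dirac a) k).quasiMeasurePreserving.ae
      (p := fun t ↦ t = a) (ae_dirac_iff (measurableSet_singleton a) |>.2 rfl)
  exact Measure.quasiMeasurePreserving_snd.ae h1

theorem circleWeight_eq_pow {n j : ℕ} {q : Ω × (Fin n → ℝ)} {a : ℝ} (h : ∀ k, q.2 k = a) :
    circleWeight x n j q = rot a ^ pointCount x n (some j) q.1 := by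
  rw [circleWeight, labelProd, pointCount, labelCount, ← Finset.prod_const]
  exact Finset.prod_congr rfl fun k _ ↦ by rw [h]

/-- Dominated convergence: if l j = 0 the two powers are both 1 and cancel, and if 0 < l j < 1 both
bases have modulus less than one. -/
theorem tendsto_integral_circle (hp : ∀ᵐ l ∂p, l ∈ nabla) [IsProbabilityMeasure p]
    (hlt : ∀ᵐ l ∂p, ∀ j, l j < 1) (j : ℕ) {w : ℂ} (hw : ‖w‖ = 1) (hw1 : w ≠ 1) :
    Tendsto (fun n : ℕ ↦ ∫ l, ((1 + (l j : ℂ) * (w - 1)) ^ n - (1 - (l j : ℂ)) ^ n) ∂p) atTop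
      (𝓝 0) := by
  have hml : Measurable fun l : ℕ → ℝ ↦ (l j : ℂ) :=
    Complex.measurable_ofReal.comp (measurable_pi_apply j)
  have h1 : ∀ l ∈ nabla, ∀ n : ℕ, ‖(1 - (l j : ℂ))‖ = 1 - l j := fun l hl n ↦ by
    rw [show (1 - (l j : ℂ)) = ((1 - l j : ℝ) : ℂ) by push_cast; rfl, Complex.norm_real,
      Real.norm_eq_abs, abs_of_nonneg (by linarith [(hl.1 j).2])]
  have h2 : ∀ l ∈ nabla, ‖1 + (l j : ℂ) * (w - 1)‖ ≤ 1 := fun l hl ↦ by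
    refine abs_le_of_sq_le_sq' ?_ zero_le_one |>.2
    rw [norm_one_add_mul_sub_one_sq _ hw, one_pow]
    have := mul_nonneg (mul_nonneg (hl.1 j).1 (sub_nonneg.2 (hl.1 j).2)) (sq_nonneg ‖1 - w‖)
    linarith
  rw [show (0 : ℂ) = ∫ l : ℕ → ℝ, (0 : ℂ) ∂p by simp]
  refine tendsto_integral_of_dominated_convergence (fun _ ↦ 2) (fun n ↦ ?_)
    (integrable_const _) (fun n ↦ ?_) ?_
  · exact (((measurable_const.add (hml.mul measurable_const)).pow_const n).sub
      ((measurable_const.sub hml).pow_const n)).aestronglyMeasurable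
  · filter_upwards [hp] with l hl
    refine (norm_sub_le _ _).trans ?_
    rw [norm_pow, norm_pow, h1 l hl n]
    have := pow_le_one₀ (n := n) (norm_nonneg _) (h2 l hl)
    have := pow_le_one₀ (n := n) (sub_nonneg.2 (hl.1 j).2) (by linarith [(hl.1 j).1])
    linarith
  · filter_upwards [hp, hlt] with l hl hl1
    rcases (hl.1 j).1.eq_or_lt with h0 | h0
    · simp [← h0]
    · rw [← sub_zero (0 : ℂ)]
      refine Tendsto.sub ?_ ?_
      · exact tendsto_pow_atTop_nhds_zero_of_norm_lt_one
          (norm_one_add_mul_sub_one_lt h0 (hl1 j) hw hw1)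
      · refine tendsto_pow_atTop_nhds_zero_of_norm_lt_one ?_
        rw [h1 l hl 0]; linarith

/-- A bound for the difference of integrals when the circle carries many points. -/
theorem norm_setIntegral_circle_le (hp : ∀ᵐ l ∂p, l ∈ nabla) [IsProbabilityMeasure p]
    {j : ℕ} (hj : 0 < j) {A : Set (ℕ → ℝ)} (hA : MeasurableSet A) {n : ℕ} {s : ℝ} (hs : 0 ≤ s)
    (hAs : ∀ l ∈ A, s ≤ n * l j) {w : ℂ} (hw : ‖w‖ = 1) :
    ‖∫ l in A, ((1 + (l j : ℂ) * (w - 1)) ^ n - (1 - (l j : ℂ)) ^ n) ∂p‖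
      ≤ 2 * Real.exp (-(s * ‖1 - w‖ ^ 2 / 4)) := by
  have hb : ∀ᵐ l ∂p.restrict A, ‖(1 + (l j : ℂ) * (w - 1)) ^ n - (1 - (l j : ℂ)) ^ n‖
      ≤ 2 * Real.exp (-(s * ‖1 - w‖ ^ 2 / 4)) := by
    filter_upwards [ae_restrict_of_ae hp, ae_restrict_mem hA] with l hl hlA
    have h0 := (hl.1 j).1
    -- As j ≥ 1, the perimeter l j is at most l 0 and l 1, whose sum is at most 1.
    have hhalf : l j ≤ 1 / 2 := by
      have h1 : ∑ i ∈ Finset.range 2, l i ≤ 1 :=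
        (hl.2.2.1.sum_le_tsum _ fun i _ ↦ (hl.1 i).1).trans hl.2.2.2
      rw [Finset.sum_range_succ, Finset.sum_range_one] at h1
      have h2 := hl.2.1 (Nat.zero_le 1)
      have h3 := hl.2.1 (show 1 ≤ j from hj)
      linarith
    have hsl := hAs l hlA
    -- This makes the power of 1 - l j, bounded by e^{-n l j}, fit under the same exponential.
    have hw4 : ‖1 - w‖ ^ 2 ≤ 4 := by
      have : ‖1 - w‖ ≤ 2 := (norm_sub_le _ _).trans (by rw [norm_one, hw]; norm_num)
      nlinarith [norm_nonneg (1 - w)]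
    have e1 : ‖(1 + (l j : ℂ) * (w - 1)) ^ n‖ ≤ Real.exp (-(s * ‖1 - w‖ ^ 2 / 4)) := by
      rw [norm_pow]
      refine (pow_le_pow_left₀ (norm_nonneg _) (norm_one_add_mul_sub_one_le h0 hhalf hw) n).trans ?_
      rw [← Real.exp_nat_mul]
      refine Real.exp_le_exp.2 ?_
      nlinarith [mul_le_mul_of_nonneg_right hsl (sq_nonneg ‖1 - w‖)]
    have e2 : ‖(1 - (l j : ℂ)) ^ n‖ ≤ Real.exp (-(s * ‖1 - w‖ ^ 2 / 4)) := by
      rw [norm_pow, show (1 - (l j : ℂ)) = ((1 - l j : ℝ) : ℂ) by push_cast; rfl,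
        Complex.norm_real, Real.norm_eq_abs, abs_of_nonneg (by linarith)]
      have h5 : 1 - l j ≤ Real.exp (-(l j)) := by linarith [Real.add_one_le_exp (-(l j))]
      refine (pow_le_pow_left₀ (by linarith) h5 n).trans ?_
      rw [← Real.exp_nat_mul]
      refine Real.exp_le_exp.2 ?_
      nlinarith [mul_le_mul_of_nonneg_left hw4 hs]
    calc _ ≤ ‖(1 + (l j : ℂ) * (w - 1)) ^ n‖ + ‖(1 - (l j : ℂ)) ^ n‖ := norm_sub_le _ _
      _ ≤ _ := by linarith
  have h := norm_integral_le_of_norm_le (integrable_const _) hb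
  refine h.trans ?_
  rw [integral_const, smul_eq_mul]
  refine mul_le_of_le_one_left (by positivity) ?_
  rw [measureReal_restrict_apply MeasurableSet.univ]
  exact measureReal_le_one

variable {α : ℝ}

/-- At fixed m only finitely many circles and frequencies |d| < (m+1)³ are involved. Each Fourier
term tends to zero by irrationality alone, so no rate is needed here, and the main terms add up to
at most 4 / (m+1)². -/
theorem head_dirac (hc : IsCoupling μ p Y x) (hp : ∀ᵐ l ∂p, l ∈ nabla)
    (hlt : ∀ᵐ l ∂p, ∀ j, l j < 1) (hα : Irrational α) {m : ℕ} {ε : ℝ}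
    (hm : 4 / ((m : ℝ) + 1) ^ 2 < ε) :
    ∀ᶠ n in atTop, model μ (Measure.dirac (-α)) n {q | ∃ j < m,
    0 < pointCount x n (some j) q.1 ∧ ‖(1 : ℂ) - circleWeight x n j q‖ ≤ 1 / ((m + 1) ^ 3 : ℕ)}
      ≤ ENNReal.ofReal ε := by
  have := hc.isProbabilityMeasure
  set H := (m + 1) ^ 3 with hH
  let I : ℕ → ℕ → ℤ → ℂ := fun n j d ↦
    ∫ l, ((1 + (l j : ℂ) * (((rot (-α) ^ d : Circle) : ℂ) - 1)) ^ n - (1 - (l j : ℂ)) ^ n) ∂p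
  let D : ℕ → ℕ → ℝ := fun n j ↦ ∑ d ∈ (Finset.Ioo (-(H : ℤ)) H).erase 0, ‖I n j d‖
  have hD : ∀ j, Tendsto (fun n ↦ D n j) atTop (𝓝 0) := by
    intro j
    rw [show (0 : ℝ) = ∑ d ∈ (Finset.Ioo (-(H : ℤ)) H).erase 0, ‖(0 : ℂ)‖ by simp]
    refine tendsto_finsetSum _ fun d hd ↦ Tendsto.norm ?_
    refine tendsto_integral_circle hp hlt j (Circle.norm_coe _) ?_
    rw [Ne, Circle.coe_eq_one]
    exact rot_zpow_ne_one_of_irrational hα (Finset.ne_of_mem_erase hd)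
  have hsum : Tendsto (fun n ↦ ∑ j ∈ Finset.range m, (4 / (H : ℝ) + 4 * D n j)) atTop
      (𝓝 (∑ j ∈ Finset.range m, (4 / (H : ℝ) + 4 * 0))) :=
    tendsto_finsetSum _ fun j _ ↦ ((hD j).const_mul 4).const_add _
  have hlim : ∑ j ∈ Finset.range m, (4 / (H : ℝ) + 4 * 0) < ε := by
    refine lt_of_le_of_lt ?_ hm
    rw [Finset.sum_const, Finset.card_range, nsmul_eq_mul, mul_zero, add_zero, hH]
    push_cast
    rw [mul_div_assoc', div_le_div_iff₀ (by positivity) (by positivity)]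
    have : (0 : ℝ) ≤ m := by positivity
    nlinarith [pow_pos (show (0 : ℝ) < m + 1 by positivity) 2]
  filter_upwards [hsum.eventually (gt_mem_nhds hlim)] with n hn
  have hsub : {q : Ω × (Fin n → ℝ) | ∃ j < m, 0 < pointCount x n (some j) q.1 ∧
      ‖(1 : ℂ) - circleWeight x n j q‖ ≤ 1 / H} ⊆ ⋃ j ∈ Finset.range m,
      {q | 0 < pointCount x n (some j) q.1 ∧ ‖(1 : ℂ) - circleWeight x n j q‖ ≤ 1 / H} := by
    rintro q ⟨j, hj, hq⟩
    exact Set.mem_biUnion (Finset.mem_coe.2 (Finset.mem_range.2 hj)) hq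
  have hDn : ∀ j, 0 ≤ D n j := fun j ↦ Finset.sum_nonneg fun _ _ ↦ norm_nonneg _
  refine (measure_mono hsub).trans ((measure_biUnion_finset_le _ _).trans ?_)
  refine (Finset.sum_le_sum (g := fun j ↦ ENNReal.ofReal (4 / (H : ℝ) + 4 * D n j))
    fun j _ ↦ ?_).trans ?_
  · have h := measure_near_one_le (ν := Measure.dirac (-α)) hc hp n j MeasurableSet.univ (H := H)
      (by positivity) (hDn j) fun d hd hdH ↦ by
        rw [Measure.restrict_univ, fourierCoeffOf_dirac]
        exact Finset.single_le_sum (f := fun d ↦ ‖I n j d‖) (fun _ _ ↦ norm_nonneg _)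
          (Finset.mem_erase.2 ⟨hd, Finset.mem_Ioo.2 (abs_lt.1 hdH)⟩)
    simpa using h
  · rw [← ENNReal.ofReal_sum_of_nonneg fun j _ ↦ by have := hDn j; positivity]
    exact ENNReal.ofReal_le_ofReal hn.le

end

/-! ### Tail of the small divisors for a constant angle -/

section

variable {Ω : Type*} [MeasurableSpace Ω] {μ : Measure Ω} [IsProbabilityMeasure μ]
  {p : Measure (ℕ → ℝ)} {Y : Ω → ℕ → ℝ} {x : Ω → ℕ → Point} {α : ℝ}

theorem model_le_pointCount_le {ν : Measure ℝ} [IsProbabilityMeasure ν] (hc : IsCoupling μ p Y x)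
    (hp : ∀ᵐ l ∂p, l ∈ nabla)
    {A : Set (ℕ → ℝ)} (hA : MeasurableSet A) (n j : ℕ) {b : ℝ} (hb : ∀ l ∈ A, l j ≤ b) {K : ℕ}
    (hK : 0 < K) :
    model μ ν n {q | Y q.1 ∈ A ∧ K ≤ pointCount x n (some j) q.1} ≤ ENNReal.ofReal (n * b / K) :=
  (model_preimage_fst ν n ((hc.measurable_y hA).inter
    (measurable_pointCount hc n (some j) (measurableSet_Ici (a := K))))).le.trans
    (measure_le_pointCount_le hc hp hA n j hb hK)

theorem le_norm_one_sub_zpow {u : Circle} {c : ℝ} {γ : ℕ}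
    (h : ∀ m : ℕ, m ≠ 0 → c / (m : ℝ) ^ γ ≤ ‖(1 : ℂ) - (u : ℂ) ^ m‖) {d : ℤ} (hd : d ≠ 0) :
    c / ((d.natAbs : ℕ) : ℝ) ^ γ ≤ ‖(1 : ℂ) - ((u ^ d : Circle) : ℂ)‖ := by
  refine (h _ (Int.natAbs_ne_zero.2 hd)).trans (le_of_eq ?_)
  rcases Int.natAbs_eq d with e | e
  · conv_rhs => rw [e, zpow_natCast, Circle.coe_pow]
  · conv_rhs => rw [e, zpow_neg, zpow_natCast, Circle.coe_inv_eq_conj]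
    rw [← Complex.norm_conj, map_sub, map_one, Circle.coe_pow]

/-- The frequencies satisfy |d| < (j+1)² ≤ t², so |1 - e^{-2iπdα}|² ≥ c² / t^(4γ). Against at least
t^(4γ+1) expected points, the exponent in the Fourier bound is at least t c² / 4. -/
theorem measure_many_points_near_one_le (hc : IsCoupling μ p Y x) (hp : ∀ᵐ l ∂p, l ∈ nabla)
    {c : ℝ} (hc0 : 0 < c) {γ : ℕ}
    (h : ∀ m : ℕ, m ≠ 0 → c / (m : ℝ) ^ γ ≤ ‖(1 : ℂ) - (rot (-α) : ℂ) ^ m‖)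
    {A : Set (ℕ → ℝ)} (hA : MeasurableSet A) {n t j : ℕ} (hj0 : 0 < j) (hjt : j < t)
    (hAt : ∀ l ∈ A, (t : ℝ) ^ (4 * γ + 1) ≤ n * l j) :
    model μ (Measure.dirac (-α)) n {q | Y q.1 ∈ A ∧ 0 < pointCount x n (some j) q.1 ∧
      ‖(1 : ℂ) - circleWeight x n j q‖ ≤ 1 / ((j + 1) ^ 2 : ℕ)}
      ≤ ENNReal.ofReal (4 / ((j : ℝ) + 1) ^ 2 + 8 * Real.exp (-(c ^ 2 / 4)) ^ t) := by
  have := hc.isProbabilityMeasure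
  have hexp : 0 ≤ Real.exp (-(c ^ 2 / 4)) ^ t := by positivity
  have ht : (0 : ℝ) < t := by exact_mod_cast hj0.trans hjt
  refine (measure_near_one_le hc hp n j hA (by positivity)
    (D := 2 * Real.exp (-(c ^ 2 / 4)) ^ t) (by positivity) fun d hd hdH ↦ ?_).trans (le_of_eq ?_)
  · rw [fourierCoeffOf_dirac]
    refine (norm_setIntegral_circle_le hp hj0 hA (by positivity) hAt (Circle.norm_coe _)).trans ?_
    rw [← Real.exp_nat_mul]
    gcongr 2 * Real.exp ?_
    have h1 := le_norm_one_sub_zpow h hd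
    have h2 : ((d.natAbs : ℕ) : ℝ) ^ γ ≤ (t : ℝ) ^ (2 * γ) := by
      rw [pow_mul]
      gcongr
      have h3 : d.natAbs < (j + 1) ^ 2 := by
        have := Int.natCast_natAbs d
        zify
        push_cast at hdH
        exact hdH
      have h4 : (j + 1) ^ 2 ≤ t ^ 2 := Nat.pow_le_pow_left hjt 2
      exact_mod_cast h3.le.trans h4
    have h5 : c / (t : ℝ) ^ (2 * γ) ≤ ‖(1 : ℂ) - ((rot (-α) ^ d : Circle) : ℂ)‖ := by
      refine le_trans ?_ h1
      have : (0 : ℝ) < (d.natAbs : ℕ) := by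
        exact_mod_cast Nat.pos_of_ne_zero (Int.natAbs_ne_zero.2 hd)
      gcongr
    have h6 : c ^ 2 / (t : ℝ) ^ (4 * γ) ≤ ‖(1 : ℂ) - ((rot (-α) ^ d : Circle) : ℂ)‖ ^ 2 := by
      refine le_trans (le_of_eq ?_) (pow_le_pow_left₀ (by positivity) h5 2)
      rw [div_pow, ← pow_mul]; ring_nf
    have h7 := mul_le_mul_of_nonneg_left h6 (show 0 ≤ (t : ℝ) ^ (4 * γ + 1) by positivity)
    have h8 : (t : ℝ) ^ (4 * γ + 1) * (c ^ 2 / (t : ℝ) ^ (4 * γ)) = t * c ^ 2 := by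
      rw [pow_succ]; field_simp
    rw [h8] at h7
    linarith
  · congr 1; push_cast; ring

/-- Let t be the integer part of n^(1/(b+2)). Beyond t, the circles are empty with high probability
by exponential decay. Below t, a circle with n l_j ≥ t^a carries enough points for the Fourier
estimate, and |1 - W_j|⁻¹ ≤ (j+1)² off a summable event. A circle below t with n l_j < t^a has fewer
than t^(a+2) points up to probability t⁻²; then W_j = e^{-2iπN_jα} and the Diophantine bound for N_j
itself give |1 - W_j|⁻¹ ≤ N_j^γ / c, which is only polynomial in t and is beaten by the factor 1/n.
-/
theorem tail_dirac (hc : IsCoupling μ p Y x) (hp : ∀ᵐ l ∂p, l ∈ nabla)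
    {r : ℝ} (hr : 0 < r) (hr1 : r < 1) {c : ℝ} (hc0 : 0 < c) {γ : ℕ}
    (h : ∀ m : ℕ, m ≠ 0 → c / (m : ℝ) ^ γ ≤ ‖(1 : ℂ) - (rot (-α) : ℂ) ^ m‖) (M : ℕ) {ε : ℝ}
    (hε : 0 < ε) :
    ∃ e : ℕ → ℝ, Tendsto e atTop (𝓝 0) ∧ ∀ᶠ m in atTop, ∀ᶠ n in atTop,
      model μ (Measure.dirac (-α)) n {q | Y q.1 ∈ decaySet r M ∧ ¬ ∀ B, ∑ j ∈ Finset.Ico m B,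
        (pointCount x n (some j) q.1 : ℝ) / n * ‖(1 : ℂ) - circleWeight x n j q‖⁻¹
        ≤ ∑ j ∈ Finset.Ico m B, ((j : ℝ) + 1) ^ 2 * ((pointCount x n (some j) q.1 : ℝ) / n) + e n}
        ≤ ENNReal.ofReal ε := by
  obtain ⟨a, ha⟩ : ∃ a, a = 4 * γ + 1 := ⟨_, rfl⟩
  obtain ⟨b, hb⟩ : ∃ b, b = (a + 2) * (γ + 1) := ⟨_, rfl⟩
  obtain ⟨t, htt, htK⟩ := exists_root_floor (K := b + 2) (by positivity)
  have htR : Tendsto (fun n ↦ (t n : ℝ)) atTop atTop := tendsto_natCast_atTop_atTop.comp htt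
  -- The error is due to at most t circles with few points, each contributing at most t^((a+2)(γ+1))
  -- / (c n), and b is this exponent. Since n ≥ t^(b+2), the total is at most 1 / (c t).
  refine ⟨fun n ↦ (t n : ℝ) * ((t n : ℝ) ^ b / (c * n)), ?_, ?_⟩
  · have h1 : Tendsto (fun n ↦ c⁻¹ * (t n : ℝ)⁻¹) atTop (𝓝 (c⁻¹ * 0)) :=
      htR.inv_tendsto_atTop.const_mul _
    rw [mul_zero] at h1
    refine squeeze_zero' (Eventually.of_forall fun n ↦ by positivity) ?_ h1
    filter_upwards [htt.eventually_gt_atTop 0, eventually_gt_atTop 0] with n hn hn0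
    have h2 : ((t n : ℝ)) ^ (b + 2) ≤ n := by exact_mod_cast (htK n).1
    have h3 : (0 : ℝ) < t n := by exact_mod_cast hn
    have h4 : (0 : ℝ) < n := by exact_mod_cast hn0
    rw [← mul_inv, mul_div_assoc', inv_eq_one_div, div_le_div_iff₀ (by positivity) (by positivity)]
    calc _ = c * (t n : ℝ) ^ (b + 2) := by ring
      _ ≤ _ := by rw [one_mul]; gcongr
  -- Probabilities of the exceptional events: at most t Fourier errors, t events of probability t⁻²,
  -- and the geometric tail of the expected numbers of points on the circles beyond t, where n ≤
  -- (t+1)^(b+2).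
  have hrest : Tendsto (fun n ↦ 8 * ((t n : ℝ) ^ 1 * Real.exp (-(c ^ 2 / 4)) ^ t n) + (t n : ℝ)⁻¹
      + M / (1 - r) * (((t n + 1 : ℕ) : ℝ) ^ (b + 2) * r ^ (t n + 1))) atTop
      (𝓝 (8 * 0 + 0 + M / (1 - r) * 0)) := by
    refine Tendsto.add (Tendsto.add (Tendsto.const_mul _ ?_) htR.inv_tendsto_atTop)
      (Tendsto.const_mul _ ?_)
    · refine (tendsto_pow_const_mul_const_pow_of_abs_lt_one 1
        (r := Real.exp (-(c ^ 2 / 4))) ?_).comp htt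
      rw [abs_of_pos (Real.exp_pos _), Real.exp_lt_one_iff]
      have := pow_pos hc0 2
      linarith
    · exact (tendsto_pow_const_mul_const_pow_of_abs_lt_one (b + 2)
        (by rwa [abs_of_pos hr])).comp ((tendsto_add_atTop_nat 1).comp htt)
  rw [show (8 * 0 + 0 + M / (1 - r) * 0 : ℝ) = 0 by ring] at hrest
  filter_upwards [eventually_tsum_nat_add_le (b := fun j : ℕ ↦ 4 / ((j : ℝ) + 1) ^ 2)
    (show 0 < ε / 2 by positivity), eventually_gt_atTop 0] with m hm hm0
  filter_upwards [hrest.eventually (gt_mem_nhds (show 0 < ε / 2 by positivity)),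
    htt.eventually_gt_atTop 0, eventually_gt_atTop 0] with n hn ht0 hn0
  have htp : (0 : ℝ) < t n := by exact_mod_cast ht0
  have hnp : (0 : ℝ) < n := by exact_mod_cast hn0
  set A := decaySet r M with hAdef
  have hAm : MeasurableSet A := measurableSet_decaySet r M
  let A1 : ℕ → Set (ℕ → ℝ) := fun j ↦ A ∩ {l | (t n : ℝ) ^ a ≤ n * l j}
  have hA1 : ∀ j, MeasurableSet (A1 j) := fun j ↦ hAm.inter
    (measurableSet_le measurable_const ((measurable_pi_apply j).const_mul _))
  let A2 : ℕ → Set (ℕ → ℝ) := fun j ↦ A ∩ {l | n * l j < (t n : ℝ) ^ a}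
  have hA2 : ∀ j, MeasurableSet (A2 j) := fun j ↦ hAm.inter
    (measurableSet_lt ((measurable_pi_apply j).const_mul _) measurable_const)
  let S1 : ℕ → Set (Ω × (Fin n → ℝ)) := fun j ↦ {q | Y q.1 ∈ A1 j ∧
    0 < pointCount x n (some j) q.1 ∧ ‖(1 : ℂ) - circleWeight x n j q‖ ≤ 1 / ((j + 1) ^ 2 : ℕ)}
  let S2 : ℕ → Set (Ω × (Fin n → ℝ)) := fun j ↦ {q | Y q.1 ∈ A2 j ∧
    t n ^ (a + 2) ≤ pointCount x n (some j) q.1}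
  let S3 : ℕ → Set (Ω × (Fin n → ℝ)) := fun j ↦ {q | Y q.1 ∈ A ∧
    1 ≤ pointCount x n (some j) q.1}
  have hS1 : ∀ j ∈ Finset.Ico m (t n), model μ (Measure.dirac (-α)) n (S1 j)
      ≤ ENNReal.ofReal (4 / ((j : ℝ) + 1) ^ 2 + 8 * Real.exp (-(c ^ 2 / 4)) ^ t n) := by
    intro j hj
    rw [Finset.mem_Ico] at hj
    refine measure_many_points_near_one_le hc hp hc0 h (hA1 j) (hm0.trans_le hj.1) hj.2 ?_
    intro l hl
    rw [← ha]
    exact hl.2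
  have hS2 : ∀ j ∈ Finset.range (t n), model μ (Measure.dirac (-α)) n (S2 j)
      ≤ ENNReal.ofReal ((t n : ℝ)⁻¹ ^ 2) := by
    intro j hj
    refine (model_le_pointCount_le hc hp (hA2 j) n j (b := (t n : ℝ) ^ a / n) (fun l hl ↦ ?_)
      (by positivity)).trans (le_of_eq ?_)
    · rw [le_div_iff₀ hnp, mul_comm]
      exact hl.2.le
    · congr 1
      push_cast
      rw [pow_add]
      field_simp
  have hS3 : ∀ j, t n ≤ j → model μ (Measure.dirac (-α)) n (S3 j)
      ≤ ENNReal.ofReal (n * (M * r ^ (j + 1))) := by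
    intro j _
    have := model_le_pointCount_le (ν := Measure.dirac (-α)) hc hp hAm n j
      (b := M * r ^ (j + 1)) (fun l hl ↦ hl j) one_pos
    simpa using this
  have hgeo : Summable fun j : ℕ ↦ r ^ j := summable_geometric_of_lt_one hr.le hr1
  have hb3 : Summable fun j : ℕ ↦ n * (M * r ^ (j + 1)) :=
    (((summable_nat_add_iff 1).2 hgeo).mul_left _).mul_left _
  have hB3 := measure_biUnion_le_ofReal_tsum (fun j ↦ by positivity) hb3 hS3
  have hB3' : ∑' j : ℕ, (n * (M * r ^ (j + t n + 1)) : ℝ)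
      ≤ M / (1 - r) * (((t n + 1 : ℕ) : ℝ) ^ (b + 2) * r ^ (t n + 1)) := by
    have e : ∀ j : ℕ, (n * (M * r ^ (j + t n + 1)) : ℝ) = (n * M * r ^ (t n + 1)) * r ^ j := by
      intro j; rw [add_assoc, pow_add]; ring
    simp only [e]
    rw [tsum_mul_left, tsum_geometric_of_lt_one hr.le hr1]
    have h2 : (n : ℝ) ≤ ((t n + 1 : ℕ) : ℝ) ^ (b + 2) := by exact_mod_cast (htK n).2.le
    calc (n * M * r ^ (t n + 1)) * (1 - r)⁻¹ = M / (1 - r) * (n * r ^ (t n + 1)) := by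
          rw [div_eq_mul_inv]; ring
      _ ≤ _ := by
          have : 0 < 1 - r := by linarith
          gcongr
  have hsub : {q : Ω × (Fin n → ℝ) | Y q.1 ∈ A ∧ ¬ ∀ B, ∑ j ∈ Finset.Ico m B,
        (pointCount x n (some j) q.1 : ℝ) / n * ‖(1 : ℂ) - circleWeight x n j q‖⁻¹
        ≤ ∑ j ∈ Finset.Ico m B, ((j : ℝ) + 1) ^ 2 * ((pointCount x n (some j) q.1 : ℝ) / n)
          + (t n : ℝ) * ((t n : ℝ) ^ b / (c * n))} ⊆
      (((⋃ j ∈ Finset.Ico m (t n), S1 j) ∪ ⋃ j ∈ Finset.range (t n), S2 j) ∪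
      {q | ∃ j, t n ≤ j ∧ q ∈ S3 j}) ∪ {q | ¬ ∀ k, q.2 k = -α} := by
    rintro q ⟨hqA, hq⟩
    by_contra hcon
    simp only [Set.mem_union, not_or, Set.mem_iUnion, not_exists, Finset.mem_Ico, Finset.mem_range,
      Set.mem_ofPred_eq, not_and, not_not] at hcon
    obtain ⟨⟨⟨h1, h2⟩, h3⟩, h4⟩ := hcon
    refine hq fun B ↦ ?_
    have key : ∀ j ∈ Finset.Ico m B,
        (pointCount x n (some j) q.1 : ℝ) / n * ‖(1 : ℂ) - circleWeight x n j q‖⁻¹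
        ≤ ((j : ℝ) + 1) ^ 2 * ((pointCount x n (some j) q.1 : ℝ) / n) +
          if j ∈ Finset.range (t n) then (t n : ℝ) ^ b / (c * n) else 0 := by
      intro j hj
      rw [Finset.mem_Ico] at hj
      have hite : 0 ≤ if j ∈ Finset.range (t n) then (t n : ℝ) ^ b / (c * n) else 0 := by
        split_ifs <;> positivity
      rcases Nat.eq_zero_or_pos (pointCount x n (some j) q.1) with h0 | h0
      · simpa [h0] using hite
      have hjt : j < t n := by
        by_contra hjt
        exact h3 j (not_lt.1 hjt) ⟨hqA, h0⟩
      by_cases hY : (t n : ℝ) ^ a ≤ n * Y q.1 j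
      · have h5 : ¬ ‖(1 : ℂ) - circleWeight x n j q‖ ≤ 1 / ((j + 1) ^ 2 : ℕ) := fun h5 ↦
          h1 j ⟨hj.1, hjt⟩ ⟨⟨hqA, hY⟩, h0, h5⟩
        rw [not_le] at h5
        refine le_add_of_le_of_nonneg ?_ hite
        rw [mul_comm]
        gcongr
        rw [inv_le_comm₀ (lt_trans (by positivity) h5) (by positivity)]
        refine le_trans (le_of_eq ?_) h5.le
        push_cast; rw [one_div]
      · have h6 : pointCount x n (some j) q.1 ≤ t n ^ (a + 2) := by
          by_contra h6
          exact h2 j hjt ⟨⟨hqA, not_le.1 hY⟩, (not_le.1 h6).le⟩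
        refine le_add_of_nonneg_of_le (by positivity) ?_
        rw [if_pos (Finset.mem_range.2 hjt), circleWeight_eq_pow h4, Circle.coe_pow]
        set N := pointCount x n (some j) q.1
        have hN : (0 : ℝ) < N := by exact_mod_cast h0
        have h7 := h N h0.ne'
        have h8 : ‖(1 : ℂ) - (rot (-α) : ℂ) ^ N‖⁻¹ ≤ (N : ℝ) ^ γ / c := by
          rw [← inv_div]
          gcongr
        calc (N : ℝ) / n * ‖(1 : ℂ) - (rot (-α) : ℂ) ^ N‖⁻¹ ≤ (N : ℝ) / n * ((N : ℝ) ^ γ / c) := by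
              gcongr
          _ = (N : ℝ) ^ (γ + 1) / (c * n) := by rw [pow_succ]; field_simp
          _ ≤ ((t n : ℝ) ^ (a + 2)) ^ (γ + 1) / (c * n) := by
              gcongr
              exact_mod_cast h6
          _ = _ := by rw [← pow_mul, hb]
    refine (Finset.sum_le_sum key).trans ?_
    rw [Finset.sum_add_distrib]
    gcongr
    rw [← Finset.sum_filter, Finset.sum_const, nsmul_eq_mul]
    have h9 : (Finset.filter (fun j ↦ j ∈ Finset.range (t n)) (Finset.Ico m B)).card ≤ t n := by
      calc _ ≤ (Finset.range (t n)).card := Finset.card_le_card fun j hj ↦ (Finset.mem_filter.1 hj).2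
        _ = t n := Finset.card_range _
    gcongr
  have hnull : model μ (Measure.dirac (-α)) n {q | ¬ ∀ k, q.2 k = -α} = 0 := ae_model_dirac (-α) n
  refine (measure_mono hsub).trans ((measure_union_le _ _).trans ?_)
  rw [hnull, add_zero]
  refine (measure_union_le _ _).trans ?_
  refine (add_le_add (measure_union_le _ _) hB3).trans ?_
  refine (add_le_add (add_le_add ((measure_biUnion_finset_le _ _).trans (Finset.sum_le_sum hS1))
    ((measure_biUnion_finset_le _ _).trans (Finset.sum_le_sum hS2)))
    (ENNReal.ofReal_le_ofReal hB3')).trans ?_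
  have h1r : 0 < 1 - r := by linarith
  rw [← ENNReal.ofReal_sum_of_nonneg fun j _ ↦ by positivity,
    ← ENNReal.ofReal_sum_of_nonneg fun j _ ↦ by positivity,
    ← ENNReal.ofReal_add (Finset.sum_nonneg fun j _ ↦ by positivity)
      (Finset.sum_nonneg fun j _ ↦ by positivity),
    ← ENNReal.ofReal_add (add_nonneg (Finset.sum_nonneg fun j _ ↦ by positivity)
      (Finset.sum_nonneg fun j _ ↦ by positivity)) (by positivity)]
  refine ENNReal.ofReal_le_ofReal ?_
  have f1 : ∑ j ∈ Finset.Ico m (t n), (4 / ((j : ℝ) + 1) ^ 2 + 8 * Real.exp (-(c ^ 2 / 4)) ^ t n)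
      ≤ ε / 2 + 8 * ((t n : ℝ) ^ 1 * Real.exp (-(c ^ 2 / 4)) ^ t n) := by
    rw [Finset.sum_add_distrib]
    refine add_le_add ?_ ?_
    · refine le_trans ?_ hm
      rw [Finset.sum_Ico_eq_sum_range]
      refine le_trans (le_of_eq (Finset.sum_congr rfl fun j _ ↦ ?_))
        (((summable_nat_add_iff m).2 summable_four_div_sq).sum_le_tsum (Finset.range (t n - m))
          fun j _ ↦ by positivity)
      rw [add_comm m j]
    · rw [Finset.sum_const, Nat.card_Ico, nsmul_eq_mul, pow_one]
      have : ((t n - m : ℕ) : ℝ) ≤ t n := by exact_mod_cast Nat.sub_le _ _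
      nlinarith [mul_le_mul_of_nonneg_right this
        (show 0 ≤ 8 * Real.exp (-(c ^ 2 / 4)) ^ t n by positivity)]
  have f2 : ∑ j ∈ Finset.range (t n), ((t n : ℝ)⁻¹ ^ 2) = (t n : ℝ)⁻¹ := by
    rw [Finset.sum_const, Finset.card_range, nsmul_eq_mul]
    field_simp
  rw [f2]
  linarith

theorem hasSmallDivisors_dirac (hc : IsCoupling μ p Y x) (hp : ∀ᵐ l ∂p, l ∈ nabla)
    (hdecay : HasExponentialDecay p) (hlt : ∀ᵐ l ∂p, ∀ j, l j < 1) (hα : Irrational α)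
    (hft : IsFiniteType α) : HasSmallDivisors μ (Measure.dirac (-α)) x where
  tail := by
    obtain ⟨r, ⟨hr, hr1⟩, hdec⟩ := hdecay
    obtain ⟨c, hc0, γ, h⟩ := hft.exists_le_norm hα
    exact tail_of_compare hc hp hr hr1 hdec fun M ε hε ↦ tail_dirac hc hp hr hr1 hc0 h M hε
  head := by
    intro ε hε
    filter_upwards [summable_four_div_sq.tendsto_atTop_zero.eventually (gt_mem_nhds hε)] with m hm
    exact head_dirac hc hp hlt hα hm
  ne_one := by
    intro n
    filter_upwards [ae_model_dirac (μ := μ) (-α) n] with q hq j hj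
    rw [circleWeight_eq_pow hq]
    have := rot_zpow_ne_one_of_irrational hα (d := pointCount x n (some j) q.1)
      (by exact_mod_cast hj.ne')
    rwa [zpow_natCast] at this
  rot_ne_one := by
    intro n
    filter_upwards [ae_model_dirac (μ := μ) (-α) n] with q hq k
    rw [hq]
    simpa using rot_zpow_ne_one_of_irrational hα one_ne_zero

end

/-! ### Measurability of the permutation and of its characteristic polynomial -/

instance (n : ℕ) : MeasurableSpace (Equiv.Perm (Fin n)) := ⊤

instance (n : ℕ) : DiscreteMeasurableSpace (Equiv.Perm (Fin n)) := ⟨fun _ ↦ trivial⟩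

/-- The coordinate of a point on its component. -/
def position : Point → ℝ
  | Sum.inl (_, t) => t
  | Sum.inr t => t

theorem measurable_position : Measurable position := by
  refine measurable_fun_sum ?_ ?_
  · exact measurable_snd
  · exact measurable_id

/-- In terms of the measurable functions `label` and `position`, the relation becomes a countable
combination of measurable conditions. -/
theorem isNextPoint_iff (l : ℕ → ℝ) (x : ℕ → Point) {n : ℕ} (k i : Fin n) :
    IsNextPoint l x k i ↔ (label (x k) = none ∧ i = k) ∨ ∃ j, label (x k) = some j ∧
      label (x i) = some j ∧ ∀ m : Fin n, label (x m) = some j →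
        ccwDist (l j) (position (x k)) (position (x i))
          ≤ ccwDist (l j) (position (x k)) (position (x m)) := by
  unfold IsNextPoint
  rcases hk : x k with ⟨j, s⟩ | s
  · simp only [label, reduceCtorEq, false_and, Option.some.injEq, false_or, exists_eq_left']
    constructor
    · rintro ⟨t, ht, hm⟩
      refine ⟨by rw [ht], fun m hlm ↦ ?_⟩
      obtain ⟨t', ht'⟩ := label_eq_some.1 hlm
      rw [ht, ht']
      exact hm m t' ht'
    · rintro ⟨hi, hm⟩
      obtain ⟨t, ht⟩ := label_eq_some.1 hi
      refine ⟨t, ht, fun m t' ht' ↦ ?_⟩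
      have := hm m (label_eq_some.2 ⟨t', ht'⟩)
      rwa [ht, ht'] at this
  · simp [label]

theorem measurable_ccwDist {E : Type*} [MeasurableSpace E] {L s t : E → ℝ} (hL : Measurable L)
    (hs : Measurable s) (ht : Measurable t) : Measurable fun ω ↦ ccwDist (L ω) (s ω) (t ω) :=
  Measurable.ite (measurableSet_lt hs ht) (ht.sub hs) ((ht.sub hs).add hL)

section

variable {Ω : Type*} [MeasurableSpace Ω] {μ : Measure Ω}
  {p : Measure (ℕ → ℝ)} {Y : Ω → ℕ → ℝ} {x : Ω → ℕ → Point}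

theorem measurableSet_isNextPoint (hY : Measurable Y) (hx : Measurable x) {n : ℕ} (k i : Fin n) :
    MeasurableSet {ω | IsNextPoint (Y ω) (x ω) k i} := by
  have hl : ∀ (m : Fin n) (c : Option ℕ), MeasurableSet {ω | label (x ω m) = c} := fun m c ↦
    measurable_label.comp ((measurable_pi_apply (m : ℕ)).comp hx) (measurableSet_singleton c)
  have hp : ∀ m : Fin n, Measurable fun ω ↦ position (x ω m) := fun m ↦
    measurable_position.comp ((measurable_pi_apply (m : ℕ)).comp hx)
  have hYj : ∀ j, Measurable fun ω ↦ Y ω j := fun j ↦ (measurable_pi_apply j).comp hY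
  have hd : ∀ (j : ℕ) (m : Fin n), MeasurableSet {ω | label (x ω m) = some j →
      ccwDist (Y ω j) (position (x ω k)) (position (x ω i))
          ≤ ccwDist (Y ω j) (position (x ω k)) (position (x ω m))} := fun j m ↦
    (hl m (some j)).imp (measurableSet_le (measurable_ccwDist (hYj j) (hp k) (hp i))
      (measurable_ccwDist (hYj j) (hp k) (hp m)))
  have e : {ω | IsNextPoint (Y ω) (x ω) k i} = ({ω | label (x ω k) = none} ∩ {_ω | i = k}) ∪
      ⋃ j, ({ω | label (x ω k) = some j} ∩ ({ω | label (x ω i) = some j} ∩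
        ⋂ m : Fin n, {ω | label (x ω m) = some j →
      ccwDist (Y ω j) (position (x ω k)) (position (x ω i))
          ≤ ccwDist (Y ω j) (position (x ω k)) (position (x ω m))})) := by
    ext ω
    simp only [Set.mem_ofPred_eq, isNextPoint_iff, Set.mem_union, Set.mem_inter_iff,
      Set.mem_iUnion, Set.mem_iInter]
  rw [e]
  exact ((hl k none).inter (MeasurableSet.const _)).union (MeasurableSet.iUnion fun j ↦
    (hl k _).inter ((hl i _).inter (MeasurableSet.iInter fun m ↦ hd j m)))

theorem measurable_circlePerm (hY : Measurable Y) (hx : Measurable x) (n : ℕ) :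
    Measurable fun ω ↦ circlePerm (Y ω) (x ω) n := by
  classical
  -- The permutation depends on the points only through a finite table of truth values, so the
  -- choice made in `circlePerm` raises no measurability question.
  let Φ : (Fin n → Fin n → Prop) → Equiv.Perm (Fin n) := fun P ↦
    if h : ∃ σ : Equiv.Perm (Fin n), ∀ k, P k (σ k) then h.choose else 1
  have e : (fun ω ↦ circlePerm (Y ω) (x ω) n)
      = fun ω ↦ Φ (fun k i ↦ IsNextPoint (Y ω) (x ω) k i) := by
    ext1 ω
    simp only [circlePerm, Φ]
  have hΦ : Measurable Φ := Measurable.of_discrete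
  rw [e]
  exact hΦ.comp (measurable_pi_lambda _ fun k ↦ measurable_pi_lambda _ fun i ↦
    measurableSet_setOfPred.1 (measurableSet_isNextPoint hY hx k i))

end

/-- The denominator may vanish, so continuity is not available. But the numerator is a continuous
map into C(ℂ, ℂ), by currying, and the inverse of the denominator is a measurable scalar. -/
theorem measurable_xiTilde_weighted (n : ℕ) (σ : Equiv.Perm (Fin n)) :
    Measurable fun v : Fin n → ℂ ↦ xiTilde (weightedPermMatrix σ v) := by
  have hM : Continuous fun v : Fin n → ℂ ↦ weightedPermMatrix σ v := by
    refine continuous_matrix fun i k ↦ ?_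
    simp only [weightedPermMatrix, Matrix.of_apply]
    split_ifs <;> fun_prop
  have hc : Continuous fun q : (Fin n → ℂ) × ℂ ↦ charDet (weightedPermMatrix σ q.1) q.2 :=
    Continuous.matrix_det ((continuous_snd.smul continuous_const).sub (hM.comp continuous_fst))
  let num : C((Fin n → ℂ) × ℂ, ℂ) := ⟨fun q ↦ charDet (weightedPermMatrix σ q.1)
    (Complex.exp (2 * Complex.I * Real.pi * (q.2 / n))), hc.comp (continuous_fst.prodMk
      (by fun_prop : Continuous fun q : (Fin n → ℂ) × ℂ ↦
        Complex.exp (2 * Complex.I * Real.pi * (q.2 / n))))⟩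
  have h1 : Measurable fun v : Fin n → ℂ ↦ num.curry v := num.curry.continuous.measurable
  have h2 : Measurable fun v : Fin n → ℂ ↦ (charDet (weightedPermMatrix σ v) 1)⁻¹ :=
    (hc.comp (continuous_id.prodMk continuous_const)).measurable.inv
  have h3 : Measurable fun q : ℂ × C(ℂ, ℂ) ↦ q.1 • q.2 := continuous_smul.measurable
  have e : (fun v : Fin n → ℂ ↦ xiTilde (weightedPermMatrix σ v))
      = fun v ↦ (charDet (weightedPermMatrix σ v) 1)⁻¹ • num.curry v := by
    ext v z
    simp only [xiTilde, ContinuousMap.coe_mk, ContinuousMap.coe_smul, Pi.smul_apply, smul_eq_mul,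
      ContinuousMap.curry_apply, num]
    rw [div_eq_inv_mul]
  rw [e]
  exact h3.comp (h2.prodMk h1)

theorem measurable_xiTilde_weighted_prod (n : ℕ) :
    Measurable fun q : Equiv.Perm (Fin n) × (Fin n → ℂ) ↦ xiTilde (weightedPermMatrix q.1 q.2) :=
  measurable_from_prod_countable_right fun σ ↦ measurable_xiTilde_weighted n σ

/-! ### Transfer between the random matrices and the model -/

section

variable {Ω : Type*} [MeasurableSpace Ω] {μ : Measure Ω}
  {p : Measure (ℕ → ℝ)} {Y : Ω → ℕ → ℝ} {x : Ω → ℕ → Point}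

/-- The permutation together with the weights, as functions of the points and of the angles. -/
noncomputable def modelPair (Y : Ω → ℕ → ℝ) (x : Ω → ℕ → Point) (n : ℕ) (q : Ω × (Fin n → ℝ)) :
    Equiv.Perm (Fin n) × (Fin n → ℂ) :=
  (circlePerm (Y q.1) (x q.1) n, fun k ↦ (rot (q.2 k) : ℂ))

/-- The renormalized characteristic polynomial, as a function of the points and of the angles. -/
noncomputable def modelXi (Y : Ω → ℕ → ℝ) (x : Ω → ℕ → Point) (n : ℕ) (q : Ω × (Fin n → ℝ)) :
    C(ℂ, ℂ) :=
  xiTilde (weightedPermMatrix (modelPair Y x n q).1 (modelPair Y x n q).2)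

theorem measurable_modelPair (hY : Measurable Y) (hx : Measurable x) (n : ℕ) :
    Measurable (modelPair Y x n) :=
  ((measurable_circlePerm hY hx n).comp measurable_fst).prodMk (measurable_pi_lambda _ fun k ↦
    measurable_circle_coe.comp (measurable_rot.comp ((measurable_pi_apply k).comp measurable_snd)))

theorem measurable_modelXi (hY : Measurable Y) (hx : Measurable x) (n : ℕ) :
    Measurable (modelXi Y x n) :=
  (measurable_xiTilde_weighted_prod n).comp (measurable_modelPair hY hx n)

/-- The intervals [-1/2, 1/2) and [0, 1) differ by the translation of [-1/2, 0) by a period. The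
symmetric interval is the useful one: odd functions of the angle have mean zero on it. -/
theorem map_rot_uniformAngle : uniformAngle.map (fun t ↦ (rot t : ℂ)) = uniformCircle := by
  have hm : Measurable fun t ↦ (rot t : ℂ) := measurable_circle_coe.comp measurable_rot
  have e : (fun t : ℝ ↦ Complex.exp (2 * Complex.I * Real.pi * t)) = fun t ↦ (rot t : ℂ) := by
    ext t; rw [coe_rot]
  rw [uniformCircle, e]
  ext B hB
  rw [Measure.map_apply hm hB, Measure.map_apply hm hB, uniformAngle,
    Measure.restrict_apply (hm hB), Measure.restrict_apply (hm hB)]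
  set S := (fun t ↦ (rot t : ℂ)) ⁻¹' B with hS
  have hSm : MeasurableSet S := hm hB
  have hper : ∀ t, t + 1 ∈ S ↔ t ∈ S := by
    intro t
    have : rot (t + 1) = rot t := by
      have := rot_intCast 1
      rw [Int.cast_one] at this
      rw [rot_add, this, mul_one]
    simp only [hS, Set.mem_preimage, this]
  have h1 : volume (S ∩ Set.Ico (-(1 / 2)) 0) = volume (S ∩ Set.Ico (1 / 2) 1) := by
    rw [← measure_preimage_add_right volume (1 : ℝ) (S ∩ Set.Ico (1 / 2) 1)]
    congr 1
    ext t
    simp only [Set.mem_inter_iff, Set.mem_Ico, Set.mem_preimage, hper]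
    refine and_congr_right fun _ ↦ ⟨fun h ↦ ⟨by linarith [h.1], by linarith [h.2]⟩,
      fun h ↦ ⟨by linarith [h.1], by linarith [h.2]⟩⟩
  have split : ∀ a b c : ℝ, a ≤ b → b ≤ c → volume (S ∩ Set.Ico a c)
      = volume (S ∩ Set.Ico a b) + volume (S ∩ Set.Ico b c) := by
    intro a b c hab hbc
    rw [← Set.Ico_union_Ico_eq_Ico hab hbc, Set.inter_union_distrib_left, measure_union]
    · exact (Set.Ico_disjoint_Ico_same).mono Set.inter_subset_right Set.inter_subset_right
    · exact hSm.inter measurableSet_Ico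
  rw [split _ 0 _ (by norm_num) (by norm_num), h1, split 0 (1 / 2) 1 (by norm_num) (by norm_num),
    add_comm]

theorem map_pair_eq [IsProbabilityMeasure μ] (hc : IsCoupling μ p Y x) {n : ℕ}
    {v : Ω → Fin n → ℂ} (hv : Measurable v)
    (hlaw : ∀ (τ : Equiv.Perm (Fin n)) (B : Fin n → Set ℂ), (∀ k, MeasurableSet (B k)) →
      μ {ω | circlePerm (Y ω) (x ω) n = τ ∧ ∀ k, v ω k ∈ B k}
        = μ {ω | circlePerm (Y ω) (x ω) n = τ} * ∏ k, uniformCircle (B k)) :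
    μ.map (fun ω ↦ (circlePerm (Y ω) (x ω) n, v ω))
      = (model μ uniformAngle n).map (modelPair Y x n) := by
  have hσ := measurable_circlePerm hc.measurable_y hc.measurable_x n
  have hm : Measurable fun t ↦ (rot t : ℂ) := measurable_circle_coe.comp measurable_rot
  have : IsProbabilityMeasure uniformCircle := by
    rw [← map_rot_uniformAngle]; exact Measure.isProbabilityMeasure_map hm.aemeasurable
  have key : μ.map (fun ω ↦ (circlePerm (Y ω) (x ω) n, v ω))
      = (μ.map fun ω ↦ circlePerm (Y ω) (x ω) n).prod (Measure.pi fun _ ↦ uniformCircle) := by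
    have : IsProbabilityMeasure (μ.map fun ω ↦ circlePerm (Y ω) (x ω) n) :=
      Measure.isProbabilityMeasure_map hσ.aemeasurable
    -- Given any permutation of positive probability the entries have the same product law, so they
    -- are independent of the permutation; the other permutations are negligible.
    have h1 : ∀ τ : Equiv.Perm (Fin n), μ {ω | circlePerm (Y ω) (x ω) n = τ} ≠ 0 →
        (μ {ω | circlePerm (Y ω) (x ω) n = τ})⁻¹ •
          (μ.restrict {ω | circlePerm (Y ω) (x ω) n = τ}).map v
        = Measure.pi fun _ ↦ uniformCircle := by
      intro τ hτ
      refine (Measure.pi_eq fun B hB ↦ ?_).symm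
      rw [Measure.smul_apply, Measure.map_apply hv (MeasurableSet.univ_pi hB),
        Measure.restrict_apply (hv (MeasurableSet.univ_pi hB)), smul_eq_mul]
      have e : v ⁻¹' Set.univ.pi B ∩ {ω | circlePerm (Y ω) (x ω) n = τ}
          = {ω | circlePerm (Y ω) (x ω) n = τ ∧ ∀ k, v ω k ∈ B k} := by
        ext ω
        simp only [Set.mem_inter_iff, Set.mem_preimage, Set.mem_pi, Set.mem_univ, true_imp_iff,
          Set.mem_ofPred_eq]
        tauto
      rw [e, hlaw τ B hB, ← mul_assoc, ENNReal.inv_mul_cancel hτ (measure_ne_top _ _), one_mul]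
    refine (Measure.prod_eq fun S T hS hT ↦ ?_).symm
    have hfin : S.Finite := Set.toFinite S
    rw [Measure.map_apply hσ hS, Measure.map_apply (hσ.prodMk hv) (hS.prod hT)]
    have e1 : ∀ T : Set (Fin n → ℂ), (fun ω ↦ (circlePerm (Y ω) (x ω) n, v ω)) ⁻¹' S ×ˢ T
        = ⋃ τ ∈ hfin.toFinset, ({ω | circlePerm (Y ω) (x ω) n = τ} ∩ v ⁻¹' T) := by
      intro T
      ext ω
      simp
    have hsing : ∀ τ, MeasurableSet {ω | circlePerm (Y ω) (x ω) n = τ} := fun τ ↦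
      hσ (measurableSet_singleton τ)
    have e2 : ∀ T : Set (Fin n → ℂ), MeasurableSet T →
        μ ((fun ω ↦ (circlePerm (Y ω) (x ω) n, v ω)) ⁻¹' S ×ˢ T)
        = ∑ τ ∈ hfin.toFinset, μ ({ω | circlePerm (Y ω) (x ω) n = τ} ∩ v ⁻¹' T) := by
      intro T hT
      rw [e1, measure_biUnion_finset _ fun τ _ ↦ (hsing τ).inter (hv hT)]
      intro τ _ τ' _ hne
      refine Set.disjoint_left.2 fun ω hω hω' ↦ hne ?_
      rw [← hω.1, ← hω'.1]
    have e3 := e2 Set.univ MeasurableSet.univ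
    rw [show (fun ω ↦ (circlePerm (Y ω) (x ω) n, v ω)) ⁻¹' S ×ˢ Set.univ
      = (fun ω ↦ circlePerm (Y ω) (x ω) n) ⁻¹' S by ext; simp] at e3
    rw [e2 T hT, e3, Finset.sum_mul]
    refine Finset.sum_congr rfl fun τ _ ↦ ?_
    simp only [Set.preimage_univ, Set.inter_univ]
    rcases eq_or_ne (μ {ω | circlePerm (Y ω) (x ω) n = τ}) 0 with h0 | h0
    · rw [h0, zero_mul]
      exact measure_mono_null Set.inter_subset_left h0
    · rw [← h1 τ h0, Measure.smul_apply, smul_eq_mul, ← mul_assoc,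
        ENNReal.mul_inv_cancel h0 (measure_ne_top _ _), one_mul, Measure.map_apply hv hT,
        Measure.restrict_apply (hv hT), Set.inter_comm]
  have e : (model μ uniformAngle n).map (modelPair Y x n)
      = (μ.map fun ω ↦ circlePerm (Y ω) (x ω) n).prod ((Measure.pi fun _ ↦ uniformAngle).map
        fun (θ : Fin n → ℝ) k ↦ (rot (θ k) : ℂ)) :=
    (Measure.map_prod_map μ (Measure.pi fun _ ↦ uniformAngle) hσ (measurable_pi_lambda _ fun k ↦
      hm.comp (measurable_pi_apply k))).symm
  rw [key, e]
  congr 1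
  rw [← map_rot_uniformAngle]
  exact (Measure.pi_map_pi fun _ ↦ hm.aemeasurable).symm

theorem TendstoInDistribution.of_map_eq {Ω₁ Ω₂ : ℕ → Type*} [∀ n, MeasurableSpace (Ω₁ n)]
    [∀ n, MeasurableSpace (Ω₂ n)] {μ₁ : ∀ n, Measure (Ω₁ n)} {μ₂ : ∀ n, Measure (Ω₂ n)}
    [∀ n, IsProbabilityMeasure (μ₁ n)] [∀ n, IsProbabilityMeasure (μ₂ n)] {Ω' : Type*}
    [MeasurableSpace Ω'] {μ' : Measure Ω'} [IsProbabilityMeasure μ']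
    {X₁ : ∀ n, Ω₁ n → C(ℂ, ℂ)} {X₂ : ∀ n, Ω₂ n → C(ℂ, ℂ)} {Z : Ω' → C(ℂ, ℂ)}
    (h : TendstoInDistribution X₁ atTop Z μ₁ μ') (h₂ : ∀ n, AEMeasurable (X₂ n) (μ₂ n))
    (he : ∀ n, (μ₂ n).map (X₂ n) = (μ₁ n).map (X₁ n)) :
    TendstoInDistribution X₂ atTop Z μ₂ μ' := by
  refine ⟨h₂, h.aemeasurable_limit, ?_⟩
  refine h.tendsto.congr fun n ↦ ?_
  exact Subtype.ext (he n).symm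

theorem tendstoInDistribution_xiTilde_of_model [IsProbabilityMeasure μ] (hc : IsCoupling μ p Y x)
    {Ω' : Type*} [MeasurableSpace Ω'] {μ' : Measure Ω'} [IsProbabilityMeasure μ']
    {Z : Ω' → C(ℂ, ℂ)} (h : TendstoInDistribution (fun n ↦ modelXi Y x n) atTop Z
      (fun n ↦ model μ uniformAngle n) μ')
    {M : (n : ℕ) → Ω → Matrix (Fin n) (Fin n) ℂ}
    (hM : ∀ n, IsRandomModifiedPermMatrix μ (fun ω ↦ circlePerm (Y ω) (x ω) n) (M n)) :
    TendstoInDistribution (fun n ω ↦ xiTilde (M n ω)) atTop Z (fun _ ↦ μ) μ' := by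
  choose v hv hMv hlaw using hM
  have hpair : ∀ n, Measurable fun ω ↦ (circlePerm (Y ω) (x ω) n, v n ω) := fun n ↦
    (measurable_circlePerm hc.measurable_y hc.measurable_x n).prodMk (hv n)
  have hae : ∀ n, (fun ω ↦ xiTilde (M n ω)) =ᵐ[μ]
      fun ω ↦ xiTilde (weightedPermMatrix (circlePerm (Y ω) (x ω) n) (v n ω)) := fun n ↦ by
    filter_upwards [hMv n] with ω hω
    rw [hω]
  refine TendstoInDistribution.of_map_eq h (fun n ↦ ?_) fun n ↦ ?_
  · exact ((measurable_xiTilde_weighted_prod n).comp (hpair n)).aemeasurable.congr (hae n).symm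
  · rw [Measure.map_congr (hae n)]
    have h1 := Measure.map_map (μ := μ) (measurable_xiTilde_weighted_prod n) (hpair n)
    have h2 := Measure.map_map (μ := model μ uniformAngle n) (measurable_xiTilde_weighted_prod n)
      (measurable_modelPair hc.measurable_y hc.measurable_x n)
    rw [map_pair_eq hc (hv n) (hlaw n)] at h1
    exact h1.symm.trans h2

/-- Factoring e^{-2iπα} out of the matrix turns the evaluation at w into the evaluation of the
unweighted polynomial at e^{2iπα} w, and the power of e^{-2iπα} cancels in the quotient. This
reduces (ii) to constant angles -α. -/
theorem xiTilde_weighted_eq_xiShift {n : ℕ} (σ : Equiv.Perm (Fin n)) (α : ℝ) :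
    xiTilde (weightedPermMatrix σ fun _ ↦ (rot (-α) : ℂ)) = xiShift α (permMatrix σ) := by
  have h : ∀ w : ℂ, charDet (weightedPermMatrix σ fun _ ↦ (rot (-α) : ℂ)) w
      = (rot (-α) : ℂ) ^ n * charDet (permMatrix σ) ((rot α : ℂ) * w) := by
    intro w
    have e : w • (1 : Matrix (Fin n) (Fin n) ℂ) - weightedPermMatrix σ (fun _ ↦ (rot (-α) : ℂ))
        = (rot (-α) : ℂ) • (((rot α : ℂ) * w) • (1 : Matrix (Fin n) (Fin n) ℂ) - permMatrix σ) := by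
      rw [smul_sub, smul_smul, ← mul_assoc, rot_neg, ← Circle.coe_mul, inv_mul_cancel,
        Circle.coe_one, one_mul]
      congr 1
      ext i k
      simp [weightedPermMatrix, permMatrix]
    rw [charDet, e, Matrix.det_smul, Fintype.card_fin, charDet]
  ext z
  simp only [xiTilde, xiShift, ContinuousMap.coe_mk, h]
  rw [mul_div_mul_left _ _ (pow_ne_zero _ (Circle.coe_ne_zero _)), mul_one, coe_rot,
    ← Complex.exp_add]
  congr 2
  ring_nf

theorem tendstoInDistribution_xiShift_of_model [IsProbabilityMeasure μ] (hc : IsCoupling μ p Y x)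
    {Ω' : Type*} [MeasurableSpace Ω'] {μ' : Measure Ω'} [IsProbabilityMeasure μ']
    {Z : Ω' → C(ℂ, ℂ)} {α : ℝ} (h : TendstoInDistribution (fun n ↦ modelXi Y x n) atTop Z
      (fun n ↦ model μ (Measure.dirac (-α)) n) μ') :
    TendstoInDistribution (fun n ω ↦ xiShift α (permMatrix (circlePerm (Y ω) (x ω) n))) atTop Z
      (fun _ ↦ μ) μ' := by
  have hσ := fun n ↦ measurable_circlePerm hc.measurable_y hc.measurable_x n
  have hm : ∀ n, Measurable fun σ : Equiv.Perm (Fin n) ↦ xiShift α (permMatrix σ) := fun n ↦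
    Measurable.of_discrete
  have hms : ∀ n, Measurable fun ω ↦ xiShift α (permMatrix (circlePerm (Y ω) (x ω) n)) := fun n ↦
    (hm n).comp (hσ n)
  refine TendstoInDistribution.of_map_eq h (fun n ↦ (hms n).aemeasurable) fun n ↦ ?_
  have hae : modelXi Y x n =ᵐ[model μ (Measure.dirac (-α)) n]
      ((fun ω ↦ xiShift α (permMatrix (circlePerm (Y ω) (x ω) n))) ∘ Prod.fst) := by
    filter_upwards [ae_model_dirac (μ := μ) (-α) n] with q hq
    simp only [modelXi, modelPair, hq, Function.comp_apply]
    exact xiTilde_weighted_eq_xiShift _ α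
  rw [Measure.map_congr hae, ← Measure.map_map (hms n) measurable_fst]
  congr 1
  exact (measurePreserving_fst (μ := μ) (ν := Measure.pi fun _ : Fin n ↦
    Measure.dirac (-α))).map_eq.symm

end

/-! ### Factorization over circles and segment, and truncation of the product over the circles -/

/-- The inverse of a complex number, continued continuously where the norm is less than `1 / H`. -/
noncomputable def clippedInv (H : ℝ) (w : ℂ) : ℂ :=
  (starRingEnd ℂ) w / ((max (‖w‖ ^ 2) ((H ^ 2)⁻¹) : ℝ) : ℂ)

theorem continuous_clippedInv {H : ℝ} (hH : 0 < H) : Continuous (clippedInv H) := by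
  unfold clippedInv
  refine Continuous.div Complex.continuous_conj (Complex.continuous_ofReal.comp
    ((continuous_norm.pow 2).max continuous_const)) fun w ↦ ?_
  rw [Complex.ofReal_ne_zero]
  exact (lt_max_of_lt_right (by positivity)).ne'

theorem clippedInv_eq_inv {H : ℝ} (hH : 0 < H) {w : ℂ} (hw : 1 / H ≤ ‖w‖) :
    clippedInv H w = w⁻¹ := by
  rw [clippedInv, max_eq_left, Complex.inv_def, Complex.normSq_eq_norm_sq, div_eq_mul_inv,
    Complex.ofReal_inv]
  rw [← inv_pow, ← one_div]
  exact pow_le_pow_left₀ (by positivity) hw 2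

/-- Product over the first `m` circles, with clipped inverses. -/
noncomputable def circleClip (m : ℕ) : C((Fin m → ℝ) × (Fin m → Circle), C(ℂ, ℂ)) :=
  -- Clipping makes the product continuous in the weights, including at weight one, so that
  -- convergence in distribution passes through it.
  ContinuousMap.curry ⟨fun q ↦ ∏ j : Fin m, (1 +
    (Complex.exp (2 * Complex.I * Real.pi * q.2 * q.1.1 j) - 1) *
      clippedInv (((m + 1) ^ 3 : ℕ) : ℝ) (1 - (q.1.2 j : ℂ))), by
    have h := continuous_clippedInv (show 0 < (((m + 1) ^ 3 : ℕ) : ℝ) by positivity)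
    refine continuous_finsetProd _ fun j _ ↦ continuous_const.add (Continuous.mul ?_ ?_)
    · fun_prop
    · refine h.comp (continuous_const.sub (continuous_circle_coe.comp ?_))
      fun_prop⟩

theorem circleClip_apply (m : ℕ) (q : (Fin m → ℝ) × (Fin m → Circle)) (z : ℂ) :
    circleClip m q z = ∏ j : Fin m, (1 + (Complex.exp (2 * Complex.I * Real.pi * z * q.1 j) - 1) *
      clippedInv (((m + 1) ^ 3 : ℕ) : ℝ) (1 - (q.2 j : ℂ))) := rfl

theorem norm_exp_mul_sub_one_le {A s : ℝ} {z : ℂ} (hz : ‖z‖ ≤ A) (hs : s ∈ Set.Icc (0 : ℝ) 1) :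
    ‖Complex.exp (2 * Complex.I * Real.pi * z * s) - 1‖
      ≤ (2 * Real.pi * A * Real.exp (2 * Real.pi * A)) * s := by
  have h := Complex.norm_exp_sub_sum_le_norm_mul_exp (2 * Complex.I * Real.pi * z * s) 1
  simp only [Finset.sum_range_one, pow_zero, Nat.factorial_zero, Nat.cast_one, div_one,
    pow_one] at h
  refine h.trans ?_
  have hpi := Real.pi_pos
  have e : ‖2 * Complex.I * Real.pi * z * s‖ = 2 * Real.pi * ‖z‖ * s := by
    simp [abs_of_pos hpi, abs_of_nonneg hs.1]
  rw [e]
  have h1 : 2 * Real.pi * ‖z‖ * s ≤ 2 * Real.pi * A * s := by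
    have := hs.1
    gcongr
  have hA : 0 ≤ A := (norm_nonneg z).trans hz
  have h2 : 2 * Real.pi * A * s ≤ 2 * Real.pi * A :=
    mul_le_of_le_one_right (by positivity) hs.2
  calc 2 * Real.pi * ‖z‖ * s * Real.exp (2 * Real.pi * ‖z‖ * s)
      ≤ 2 * Real.pi * A * s * Real.exp (2 * Real.pi * A) := by
        exact mul_le_mul h1 (Real.exp_le_exp.2 (h1.trans h2)) (Real.exp_pos _).le
          (mul_nonneg (by positivity) hs.1)
    _ = _ := by ring

section

variable {Ω : Type*} [MeasurableSpace Ω] {μ : Measure Ω} [IsProbabilityMeasure μ]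
  {p : Measure (ℕ → ℝ)} {Y : Ω → ℕ → ℝ} {x : Ω → ℕ → Point}

/-- The product of the factors of the points of the segment. -/
noncomputable def segProd (x : Ω → ℕ → Point) (n : ℕ) (q : Ω × (Fin n → ℝ)) : C(ℂ, ℂ) where
  toFun z := ∏ k : Fin n, if label (x q.1 k) = none then
    1 + (Complex.exp (2 * Complex.I * Real.pi * (z / n)) - 1) / (1 - (rot (q.2 k) : ℂ)) else 1
  continuous_toFun := by
    refine continuous_finsetProd _ fun k _ ↦ ?_
    split_ifs <;> fun_prop

/-- Frequencies of the points on the first `m` circles, with the products of the weights. -/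
noncomputable def circleData (x : Ω → ℕ → Point) (m n : ℕ) (q : Ω × (Fin n → ℝ)) :
    (Fin m → ℝ) × (Fin m → Circle) :=
  (fun j ↦ (pointCount x n (some j) q.1 : ℝ) / n, fun j ↦ circleWeight x n j q)

variable {ν : Measure ℝ} [IsProbabilityMeasure ν]

/-- The labels are not bounded by a constant, so the number of factors is random; but any larger
number is also allowed, as empty circles contribute the factor one. -/
theorem ae_modelXi_eq (hc : IsCoupling μ p Y x) (hp : ∀ᵐ l ∂p, l ∈ nabla)
    (hsd : HasSmallDivisors μ ν x) (n : ℕ) :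
    ∀ᵐ q ∂model μ ν n, ∃ B₀, ∀ B ≥ B₀, ∀ z, modelXi Y x n q z =
      (∏ j ∈ Finset.range B, (1 + (Complex.exp (2 * Complex.I * Real.pi * z *
        ((pointCount x n (some j) q.1 : ℝ) / n : ℝ)) - 1) / (1 - (circleWeight x n j q : ℂ)))) *
        segProd x n q z := by
  have hgood : ∀ᵐ q ∂model μ ν n, GoodPoints (Y q.1) (x q.1) :=
    Measure.quasiMeasurePreserving_fst.ae (hc.ae_goodPoints hp)
  filter_upwards [hgood, hsd.ne_one n, hsd.rot_ne_one n] with q hq h1 h2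
  obtain ⟨B₀, hB₀⟩ : ∃ B₀, ∀ (k : Fin n) j, label (x q.1 k) = some j → j < B₀ := by
    refine ⟨∑ k : Fin n, ((label (x q.1 k)).getD 0 + 1), fun k j hkj ↦ ?_⟩
    have := Finset.single_le_sum (f := fun k : Fin n ↦ (label (x q.1 k)).getD 0 + 1)
      (fun _ _ ↦ Nat.zero_le _) (Finset.mem_univ k)
    simp only [hkj, Option.getD_some] at this
    omega
  refine ⟨B₀, fun B hB z ↦ ?_⟩
  have hprod : ∀ j, labelProd (labels (x q.1) n) (fun k ↦ (rot (q.2 k) : ℂ)) (some j)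
      = (circleWeight x n j q : ℂ) := fun j ↦ by
    rw [circleWeight, labelProd, labelProd, circle_coe_prod]
  have h := charDet_div_charDet_one (labels (x q.1) n) (circlePerm (Y q.1) (x q.1) n)
    (fun k hk ↦ hq.circlePerm_eq_self n k hk) (fun j ↦ hq.circlePerm_isCycleOn n j)
    (fun k ↦ (rot (q.2 k) : ℂ)) (fun k _ ↦ by
      rw [Ne, Circle.coe_eq_one]; exact h2 k) (fun k j hkj ↦ by
      rw [hprod, Ne, Circle.coe_eq_one]
      refine h1 j ?_
      rw [pointCount, labelCount, Finset.card_pos]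
      exact ⟨k, Finset.mem_filter.2 ⟨Finset.mem_univ k, hkj⟩⟩)
    (Complex.exp (2 * Complex.I * Real.pi * (z / n))) B
    (fun k j hkj ↦ (hB₀ k j hkj).trans_le hB)
  simp only [modelXi, modelPair, xiTilde, ContinuousMap.coe_mk]
  rw [h]
  congr 1
  refine Finset.prod_congr rfl fun j _ ↦ ?_
  rw [hprod, ← Complex.exp_nat_mul]
  congr 4
  rw [pointCount]
  push_cast
  ring

/-- The convergence in distribution of the renormalized characteristic polynomial follows from the
one of the product of the truncated product over the circles and of an approximation of the
product over the segment. -/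
theorem tendstoInDistribution_modelXi (hc : IsCoupling μ p Y x) (hp : ∀ᵐ l ∂p, l ∈ nabla)
    (hsd : HasSmallDivisors μ ν x) {Ω' : Type*} [MeasurableSpace Ω'] {μ' : Measure Ω'}
    [IsProbabilityMeasure μ'] {seg : ℕ → ∀ n, Ω × (Fin n → ℝ) → C(ℂ, ℂ)}
    {L : ℕ → Ω' → C(ℂ, ℂ)} {Z : Ω' → C(ℂ, ℂ)}
    (h1 : ∀ m, TendstoInDistribution (fun n q ↦ circleClip m (circleData x m n q) * seg m n q) atTop
      (L m) (fun n ↦ model μ ν n) μ')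
    (h2 : ∀ᵐ ω ∂μ', Tendsto (fun m ↦ L m ω) atTop (𝓝 (Z ω)))
    (h3 : ∀ A δ ε : ℝ, 0 < δ → 0 < ε → ∀ᶠ m in atTop, ∀ᶠ n in atTop, model μ ν n
      {q | ¬ ∀ z, ‖z‖ ≤ A → ∃ T : ℂ, ‖T - 1‖ ≤ δ ∧ segProd x n q z = seg m n q z * T}
        ≤ ENNReal.ofReal ε) :
    TendstoInDistribution (fun n ↦ modelXi Y x n) atTop Z (fun n ↦ model μ ν n) μ' := by
  refine tendstoInDistribution_of_approx_mul
    (fun n ↦ (measurable_modelXi hc.measurable_y hc.measurable_x n).aemeasurable) h1 h2 ?_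
  intro A δ ε hδ hε
  obtain ⟨C, hC⟩ : ∃ C, C = 2 * Real.pi * |A| * Real.exp (2 * Real.pi * |A|) := ⟨_, rfl⟩
  have hC0 : 0 ≤ C := by have := Real.pi_pos; rw [hC]; positivity
  -- With δ₁ ≤ 1, two relative errors δ₁ combine to at most δ₁² + 2 δ₁ ≤ 3 δ₁ ≤ δ.
  set δ₁ := min (δ / 3) 1 with hδ₁
  have hδ₁0 : 0 < δ₁ := lt_min (by positivity) one_pos
  set δ₂ := Real.log (1 + δ₁) / (C + 1) with hδ₂
  have hlog : 0 < Real.log (1 + δ₁) := Real.log_pos (by linarith)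
  have hδ₂0 : 0 < δ₂ := by positivity
  have hexp : Real.exp (C * δ₂) - 1 ≤ δ₁ := by
    have : C * δ₂ ≤ Real.log (1 + δ₁) := by
      rw [hδ₂, mul_div_assoc', div_le_iff₀ (by positivity)]
      nlinarith
    have h := Real.exp_le_exp.2 this
    rw [Real.exp_log (by linarith)] at h
    linarith
  filter_upwards [h3 A δ₁ (ε / 3) hδ₁0 (by positivity), hsd.tail δ₂ hδ₂0 (ε / 3) (by positivity),
    hsd.head (ε / 3) (by positivity)] with m hm1 hm2 hm3
  filter_upwards [hm1, hm2, hm3] with n hn1 hn2 hn3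
  have hsub : {q : Ω × (Fin n → ℝ) | ¬ ∀ z, ‖z‖ ≤ A → ∃ T : ℂ, ‖T - 1‖ ≤ δ ∧ modelXi Y x n q z
      = (circleClip m (circleData x m n q) * seg m n q) z * T} ⊆
      (({q | ¬ ∀ z, ‖z‖ ≤ A → ∃ T : ℂ, ‖T - 1‖ ≤ δ₁ ∧ segProd x n q z = seg m n q z * T} ∪
      {q | ¬ ∀ B, ∑ j ∈ Finset.Ico m B, (pointCount x n (some j) q.1 : ℝ) / n *
        ‖(1 : ℂ) - circleWeight x n j q‖⁻¹ ≤ δ₂}) ∪ {q | ∃ j < m,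
      0 < pointCount x n (some j) q.1 ∧ ‖(1 : ℂ) - circleWeight x n j q‖ ≤ 1 / ((m + 1) ^ 3 : ℕ)}) ∪
      {q | ¬ ∃ B₀, ∀ B ≥ B₀, ∀ z, modelXi Y x n q z =
      (∏ j ∈ Finset.range B, (1 + (Complex.exp (2 * Complex.I * Real.pi * z *
        ((pointCount x n (some j) q.1 : ℝ) / n : ℝ)) - 1) / (1 - (circleWeight x n j q : ℂ)))) *
        segProd x n q z} := by
    intro q hq
    by_contra hcon
    simp only [Set.mem_union, Set.mem_ofPred_eq, not_or, not_not] at hcon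
    obtain ⟨⟨⟨hs, ht⟩, hh⟩, B₀, hB⟩ := hcon
    refine hq fun z hz ↦ ?_
    obtain ⟨T₂, hT₂, hseg⟩ := hs z hz
    set a : ℕ → ℂ := fun j ↦ (Complex.exp (2 * Complex.I * Real.pi * z *
        ((pointCount x n (some j) q.1 : ℝ) / n : ℝ)) - 1) / (1 - (circleWeight x n j q : ℂ)) with ha
    set T₁ : ℂ := ∏ j ∈ Finset.Ico m (max m B₀), (1 + a j) with hT₁
    have hz' : ‖z‖ ≤ |A| := hz.trans (le_abs_self A)
    have hT₁' : ‖T₁ - 1‖ ≤ δ₁ := by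
      refine (Finset.norm_prod_one_add_sub_one_le _ _).trans (le_trans ?_ hexp)
      gcongr
      calc ∑ j ∈ Finset.Ico m (max m B₀), ‖a j‖ ≤ ∑ j ∈ Finset.Ico m (max m B₀), C *
            ((pointCount x n (some j) q.1 : ℝ) / n * ‖(1 : ℂ) - circleWeight x n j q‖⁻¹) := by
            refine Finset.sum_le_sum fun j _ ↦ ?_
            rw [ha]
            simp only
            rw [norm_div, div_eq_mul_inv, ← mul_assoc]
            gcongr
            rw [hC]
            exact norm_exp_mul_sub_one_le hz' (labelCount_div_mem _ _)
        _ ≤ C * δ₂ := by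
            rw [← Finset.mul_sum]
            exact mul_le_mul_of_nonneg_left (ht _) hC0
    -- Off the event of `head`, clipping is inactive on occupied circles; on an empty circle the
    -- factor is one whatever the inverse.
    have hclip : circleClip m (circleData x m n q) z = ∏ j ∈ Finset.range m, (1 + a j) := by
      rw [circleClip_apply, Finset.prod_range fun j ↦ 1 + a j]
      refine Finset.prod_congr rfl fun j _ ↦ ?_
      simp only [circleData, ha]
      rcases Nat.eq_zero_or_pos (pointCount x n (some j) q.1) with h0 | h0
      · simp [h0]
      · rw [clippedInv_eq_inv (by positivity), div_eq_mul_inv (Complex.exp _ - 1)]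
        by_contra hlt
        exact hh ⟨j, j.2, h0, (not_le.1 hlt).le⟩
    refine ⟨T₁ * T₂, ?_, ?_⟩
    · have e : T₁ * T₂ - 1 = (T₁ - 1) * (T₂ - 1) + (T₁ - 1) + (T₂ - 1) := by ring
      have h4 : δ₁ ≤ 1 := min_le_right _ _
      have h5 : δ₁ ≤ δ / 3 := min_le_left _ _
      rw [e]
      refine (norm_add₃_le).trans ?_
      rw [norm_mul]
      nlinarith [mul_le_mul hT₁' hT₂ (norm_nonneg _) hδ₁0.le]
    · rw [hB (max m B₀) (le_max_right _ _) z, ContinuousMap.mul_apply, hclip, hseg, hT₁,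
        ← Finset.prod_range_mul_prod_Ico _ (le_max_left m B₀)]
      ring
  have hnull := ae_modelXi_eq (ν := ν) hc hp hsd n
  refine (measure_mono hsub).trans ((measure_union_le _ _).trans ?_)
  rw [show model μ ν n {q | ¬ ∃ B₀, ∀ B ≥ B₀, ∀ z, modelXi Y x n q z =
      (∏ j ∈ Finset.range B, (1 + (Complex.exp (2 * Complex.I * Real.pi * z *
        ((pointCount x n (some j) q.1 : ℝ) / n : ℝ)) - 1) / (1 - (circleWeight x n j q : ℂ)))) *
        segProd x n q z} = 0 from hnull, add_zero]
  refine (measure_union_le _ _).trans ((add_le_add (measure_union_le _ _) hn3).trans ?_)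
  calc _ ≤ ENNReal.ofReal (ε / 3) + ENNReal.ofReal (ε / 3) + ENNReal.ofReal (ε / 3) := by
        gcongr
    _ = ENNReal.ofReal ε := by
        rw [← ENNReal.ofReal_add (by positivity) (by positivity),
          ← ENNReal.ofReal_add (by positivity) (by positivity)]
        congr 1; ring

end

/-! ### Joint convergence of the observables -/

theorem tendsto_natCast_mul_exp_div_sub_one (w : ℂ) :
    Tendsto (fun n : ℕ ↦ (n : ℂ) * (Complex.exp (w / n) - 1)) atTop (𝓝 w) := by
  have h : HasDerivAt (fun t : ℝ ↦ Complex.exp (w * t)) w 0 := by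
    have h1 : HasDerivAt (fun t : ℝ ↦ w * (t : ℂ)) w 0 := by
      simpa using (Complex.ofRealCLM.hasDerivAt (x := 0)).const_mul w
    simpa using h1.cexp
  have h2 := h.tendsto_slope_zero
  have h3 : Tendsto (fun n : ℕ ↦ (n : ℝ)⁻¹) atTop (𝓝[≠] 0) :=
    (tendsto_inv_atTop_nhdsGT_zero.comp tendsto_natCast_atTop_atTop).mono_right
      (nhdsWithin_mono _ fun t ht ↦ ne_of_gt ht)
  refine (h2.comp h3).congr fun n ↦ ?_
  simp [div_eq_mul_inv]

theorem tendsto_exp_div_natCast (w : ℂ) :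
    Tendsto (fun n : ℕ ↦ Complex.exp (w / n)) atTop (𝓝 1) := by
  have h : Tendsto (fun n : ℕ ↦ w / n) atTop (𝓝 0) := tendsto_const_div_atTop_nhds_zero_nat w
  simpa using h.cexp

theorem tendsto_pow_zero_of_tendsto {G : ℕ → ℂ} {g : ℂ} (h : Tendsto G atTop (𝓝 g))
    (hg : ‖g‖ < 1) : Tendsto (fun n ↦ G n ^ n) atTop (𝓝 0) := by
  obtain ⟨ρ, hρ, hρ1⟩ := exists_between hg
  refine squeeze_zero_norm' ?_ (tendsto_pow_atTop_nhds_zero_of_lt_one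
    ((norm_nonneg g).trans hρ.le) hρ1)
  filter_upwards [h.norm.eventually (gt_mem_nhds hρ)] with n hn
  rw [norm_pow]
  exact pow_le_pow_left₀ (norm_nonneg _) hn.le n

section

variable {Ω : Type*} {x : Ω → ℕ → Point}

open Classical in
/-- The number of points of the segment with a rescaled angle in `I`. -/
noncomputable def cellCount (x : Ω → ℕ → Point) (n : ℕ) (I : Set ℝ) (q : Ω × (Fin n → ℝ)) : ℕ :=
  ∑ k : Fin n, if label (x q.1 k) = none ∧ (n : ℝ) * q.2 k ∈ I then 1 else 0

/-- Frequencies on the first circles and on the segment, counts in cells, products of weights. -/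
noncomputable def modelObs {κ : Type*} (x : Ω → ℕ → Point) (J : ℕ) (I : κ → Set ℝ) (n : ℕ)
    (q : Ω × (Fin n → ℝ)) : Observables (Fin J) κ :=
  (fun j ↦ (pointCount x n (some j) q.1 : ℝ) / n, (pointCount x n none q.1 : ℝ) / n,
    fun i ↦ cellCount x n (I i) q, fun j ↦ circleWeight x n j q)

open Classical in
/-- The contribution of one point to a character of the observables. -/
noncomputable def pointChar {J : ℕ} {κ : Type*} [Fintype κ] (I : κ → Set ℝ) (a : Fin J → ℝ) (b : ℝ)
    (c : κ → ℝ) (m : Fin J → ℤ) (n : ℕ) : Option ℕ → ℝ → ℂ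
  | some j, t => if h : j < J then
      Complex.exp (Complex.I * a ⟨j, h⟩ / n) * ((rot t ^ m ⟨j, h⟩ : Circle) : ℂ) else 1
  | none, t => Complex.exp (Complex.I * b / n) *
      ∏ i, if (n : ℝ) * t ∈ I i then Complex.exp (Complex.I * c i) else 1

theorem norm_exp_I_mul_div (a : ℝ) (n : ℕ) : ‖Complex.exp (Complex.I * a / n)‖ = 1 := by
  rw [show Complex.I * a / n = ((a / n : ℝ) : ℂ) * Complex.I by push_cast; ring,
    Complex.norm_exp_ofReal_mul_I]

theorem norm_pointChar_le {J : ℕ} {κ : Type*} [Fintype κ] (I : κ → Set ℝ) (a : Fin J → ℝ) (b : ℝ)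
    (c : κ → ℝ) (m : Fin J → ℤ) (n : ℕ) (o : Option ℕ) (t : ℝ) :
    ‖pointChar I a b c m n o t‖ ≤ 1 := by
  classical
  rcases o with _ | j
  · simp only [pointChar]
    rw [norm_mul, norm_exp_I_mul_div, one_mul, norm_prod]
    refine Finset.prod_le_one (fun _ _ ↦ norm_nonneg _) fun i _ ↦ ?_
    split_ifs
    · rw [mul_comm, Complex.norm_exp_ofReal_mul_I]
    · simp
  · simp only [pointChar]
    split_ifs
    · rw [norm_mul, norm_exp_I_mul_div, one_mul, Circle.norm_coe]
    · simp

theorem measurable_pointChar {J : ℕ} {κ : Type*} [Fintype κ] {I : κ → Set ℝ}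
    (hI : ∀ i, MeasurableSet (I i)) (a : Fin J → ℝ) (b : ℝ)
    (c : κ → ℝ) (m : Fin J → ℤ) (n : ℕ) (o : Option ℕ) :
    Measurable (pointChar I a b c m n o) := by
  classical
  rcases o with _ | j
  · refine Measurable.const_mul (Finset.measurable_prod _ fun i _ ↦ ?_) _
    exact Measurable.ite ((measurable_id.const_mul (n : ℝ)) (hI i)) measurable_const
      measurable_const
  · by_cases h : j < J
    · have e : pointChar I a b c m n (some j) = fun t ↦ Complex.exp (Complex.I * a ⟨j, h⟩ / n) *
          ((rot t ^ m ⟨j, h⟩ : Circle) : ℂ) := by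
        ext t; simp [pointChar, h]
      rw [e]
      exact ((continuous_circle_coe.comp (continuous_rot.zpow _)).measurable).const_mul _
    · have e : pointChar I a b c m n (some j) = fun t ↦ 1 := by
        ext t; simp [pointChar, h]
      rw [e]
      exact measurable_const

/-- All the observables are sums or products over the points, so a character is a product of
contributions, each depending only on the label and the angle of one point. -/
theorem observableChar_modelObs {J : ℕ} {κ : Type*} [Fintype κ] (I : κ → Set ℝ) (a : Fin J → ℝ)
    (b : ℝ) (c : κ → ℝ) (m : Fin J → ℤ) (n : ℕ) (q : Ω × (Fin n → ℝ)) :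
    (observableChar a b c m (modelObs x J I n q) : ℂ)
      = ∏ k : Fin n, pointChar I a b c m n (label (x q.1 k)) (q.2 k) := by
  classical
  have hsplit : ∀ k : Fin n, pointChar I a b c m n (label (x q.1 k)) (q.2 k)
      = (∏ j : Fin J, if label (x q.1 k) = some (j : ℕ) then Complex.exp (Complex.I * a j / n) else 1)
        * (if label (x q.1 k) = none then Complex.exp (Complex.I * b / n) else 1)
        * (∏ i, if label (x q.1 k) = none ∧ (n : ℝ) * q.2 k ∈ I i then
            Complex.exp (Complex.I * c i) else 1)
        * (∏ j : Fin J, ((if label (x q.1 k) = some (j : ℕ) then rot (q.2 k) else 1 : Circle) : ℂ)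
            ^ m j) := by
    intro k
    rcases label (x q.1 k) with _ | j
    · simp [pointChar]
    · by_cases h : j < J
      · have h1 : ∀ j' : Fin J, (j = (j' : ℕ)) ↔ (⟨j, h⟩ : Fin J) = j' := fun j' ↦ by
          rw [Fin.ext_iff]
        simp only [pointChar, dif_pos h, Option.some.injEq, h1, reduceCtorEq, if_false, false_and,
          Finset.prod_const_one, mul_one, Finset.prod_ite_eq, Finset.mem_univ, if_true,
          Circle.coe_zpow]
        congr 1
        rw [Finset.prod_eq_single (⟨j, h⟩ : Fin J)]
        · simp
        · intro j' _ hj'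
          rw [if_neg (Ne.symm hj')]; simp
        · simp
      · have h1 : ∀ j' : Fin J, ¬ (j = (j' : ℕ)) := fun j' hj' ↦ h (hj' ▸ j'.2)
        simp [pointChar, h, h1]
  simp only [hsplit, Finset.prod_mul_distrib]
  rw [observableChar, Circle.coe_mul, circle_coe_prod, Circle.coe_exp]
  have hpow : ∀ (s : Prop) [Decidable s] (w : ℂ), (if s then Complex.exp w else 1)
      = Complex.exp (w * (if s then 1 else 0)) := by
    intro s _ w; split_ifs <;> simp
  congr 1
  · simp only [hpow, ← Complex.exp_sum]
    rw [← Complex.exp_add, ← Complex.exp_add]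
    congr 1
    have e1 : ∑ k : Fin n, ∑ j : Fin J, Complex.I * a j / n *
        (if label (x q.1 k) = some (j : ℕ) then 1 else 0)
        = ∑ j : Fin J, Complex.I * a j / n * (pointCount x n (some (j : ℕ)) q.1 : ℂ) := by
      rw [Finset.sum_comm]
      refine Finset.sum_congr rfl fun j _ ↦ ?_
      rw [← Finset.mul_sum, pointCount, labelCount_eq_sum]
      push_cast
      rfl
    have e2 : ∑ k : Fin n, Complex.I * b / n * (if label (x q.1 k) = none then 1 else 0)
        = Complex.I * b / n * (pointCount x n none q.1 : ℂ) := by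
      rw [← Finset.mul_sum, pointCount, labelCount_eq_sum]
      push_cast
      rfl
    have e3 : ∑ k : Fin n, ∑ i, Complex.I * c i *
        (if label (x q.1 k) = none ∧ (n : ℝ) * q.2 k ∈ I i then 1 else 0)
        = ∑ i, Complex.I * c i * (cellCount x n (I i) q : ℂ) := by
      rw [Finset.sum_comm]
      refine Finset.sum_congr rfl fun i _ ↦ ?_
      rw [← Finset.mul_sum, cellCount]
      push_cast
      rfl
    rw [e1, e2, e3]
    simp only [modelObs]
    push_cast
    rw [add_mul, add_mul, Finset.sum_mul, Finset.sum_mul]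
    refine congrArg₂ _ (congrArg₂ _ (Finset.sum_congr rfl fun j _ ↦ ?_) ?_)
      (Finset.sum_congr rfl fun i _ ↦ ?_) <;> ring
  · rw [Finset.prod_comm]
    refine Finset.prod_congr rfl fun j _ ↦ ?_
    change ((circleWeight x n j q ^ m j : Circle) : ℂ) = _
    rw [Circle.coe_zpow, circleWeight, labelProd_eq_prod, circle_coe_prod, ← Finset.prod_zpow]
    rfl

end

section

variable {Ω : Type*} [MeasurableSpace Ω] {μ : Measure Ω}
  {p : Measure (ℕ → ℝ)} {Y : Ω → ℕ → ℝ} {x : Ω → ℕ → Point}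

theorem measurable_cellCount (hc : IsCoupling μ p Y x) (n : ℕ) {I : Set ℝ} (hI : MeasurableSet I) :
    Measurable (cellCount x n I) := by
  classical
  refine Finset.measurable_sum _ fun k _ ↦ ?_
  refine measurable_apply_label hc n
    (γ := fun c t ↦ if c = none ∧ (n : ℝ) * t ∈ I then (1 : ℕ) else 0) (fun c ↦ ?_) k
  by_cases h : c = none
  · simp only [h, true_and]
    exact Measurable.ite ((measurable_id.const_mul (n : ℝ)) hI) measurable_const measurable_const
  · simp [h]

theorem measurable_modelObs (hc : IsCoupling μ p Y x) (J : ℕ) {κ : Type*} {I : κ → Set ℝ}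
    (hI : ∀ i, MeasurableSet (I i)) (n : ℕ) : Measurable (modelObs x J I n) := by
  have h : ∀ o, Measurable fun q : Ω × (Fin n → ℝ) ↦ (pointCount x n o q.1 : ℝ) / n := fun o ↦
    (measurable_from_nat.comp ((measurable_pointCount hc n o).comp measurable_fst)).div_const _
  exact (measurable_pi_lambda _ fun j ↦ h _).prodMk ((h _).prodMk
    ((measurable_pi_lambda _ fun i ↦ measurable_cellCount hc n (hI i)).prodMk
      (measurable_pi_lambda _ fun j ↦ measurable_circleWeight hc n j)))

variable [IsProbabilityMeasure μ] {ν : Measure ℝ} [IsProbabilityMeasure ν]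

theorem lintegral_cellCount_le (x : Ω → ℕ → Point) (n : ℕ) {I : Set ℝ}
    (hI : MeasurableSet I) :
    ∫⁻ q, (cellCount x n I q : ENNReal) ∂model μ ν n ≤ n * ν {t | (n : ℝ) * t ∈ I} := by
  classical
  have hS : MeasurableSet {t : ℝ | (n : ℝ) * t ∈ I} := (measurable_id.const_mul (n : ℝ)) hI
  have hk : ∀ k : Fin n, MeasurableSet {q : Ω × (Fin n → ℝ) | (n : ℝ) * q.2 k ∈ I} := fun k ↦
    measurableSet_preimage (f := fun q : Ω × (Fin n → ℝ) ↦ q.2 k)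
      ((measurable_pi_apply k).comp measurable_snd) hS
  calc ∫⁻ q, (cellCount x n I q : ENNReal) ∂model μ ν n
      ≤ ∫⁻ q, ∑ k : Fin n, {q : Ω × (Fin n → ℝ) | (n : ℝ) * q.2 k ∈ I}.indicator (fun _ ↦ 1) q
        ∂model μ ν n := by
        refine lintegral_mono fun q ↦ ?_
        rw [cellCount]
        push_cast
        refine Finset.sum_le_sum fun k _ ↦ ?_
        by_cases h : (n : ℝ) * q.2 k ∈ I
        · simp only [h, and_true, Set.mem_ofPred_eq, Set.indicator_of_mem]
          split_ifs <;> simp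
        · simp [h]
    _ = ∑ k : Fin n, ν {t | (n : ℝ) * t ∈ I} := by
        rw [lintegral_finsetSum _ fun k _ ↦ measurable_const.indicator (hk k)]
        refine Finset.sum_congr rfl fun k _ ↦ ?_
        rw [lintegral_indicator_const (hk k), one_mul]
        have h1 : MeasurePreserving (fun q : Ω × (Fin n → ℝ) ↦ q.2 k) (model μ ν n) ν :=
          (measurePreserving_eval (fun _ : Fin n ↦ ν) k).comp measurePreserving_snd
        exact h1.measure_preimage hS.nullMeasurableSet
    _ = _ := by simp

open Classical in
/-- The limit of the integral of a character of the observables, conditionally on the perimeters. -/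
noncomputable def limitChar {J : ℕ} {κ : Type*} [Fintype κ] (lam : κ → ℝ) (a : Fin J → ℝ) (b : ℝ)
    (c : κ → ℝ) (m : Fin J → ℤ) (l : ℕ → ℝ) : ℂ :=
  if ∀ j : Fin J, m j ≠ 0 → l j = 0 then
    Complex.exp (∑ j : Fin J, (l j : ℂ) * (Complex.I * a j) + ((1 - ∑' j, l j : ℝ) : ℂ) *
      (Complex.I * b + ∑ i, (lam i : ℂ) * (Complex.exp (Complex.I * c i) - 1))) else 0

theorem integral_pointChar_none {J : ℕ} {κ : Type*} [Fintype κ] {I : κ → Set ℝ}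
    (hI : ∀ i, MeasurableSet (I i)) (hd : Pairwise (Function.onFun Disjoint I)) (a : Fin J → ℝ)
    (b : ℝ) (c : κ → ℝ) (m : Fin J → ℤ) (n : ℕ) :
    ∫ t, pointChar I a b c m n none t ∂ν = Complex.exp (Complex.I * b / n) *
      (1 + ∑ i, (ν.real {t | (n : ℝ) * t ∈ I i} : ℂ) * (Complex.exp (Complex.I * c i) - 1)) := by
  classical
  have hS : ∀ i, MeasurableSet {t : ℝ | (n : ℝ) * t ∈ I i} := fun i ↦
    (measurable_id.const_mul (n : ℝ)) (hI i)
  -- The cells are disjoint, so at most one factor differs from one and the product is linear in the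
  -- indicators.
  have e : ∀ t : ℝ, (∏ i, if (n : ℝ) * t ∈ I i then Complex.exp (Complex.I * c i) else 1)
      = 1 + ∑ i, {t : ℝ | (n : ℝ) * t ∈ I i}.indicator
        (fun _ ↦ Complex.exp (Complex.I * c i) - 1) t := by
    intro t
    by_cases h : ∃ i, (n : ℝ) * t ∈ I i
    · obtain ⟨i, hi⟩ := h
      have hne : ∀ i', i' ≠ i → (n : ℝ) * t ∉ I i' := fun i' hi' hmem ↦
        Set.disjoint_left.1 (hd hi') hmem hi
      rw [Finset.prod_eq_single i (fun i' _ hi' ↦ if_neg (hne i' hi')) (by simp), if_pos hi,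
        Finset.sum_eq_single i (fun i' _ hi' ↦
          Set.indicator_of_notMem (s := {t : ℝ | (n : ℝ) * t ∈ I i'}) (hne i' hi') _) (by simp),
        Set.indicator_of_mem (show t ∈ {t : ℝ | (n : ℝ) * t ∈ I i} from hi)]
      ring
    · push Not at h
      simp [h]
  simp only [pointChar, e]
  have hi : ∀ i, Integrable ({t : ℝ | (n : ℝ) * t ∈ I i}.indicator
      (fun _ ↦ Complex.exp (Complex.I * c i) - 1)) ν := fun i ↦
    (integrable_const _).indicator (hS i)
  rw [integral_const_mul, integral_add (integrable_const _) (integrable_finsetSum _ fun i _ ↦ hi i),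
    integral_finsetSum _ fun i _ ↦ hi i]
  simp [integral_indicator_const _ (hS _)]

/-- Conditionally on the perimeters the mean is G n l ^ n. If all the circles whose weight is tested
have length zero, n (G n l - 1) converges and the power tends to an exponential. Otherwise G n l
tends to the number in `hχ`, of modulus less than one, and the power vanishes. Since |G n l| ≤ 1,
dominated convergence concludes. -/
theorem tendsto_integral_observableChar (hc : IsCoupling μ p Y x) (hp : ∀ᵐ l ∂p, l ∈ nabla)
    {J : ℕ} {κ : Type*} [Fintype κ] {I : κ → Set ℝ}
    (hI : ∀ i, MeasurableSet (I i)) (hd : Pairwise (Function.onFun Disjoint I)) {lam : κ → ℝ}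
    (hlam : ∀ i, Tendsto (fun n : ℕ ↦ (n : ℝ) * ν.real {t | (n : ℝ) * t ∈ I i}) atTop (𝓝 (lam i)))
    (hχ : ∀ m : Fin J → ℤ, ∀ᵐ l ∂p, (∃ j : Fin J, m j ≠ 0 ∧ l j ≠ 0) →
      ‖1 + ∑ j : Fin J, (l j : ℂ) * (fourierCoeffOf ν (m j) - 1)‖ < 1)
    (a : Fin J → ℝ) (b : ℝ) (c : κ → ℝ) (m : Fin J → ℤ) :
    Tendsto (fun n ↦ ∫ q, (observableChar a b c m (modelObs x J I n q) : ℂ) ∂model μ ν n) atTop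
      (𝓝 (∫ l, limitChar lam a b c m l ∂p)) := by
  have := hc.isProbabilityMeasure
  let β : ℕ → ℂ := fun n ↦
    ∑ i, (ν.real {t | (n : ℝ) * t ∈ I i} : ℂ) * (Complex.exp (Complex.I * c i) - 1)
  let G : ℕ → (ℕ → ℝ) → ℂ := fun n l ↦ 1 + ∑ j : Fin J, (l j : ℂ) *
    (Complex.exp (Complex.I * a j / n) * fourierCoeffOf ν (m j) - 1) +
    ((1 - ∑' j, l j : ℝ) : ℂ) * (Complex.exp (Complex.I * b / n) * (1 + β n) - 1)
  have hβ : Tendsto (fun n : ℕ ↦ (n : ℂ) * β n) atTop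
      (𝓝 (∑ i, (lam i : ℂ) * (Complex.exp (Complex.I * c i) - 1))) := by
    simp only [β, Finset.mul_sum, ← mul_assoc]
    refine tendsto_finsetSum _ fun i _ ↦ Tendsto.mul_const _ ?_
    have := (Complex.continuous_ofReal.tendsto _).comp (hlam i)
    refine this.congr fun n ↦ ?_
    simp
  have hβ0 : Tendsto β atTop (𝓝 0) := by
    have h1 := (tendsto_inv_atTop_nhds_zero_nat (𝕜 := ℂ)).mul hβ
    rw [zero_mul] at h1
    refine h1.congr' ?_
    filter_upwards [eventually_gt_atTop 0] with n hn
    rw [← mul_assoc, inv_mul_cancel₀ (by exact_mod_cast hn.ne'), one_mul]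
  have hGe : ∀ n, ∀ l ∈ nabla, ∫ c', (∫ t, pointChar I a b c m n c' t ∂ν) ∂labelLaw l = G n l := by
    intro n l hl
    rw [integral_labelLaw hl J fun j hj ↦ by simp [pointChar, not_lt.2 hj],
      integral_pointChar_none hI hd, Finset.sum_range]
    simp only [G]
    refine congrArg₂ _ (congrArg₂ _ rfl (Finset.sum_congr rfl fun j _ ↦ ?_)) rfl
    simp only [pointChar, j.2, dif_pos, integral_const_mul]
    rfl
  have hG : ∀ n, ∫ q, (observableChar a b c m (modelObs x J I n q) : ℂ) ∂model μ ν n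
      = ∫ l, G n l ^ n ∂p := by
    intro n
    simp only [observableChar_modelObs]
    have h := integral_model_prod ν hc hp n (ψ := fun _ ↦ 1) measurable_const (C := 1) (by simp)
      (measurable_pointChar hI a b c m n) (norm_pointChar_le I a b c m n)
    simp only [one_mul] at h
    rw [h]
    refine integral_congr_ae ?_
    filter_upwards [hp] with l hl
    rw [hGe n l hl]
  have hGb : ∀ n, ∀ l ∈ nabla, ‖G n l‖ ≤ 1 := by
    intro n l hl
    have h1 : ∀ c', ‖∫ t, pointChar I a b c m n c' t ∂ν‖ ≤ 1 := fun c' ↦ by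
      refine (norm_integral_le_of_norm_le_const (ae_of_all _
        (norm_pointChar_le I a b c m n c'))).trans ?_
      simp
    rw [← hGe n l hl]
    refine (norm_integral_le_of_norm_le_const (ae_of_all _ h1)).trans ?_
    simp
  simp only [hG]
  have hGm : ∀ n, Measurable (G n) := by
    intro n
    have hl : ∀ j, Measurable fun l : ℕ → ℝ ↦ (l j : ℂ) := fun j ↦
      Complex.measurable_ofReal.comp (measurable_pi_apply j)
    refine (measurable_const.add (Finset.measurable_sum _ fun j _ ↦ (hl _).mul_const _)).add
      (Measurable.mul_const ?_ _)
    exact Complex.measurable_ofReal.comp (measurable_const.sub measurable_tsum_nat)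
  refine tendsto_integral_of_dominated_convergence (fun _ ↦ 1)
    (fun n ↦ ((hGm n).pow_const n).aestronglyMeasurable) (integrable_const _) (fun n ↦ ?_) ?_
  · filter_upwards [hp] with l hl
    rw [norm_pow]
    exact pow_le_one₀ (norm_nonneg _) (hGb n l hl)
  · filter_upwards [hχ m] with l hl
    by_cases h : ∀ j : Fin J, m j ≠ 0 → l j = 0
    · rw [limitChar, if_pos h]
      have hlim : Tendsto (fun n : ℕ ↦ (n : ℂ) * (G n l - 1)) atTop
          (𝓝 (∑ j : Fin J, (l j : ℂ) * (Complex.I * a j) + ((1 - ∑' j, l j : ℝ) : ℂ) *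
      (Complex.I * b + ∑ i, (lam i : ℂ) * (Complex.exp (Complex.I * c i) - 1)))) := by
        have e : ∀ n : ℕ, (n : ℂ) * (G n l - 1) = ∑ j : Fin J, (l j : ℂ) *
            ((n : ℂ) * (Complex.exp (Complex.I * a j / n) * fourierCoeffOf ν (m j) - 1)) +
            ((1 - ∑' j, l j : ℝ) : ℂ) * ((n : ℂ) * (Complex.exp (Complex.I * b / n) - 1) +
              Complex.exp (Complex.I * b / n) * ((n : ℂ) * β n)) := by
          intro n
          have : ∑ j : Fin J, (l j : ℂ) *
            ((n : ℂ) * (Complex.exp (Complex.I * a j / n) * fourierCoeffOf ν (m j) - 1))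
            = n * ∑ j : Fin J, (l j : ℂ) *
            (Complex.exp (Complex.I * a j / n) * fourierCoeffOf ν (m j) - 1) := by
            rw [Finset.mul_sum]
            exact Finset.sum_congr rfl fun j _ ↦ by ring
          rw [this]
          simp only [G]
          ring
        simp only [e]
        refine Tendsto.add (tendsto_finsetSum _ fun j _ ↦ ?_) (Tendsto.const_mul _ ?_)
        · by_cases hm : m j = 0
          · have : fourierCoeffOf ν (m j) = 1 := by simp [hm, fourierCoeffOf]
            simp only [this, mul_one]
            exact (tendsto_natCast_mul_exp_div_sub_one _).const_mul _
          · simp [h j hm]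
        · have h1 := (tendsto_exp_div_natCast (Complex.I * b)).mul hβ
          rw [one_mul] at h1
          exact (tendsto_natCast_mul_exp_div_sub_one _).add h1
      have := Complex.tendsto_one_add_pow_exp_of_tendsto hlim
      simpa using this
    · rw [limitChar, if_neg h]
      push Not at h
      obtain ⟨j, hmj, hlj⟩ := h
      refine tendsto_pow_zero_of_tendsto (g := 1 + ∑ j : Fin J, (l j : ℂ) *
        (fourierCoeffOf ν (m j) - 1)) ?_ (hl ⟨j, hmj, hlj⟩)
      have h1 : Tendsto (fun n ↦ G n l) atTop (𝓝 (1 + ∑ j : Fin J, (l j : ℂ) *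
          (1 * fourierCoeffOf ν (m j) - 1) +
          ((1 - ∑' j, l j : ℝ) : ℂ) * (1 * (1 + 0) - 1))) := by
        refine Tendsto.add (tendsto_const_nhds.add (tendsto_finsetSum _ fun j _ ↦ ?_)) ?_
        · exact (((tendsto_exp_div_natCast _).mul_const _).sub_const _).const_mul _
        · exact (((tendsto_exp_div_natCast _).mul (hβ0.const_add 1)).sub_const _).const_mul _
      simpa using h1

end

/-! ### Counts of a Poisson process -/

section

variable {Ω γ : Type*} [MeasurableSpace Ω] [MeasurableSpace γ] {μ : Measure Ω}
  {G : Ω → γ} {c : γ → ℝ} {w : Ω → ℤ → ℝ}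

/-- The number of points in a set, which is zero where there are no points. -/
noncomputable def poissonCount (G : Ω → γ) (c : γ → ℝ) (w : Ω → ℤ → ℝ) (B : Set ℝ) (ω : Ω) : ℕ :=
  open Classical in if 0 < c (G ω) then (w ω ⁻¹' B).ncard else 0

theorem measurableSet_encard_eq (hw : Measurable w) {B : Set ℝ} (hB : MeasurableSet B) (N : ℕ) :
    MeasurableSet {ω | (w ω ⁻¹' B).encard = N} := by
  have e : {ω | (w ω ⁻¹' B).encard = N}
      = {ω | ∑' k : ℤ, B.indicator (fun _ ↦ (1 : ENNReal)) (w ω k) = N} := by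
    ext ω
    have h : ∑' k : ℤ, B.indicator (fun _ ↦ (1 : ENNReal)) (w ω k)
        = ((w ω ⁻¹' B).encard : ENNReal) := by
      rw [← ENNReal.tsum_set_one, tsum_subtype (w ω ⁻¹' B) (fun _ ↦ (1 : ENNReal))]
      rfl
    simp only [Set.mem_ofPred_eq, h]
    norm_cast
  rw [e]
  have : Measurable fun ω ↦ ∑' k : ℤ, B.indicator (fun _ ↦ (1 : ENNReal)) (w ω k) :=
    Measurable.tsum fun k ↦ (measurable_const.indicator hB).comp ((measurable_pi_apply k).comp hw)
  exact this (measurableSet_singleton _)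

theorem measurable_poissonMeasure_singleton {c : γ → ℝ} (hc : Measurable c) (v : NNReal) (N : ℕ) :
    Measurable fun g ↦ poissonMeasure ((c g).toNNReal * v) {N} := by
  simp only [poissonMeasure_singleton]
  have h : Measurable fun g ↦ (((c g).toNNReal * v : NNReal) : ℝ) :=
    measurable_coe_nnreal_real.comp (hc.real_toNNReal.mul_const v)
  exact (((h.neg.exp).mul (h.pow_const N)).div_const _).ennreal_ofReal

/-- Independent Poisson variables with means proportional to the intensity. -/
noncomputable def poissonKernel {c : γ → ℝ} (hc : Measurable c) {K : ℕ} (v : Fin K → NNReal) :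
    Kernel γ (Fin K → ℕ) where
  toFun g := Measure.pi fun i ↦ poissonMeasure ((c g).toNNReal * v i)
  measurable' := by
    refine Measure.measurable_of_measurable_coe _ fun S _ ↦ ?_
    have hS : S = ⋃ a : S, {(a : Fin K → ℕ)} := by ext; simp
    have : (fun g ↦ (Measure.pi fun i ↦ poissonMeasure ((c g).toNNReal * v i)) S)
        = fun g ↦ ∑' a : S, ∏ i, poissonMeasure ((c g).toNNReal * v i) {(a : Fin K → ℕ) i} := by
      ext g
      conv_lhs => rw [hS]
      rw [measure_iUnion]
      · exact tsum_congr fun a ↦ Measure.pi_singleton _ _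
      · intro a a' h
        simpa [Function.onFun, Subtype.ext_iff] using h
      · exact fun a ↦ measurableSet_singleton _
    rw [this]
    exact Measurable.tsum fun a ↦ Finset.measurable_prod _ fun k _ ↦
      measurable_poissonMeasure_singleton hc _ _

theorem poissonKernel_apply {c : γ → ℝ} (hc : Measurable c) {K : ℕ} (v : Fin K → NNReal) (g : γ) :
    poissonKernel hc v g = Measure.pi fun i ↦ poissonMeasure ((c g).toNNReal * v i) := rfl

instance {c : γ → ℝ} (hc : Measurable c) {K : ℕ} (v : Fin K → NNReal) :
    IsMarkovKernel (poissonKernel hc v) :=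
  ⟨fun l ↦ by rw [poissonKernel_apply]; infer_instance⟩

/-- The Poisson probabilities of the finite values add up to one, so nothing is left for the value
⊤. -/
theorem IsPoissonPoints.ae_encard_ne_top [IsFiniteMeasure μ] (h : IsPoissonPoints μ G c w)
    (hG : Measurable G)
    (hc : Measurable c) {B : Set ℝ} (hB : MeasurableSet B) (hBb : Bornology.IsBounded B) :
    ∀ᵐ ω ∂μ, 0 < c (G ω) → (w ω ⁻¹' B).encard ≠ ⊤ := by
  have hA : MeasurableSet {g | 0 < c g} := measurableSet_lt measurable_const hc
  have h1 : ∀ N : ℕ, μ {ω | G ω ∈ {g | 0 < c g} ∧ (w ω ⁻¹' B).encard = N}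
      = ∫⁻ ω in G ⁻¹' {g | 0 < c g},
        poissonMeasure ((c (G ω)).toNNReal * (volume B).toNNReal) {N} ∂μ := by
    intro N
    have := h.counts _ hA subset_rfl 1 (fun _ ↦ B) (fun _ ↦ N) (fun _ ↦ hB) (fun _ ↦ hBb)
      (fun i j hij ↦ absurd (Subsingleton.elim i j) hij)
    simpa using this
  have hm : ∀ N : ℕ, MeasurableSet {ω | G ω ∈ {g | 0 < c g} ∧ (w ω ⁻¹' B).encard = N} := fun N ↦
    (hG hA).inter (measurableSet_encard_eq h.measurable_w hB N)
  have h2 : μ (⋃ N : ℕ, {ω | G ω ∈ {g | 0 < c g} ∧ (w ω ⁻¹' B).encard = N})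
      = μ (G ⁻¹' {g | 0 < c g}) := by
    rw [measure_iUnion _ hm]
    · simp only [h1]
      have hmeas : ∀ N : ℕ, Measurable fun ω ↦
          poissonMeasure ((c (G ω)).toNNReal * (volume B).toNNReal) {N} := fun N ↦
        (measurable_poissonMeasure_singleton hc _ N).comp hG
      rw [← lintegral_tsum fun N ↦ (hmeas N).aemeasurable]
      have : ∀ ω, ∑' N, poissonMeasure ((c (G ω)).toNNReal * (volume B).toNNReal) {N} = 1 := by
        intro ω
        rw [← measure_iUnion (by
          intro i j hij; simpa [Function.onFun] using hij) fun N ↦ measurableSet_singleton N]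
        have : (⋃ N : ℕ, {N}) = Set.univ := by ext; simp
        rw [this, measure_univ]
      simp [this]
    · intro N N' hne
      refine Set.disjoint_left.2 fun ω hω hω' ↦ hne ?_
      have := hω.2.symm.trans hω'.2
      exact_mod_cast this
  rw [ae_iff]
  have hsub : (⋃ N : ℕ, {ω | G ω ∈ {g | 0 < c g} ∧ (w ω ⁻¹' B).encard = N})
      ⊆ G ⁻¹' {g | 0 < c g} := Set.iUnion_subset fun N ω hω ↦ hω.1
  have h4 := measure_sdiff hsub (MeasurableSet.iUnion hm).nullMeasurableSet (measure_ne_top μ _)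
  rw [h2, tsub_self] at h4
  refine measure_mono_null (fun ω hω ↦ ?_) h4
  simp only [ne_eq, Classical.not_imp, not_not, Set.mem_ofPred_eq] at hω
  refine ⟨hω.1, fun hmem ↦ ?_⟩
  obtain ⟨N, hN⟩ := Set.mem_iUnion.1 hmem
  exact ENat.natCast_ne_top N (hN.2.symm.trans hω.2)

theorem IsPoissonPoints.measurable_poissonCount (h : IsPoissonPoints μ G c w) (hG : Measurable G)
    (hc : Measurable c) {B : Set ℝ} (hB : MeasurableSet B) :
    Measurable (poissonCount G c w B) := by
  classical
  refine Measurable.ite (measurableSet_lt measurable_const (hc.comp hG)) ?_ measurable_const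
  refine measurable_to_countable' fun N ↦ ?_
  -- The value 0 of `ncard` also occurs for infinite sets, so its preimage is obtained as a
  -- complement.
  rcases Nat.eq_zero_or_pos N with rfl | hN
  · have e : (fun ω ↦ (w ω ⁻¹' B).ncard) ⁻¹' {0}
        = (⋃ N : ℕ, {ω | (w ω ⁻¹' B).encard = (N + 1 : ℕ)})ᶜ := by
      ext ω
      simp only [Set.mem_preimage, Set.mem_singleton_iff, Set.mem_compl_iff, Set.mem_iUnion,
        Set.mem_ofPred_eq, not_exists, Set.ncard_def]
      cases h : (w ω ⁻¹' B).encard with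
      | top =>
        simp only [ENat.toNat_top, true_iff]
        exact fun N hN ↦ ENat.natCast_ne_top _ hN.symm
      | coe N =>
        simp only [ENat.toNat_natCast, Nat.cast_inj]
        exact ⟨fun h ↦ by omega, fun h ↦ by
          by_contra h0
          exact h (N - 1) (by omega)⟩
    rw [e]
    exact (MeasurableSet.iUnion fun N ↦ measurableSet_encard_eq h.measurable_w hB _).compl
  · have e : (fun ω ↦ (w ω ⁻¹' B).ncard) ⁻¹' {N} = {ω | (w ω ⁻¹' B).encard = N} := by
      ext ω
      simp only [Set.mem_preimage, Set.mem_singleton_iff, Set.mem_ofPred_eq, Set.ncard_def]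
      cases h : (w ω ⁻¹' B).encard with
      | top => simp [hN.ne]
      | coe N => simp
    rw [e]
    exact measurableSet_encard_eq h.measurable_w hB _

/-- Where the intensity is positive this is the defining property, `ncard` and `encard` being almost
surely equivalent there. Elsewhere the count is set to zero, and `toNNReal` makes the Poisson law a
Dirac mass at zero. -/
theorem IsPoissonPoints.map_counts [IsProbabilityMeasure μ] (h : IsPoissonPoints μ G c w)
    (hG : Measurable G) (hc : Measurable c) {K : ℕ} {B : Fin K → Set ℝ}
    (hB : ∀ i, MeasurableSet (B i)) (hBb : ∀ i, Bornology.IsBounded (B i))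
    (hd : Pairwise (Function.onFun Disjoint B)) :
    μ.map (fun ω ↦ (G ω, fun i ↦ poissonCount G c w (B i) ω))
      = (μ.map G) ⊗ₘ poissonKernel hc fun i ↦ (volume (B i)).toNNReal := by
  classical
  have hP : MeasurableSet {g | 0 < c g} := measurableSet_lt measurable_const hc
  have hm : ∀ i, Measurable (poissonCount G c w (B i)) := fun i ↦
    h.measurable_poissonCount hG hc (hB i)
  have : IsProbabilityMeasure (μ.map G) := Measure.isProbabilityMeasure_map hG.aemeasurable
  refine map_eq_compProd_of_countable fun A hA d ↦ ?_
  rw [Measure.map_apply (hG.prodMk (measurable_pi_lambda _ hm)) (hA.prod (measurableSet_singleton d))]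
  have hker : Measurable fun g ↦ (poissonKernel hc fun i ↦ (volume (B i)).toNNReal) g {d} :=
    Kernel.measurable_coe _ (measurableSet_singleton d)
  have e1 : (fun ω ↦ (G ω, fun i ↦ poissonCount G c w (B i) ω)) ⁻¹' A ×ˢ {d}
      = {ω | G ω ∈ A ∩ {g | 0 < c g} ∧ ∀ i, (w ω ⁻¹' B i).ncard = d i} ∪
        (G ⁻¹' (A \ {g | 0 < c g}) ∩ {_ω | d = 0}) := by
    ext ω
    by_cases hω : 0 < c (G ω)
    · simp [poissonCount, hω, funext_iff]
    · simp [poissonCount, hω, funext_iff, eq_comm]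
  have hms : MeasurableSet (G ⁻¹' (A \ {g | 0 < c g}) ∩ {_ω | d = 0}) :=
    (hG (hA.diff hP)).inter (MeasurableSet.const _)
  have hdisj : Disjoint {ω | G ω ∈ A ∩ {g | 0 < c g} ∧ ∀ i, (w ω ⁻¹' B i).ncard = d i}
      (G ⁻¹' (A \ {g | 0 < c g}) ∩ {_ω | d = 0}) := by
    refine Set.disjoint_left.2 fun ω hω hω' ↦ hω'.1.2 hω.1.2
  rw [e1, measure_union hdisj hms, ← lintegral_inter_add_sdiff _ A hP]
  congr 1
  · have hae : μ {ω | G ω ∈ A ∩ {g | 0 < c g} ∧ ∀ i, (w ω ⁻¹' B i).ncard = d i}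
        = μ {ω | G ω ∈ A ∩ {g | 0 < c g} ∧ ∀ i, (w ω ⁻¹' B i).encard = d i} := by
      refine measure_congr ?_
      have hfin : ∀ᵐ ω ∂μ, ∀ i, 0 < c (G ω) → (w ω ⁻¹' B i).encard ≠ ⊤ :=
        ae_all_iff.2 fun i ↦ h.ae_encard_ne_top hG hc (hB i) (hBb i)
      filter_upwards [hfin] with ω hω
      refine propext (and_congr_right fun hg ↦ forall_congr' fun i ↦ ?_)
      have := hω i hg.2
      rw [Set.ncard_def]
      constructor
      · intro h'; rw [← h', ENat.natCast_toNat this]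
      · intro h'; rw [h']; simp
    rw [hae, h.counts _ (hA.inter hP) Set.inter_subset_right K B d hB hBb hd,
      setLIntegral_map (hA.inter hP) hker hG]
    refine lintegral_congr fun ω ↦ ?_
    rw [poissonKernel_apply, Measure.pi_singleton]
  · have e2 : ∀ g ∈ A \ {g | 0 < c g}, (poissonKernel hc fun i ↦ (volume (B i)).toNNReal) g {d}
        = if d = 0 then 1 else 0 := by
      intro g hg
      have : (c g).toNNReal = 0 := Real.toNNReal_eq_zero.2 (not_lt.1 hg.2)
      rw [poissonKernel_apply, Measure.pi_singleton]
      simp only [this, zero_mul, poissonMeasure_singleton]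
      split_ifs with h0
      · simp [h0]
      · obtain ⟨i, hi⟩ := Function.ne_iff.1 h0
        refine Finset.prod_eq_zero (Finset.mem_univ i) ?_
        simp only [Pi.zero_apply, ne_eq] at hi
        simp [hi]
    rw [setLIntegral_congr_fun (hA.diff hP) e2, setLIntegral_const,
      Measure.map_apply hG (hA.diff hP)]
    split_ifs with h0 <;> simp [h0]

theorem integral_exp_poissonMeasure (r : NNReal) (t : ℝ) :
    ∫ N : ℕ, Complex.exp (Complex.I * t * N) ∂poissonMeasure r
      = Complex.exp (r * (Complex.exp (Complex.I * t) - 1)) := by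
  have h := charFun_map_cast_poissonMeasure r t
  rw [charFun_apply_real, integral_map (measurable_from_nat.aemeasurable)
    (by fun_prop)] at h
  rw [mul_comm Complex.I, ← h]
  refine integral_congr_ae (ae_of_all _ fun N ↦ ?_)
  simp only
  congr 1
  push_cast
  ring

theorem IsPoissonPoints.integral_mul_exp_counts [IsProbabilityMeasure μ]
    (h : IsPoissonPoints μ G c w)
    (hG : Measurable G) (hc : Measurable c) {K : ℕ} {B : Fin K → Set ℝ}
    (hB : ∀ i, MeasurableSet (B i)) (hBb : ∀ i, Bornology.IsBounded (B i))
    (hd : Pairwise (Function.onFun Disjoint B)) (hc0 : ∀ᵐ ω ∂μ, 0 ≤ c (G ω))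
    {ψ : γ → ℂ} (hψ : Measurable ψ) {C : ℝ} (hψC : ∀ g, ‖ψ g‖ ≤ C) (t : Fin K → ℝ) :
    ∫ ω, ψ (G ω) * Complex.exp (Complex.I * ∑ i, (t i : ℂ) * poissonCount G c w (B i) ω) ∂μ
      = ∫ ω, ψ (G ω) * Complex.exp ((c (G ω) : ℂ) * ∑ i, ((volume.real (B i) : ℝ) : ℂ) *
        (Complex.exp (Complex.I * t i) - 1)) ∂μ := by
  have : IsProbabilityMeasure (μ.map G) := Measure.isProbabilityMeasure_map hG.aemeasurable
  let Φ : γ × (Fin K → ℕ) → ℂ := fun q ↦ ψ q.1 * ∏ i, Complex.exp (Complex.I * t i * q.2 i)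
  have hΦ : Measurable Φ := by
    refine (hψ.comp measurable_fst).mul (Finset.measurable_prod _ fun k _ ↦ ?_)
    exact (Measurable.of_discrete (f := fun N : ℕ ↦ Complex.exp (Complex.I * t k * N))).comp
      ((measurable_pi_apply k).comp measurable_snd)
  have hΦb : ∀ q, ‖Φ q‖ ≤ C := fun q ↦ by
    have h1 : ∀ i, ‖Complex.exp (Complex.I * t i * q.2 i)‖ = 1 := fun i ↦ by
      rw [show Complex.I * t i * q.2 i = ((t i * q.2 i : ℝ) : ℂ) * Complex.I by push_cast; ring,
        Complex.norm_exp_ofReal_mul_I]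
    rw [norm_mul, norm_prod]
    simp only [h1, Finset.prod_const_one, mul_one]
    exact hψC _
  have hm : Measurable fun ω ↦ (G ω, fun i ↦ poissonCount G c w (B i) ω) :=
    hG.prodMk (measurable_pi_lambda _ fun i ↦ h.measurable_poissonCount hG hc (hB i))
  have e1 : ∀ ω, ψ (G ω) * Complex.exp (Complex.I * ∑ i, (t i : ℂ) * poissonCount G c w (B i) ω)
      = Φ (G ω, fun i ↦ poissonCount G c w (B i) ω) := by
    intro ω
    simp only [Φ, ← Complex.exp_sum]
    congr 2
    rw [Finset.mul_sum]
    exact Finset.sum_congr rfl fun i _ ↦ by ring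
  simp only [e1]
  rw [← integral_map hm.aemeasurable hΦ.aestronglyMeasurable, h.map_counts hG hc hB hBb hd,
    Measure.integral_compProd (Integrable.of_bound hΦ.aestronglyMeasurable C (ae_of_all _ hΦb))]
  have e2 : ∀ g, ∫ N, Φ (g, N) ∂poissonKernel hc (fun i ↦ (volume (B i)).toNNReal) g
      = ψ g * Complex.exp (((c g).toNNReal : ℂ) * ∑ i, ((volume.real (B i) : ℝ) : ℂ) *
        (Complex.exp (Complex.I * t i) - 1)) := by
    intro g
    simp only [Φ, poissonKernel_apply]
    rw [integral_const_mul, integral_fintype_prod_eq_prod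
      (f := fun i (N : ℕ) ↦ Complex.exp (Complex.I * t i * N))]
    simp only [integral_exp_poissonMeasure, ← Complex.exp_sum]
    congr 2
    rw [Finset.mul_sum]
    refine Finset.sum_congr rfl fun i _ ↦ ?_
    have : ((volume.real (B i) : ℝ) : ℂ) = (((volume (B i)).toNNReal : NNReal) : ℂ) := rfl
    rw [this]
    push_cast
    ring
  simp only [e2]
  rw [integral_map hG.aemeasurable (by
    have h1 : Measurable fun g ↦ (((c g).toNNReal : ℝ) : ℂ) :=
      Complex.measurable_ofReal.comp (measurable_coe_nnreal_real.comp hc.real_toNNReal)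
    exact (hψ.mul (h1.mul_const _).cexp).aestronglyMeasurable)]
  refine integral_congr_ae ?_
  filter_upwards [hc0] with ω hω
  congr 4
  rw [Real.coe_toNNReal _ hω]

end

/-! ### Law of the observables in the limit -/

/-- The point of the unit circle with the argument of a complex number. -/
noncomputable def toCircle (z : ℂ) : Circle := Circle.exp z.arg

theorem measurable_toCircle : Measurable toCircle :=
  Circle.exp.continuous.measurable.comp Complex.measurable_arg

theorem toCircle_coe (u : Circle) : toCircle (u : ℂ) = u := Circle.exp_arg u

/-- The variable attached to a circle in the limit, which is one if the circle is empty. -/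
noncomputable def limitCircle (t : ℝ) (z : ℂ) : Circle :=
  -- This convention agrees with `circleWeight`, which is one on a circle without points.
  open Classical in if t = 0 then 1 else toCircle z

theorem measurable_limitCircle : Measurable fun q : ℝ × ℂ ↦ limitCircle q.1 q.2 := by
  classical
  exact Measurable.ite (measurable_fst (measurableSet_singleton 0)) measurable_const
    (measurable_toCircle.comp measurable_snd)

theorem measurable_limitCircle_apply (j : ℕ) :
    Measurable fun q : (ℕ → ℝ) × (ℕ → ℂ) ↦ limitCircle (q.1 j) (q.2 j) := by
  have h : Measurable fun q : (ℕ → ℝ) × (ℕ → ℂ) ↦ (q.1 j, q.2 j) := by fun_prop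
  exact measurable_limitCircle.comp h

section

variable {Ω : Type*} [MeasurableSpace Ω] {μ : Measure Ω}
  {p : Measure (ℕ → ℝ)} {y : Ω → ℕ → ℝ} {u : Ω → ℕ → ℂ}

theorem IsLimitData.isProbabilityMeasure [IsProbabilityMeasure μ] (h : IsLimitData μ p y u) : IsProbabilityMeasure p := by
  rw [← h.law_y]
  exact Measure.isProbabilityMeasure_map h.measurable_y.aemeasurable

theorem IsLimitData.ae_y (h : IsLimitData μ p y u) {P : (ℕ → ℝ) → Prop} (hP : ∀ᵐ l ∂p, P l) :
    ∀ᵐ ω ∂μ, P (y ω) := by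
  rw [← h.law_y] at hP
  exact ae_of_ae_map h.measurable_y.aemeasurable hP

theorem integral_uniformCircle_toCircle_zpow (d : ℤ) :
    ∫ z, ((toCircle z ^ d : Circle) : ℂ) ∂uniformCircle = if d = 0 then 1 else 0 := by
  have hm : Measurable fun t ↦ (rot t : ℂ) := measurable_circle_coe.comp measurable_rot
  have hm2 : Measurable fun z ↦ ((toCircle z ^ d : Circle) : ℂ) :=
    measurable_circle_coe.comp ((continuous_zpow d).measurable.comp measurable_toCircle)
  rw [← map_rot_uniformAngle, integral_map hm.aemeasurable hm2.aestronglyMeasurable]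
  simp only [toCircle_coe]
  change fourierCoeffOf uniformAngle d = _
  split_ifs with hd
  · simp [hd, fourierCoeffOf]
  · exact fourierCoeffOf_uniformAngle hd

/-- At fixed perimeters the integral over the independent u_j factorizes, and a non-zero power of a
uniform variable has mean zero: only the characters testing no circle of positive length survive. -/
theorem IsLimitData.integral_prod_limitCircle [IsProbabilityMeasure μ] (h : IsLimitData μ p y u) {f : (ℕ → ℝ) → ℂ}
    (hf : Measurable f) {C : ℝ} (hfC : ∀ᵐ l ∂p, ‖f l‖ ≤ C) {J : ℕ} (m : Fin J → ℤ) :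
    ∫ ω, f (y ω) * ∏ j : Fin J, ((limitCircle (y ω j) (u ω j) ^ m j : Circle) : ℂ) ∂μ
      = ∫ l, (open Classical in if ∀ j : Fin J, m j ≠ 0 → l j = 0 then f l else 0) ∂p := by
  classical
  have := h.isProbabilityMeasure
  have hpu : IsProbabilityMeasure (μ.map u) :=
    Measure.isProbabilityMeasure_map h.measurable_u.aemeasurable
  have hyu : μ.map (fun ω ↦ (y ω, u ω)) = p.prod (μ.map u) := by
    rw [(indepFun_iff_map_prod_eq_prod_map_map h.measurable_y.aemeasurable
      h.measurable_u.aemeasurable).1 h.indep_yu, h.law_y]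
  let Φ : (ℕ → ℝ) × (ℕ → ℂ) → ℂ := fun q ↦
    f q.1 * ∏ j : Fin J, ((limitCircle (q.1 j) (q.2 j) ^ m j : Circle) : ℂ)
  have hΦ : Measurable Φ := by
    refine (hf.comp measurable_fst).mul (Finset.measurable_prod _ fun j _ ↦ ?_)
    refine measurable_circle_coe.comp ((continuous_zpow (m j)).measurable.comp ?_)
    exact measurable_limitCircle_apply j
  have hΦb : ∀ᵐ q ∂p.prod (μ.map u), ‖Φ q‖ ≤ C := by
    filter_upwards [Measure.quasiMeasurePreserving_fst.ae hfC] with q hq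
    rw [norm_mul, norm_prod]
    simpa only [Circle.norm_coe, Finset.prod_const_one, mul_one] using hq
  have e1 : ∫ ω, f (y ω) * ∏ j : Fin J, ((limitCircle (y ω j) (u ω j) ^ m j : Circle) : ℂ) ∂μ
      = ∫ q, Φ q ∂μ.map (fun ω ↦ (y ω, u ω)) :=
    (integral_map (h.measurable_y.prodMk h.measurable_u).aemeasurable hΦ.aestronglyMeasurable).symm
  rw [e1, hyu, integral_prod _ (Integrable.of_bound hΦ.aestronglyMeasurable C hΦb)]
  refine integral_congr_ae (ae_of_all _ fun l ↦ ?_)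
  simp only [Φ]
  rw [integral_const_mul]
  have hind : iIndepFun (fun (j : Fin J) ω ↦ u ω j) μ := h.indep_u.precomp Fin.val_injective
  have hmj : ∀ j : ℕ, Measurable fun ω ↦ u ω j := fun j ↦ (measurable_pi_apply j).comp h.measurable_u
  have hmg : ∀ j : Fin J, Measurable fun z ↦ ((limitCircle (l j) z ^ m j : Circle) : ℂ) := fun j ↦
    measurable_circle_coe.comp ((continuous_zpow (m j)).measurable.comp
      (measurable_limitCircle.comp (measurable_const.prodMk measurable_id)))
  have e2 : ∫ v : ℕ → ℂ, ∏ j : Fin J, ((limitCircle (l j) (v j) ^ m j : Circle) : ℂ) ∂μ.map u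
      = ∏ j : Fin J, ∫ ω, ((limitCircle (l j) (u ω j) ^ m j : Circle) : ℂ) ∂μ := by
    have hmp : Measurable fun v : ℕ → ℂ ↦
        ∏ j : Fin J, ((limitCircle (l (j : ℕ)) (v (j : ℕ)) ^ m j : Circle) : ℂ) :=
      Finset.measurable_prod _ fun j _ ↦ (hmg j).comp (measurable_pi_apply (j : ℕ))
    refine (integral_map h.measurable_u.aemeasurable hmp.aestronglyMeasurable).trans ?_
    exact hind.integral_fun_prod_comp (f := fun (j : Fin J) z ↦ ((limitCircle (l j) z ^ m j : Circle) : ℂ))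
      (fun j : Fin J ↦ (hmj j).aemeasurable) fun j : Fin J ↦ (hmg j).aestronglyMeasurable
  have e3 : ∀ j : Fin J, ∫ ω, ((limitCircle (l j) (u ω j) ^ m j : Circle) : ℂ) ∂μ
      = if m j ≠ 0 → l j = 0 then 1 else 0 := by
    intro j
    have := integral_map (μ := μ) (hmj j).aemeasurable (hmg j).aestronglyMeasurable
    rw [← this, h.law_u]
    by_cases hl : l j = 0
    · have hpu : IsProbabilityMeasure uniformCircle := by
        rw [← h.law_u 0]; exact Measure.isProbabilityMeasure_map (hmj 0).aemeasurable
      simp [limitCircle, hl]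
    · simp only [limitCircle, hl, if_false, imp_false, not_not]
      exact integral_uniformCircle_toCircle_zpow (m j)
  rw [e2, Finset.prod_congr rfl fun j _ ↦ e3 j]
  split_ifs with hall
  · rw [Finset.prod_congr rfl fun j _ ↦ if_pos (hall j), Finset.prod_const_one, mul_one]
  · push Not at hall
    obtain ⟨j, hj, hlj⟩ := hall
    rw [Finset.prod_eq_zero (Finset.mem_univ j) (if_neg fun h ↦ hlj (h hj)), mul_zero]

/-- The limit of the observables. -/
noncomputable def limitObs {K : ℕ} (y : Ω → ℕ → ℝ) (u : Ω → ℕ → ℂ) (J : ℕ) (N : Ω → Fin K → ℕ)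
    (ω : Ω) : Observables (Fin J) (Fin K) :=
  (fun j ↦ y ω j, 1 - ∑' j, y ω j, N ω, fun j ↦ limitCircle (y ω j) (u ω j))

theorem IsLimitData.measurable_limitCircle_comp (h : IsLimitData μ p y u) (j : ℕ) :
    Measurable fun ω ↦ limitCircle (y ω j) (u ω j) :=
  measurable_limitCircle.comp (((measurable_pi_apply j).comp h.measurable_y).prodMk
    ((measurable_pi_apply j).comp h.measurable_u))

theorem IsLimitData.measurable_limitObs (h : IsLimitData μ p y u) (J : ℕ) {K : ℕ}
    {N : Ω → Fin K → ℕ} (hN : Measurable N) : Measurable (limitObs y u J N) := by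
  have h1 : Measurable fun ω ↦ fun j : Fin J ↦ y ω j :=
    measurable_pi_lambda _ fun j ↦ (measurable_pi_apply (j : ℕ)).comp h.measurable_y
  have h2 : Measurable fun ω ↦ 1 - ∑' j, y ω j :=
    measurable_const.sub (measurable_tsum_nat.comp h.measurable_y)
  have h3 : Measurable fun ω ↦ fun j : Fin J ↦ limitCircle (y ω j) (u ω j) :=
    measurable_pi_lambda _ fun j ↦ h.measurable_limitCircle_comp j
  exact h1.prodMk (h2.prodMk (hN.prodMk h3))

theorem norm_exp_mul_sum_le_one {K : ℕ} {c : ℝ} (hc : 0 ≤ c) {lam : Fin K → ℝ}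
    (hlam : ∀ i, 0 ≤ lam i) (t : Fin K → ℝ) :
    ‖Complex.exp ((c : ℂ) * ∑ i, (lam i : ℂ) * (Complex.exp (Complex.I * t i) - 1))‖ ≤ 1 := by
  rw [Complex.norm_exp, Real.exp_le_one_iff, Complex.re_ofReal_mul, Complex.re_sum]
  refine mul_nonpos_of_nonneg_of_nonpos hc (Finset.sum_nonpos fun i _ ↦ ?_)
  rw [Complex.re_ofReal_mul]
  refine mul_nonpos_of_nonneg_of_nonpos (hlam i) ?_
  have h := Complex.re_le_norm (Complex.exp (Complex.I * t i))
  rw [mul_comm, Complex.norm_exp_ofReal_mul_I] at h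
  rw [Complex.sub_re, Complex.one_re, mul_comm]
  linarith

/-- The hypothesis `hN` expresses through characteristic functions that, given (y, u), the counts
are independent Poisson variables. In this form it is trivial for an empty family of cells, which is
the case needed for constant angles. -/
theorem IsLimitData.integral_observableChar [IsProbabilityMeasure μ] (h : IsLimitData μ p y u) (hp : ∀ᵐ l ∂p, l ∈ nabla)
    {J K : ℕ} {N : Ω → Fin K → ℕ} {lam : Fin K → ℝ} (hlam : ∀ i, 0 ≤ lam i)
    (hN : ∀ (ψ : (ℕ → ℝ) × (ℕ → ℂ) → ℂ), Measurable ψ → (∀ g, ‖ψ g‖ ≤ 1) → ∀ t : Fin K → ℝ,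
      ∫ ω, ψ (y ω, u ω) * Complex.exp (Complex.I * ∑ i, (t i : ℂ) * N ω i) ∂μ
      = ∫ ω, ψ (y ω, u ω) * Complex.exp (((1 - ∑' j, y ω j : ℝ) : ℂ) * ∑ i, (lam i : ℂ) *
        (Complex.exp (Complex.I * t i) - 1)) ∂μ)
    (a : Fin J → ℝ) (b : ℝ) (c : Fin K → ℝ) (m : Fin J → ℤ) :
    ∫ ω, (observableChar a b c m (limitObs y u J N ω) : ℂ) ∂μ = ∫ l, limitChar lam a b c m l ∂p := by
  classical
  let f₀ : (ℕ → ℝ) → ℂ := fun l ↦ Complex.exp (Complex.I *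
    ((∑ j : Fin J, a j * l j + b * (1 - ∑' j, l j) : ℝ) : ℂ))
  have hf₀ : Measurable f₀ := by
    have h1 : Measurable fun l : ℕ → ℝ ↦ ∑ j : Fin J, a j * l j + b * (1 - ∑' j, l j) := by
      have := measurable_tsum_nat
      fun_prop
    exact ((Complex.measurable_ofReal.comp h1).const_mul _).cexp
  have hf₀n : ∀ l, ‖f₀ l‖ = 1 := fun l ↦ by
    simp only [f₀]
    rw [mul_comm, Complex.norm_exp_ofReal_mul_I]
  let ψ : (ℕ → ℝ) × (ℕ → ℂ) → ℂ := fun q ↦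
    f₀ q.1 * ∏ j : Fin J, ((limitCircle (q.1 j) (q.2 j) ^ m j : Circle) : ℂ)
  have hψ : Measurable ψ := by
    refine (hf₀.comp measurable_fst).mul (Finset.measurable_prod _ fun j _ ↦ ?_)
    refine measurable_circle_coe.comp ((continuous_zpow (m j)).measurable.comp ?_)
    exact measurable_limitCircle_apply j
  have hψ1 : ∀ g, ‖ψ g‖ ≤ 1 := fun g ↦ by
    simp only [ψ]
    rw [norm_mul, hf₀n, norm_prod]
    simp only [Circle.norm_coe, Finset.prod_const_one, mul_one, le_refl]
  have e1 : ∀ ω, (observableChar a b c m (limitObs y u J N ω) : ℂ)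
      = ψ (y ω, u ω) * Complex.exp (Complex.I * ∑ i, (c i : ℂ) * N ω i) := by
    intro ω
    rw [observableChar, Circle.coe_mul, circle_coe_prod, Circle.coe_exp]
    simp only [ψ, f₀, limitObs]
    rw [mul_right_comm, ← Complex.exp_add]
    congr 2
    push_cast
    ring
  simp only [e1]
  rw [hN ψ hψ hψ1 c]
  let f : (ℕ → ℝ) → ℂ := fun l ↦ f₀ l * Complex.exp (((1 - ∑' j, l j : ℝ) : ℂ) *
    ∑ i, (lam i : ℂ) * (Complex.exp (Complex.I * c i) - 1))
  have hf : Measurable f := hf₀.mul (((Complex.measurable_ofReal.comp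
    (measurable_const.sub measurable_tsum_nat)).mul_const _).cexp)
  have hfb : ∀ᵐ l ∂p, ‖f l‖ ≤ 1 := by
    filter_upwards [hp] with l hl
    simp only [f]
    rw [norm_mul, hf₀n, one_mul]
    exact norm_exp_mul_sum_le_one (sub_nonneg.2 hl.2.2.2) hlam c
  have e2 : ∀ ω, ψ (y ω, u ω) * Complex.exp (((1 - ∑' j, y ω j : ℝ) : ℂ) * ∑ i, (lam i : ℂ) *
        (Complex.exp (Complex.I * c i) - 1))
      = f (y ω) * ∏ j : Fin J, ((limitCircle (y ω j) (u ω j) ^ m j : Circle) : ℂ) := by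
    intro ω
    simp only [ψ, f]
    ring
  simp only [e2]
  rw [h.integral_prod_limitCircle hf hfb m]
  refine integral_congr_ae (ae_of_all _ fun l ↦ ?_)
  simp only [limitChar]
  split_ifs
  · simp only [f, f₀]
    rw [← Complex.exp_add]
    congr 1
    push_cast
    rw [mul_add, mul_add, Finset.mul_sum]
    rw [show ∑ j : Fin J, Complex.I * ((a j : ℂ) * (l j : ℂ))
      = ∑ j : Fin J, (l j : ℂ) * (Complex.I * a j) from Finset.sum_congr rfl fun j _ ↦ by ring]
    ring
  · rfl

end

/-- Joint convergence in distribution of the observables. -/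
theorem tendstoInDistribution_modelObs {Ω Ω' : Type*} [MeasurableSpace Ω] [MeasurableSpace Ω']
    {μ : Measure Ω} [IsProbabilityMeasure μ] {μ' : Measure Ω'} [IsProbabilityMeasure μ']
    {p : Measure (ℕ → ℝ)} {Y : Ω → ℕ → ℝ} {x : Ω → ℕ → Point} {y : Ω' → ℕ → ℝ} {u : Ω' → ℕ → ℂ}
    {ν : Measure ℝ} [IsProbabilityMeasure ν]
    (hc : IsCoupling μ p Y x) (hp : ∀ᵐ l ∂p, l ∈ nabla) (hlim : IsLimitData μ' p y u)
    {J K : ℕ} {I : Fin K → Set ℝ} (hI : ∀ i, MeasurableSet (I i))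
    (hd : Pairwise (Function.onFun Disjoint I)) {lam : Fin K → ℝ} (hlam0 : ∀ i, 0 ≤ lam i)
    (hlam : ∀ i, Tendsto (fun n : ℕ ↦ (n : ℝ) * ν.real {t | (n : ℝ) * t ∈ I i}) atTop (𝓝 (lam i)))
    (hχ : ∀ m : Fin J → ℤ, ∀ᵐ l ∂p, (∃ j : Fin J, m j ≠ 0 ∧ l j ≠ 0) →
      ‖1 + ∑ j : Fin J, (l j : ℂ) * (fourierCoeffOf ν (m j) - 1)‖ < 1)
    {N : Ω' → Fin K → ℕ} (hNm : Measurable N)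
    (hN : ∀ (ψ : (ℕ → ℝ) × (ℕ → ℂ) → ℂ), Measurable ψ → (∀ g, ‖ψ g‖ ≤ 1) → ∀ t : Fin K → ℝ,
      ∫ ω, ψ (y ω, u ω) * Complex.exp (Complex.I * ∑ i, (t i : ℂ) * N ω i) ∂μ'
      = ∫ ω, ψ (y ω, u ω) * Complex.exp (((1 - ∑' j, y ω j : ℝ) : ℂ) * ∑ i, (lam i : ℂ) *
        (Complex.exp (Complex.I * t i) - 1)) ∂μ') :
    TendstoInDistribution (fun n ↦ modelObs x J I n) atTop (limitObs y u J N)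
      (fun n ↦ model μ ν n) μ' := by
  obtain ⟨C, hC⟩ : ∃ C : NNReal, ∀ (n : ℕ) (i), (n : ENNReal) * ν {t | (n : ℝ) * t ∈ I i} ≤ C := by
    choose b hb using fun i ↦ (hlam i).bddAbove_range
    refine ⟨∑ i, (b i).toNNReal, fun n i ↦ ?_⟩
    have h1 : (n : ENNReal) * ν {t | (n : ℝ) * t ∈ I i}
        = ENNReal.ofReal ((n : ℝ) * ν.real {t | (n : ℝ) * t ∈ I i}) := by
      rw [ENNReal.ofReal_mul (by positivity), ENNReal.ofReal_natCast, ofReal_measureReal]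
    rw [h1]
    refine (ENNReal.ofReal_le_ofReal (hb i ⟨n, rfl⟩)).trans ?_
    rw [ENNReal.ofReal, ENNReal.coe_le_coe]
    exact Finset.single_le_sum (f := fun i ↦ (b i).toNNReal) (fun _ _ ↦ zero_le) (Finset.mem_univ i)
  refine tendstoInDistribution_of_observableChar (fun n ↦ measurable_modelObs hc J hI n)
    (hlim.measurable_limitObs J hNm).aemeasurable (fun n q j ↦ labelCount_div_mem _ _)
    (fun n q ↦ labelCount_div_mem _ _) C
    (fun n i ↦ (lintegral_cellCount_le x n (hI i)).trans (hC n i)) fun a b c m ↦ ?_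
  rw [hlim.integral_observableChar hp hlam0 hN]
  exact tendsto_integral_observableChar hc hp hI hd hlam hχ a b c m

/-! ### Renormalized factors -/

/-- Second order expansion of 1 + b (e^w - 1) compared with e^{bw}. The lower bound on |b| turns the
term |b| |w|² into 2 |b|² |w|², and 7 = 4 + 2 + 1. -/
theorem norm_renormalized_factor_sub_one_le {b w : ℂ} (hw : ‖w‖ ≤ 1) (hbw : ‖b‖ * ‖w‖ ≤ 1)
    (hb : 1 / 2 ≤ ‖b‖) :
    ‖(1 + b * (Complex.exp w - 1)) * Complex.exp (-(b * w)) - 1‖ ≤ 7 * ‖w‖ ^ 2 * ‖b‖ ^ 2 := by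
  have hbw' : ‖-(b * w)‖ ≤ 1 := by rwa [norm_neg, norm_mul]
  have h1 := Complex.norm_exp_sub_one_sub_id_le hw
  have h2 := Complex.norm_exp_sub_one_sub_id_le hbw'
  have h3 := Complex.norm_exp_sub_one_le hw
  have h4 := Complex.norm_exp_sub_one_le hbw'
  rw [norm_neg, norm_mul] at h2 h4
  have e : (1 + b * (Complex.exp w - 1)) * Complex.exp (-(b * w)) - 1
      = b * (Complex.exp w - 1) * (Complex.exp (-(b * w)) - 1) + b * (Complex.exp w - 1 - w)
        + (Complex.exp (-(b * w)) - 1 - -(b * w)) := by ring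
  rw [e]
  calc _ ≤ ‖b‖ * ‖Complex.exp w - 1‖ * ‖Complex.exp (-(b * w)) - 1‖
        + ‖b‖ * ‖Complex.exp w - 1 - w‖ + ‖Complex.exp (-(b * w)) - 1 - -(b * w)‖ := by
        refine (norm_add_le _ _).trans (add_le_add ((norm_add_le _ _).trans ?_) le_rfl)
        rw [norm_mul, norm_mul, norm_mul]
    _ ≤ ‖b‖ * (2 * ‖w‖) * (2 * (‖b‖ * ‖w‖)) + ‖b‖ * ‖w‖ ^ 2 + (‖b‖ * ‖w‖) ^ 2 := by gcongr
    _ ≤ _ := by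
        have := mul_nonneg (mul_nonneg (norm_nonneg b) (sq_nonneg ‖w‖)) (sub_nonneg.2 hb)
        nlinarith

theorem norm_prod_renormalized_sub_one_le {ι : Type*} (S : Finset ι) {b : ι → ℂ} {w : ℂ}
    (hw : ‖w‖ ≤ 1) (hbw : ∀ k ∈ S, ‖b k‖ * ‖w‖ ≤ 1) (hb : ∀ k ∈ S, 1 / 2 ≤ ‖b k‖) :
    ‖∏ k ∈ S, (1 + b k * (Complex.exp w - 1)) * Complex.exp (-(b k * w)) - 1‖
      ≤ Real.exp (7 * ‖w‖ ^ 2 * ∑ k ∈ S, ‖b k‖ ^ 2) - 1 := by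
  have h := Finset.norm_prod_one_add_sub_one_le S
    fun k ↦ (1 + b k * (Complex.exp w - 1)) * Complex.exp (-(b k * w)) - 1
  simp only [add_sub_cancel] at h
  refine h.trans (sub_le_sub_right (Real.exp_le_exp.2 ?_) 1)
  rw [Finset.mul_sum]
  exact Finset.sum_le_sum fun k hk ↦ norm_renormalized_factor_sub_one_le hw (hbw k hk) (hb k hk)

theorem half_le_norm_inv_one_sub_rot {t : ℝ} (ht : rot t ≠ 1) :
    1 / 2 ≤ ‖(1 - (rot t : ℂ))⁻¹‖ := by
  have h0 : 0 < ‖(1 : ℂ) - rot t‖ := by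
    rw [norm_pos_iff, sub_ne_zero, Ne, eq_comm, Circle.coe_eq_one]
    exact ht
  rw [norm_inv, ← one_div]
  refine one_div_le_one_div_of_le h0 ?_
  rw [norm_one_sub_rot]
  nlinarith [Real.abs_sin_le_one (Real.pi * t)]

/-- The map u ↦ 1 / (1 - u) sends the unit circle to the line of real part 1/2. This is the origin
of the factor e^{iπz(1 - y_0)} in the limit (i). -/
theorem inv_one_sub_rot_re {t : ℝ} (ht : rot t ≠ 1) : ((1 - (rot t : ℂ))⁻¹).re = 1 / 2 := by
  have h : (rot t : ℂ).re * (rot t : ℂ).re + (rot t : ℂ).im * (rot t : ℂ).im = 1 := by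
    rw [← Complex.normSq_apply, Circle.normSq_coe]
  have h1 : (rot t : ℂ).re ≠ 1 := fun h1 ↦ ht (by
    rw [h1] at h
    rw [← Circle.coe_eq_one]
    have : (rot t : ℂ).im = 0 := by nlinarith
    exact Complex.ext h1 this)
  rw [Complex.inv_re, Complex.normSq_apply]
  simp only [Complex.sub_re, Complex.one_re, Complex.sub_im, Complex.one_im]
  have e : (1 - (rot t : ℂ).re) * (1 - (rot t : ℂ).re)
      + (0 - (rot t : ℂ).im) * (0 - (rot t : ℂ).im) = 2 * (1 - (rot t : ℂ).re) := by
    linear_combination h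
  rw [e]
  field_simp [sub_ne_zero.2 h1.symm]

/-! ### Characters that do not contribute to the limit -/

/-- The number is a combination of 1, with coefficient 1 - ∑ l_j, and of the χ_j, with coefficients
l_j. A strict triangle inequality between 1 and a single χ_i is enough. -/
theorem norm_one_add_sum_mul_sub_one_lt {ι : Type*} {S : Finset ι} {l : ι → ℝ} {χ : ι → ℂ}
    (hl : ∀ j ∈ S, 0 ≤ l j) (hχ : ∀ j ∈ S, ‖χ j‖ ≤ 1) {i : ι} (hi : i ∈ S)
    (h : ‖((1 - ∑ j ∈ S, l j : ℝ) : ℂ) + l i * χ i‖ < 1 - ∑ j ∈ S, l j + l i) :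
    ‖1 + ∑ j ∈ S, (l j : ℂ) * (χ j - 1)‖ < 1 := by
  classical
  have e : 1 + ∑ j ∈ S, (l j : ℂ) * (χ j - 1)
      = (((1 - ∑ j ∈ S, l j : ℝ) : ℂ) + l i * χ i) + ∑ j ∈ S.erase i, (l j : ℂ) * χ j := by
    rw [add_assoc, Finset.add_sum_erase S (fun j ↦ (l j : ℂ) * χ j) hi]
    push_cast
    simp only [mul_sub, mul_one, Finset.sum_sub_distrib]
    ring
  have e2 := Finset.add_sum_erase S l hi
  rw [e]
  calc _ ≤ ‖((1 - ∑ j ∈ S, l j : ℝ) : ℂ) + l i * χ i‖ + ∑ j ∈ S.erase i, l j := by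
        refine (norm_add_le _ _).trans (add_le_add le_rfl ((norm_sum_le _ _).trans
          (Finset.sum_le_sum fun j hj ↦ ?_)))
        have hj' := Finset.mem_of_mem_erase hj
        rw [norm_mul, Complex.norm_real, Real.norm_eq_abs, abs_of_nonneg (hl j hj')]
        exact mul_le_of_le_one_right (hl j hj') (hχ j hj')
    _ < 1 := by linarith

theorem norm_add_mul_lt {a l : ℝ} (ha : 0 < a) (hl : 0 < l) {w : ℂ} (hw : ‖w‖ = 1) (hne : w ≠ 1) :
    ‖(a : ℂ) + l * w‖ < a + l := by
  have h := norm_one_add_mul_sub_one_lt (l := l / (a + l)) (by positivity)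
    (by rw [div_lt_one (by positivity)]; linarith) hw hne
  have e : (a : ℂ) + l * w = ((a + l : ℝ) : ℂ) * (1 + ((l / (a + l) : ℝ) : ℂ) * (w - 1)) := by
    have : ((a : ℂ) + l) ≠ 0 := by exact_mod_cast (by positivity : a + l ≠ 0)
    push_cast
    field_simp
    ring
  rw [e, norm_mul, Complex.norm_real, Real.norm_eq_abs, abs_of_pos (by positivity)]
  exact mul_lt_of_lt_one_right (by positivity) h

/-- Strict convexity, because 1 has a positive coefficient and e^{-2iπ m_i α} ≠ 1. If finitely many
circles carried all the mass, the product of their weights would be the deterministic number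
e^{-2iπnα}, and the limiting weights could not be independent. -/
theorem norm_one_add_sum_fourierCoeffOf_dirac_lt {α : ℝ} (hα : Irrational α) {J : ℕ}
    (m : Fin J → ℤ) {l : ℕ → ℝ} (hl : l ∈ nabla) (hlt : ∀ k, ∑ j ∈ Finset.range k, l j < 1)
    (h : ∃ j : Fin J, m j ≠ 0 ∧ l j ≠ 0) :
    ‖1 + ∑ j : Fin J, (l j : ℂ) * (fourierCoeffOf (Measure.dirac (-α)) (m j) - 1)‖ < 1 := by
  obtain ⟨i, hi, hli⟩ := h
  have hs : ∑ j : Fin J, l j < 1 := by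
    rw [Fin.sum_univ_eq_sum_range (fun j ↦ l j)]
    exact hlt J
  refine norm_one_add_sum_mul_sub_one_lt (l := fun j : Fin J ↦ l j)
    (fun j _ ↦ (hl.1 j).1) (fun j _ ↦ ?_) (Finset.mem_univ i) ?_
  · rw [fourierCoeffOf_dirac, Circle.norm_coe]
  · refine norm_add_mul_lt (sub_pos.2 hs) ((hl.1 i).1.lt_of_ne' hli) ?_ ?_
    · rw [fourierCoeffOf_dirac, Circle.norm_coe]
    · rw [fourierCoeffOf_dirac, Ne, Circle.coe_eq_one]
      exact rot_zpow_ne_one_of_irrational hα hi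

/-- The Fourier coefficient at m_i is zero, so the mass l_i is lost, even if no mass is left on the
segment. -/
theorem norm_one_add_sum_fourierCoeffOf_uniformAngle_lt {J : ℕ} (m : Fin J → ℤ) {l : ℕ → ℝ}
    (hl : l ∈ nabla) (h : ∃ j : Fin J, m j ≠ 0 ∧ l j ≠ 0) :
    ‖1 + ∑ j : Fin J, (l j : ℂ) * (fourierCoeffOf uniformAngle (m j) - 1)‖ < 1 := by
  obtain ⟨i, hi, hli⟩ := h
  have hs : ∑ j : Fin J, l j ≤ 1 := by
    rw [Fin.sum_univ_eq_sum_range (fun j ↦ l j)]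
    exact (hl.2.2.1.sum_le_tsum _ fun j _ ↦ (hl.1 j).1).trans hl.2.2.2
  refine norm_one_add_sum_mul_sub_one_lt (l := fun j : Fin J ↦ l j)
    (fun j _ ↦ (hl.1 j).1) (fun j _ ↦ norm_fourierCoeffOf_le _ _) (Finset.mem_univ i) ?_
  rw [fourierCoeffOf_uniformAngle hi, mul_zero, add_zero, Complex.norm_real, Real.norm_eq_abs,
    abs_of_nonneg (sub_nonneg.2 hs)]
  linarith [(hl.1 i).1.lt_of_ne' hli]

/-! ### Random functions as continuous functions of the observables -/

/-- `expMul` as a continuous function. -/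
noncomputable def expMulMap : C(ℂ, C(ℂ, ℂ)) :=
  ContinuousMap.curry ⟨fun q ↦ Complex.exp (q.1 * q.2), by fun_prop⟩

/-- The polynomial vanishing at `s`, with value one at zero. -/
noncomputable def linFactor (s : ℝ) : C(ℂ, ℂ) := ⟨fun z ↦ 1 - z / s, by fun_prop⟩

theorem linFactor_apply (s : ℝ) (z : ℂ) : linFactor s z = 1 - z / s := rfl

/-- The product over the circles, the exponential and the product over the cells. -/
noncomputable def obsMap {m K : ℕ} (c : ℂ) (s : Fin K → ℝ) (e : Observables (Fin m) (Fin K)) :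
    C(ℂ, ℂ) :=
  circleClip m (e.1, e.2.2.2) * (expMul (c * e.2.1) * ∏ i, linFactor (s i) ^ e.2.2.1 i)

theorem continuous_obsMap {m K : ℕ} (c : ℂ) (s : Fin K → ℝ) :
    Continuous (obsMap c s : Observables (Fin m) (Fin K) → C(ℂ, ℂ)) := by
  have h1 : Continuous fun e : Observables (Fin m) (Fin K) ↦ circleClip m (e.1, e.2.2.2) :=
    (circleClip m).continuous.comp (by fun_prop)
  have h2 : Continuous fun e : Observables (Fin m) (Fin K) ↦ expMul (c * e.2.1) :=
    expMulMap.continuous.comp (by fun_prop)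
  have h3 : ∀ i, Continuous fun e : Observables (Fin m) (Fin K) ↦ linFactor (s i) ^ e.2.2.1 i :=
    fun i ↦ (continuous_of_discreteTopology (f := fun N : ℕ ↦ linFactor (s i) ^ N)).comp
      (by fun_prop)
  exact h1.mul (h2.mul (continuous_finsetProd _ fun i _ ↦ h3 i))

section

variable {Ω : Type*}

open Classical in
/-- Indices of the points on the segment. -/
noncomputable def segIndices (x : Ω → ℕ → Point) (n : ℕ) (ω : Ω) : Finset (Fin n) :=
  Finset.univ.filter fun k ↦ label (x ω k) = none

theorem card_segIndices (x : Ω → ℕ → Point) (n : ℕ) (ω : Ω) :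
    (segIndices x n ω).card = pointCount x n none ω := by
  classical
  rw [segIndices, pointCount, labelCount]
  congr!

theorem segProd_apply (x : Ω → ℕ → Point) (n : ℕ) (q : Ω × (Fin n → ℝ)) (z : ℂ) :
    segProd x n q z = ∏ k ∈ segIndices x n q.1, (1 + (1 - (rot (q.2 k) : ℂ))⁻¹ *
      (Complex.exp (2 * Complex.I * Real.pi * (z / n)) - 1)) := by
  classical
  rw [segIndices, Finset.prod_filter]
  simp only [segProd, ContinuousMap.coe_mk]
  refine Finset.prod_congr rfl fun k _ ↦ ?_
  split_ifs
  · rw [div_eq_inv_mul]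
  · rfl

end

section

variable {Ω Ω' : Type*} [MeasurableSpace Ω] [MeasurableSpace Ω']
  {μ : Measure Ω} [IsProbabilityMeasure μ] {μ' : Measure Ω'} [IsProbabilityMeasure μ']
  {p : Measure (ℕ → ℝ)} {Y : Ω → ℕ → ℝ} {x : Ω → ℕ → Point} {y : Ω' → ℕ → ℝ} {u : Ω' → ℕ → ℂ}

theorem norm_two_pi_I_mul_div (z : ℂ) (n : ℕ) :
    ‖2 * Complex.I * Real.pi * (z / n)‖ = 2 * Real.pi * ‖z‖ / n := by
  simp [abs_of_pos Real.pi_pos, mul_div_assoc]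

/-- There are at most n factors, each of them e^{bw} up to a relative error of order n⁻², uniformly
on balls. -/
theorem eventually_norm_prod_renormalized_const {α : ℝ} (hα : rot (-α) ≠ 1) (A : ℝ) {δ : ℝ}
    (hδ : 0 < δ) : ∀ᶠ n : ℕ in atTop, ∀ (S : Finset (Fin n)) (z : ℂ), ‖z‖ ≤ A →
      ‖∏ _k ∈ S, (1 + (1 - (rot (-α) : ℂ))⁻¹ *
        (Complex.exp (2 * Complex.I * Real.pi * (z / n)) - 1)) *
        Complex.exp (-((1 - (rot (-α) : ℂ))⁻¹ * (2 * Complex.I * Real.pi * (z / n)))) - 1‖ ≤ δ := by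
  set b := (1 - (rot (-α) : ℂ))⁻¹ with hb
  have hb2 : 1 / 2 ≤ ‖b‖ := half_le_norm_inv_one_sub_rot hα
  have ht : Tendsto (fun n : ℕ ↦ Real.exp ((7 * (2 * Real.pi * |A|) ^ 2 * ‖b‖ ^ 2) / n) - 1)
      atTop (𝓝 0) := by
    have := (tendsto_const_div_atTop_nhds_zero_nat (7 * (2 * Real.pi * |A|) ^ 2 * ‖b‖ ^ 2)).rexp
    simpa using this.sub_const 1
  have ht1 := tendsto_const_div_atTop_nhds_zero_nat (2 * Real.pi * |A|)
  have ht2 := tendsto_const_div_atTop_nhds_zero_nat (‖b‖ * (2 * Real.pi * |A|))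
  filter_upwards [ht.eventually_le_const hδ, ht1.eventually_le_const one_pos,
    ht2.eventually_le_const one_pos, eventually_gt_atTop 0] with n h1 h2 h3 hn S z hz
  have hn' : (0 : ℝ) < n := by exact_mod_cast hn
  have hpi := Real.pi_pos
  have hw : ‖2 * Complex.I * Real.pi * (z / n)‖ ≤ 2 * Real.pi * |A| / n := by
    rw [norm_two_pi_I_mul_div]
    have := hz.trans (le_abs_self A)
    gcongr
  refine (norm_prod_renormalized_sub_one_le S (b := fun _ ↦ b) (hw.trans h2) (fun _ _ ↦ ?_)
    fun _ _ ↦ hb2).trans (le_trans (sub_le_sub_right (Real.exp_le_exp.2 ?_) 1) h1)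
  · refine le_trans (mul_le_mul_of_nonneg_left hw (norm_nonneg b)) ?_
    rwa [mul_div_assoc']
  · rw [Finset.sum_const, nsmul_eq_mul]
    have hS : (S.card : ℝ) ≤ n := by
      have := Finset.card_le_univ S
      rw [Fintype.card_fin] at this
      exact_mod_cast this
    calc 7 * ‖2 * Complex.I * Real.pi * (z / n)‖ ^ 2 * (S.card * ‖b‖ ^ 2)
        ≤ 7 * (2 * Real.pi * |A| / n) ^ 2 * (n * ‖b‖ ^ 2) := by gcongr
      _ = _ := by field_simp

/-- With a = πα, s = sin a and c = cos a, one has 1 - e^{-2ia} = 2 s (s + ic), and the inverse of s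
+ ic is s - ic. -/
theorem two_pi_I_mul_inv_one_sub_rot {α : ℝ} (hα : Irrational α) :
    2 * Complex.I * Real.pi * (1 - (rot (-α) : ℂ))⁻¹
      = Complex.I * Real.pi * (1 - Complex.I / (Real.tan (Real.pi * α) : ℝ)) := by
  have hne : rot (-α) ≠ 1 := by simpa using rot_zpow_ne_one_of_irrational hα one_ne_zero
  have h1 : (1 : ℂ) - rot (-α) ≠ 0 := by
    rw [sub_ne_zero, Ne, eq_comm, Circle.coe_eq_one]; exact hne
  have hs : Real.sin (Real.pi * α) ≠ 0 := by
    intro h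
    have h2 := norm_one_sub_rot (-α)
    rw [mul_neg, Real.sin_neg, h, neg_zero, abs_zero, mul_zero, norm_eq_zero] at h2
    exact h1 h2
  have hs' : Complex.sin ((Real.pi * α : ℝ) : ℂ) ≠ 0 := by
    rw [← Complex.ofReal_sin]; exact_mod_cast hs
  have e1 : (rot (-α) : ℂ) = (Complex.cos ((Real.pi * α : ℝ) : ℂ)
      - Complex.sin ((Real.pi * α : ℝ) : ℂ) * Complex.I) ^ 2 := by
    rw [coe_rot, Complex.cos_sub_sin_I, ← Complex.exp_nat_mul]
    congr 1
    push_cast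
    ring
  have e2 := Complex.sin_sq_add_cos_sq ((Real.pi * α : ℝ) : ℂ)
  rw [Real.tan_eq_sin_div_cos]
  rw [e1] at h1 ⊢
  push_cast at *
  set c := Complex.cos (Real.pi * α)
  set s := Complex.sin (Real.pi * α)
  have hI := Complex.I_sq
  have e3 : (1 : ℂ) - (c - s * Complex.I) ^ 2 = 2 * s * (s + c * Complex.I) := by
    linear_combination (-1 : ℂ) * e2 - s ^ 2 * hI
  rw [e3] at h1 ⊢
  have h2 : s + c * Complex.I ≠ 0 := fun h ↦ h1 (by rw [h, mul_zero])
  have e4 : (s + c * Complex.I) * (s - c * Complex.I) = 1 := by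
    linear_combination e2 - c ^ 2 * hI
  have e5 : (s + c * Complex.I)⁻¹ = s - c * Complex.I := inv_eq_of_mul_eq_one_right e4
  rw [mul_inv, e5]
  field_simp

/-- Convergence of the model with constant angles, from the one of the product over the circles. -/
theorem tendstoInDistribution_modelXi_dirac (hc : IsCoupling μ p Y x) (hp : ∀ᵐ l ∂p, l ∈ nabla)
    (hdecay : HasExponentialDecay p) (hlim : IsLimitData μ' p y u)
    (hlt : ∀ᵐ l ∂p, ∀ k, ∑ j ∈ Finset.range k, l j < 1) {α : ℝ} (hα : Irrational α)
    (hft : IsFiniteType α) {F : Ω' → C(ℂ, ℂ)}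
    (hF : ∀ᵐ ω ∂μ', Tendsto (fun m : ℕ ↦ circleClip m (fun j ↦ y ω j,
      fun j ↦ limitCircle (y ω j) (u ω j))) atTop (𝓝 (F ω))) :
    TendstoInDistribution (fun n ↦ modelXi Y x n) atTop
      (fun ω ↦ F ω * expMul (Complex.I * Real.pi * (1 - (∑' j, y ω j : ℝ)) *
        (1 - Complex.I / (Real.tan (Real.pi * α) : ℝ))))
      (fun n ↦ model μ (Measure.dirac (-α)) n) μ' := by
  have hne : rot (-α) ≠ 1 := by simpa using rot_zpow_ne_one_of_irrational hα one_ne_zero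
  have hlt1 : ∀ᵐ l ∂p, ∀ j, l j < 1 := by
    filter_upwards [hp, hlt] with l hl h j
    refine lt_of_le_of_lt ?_ (h (j + 1))
    exact Finset.single_le_sum (fun i _ ↦ (hl.1 i).1) (Finset.self_mem_range_succ j)
  set c := 2 * Complex.I * Real.pi * (1 - (rot (-α) : ℂ))⁻¹ with hcdef
  -- No cell is needed (K = 0): with constant angles the segment acts only through its proportion of
  -- points.
  refine tendstoInDistribution_modelXi hc hp (hasSmallDivisors_dirac hc hp hdecay hlt1 hα hft)
    (seg := fun _ n q ↦ expMul (c * ((pointCount x n none q.1 : ℝ) / n : ℝ)))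
    (L := fun m ω ↦ obsMap c (fun i : Fin 0 ↦ i.elim0)
      (limitObs y u m (fun _ (i : Fin 0) ↦ i.elim0) ω)) ?_ ?_ ?_
  · intro m
    have h := tendstoInDistribution_modelObs (ν := Measure.dirac (-α)) hc hp hlim (J := m)
      (I := fun i : Fin 0 ↦ i.elim0) (fun i ↦ i.elim0) (fun i ↦ i.elim0)
      (lam := fun i ↦ i.elim0) (fun i ↦ i.elim0) (fun i ↦ i.elim0)
      (fun k ↦ by
        filter_upwards [hp, hlt] with l hl hl1 h
        exact norm_one_add_sum_fourierCoeffOf_dirac_lt hα k hl hl1 h)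
      (N := fun _ i ↦ i.elim0) measurable_const (fun ψ _ _ t ↦ by simp)
    refine (h.continuous_comp (continuous_obsMap c fun i : Fin 0 ↦ i.elim0)).congr
      (fun n ↦ ae_of_all _ fun q ↦ ?_) (ae_of_all _ fun ω ↦ rfl)
    simp [obsMap, modelObs, circleData]
  · filter_upwards [hF] with ω hω
    refine (hω.mul_const _).congr fun m ↦ ?_
    simp only [obsMap, limitObs, Finset.univ_eq_empty, Finset.prod_empty, mul_one]
    rw [hcdef, two_pi_I_mul_inv_one_sub_rot hα]
    congr 2
    push_cast
    ring
  · intro A δ ε hδ hε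
    refine Eventually.of_forall fun m ↦ ?_
    filter_upwards [eventually_norm_prod_renormalized_const hne A hδ] with n hn
    refine le_of_eq_of_le ?_ zero_le
    rw [← ae_iff]
    filter_upwards [ae_model_dirac (μ := μ) (-α) n] with q hq z hz
    refine ⟨_, hn (segIndices x n q.1) z hz, ?_⟩
    rw [segProd_apply]
    simp only [hq, Finset.prod_const, card_segIndices]
    rw [mul_pow, mul_left_comm, ← Complex.exp_nat_mul]
    simp only [expMul, ContinuousMap.coe_mk]
    rw [← Complex.exp_add]
    rw [show c * ((pointCount x n none q.1 : ℝ) / n : ℝ) * z + (pointCount x n none q.1 : ℂ) *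
      -((1 - (rot (-α) : ℂ))⁻¹ * (2 * Complex.I * Real.pi * (z / n))) = 0 by
        rw [hcdef]; push_cast; ring, Complex.exp_zero, mul_one]

end

/-! ### Uniform angles far from the origin -/

/-- The inverse of `1 - e^{2iπt}`. -/
noncomputable def rotInv (t : ℝ) : ℂ := (1 - (rot t : ℂ))⁻¹

theorem measurable_rotInv : Measurable rotInv :=
  (measurable_const.sub (measurable_circle_coe.comp measurable_rot)).inv

theorem rotInv_neg_im (t : ℝ) : (rotInv (-t)).im = -(rotInv t).im := by
  rw [rotInv, rotInv, rot_neg, Circle.coe_inv_eq_conj]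
  have : (1 : ℂ) - (starRingEnd ℂ) (rot t : ℂ) = (starRingEnd ℂ) (1 - (rot t : ℂ)) := by simp
  rw [this, ← map_inv₀, Complex.conj_im]

theorem rotInv_eq {t : ℝ} (ht : rot t ≠ 1) : rotInv t = 1 / 2 + (rotInv t).im * Complex.I := by
  have h := inv_one_sub_rot_re ht
  conv_lhs => rw [← Complex.re_add_im (rotInv t)]
  rw [rotInv, h]
  push_cast
  rfl

theorem norm_rotInv_le {t : ℝ} (ht : |t| ≤ 1 / 2) (h0 : t ≠ 0) : ‖rotInv t‖ ≤ 1 / (4 * |t|) := by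
  have h1 : 0 < |t| := abs_pos.2 h0
  rw [rotInv, norm_inv, ← one_div]
  refine one_div_le_one_div_of_le (by positivity) ?_
  rw [norm_one_sub_rot]
  have hpi := Real.pi_pos
  have h2 := Real.mul_le_sin (x := Real.pi * |t|) (by positivity) (by nlinarith)
  have h3 : Real.sin (Real.pi * |t|) ≤ |Real.sin (Real.pi * t)| := by
    rcases abs_cases t with ⟨h, _⟩ | ⟨h, _⟩
    · rw [h]; exact le_abs_self _
    · rw [h, mul_neg, Real.sin_neg]; exact neg_le_abs _
  have h4 : 2 / Real.pi * (Real.pi * |t|) = 2 * |t| := by field_simp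
  linarith

theorem ae_abs_le_uniformAngle : ∀ᵐ t ∂uniformAngle, |t| ≤ 1 / 2 := by
  rw [uniformAngle, ae_restrict_iff' measurableSet_Ico]
  exact ae_of_all _ fun t ht ↦ abs_le.2 ⟨ht.1, ht.2.le⟩

theorem integral_indicator_inv_sq {a : ℝ} (ha : 0 < a) :
    ∫ t : ℝ, (Set.Ici a).indicator (fun s : ℝ ↦ s ^ (-2 : ℝ)) |t| = 2 / a := by
  rw [integral_comp_abs (f := (Set.Ici a).indicator fun s : ℝ ↦ s ^ (-2 : ℝ)),
    setIntegral_indicator measurableSet_Ici, Set.inter_eq_right.2 (Set.Ici_subset_Ioi.2 ha),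
    integral_Ici_eq_integral_Ioi, integral_Ioi_rpow_of_lt (by norm_num) ha]
  norm_num [Real.rpow_neg_one]
  rfl

/-- The function equal to `rotInv` outside of `[-a,a)`, and to zero in this interval. -/
noncomputable def rotInvTail (a : ℝ) : ℝ → ℂ := (Set.Ico (-a) a)ᶜ.indicator rotInv

theorem measurable_rotInvTail (a : ℝ) : Measurable (rotInvTail a) :=
  measurable_rotInv.indicator measurableSet_Ico.compl

theorem le_abs_of_notMem_Ico {a t : ℝ} (h : t ∉ Set.Ico (-a) a) : a ≤ |t| := by
  by_contra! h'
  exact h ⟨(abs_lt.1 h').1.le, (abs_lt.1 h').2⟩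

theorem norm_rotInvTail_le {a t : ℝ} (ha : 0 < a) (ht : |t| ≤ 1 / 2) :
    ‖rotInvTail a t‖ ≤ 1 / (4 * a) := by
  by_cases h : t ∈ Set.Ico (-a) a
  · rw [rotInvTail, Set.indicator_of_notMem (by simpa using h), norm_zero]
    positivity
  · have h1 := le_abs_of_notMem_Ico h
    rw [rotInvTail, Set.indicator_of_mem (by exact h)]
    refine (norm_rotInv_le ht (abs_pos.1 (ha.trans_le h1))).trans ?_
    gcongr

/-- From |rotInv t| ≤ 1 / (4 |t|): the integral of 1 / (16 t²) over |t| ≥ a is 1 / (8 a). -/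
theorem integral_norm_rotInvTail_sq_le {a : ℝ} (ha : 0 < a) :
    ∫ t, ‖rotInvTail a t‖ ^ 2 ∂uniformAngle ≤ 1 / (8 * a) := by
  have h := integral_indicator_inv_sq ha
  -- A function with non-zero integral is integrable.
  have hi : Integrable fun t : ℝ ↦ (Set.Ici a).indicator (fun s : ℝ ↦ s ^ (-2 : ℝ)) |t| := by
    by_contra h'
    rw [integral_undef h'] at h
    have : 0 < 2 / a := by positivity
    linarith
  have hnn : ∀ t : ℝ, 0 ≤ (Set.Ici a).indicator (fun s : ℝ ↦ s ^ (-2 : ℝ)) |t| := fun t ↦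
    Set.indicator_nonneg (fun s hs ↦ Real.rpow_nonneg (ha.le.trans hs) _) _
  calc ∫ t, ‖rotInvTail a t‖ ^ 2 ∂uniformAngle
      ≤ ∫ t, 1 / 16 * (Set.Ici a).indicator (fun s : ℝ ↦ s ^ (-2 : ℝ)) |t| ∂uniformAngle := by
        refine integral_mono_of_nonneg (ae_of_all _ fun t ↦ by positivity)
          ((hi.restrict).const_mul _) ?_
        filter_upwards [ae_abs_le_uniformAngle] with t ht
        by_cases h : t ∈ Set.Ico (-a) a
        · rw [rotInvTail, Set.indicator_of_notMem (by simpa using h), norm_zero]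
          simpa using hnn t
        · have h1 := le_abs_of_notMem_Ico h
          have h0 : 0 < |t| := ha.trans_le h1
          rw [rotInvTail, Set.indicator_of_mem (by exact h), Set.indicator_of_mem (by exact h1),
            Real.rpow_neg h0.le]
          refine (pow_le_pow_left₀ (norm_nonneg _) (norm_rotInv_le ht (abs_pos.1 h0)) 2).trans ?_
          rw [Real.rpow_two]
          refine le_of_eq ?_
          field_simp
          norm_num
    _ = 1 / 16 * ∫ t in Set.Ico (-(1 / 2)) (1 / 2),
          (Set.Ici a).indicator (fun s : ℝ ↦ s ^ (-2 : ℝ)) |t| := by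
        rw [integral_const_mul]; rfl
    _ ≤ 1 / 16 * (2 / a) := by
        rw [← h]
        exact mul_le_mul_of_nonneg_left (setIntegral_le_integral hi (ae_of_all _ hnn)) (by norm_num)
    _ = _ := by field_simp; norm_num

/-- The imaginary part is odd, and the excluded window is symmetric up to its end points. -/
theorem integral_rotInvTail_im (a : ℝ) : ∫ t, (rotInvTail a t).im ∂uniformAngle = 0 := by
  have h1 : ∫ t, (rotInvTail a t).im ∂uniformAngle
      = ∫ t in (-(1 / 2) : ℝ)..(1 / 2), (rotInvTail a t).im := by
    rw [intervalIntegral.integral_of_le (by norm_num), uniformAngle, integral_Ico_eq_integral_Ioc]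
  have h2 := intervalIntegral.integral_comp_neg (a := (-(1 / 2) : ℝ)) (b := 1 / 2)
    fun t ↦ (rotInvTail a t).im
  rw [neg_neg] at h2
  have h3 : ∫ t in (-(1 / 2) : ℝ)..(1 / 2), (rotInvTail a (-t)).im
      = ∫ t in (-(1 / 2) : ℝ)..(1 / 2), -(rotInvTail a t).im := by
    refine intervalIntegral.integral_congr_ae ?_
    have hne : ∀ᵐ t : ℝ, t ≠ a ∧ t ≠ -a := by
      filter_upwards [compl_mem_ae_iff.2 (measure_singleton a),
        compl_mem_ae_iff.2 (measure_singleton (-a))] with t h h'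
      exact ⟨h, h'⟩
    filter_upwards [hne] with t ht _
    have hiff : -t ∈ Set.Ico (-a) a ↔ t ∈ Set.Ico (-a) a := by
      constructor
      · rintro ⟨h, h'⟩
        exact ⟨by linarith, lt_of_le_of_ne (by linarith) ht.1⟩
      · rintro ⟨h, h'⟩
        exact ⟨by linarith, by
          have := lt_of_le_of_ne h ht.2.symm
          linarith⟩
    by_cases h : t ∈ Set.Ico (-a) a
    · rw [rotInvTail, Set.indicator_of_notMem (by simpa using hiff.2 h),
        Set.indicator_of_notMem (by simpa using h)]
      simp
    · rw [rotInvTail, Set.indicator_of_mem (by exact fun h' ↦ h (hiff.1 h')),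
        Set.indicator_of_mem (by exact h), rotInv_neg_im]
  rw [h3, intervalIntegral.integral_neg] at h2
  rw [h1]
  linarith

theorem integral_pi_comp_eval {ν : Measure ℝ} [IsProbabilityMeasure ν] {n : ℕ} (k : Fin n)
    {φ : ℝ → ℝ} (hφ : AEStronglyMeasurable φ ν) :
    ∫ θ, φ (θ k) ∂Measure.pi (fun _ : Fin n ↦ ν) = ∫ t, φ t ∂ν := by
  have hm : MeasurePreserving (fun θ : Fin n → ℝ ↦ θ k) (Measure.pi fun _ : Fin n ↦ ν) ν :=
    measurePreserving_eval (fun _ : Fin n ↦ ν) k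
  have h := integral_map (μ := Measure.pi fun _ : Fin n ↦ ν) hm.measurable.aemeasurable (f := φ)
    (by rw [hm.map_eq]; exact hφ)
  rw [hm.map_eq] at h
  exact h.symm

/-- Chebyshev's inequality for independent centred variables, those with index outside `S` being
replaced by zero. -/
theorem measure_pi_le_abs_sum {ν : Measure ℝ} [IsProbabilityMeasure ν] {n : ℕ} (S : Finset (Fin n))
    {φ : ℝ → ℝ} (hφ : MemLp φ 2 ν) (h0 : ∫ t, φ t ∂ν = 0) {V : ℝ} (hV : ∫ t, φ t ^ 2 ∂ν ≤ V)
    {r : ℝ} (hr : 0 < r) :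
    Measure.pi (fun _ : Fin n ↦ ν) {θ | r ≤ |∑ k ∈ S, φ (θ k)|} ≤ ENNReal.ofReal (n * V / r ^ 2) := by
  classical
  have hV0 : 0 ≤ V := le_trans (integral_nonneg fun t ↦ sq_nonneg _) hV
  let X : Fin n → ℝ → ℝ := fun k ↦ if k ∈ S then φ else 0
  have hX : ∀ k, MemLp (X k) 2 ν := fun k ↦ by
    by_cases h : k ∈ S
    · simpa [X, h] using hφ
    · simp only [X, h, if_false]; exact MemLp.zero
  have hX0 : ∀ k, ∫ t, X k t ∂ν = 0 := fun k ↦ by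
    by_cases h : k ∈ S <;> simp [X, h, h0]
  have hXV : ∀ k, Var[X k; ν] ≤ V := fun k ↦ by
    refine (variance_le_expectation_sq (hX k).1).trans ?_
    by_cases h : k ∈ S
    · simpa [X, h] using hV
    · simpa [X, h] using hV0
  have hm : ∀ k : Fin n, MeasurePreserving (fun θ : Fin n → ℝ ↦ θ k)
      (Measure.pi fun _ : Fin n ↦ ν) ν := fun k ↦ measurePreserving_eval (fun _ : Fin n ↦ ν) k
  have hXk : ∀ k, MemLp (fun θ : Fin n → ℝ ↦ X k (θ k)) 2 (Measure.pi fun _ : Fin n ↦ ν) :=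
    fun k ↦ (hX k).comp_measurePreserving (hm k)
  have hsum : MemLp (∑ k, fun θ : Fin n → ℝ ↦ X k (θ k)) 2 (Measure.pi fun _ : Fin n ↦ ν) :=
    memLp_finsetSum' _ fun k _ ↦ hXk k
  have hmean : ∫ θ, (∑ k, fun θ : Fin n → ℝ ↦ X k (θ k)) θ ∂Measure.pi (fun _ : Fin n ↦ ν) = 0 := by
    simp only [Finset.sum_apply]
    rw [integral_finsetSum _ fun k _ ↦ (hXk k).integrable one_le_two]
    refine Finset.sum_eq_zero fun k _ ↦ ?_
    rw [← hX0 k]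
    exact integral_pi_comp_eval k (hX k).1
  have h := meas_ge_le_variance_div_sq hsum hr
  rw [hmean, variance_sum_pi hX] at h
  refine le_trans (le_of_eq ?_) (h.trans (ENNReal.ofReal_le_ofReal ?_))
  · congr 1
    ext θ
    simp only [Set.mem_ofPred_eq, Finset.sum_apply, sub_zero]
    have e : ∀ k, X k (θ k) = if k ∈ S then φ (θ k) else 0 := fun k ↦ by
      by_cases h : k ∈ S <;> simp [X, h]
    rw [Finset.sum_congr rfl fun k _ ↦ e k, Finset.sum_ite_mem, Finset.univ_inter]
  · gcongr
    refine (Finset.sum_le_sum fun k _ ↦ hXV k).trans ?_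
    simp

theorem measure_pi_le_sum {ν : Measure ℝ} [IsProbabilityMeasure ν] {n : ℕ} (S : Finset (Fin n))
    {φ : ℝ → ℝ} (hφ : Integrable φ ν) (h0 : ∀ t, 0 ≤ φ t) {V : ℝ} (hV : ∫ t, φ t ∂ν ≤ V)
    {r : ℝ} (hr : 0 < r) :
    Measure.pi (fun _ : Fin n ↦ ν) {θ | r ≤ ∑ k ∈ S, φ (θ k)} ≤ ENNReal.ofReal (n * V / r) := by
  have hV0 : 0 ≤ V := le_trans (integral_nonneg h0) hV
  have hm : ∀ k : Fin n, MeasurePreserving (fun θ : Fin n → ℝ ↦ θ k)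
      (Measure.pi fun _ : Fin n ↦ ν) ν := fun k ↦ measurePreserving_eval (fun _ : Fin n ↦ ν) k
  have hint : ∀ k, Integrable (fun θ : Fin n → ℝ ↦ φ (θ k)) (Measure.pi fun _ : Fin n ↦ ν) :=
    fun k ↦ (hm k).integrable_comp_of_integrable hφ
  have h := mul_meas_ge_le_integral_of_nonneg (μ := Measure.pi fun _ : Fin n ↦ ν)
    (f := fun θ ↦ ∑ k ∈ S, φ (θ k)) (ae_of_all _ fun θ ↦ Finset.sum_nonneg fun k _ ↦ h0 _)
    (integrable_finsetSum _ fun k _ ↦ hint k) r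
  rw [← ofReal_measureReal]
  refine ENNReal.ofReal_le_ofReal ?_
  rw [le_div_iff₀' hr]
  refine h.trans ?_
  rw [integral_finsetSum _ fun k _ ↦ hint k]
  have e : ∀ k, ∫ θ : Fin n → ℝ, φ (θ k) ∂Measure.pi (fun _ : Fin n ↦ ν) ≤ V := fun k ↦ by
    refine le_of_eq_of_le ?_ hV
    exact (integral_pi_comp_eval k hφ.1)
  refine (Finset.sum_le_sum fun k _ ↦ e k).trans ?_
  rw [Finset.sum_const, nsmul_eq_mul]
  have hS : (S.card : ℝ) ≤ n := by
    have := Finset.card_le_univ S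
    rw [Fintype.card_fin] at this
    exact_mod_cast this
  gcongr

section

variable {Ω : Type*} [MeasurableSpace Ω] {μ : Measure Ω} [IsProbabilityMeasure μ]
  {p : Measure (ℕ → ℝ)} {Y : Ω → ℕ → ℝ} {x : Ω → ℕ → Point}

theorem measurable_sum_segIndices (hc : IsCoupling μ p Y x) (n : ℕ) {φ : ℝ → ℝ}
    (hφ : Measurable φ) :
    Measurable fun q : Ω × (Fin n → ℝ) ↦ ∑ k ∈ segIndices x n q.1, φ (q.2 k) := by
  classical
  simp only [segIndices, Finset.sum_filter]
  refine Finset.measurable_sum _ fun k _ ↦ ?_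
  refine measurable_apply_label hc n (γ := fun c t ↦ if c = none then φ t else 0) (fun c ↦ ?_) k
  by_cases h : c = none <;> simp [h, hφ]

/-- Sums of the inverses over the points of the segment with angles far from the origin. -/
theorem measure_le_sum_rotInvTail (hc : IsCoupling μ p Y x) {n : ℕ} (hn : 0 < n) {m : ℝ}
    (hm : 0 < m) {r : ℝ} (hr : 0 < r) :
    model μ uniformAngle n
      {q | r * n ≤ |∑ k ∈ segIndices x n q.1, (rotInvTail (m / n) (q.2 k)).im| ∨
        r * n ^ 2 ≤ ∑ k ∈ segIndices x n q.1, ‖rotInvTail (m / n) (q.2 k)‖ ^ 2}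
      ≤ ENNReal.ofReal ((1 / r ^ 2 + 1 / r) / m) := by
  have hn' : (0 : ℝ) < n := by exact_mod_cast hn
  have ha : 0 < m / n := by positivity
  have hmim : Measurable fun t ↦ (rotInvTail (m / n) t).im :=
    Complex.measurable_im.comp (measurable_rotInvTail _)
  have hmsq : Measurable fun t ↦ ‖rotInvTail (m / n) t‖ ^ 2 :=
    ((measurable_rotInvTail _).norm).pow_const 2
  have hmeas : MeasurableSet
      {q : Ω × (Fin n → ℝ) | r * n ≤ |∑ k ∈ segIndices x n q.1, (rotInvTail (m / n) (q.2 k)).im| ∨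
        r * n ^ 2 ≤ ∑ k ∈ segIndices x n q.1, ‖rotInvTail (m / n) (q.2 k)‖ ^ 2} :=
    (measurableSet_le measurable_const (measurable_sum_segIndices hc n hmim).abs).union
      (measurableSet_le measurable_const (measurable_sum_segIndices hc n hmsq))
  have hsq := integral_norm_rotInvTail_sq_le ha
  have hintsq : Integrable (fun t ↦ ‖rotInvTail (m / n) t‖ ^ 2) uniformAngle := by
    refine Integrable.of_bound hmsq.aestronglyMeasurable ((1 / (4 * (m / n))) ^ 2) ?_
    filter_upwards [ae_abs_le_uniformAngle] with t ht
    rw [Real.norm_of_nonneg (by positivity)]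
    exact pow_le_pow_left₀ (norm_nonneg _) (norm_rotInvTail_le ha ht) 2
  have him : MemLp (fun t ↦ (rotInvTail (m / n) t).im) 2 uniformAngle := by
    refine MemLp.of_bound hmim.aestronglyMeasurable (1 / (4 * (m / n))) ?_
    filter_upwards [ae_abs_le_uniformAngle] with t ht
    exact (Complex.abs_im_le_norm _).trans (norm_rotInvTail_le ha ht)
  have him2 : ∫ t, (rotInvTail (m / n) t).im ^ 2 ∂uniformAngle ≤ 1 / (8 * (m / n)) := by
    refine le_trans (integral_mono_of_nonneg (ae_of_all _ fun t ↦ sq_nonneg _) hintsq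
      (ae_of_all _ fun t ↦ ?_)) hsq
    refine le_of_eq_of_le (sq_abs _).symm ?_
    exact pow_le_pow_left₀ (abs_nonneg _) (Complex.abs_im_le_norm _) 2
  -- At fixed points the set of indices is deterministic, and only the angles are integrated. With a
  -- = m / n, the variance n / (8 a) against (r n)² gives 1 / (8 r² m), and the mean n / (8 a)
  -- against r n² gives 1 / (8 r m): the bound does not depend on n.
  rw [model, Measure.prod_apply hmeas]
  refine (lintegral_mono (g := fun _ ↦ ENNReal.ofReal ((1 / r ^ 2 + 1 / r) / m))
    fun ω ↦ ?_).trans (by simp)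
  refine (measure_union_le (μ := Measure.pi fun _ : Fin n ↦ uniformAngle)
    {θ | r * n ≤ |∑ k ∈ segIndices x n ω, (rotInvTail (m / n) (θ k)).im|}
    {θ | r * n ^ 2 ≤ ∑ k ∈ segIndices x n ω, ‖rotInvTail (m / n) (θ k)‖ ^ 2}).trans ?_
  refine (add_le_add (measure_pi_le_abs_sum (segIndices x n ω) him (integral_rotInvTail_im _) him2
    (r := r * n) (by positivity)) (measure_pi_le_sum (segIndices x n ω) hintsq
      (fun t ↦ by positivity) hsq (r := r * n ^ 2) (by positivity))).trans ?_
  rw [← ENNReal.ofReal_add (by positivity) (by positivity)]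
  refine ENNReal.ofReal_le_ofReal ?_
  have e : (n : ℝ) * (1 / (8 * (m / n))) / (r * n) ^ 2 + n * (1 / (8 * (m / n))) / (r * n ^ 2)
      = 1 / 8 * ((1 / r ^ 2 + 1 / r) / m) := by field_simp
  rw [e]
  have : 0 ≤ (1 / r ^ 2 + 1 / r) / m := by positivity
  linarith

/-- The product of the factors of the points of the segment with rescaled angles in `[-m,m)`. -/
noncomputable def windowProd (x : Ω → ℕ → Point) (m n : ℕ) (q : Ω × (Fin n → ℝ)) : C(ℂ, ℂ) where
  toFun z := open Classical in
    ∏ k ∈ (segIndices x n q.1).filter fun k ↦ (n : ℝ) * q.2 k ∈ Set.Ico (-(m : ℝ)) m,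
      (1 + rotInv (q.2 k) * (Complex.exp (2 * Complex.I * Real.pi * (z / n)) - 1)) *
        Complex.exp (-(1 / 2 * (2 * Complex.I * Real.pi * (z / n))))
  continuous_toFun := by fun_prop

theorem norm_exp_sub_one_le_exp_norm_sub_one (a : ℂ) :
    ‖Complex.exp a - 1‖ ≤ Real.exp ‖a‖ - 1 := by
  have h := Complex.norm_exp_sub_sum_le_exp_norm_sub_sum a 1
  simpa using h

/-- For a point outside of the window, the factor is e^{bw} up to second order, with b = 1/2 + i Im
b. The parts e^{w/2} of these points, together with those removed from the window factors in
`windowProd`, form the exponential of iπz times the proportion of points on the segment. The rest is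
the exponential of i w ∑ Im b, controlled by `h1`, and the second order errors, controlled by `h2`;
each is within e^{L/2} - 1 of one, so their product is within e^L - 1. -/
theorem segProd_eq_windowProd_mul {n m : ℕ} (hn : 0 < n) (q : Ω × (Fin n → ℝ))
    (hq : ∀ k, rot (q.2 k) ≠ 1) (hq2 : ∀ k, |q.2 k| ≤ 1 / 2) {A L r : ℝ} (hA : 0 ≤ A)
    (hAn : 2 * Real.pi * A / n ≤ 1) (hAm : 2 * Real.pi * A ≤ m) (hm : 0 < m)
    (hr : 2 * Real.pi * A * r ≤ L / 2) (hr' : 7 * (2 * Real.pi * A) ^ 2 * r ≤ L / 2)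
    (h1 : |∑ k ∈ segIndices x n q.1, (rotInvTail (m / n) (q.2 k)).im| ≤ r * n)
    (h2 : ∑ k ∈ segIndices x n q.1, ‖rotInvTail (m / n) (q.2 k)‖ ^ 2 ≤ r * n ^ 2)
    {z : ℂ} (hz : ‖z‖ ≤ A) :
    ∃ T : ℂ, ‖T - 1‖ ≤ Real.exp L - 1 ∧ segProd x n q z =
      (expMul (Complex.I * Real.pi * ((pointCount x n none q.1 : ℝ) / n : ℝ)) *
        windowProd x m n q) z * T := by
  classical
  have hn' : (0 : ℝ) < n := by exact_mod_cast hn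
  have hm' : (0 : ℝ) < m := by exact_mod_cast hm
  have hpi := Real.pi_pos
  set w := 2 * Complex.I * Real.pi * (z / n) with hw
  set S := segIndices x n q.1 with hS
  set S₁ := S.filter fun k ↦ (n : ℝ) * q.2 k ∈ Set.Ico (-(m : ℝ)) m with hS₁
  set S₂ := S.filter fun k ↦ ¬ (n : ℝ) * q.2 k ∈ Set.Ico (-(m : ℝ)) m with hS₂
  have hIco : ∀ t : ℝ, (n : ℝ) * t ∈ Set.Ico (-(m : ℝ)) m ↔ t ∈ Set.Ico (-((m : ℝ) / n)) (m / n) := by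
    intro t
    rw [Set.mem_Ico, Set.mem_Ico, ← neg_div, div_le_iff₀' hn', lt_div_iff₀' hn']
  have htail : ∀ (f : ℂ → ℝ), f 0 = 0 → ∑ k ∈ S, f (rotInvTail (m / n) (q.2 k))
      = ∑ k ∈ S₂, f (rotInv (q.2 k)) := by
    intro f hf
    rw [hS₂, Finset.sum_filter]
    refine Finset.sum_congr rfl fun k _ ↦ ?_
    by_cases h : q.2 k ∈ Set.Ico (-((m : ℝ) / n)) (m / n)
    · rw [rotInvTail, Set.indicator_of_notMem (by simpa using h), hf, if_neg]
      rw [hIco, not_not]; exact h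
    · rw [rotInvTail, Set.indicator_of_mem (by exact h), if_pos]
      rwa [hIco]
  rw [htail Complex.im Complex.zero_im] at h1
  rw [htail (fun z ↦ ‖z‖ ^ 2) (by simp)] at h2
  have hwn : ‖w‖ ≤ 2 * Real.pi * A / n := by
    rw [hw, norm_two_pi_I_mul_div]
    gcongr
  have hbound : ∀ k ∈ S₂, ‖rotInv (q.2 k)‖ * ‖w‖ ≤ 1 := by
    intro k hk
    have hk2 := le_abs_of_notMem_Ico fun h ↦ (Finset.mem_filter.1 hk).2 ((hIco _).2 h)
    have h0 : (0 : ℝ) < m / n := by positivity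
    have h3 := norm_rotInv_le (hq2 k) (abs_pos.1 (h0.trans_le hk2))
    have h4 : ‖rotInv (q.2 k)‖ ≤ 1 / (m / n) := by
      refine h3.trans (one_div_le_one_div_of_le h0 ?_)
      linarith
    calc ‖rotInv (q.2 k)‖ * ‖w‖ ≤ 1 / (m / n) * (2 * Real.pi * A / n) := by gcongr
      _ = 2 * Real.pi * A / m := by field_simp
      _ ≤ 1 := by rwa [div_le_one hm']
  set P := ∏ k ∈ S₂, (1 + rotInv (q.2 k) * (Complex.exp w - 1)) *
    Complex.exp (-(rotInv (q.2 k) * w)) with hP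
  have hP1 : ‖P - 1‖ ≤ Real.exp (L / 2) - 1 := by
    refine (norm_prod_renormalized_sub_one_le S₂ (hwn.trans hAn) hbound
      fun k _ ↦ half_le_norm_inv_one_sub_rot (hq k)).trans
      (sub_le_sub_right (Real.exp_le_exp.2 ?_) 1)
    refine le_trans ?_ hr'
    calc 7 * ‖w‖ ^ 2 * ∑ k ∈ S₂, ‖rotInv (q.2 k)‖ ^ 2
        ≤ 7 * (2 * Real.pi * A / n) ^ 2 * (r * n ^ 2) := by gcongr
      _ = _ := by field_simp
  have hsum : ∑ k ∈ S₂, (rotInv (q.2 k) - 1 / 2)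
      = ((∑ k ∈ S₂, (rotInv (q.2 k)).im : ℝ) : ℂ) * Complex.I := by
    push_cast
    rw [Finset.sum_mul]
    refine Finset.sum_congr rfl fun k _ ↦ ?_
    have := rotInv_eq (hq k)
    linear_combination this
  set a := w * ∑ k ∈ S₂, (rotInv (q.2 k) - 1 / 2) with ha
  have ha1 : ‖Complex.exp a - 1‖ ≤ Real.exp (L / 2) - 1 := by
    refine (norm_exp_sub_one_le_exp_norm_sub_one a).trans
      (sub_le_sub_right (Real.exp_le_exp.2 ?_) 1)
    rw [ha, hsum, norm_mul w, norm_mul _ Complex.I, Complex.norm_I, mul_one, Complex.norm_real, Real.norm_eq_abs]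
    calc ‖w‖ * |∑ k ∈ S₂, (rotInv (q.2 k)).im| ≤ 2 * Real.pi * A / n * (r * n) := by gcongr
      _ = 2 * Real.pi * A * r := by field_simp
      _ ≤ L / 2 := hr
  refine ⟨Complex.exp a * P, ?_, ?_⟩
  · have hPn : ‖P‖ ≤ Real.exp (L / 2) := by
      have := norm_add_le (P - 1) 1
      rw [sub_add_cancel, norm_one] at this
      linarith
    calc ‖Complex.exp a * P - 1‖ = ‖(Complex.exp a - 1) * P + (P - 1)‖ := by ring_nf
      _ ≤ (Real.exp (L / 2) - 1) * Real.exp (L / 2) + (Real.exp (L / 2) - 1) := by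
          refine (norm_add_le _ _).trans (add_le_add ?_ hP1)
          rw [norm_mul]
          exact mul_le_mul ha1 hPn (norm_nonneg _) ((norm_nonneg _).trans ha1)
      _ = Real.exp L - 1 := by
          rw [sub_mul, ← Real.exp_add, add_halves]; ring
  · rw [segProd_apply, ← hS, ContinuousMap.mul_apply]
    have e1 : ∏ k ∈ S, (1 + rotInv (q.2 k) * (Complex.exp w - 1))
        = (∏ k ∈ S₁, (1 + rotInv (q.2 k) * (Complex.exp w - 1))) *
          ∏ k ∈ S₂, (1 + rotInv (q.2 k) * (Complex.exp w - 1)) :=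
      (Finset.prod_filter_mul_prod_filter_not _ _ _).symm
    have hcard : (pointCount x n none q.1 : ℂ) = S₁.card + S₂.card := by
      rw [← card_segIndices, ← hS, ← Finset.card_filter_add_card_filter_not (s := S)
        (fun k ↦ (n : ℝ) * q.2 k ∈ Set.Ico (-(m : ℝ)) m)]
      push_cast
      rfl
    change ∏ k ∈ S, (1 + rotInv (q.2 k) * (Complex.exp w - 1)) = _ * (∏ k ∈ S₁,
      (1 + rotInv (q.2 k) * (Complex.exp w - 1)) * Complex.exp (-(1 / 2 * w))) * _
    rw [e1, hP, Finset.prod_mul_distrib, Finset.prod_mul_distrib, Finset.prod_const,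
      ← Complex.exp_sum, ← Complex.exp_nat_mul]
    have e2 : expMul (Complex.I * Real.pi * ((pointCount x n none q.1 : ℝ) / n : ℝ)) z
        * Complex.exp (S₁.card * -(1 / 2 * w)) * Complex.exp a *
        Complex.exp (∑ k ∈ S₂, -(rotInv (q.2 k) * w)) = 1 := by
      simp only [expMul, ContinuousMap.coe_mk]
      rw [← Complex.exp_add, ← Complex.exp_add, ← Complex.exp_add, Complex.exp_eq_one_iff]
      refine ⟨0, ?_⟩
      rw [ha, Finset.sum_sub_distrib, Finset.sum_neg_distrib, ← Finset.sum_mul, Finset.sum_const,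
        nsmul_eq_mul]
      have : Complex.I * Real.pi * ((pointCount x n none q.1 : ℝ) / n : ℝ) * z
          = 1 / 2 * w * (S₁.card + S₂.card) := by
        rw [← hcard, hw]; push_cast; ring
      rw [this]
      push_cast
      ring
    linear_combination (-(∏ k ∈ S₁, (1 + rotInv (q.2 k) * (Complex.exp w - 1))) *
      ∏ k ∈ S₂, (1 + rotInv (q.2 k) * (Complex.exp w - 1))) * e2

theorem segProd_approx (hc : IsCoupling μ p Y x) (A : ℝ) {δ ε : ℝ} (hδ : 0 < δ) (hε : 0 < ε) :
    ∀ᶠ m : ℕ in atTop, ∀ᶠ n : ℕ in atTop, model μ uniformAngle n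
      {q | ¬ ∀ z, ‖z‖ ≤ A → ∃ T : ℂ, ‖T - 1‖ ≤ δ ∧ segProd x n q z =
        (expMul (Complex.I * Real.pi * ((pointCount x n none q.1 : ℝ) / n : ℝ)) *
          windowProd x m n q) z * T} ≤ ENNReal.ofReal ε := by
  have hpi := Real.pi_pos
  have hL : 0 < Real.log (1 + δ) := Real.log_pos (by linarith)
  set L := Real.log (1 + δ) with hLdef
  have hexp : Real.exp L - 1 = δ := by rw [hLdef, Real.exp_log (by linarith)]; ring
  set B := 2 * Real.pi * |A| with hB
  have hB0 : 0 ≤ B := by positivity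
  obtain ⟨r, hr0, hr1, hr2⟩ : ∃ r > 0, B * r ≤ L / 2 ∧ 7 * B ^ 2 * r ≤ L / 2 := by
    refine ⟨L / 2 / (B + 7 * B ^ 2 + 1), by positivity, ?_, ?_⟩ <;>
    · rw [mul_div_assoc', div_le_iff₀ (by positivity), mul_comm]
      refine mul_le_mul_of_nonneg_left ?_ (by positivity)
      nlinarith [sq_nonneg B]
  have ht1 : Tendsto (fun m : ℕ ↦ (1 / r ^ 2 + 1 / r) / (m : ℝ)) atTop (𝓝 0) :=
    tendsto_const_div_atTop_nhds_zero_nat _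
  filter_upwards [ht1.eventually_le_const hε, eventually_gt_atTop 0,
    tendsto_natCast_atTop_atTop.eventually_ge_atTop B] with m hm1 hm0 hmB
  filter_upwards [eventually_gt_atTop 0,
    (tendsto_const_div_atTop_nhds_zero_nat B).eventually_le_const one_pos] with n hn0 hnB
  have hae : ∀ᵐ q ∂model μ uniformAngle n, (∀ k, rot (q.2 k) ≠ 1) ∧ ∀ k, |q.2 k| ≤ 1 / 2 := by
    have h1 : ∀ k : Fin n, ∀ᵐ q ∂model μ uniformAngle n, |q.2 k| ≤ 1 / 2 := fun k ↦ by
      have hk : MeasurePreserving (fun q : Ω × (Fin n → ℝ) ↦ q.2 k) (model μ uniformAngle n)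
        uniformAngle := (measurePreserving_eval (fun _ : Fin n ↦ uniformAngle) k).comp
          measurePreserving_snd
      exact hk.quasiMeasurePreserving.ae ae_abs_le_uniformAngle
    have h2 : ∀ k : Fin n, ∀ᵐ q ∂model μ uniformAngle n, rot (q.2 k) ≠ 1 := fun k ↦ by
      have hk : MeasurePreserving (fun q : Ω × (Fin n → ℝ) ↦ q.2 k) (model μ uniformAngle n)
        uniformAngle := (measurePreserving_eval (fun _ : Fin n ↦ uniformAngle) k).comp
          measurePreserving_snd
      exact hk.quasiMeasurePreserving.ae ae_rot_ne_one
    filter_upwards [ae_all_iff.2 h1, ae_all_iff.2 h2] with q h1 h2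
    exact ⟨h2, h1⟩
  refine le_trans (measure_mono_ae ?_) ((measure_le_sum_rotInvTail hc hn0
    (m := m) (by exact_mod_cast hm0) hr0).trans (ENNReal.ofReal_le_ofReal hm1))
  filter_upwards [hae] with q hq hbad
  by_contra hgood
  refine hbad fun z hz ↦ ?_
  have hgood' : ¬ (r * n ≤ |∑ k ∈ segIndices x n q.1, (rotInvTail (m / n) (q.2 k)).im| ∨
        r * n ^ 2 ≤ ∑ k ∈ segIndices x n q.1, ‖rotInvTail (m / n) (q.2 k)‖ ^ 2) := hgood
  push Not at hgood'
  rw [← hexp]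
  exact segProd_eq_windowProd_mul hn0 q hq.1 hq.2 (abs_nonneg A) hnB hmB hm0 hr1 hr2 hgood'.1.le
    hgood'.2.le (hz.trans (le_abs_self A))

end

/-! ### Uniform angles close to the origin -/

/-- Near the origin (e^w - 1) / (1 - e^v) is close to -w / v, and e^{-w/2} is close to 1. The ratio
|w| / |v| being bounded by C, the total error is linear in |w|. -/
theorem norm_factor_sub_le {v w : ℂ} {C : ℝ} (hv : ‖v‖ ≤ 1 / 2) (hv0 : v ≠ 0) (hw : ‖w‖ ≤ 1)
    (hC : ‖w‖ ≤ C * ‖v‖) :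
    ‖(1 + (1 - Complex.exp v)⁻¹ * (Complex.exp w - 1)) * Complex.exp (-(1 / 2 * w)) - (1 - w / v)‖
      ≤ 5 * (1 + C) * ‖w‖ := by
  have hvn : 0 < ‖v‖ := norm_pos_iff.2 hv0
  have hC0 : 0 ≤ C := by
    by_contra! h
    have := mul_neg_of_neg_of_pos h hvn
    linarith [norm_nonneg w]
  have hE := Complex.norm_exp_sub_one_sub_id_le hw
  have hV := Complex.norm_exp_sub_one_sub_id_le (hv.trans (by norm_num))
  set E := Complex.exp w - 1 with hEdef
  set V := Complex.exp v - 1 with hVdef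
  have hVn : ‖v‖ / 2 ≤ ‖V‖ := by
    have h1 := norm_sub_norm_le v (v - V)
    rw [sub_sub_cancel, norm_sub_rev v V] at h1
    nlinarith
  have hVpos : 0 < ‖V‖ := by linarith
  have hV0 : V ≠ 0 := norm_pos_iff.1 hVpos
  have h1 : ‖E / V - w / v‖ ≤ 2 * (1 + C) * ‖w‖ := by
    have e : E / V - w / v = ((E - w) * v - w * (V - v)) / (v * V) := by
      field_simp; ring
    rw [e, norm_div, norm_mul v V, div_le_iff₀ (by positivity)]
    have h2 : ‖(E - w) * v - w * (V - v)‖ ≤ ‖w‖ ^ 2 * ‖v‖ + ‖w‖ * ‖v‖ ^ 2 := by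
      refine (norm_sub_le _ _).trans ?_
      rw [norm_mul, norm_mul]
      gcongr
    calc _ ≤ ‖w‖ ^ 2 * ‖v‖ + ‖w‖ * ‖v‖ ^ 2 := h2
      _ ≤ ‖w‖ * (C * ‖v‖) * ‖v‖ + ‖w‖ * ‖v‖ ^ 2 := by rw [sq ‖w‖]; gcongr
      _ = 2 * (1 + C) * ‖w‖ * (‖v‖ * (‖v‖ / 2)) := by ring
      _ ≤ _ := by gcongr
  have hhalf : ‖-(1 / 2 * w)‖ = ‖w‖ / 2 := by rw [norm_neg, norm_mul]; norm_num; ring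
  have h2 : ‖Complex.exp (-(1 / 2 * w)) - 1‖ ≤ ‖w‖ := by
    refine (Complex.norm_exp_sub_one_le (by rw [hhalf]; linarith)).trans ?_
    rw [hhalf]; linarith
  have h3 : ‖Complex.exp (-(1 / 2 * w))‖ ≤ 2 := by
    have := norm_add_le (Complex.exp (-(1 / 2 * w)) - 1) 1
    rw [sub_add_cancel, norm_one] at this
    linarith
  have h4 : ‖1 - w / v‖ ≤ 1 + C := by
    refine (norm_sub_le _ _).trans ?_
    rw [norm_one, norm_div]
    have := (div_le_iff₀ hvn).2 hC
    linarith
  have e : (1 + (1 - Complex.exp v)⁻¹ * E) * Complex.exp (-(1 / 2 * w)) - (1 - w / v)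
      = -(E / V - w / v) * Complex.exp (-(1 / 2 * w))
        + (1 - w / v) * (Complex.exp (-(1 / 2 * w)) - 1) := by
    have : (1 - Complex.exp v)⁻¹ = -V⁻¹ := by rw [hVdef, ← inv_neg, neg_sub]
    rw [this, div_eq_mul_inv E V]
    ring
  rw [e]
  refine (norm_add_le _ _).trans ?_
  rw [norm_mul, norm_mul, norm_neg]
  have h5 : ‖E / V - w / v‖ * ‖Complex.exp (-(1 / 2 * w))‖ ≤ 2 * (1 + C) * ‖w‖ * 2 := by gcongr
  have h6 : ‖1 - w / v‖ * ‖Complex.exp (-(1 / 2 * w)) - 1‖ ≤ (1 + C) * ‖w‖ := by gcongr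
  linarith

theorem norm_prod_sub_prod_le {ι : Type*} (S : Finset ι) {a b : ι → ℂ} {D κ : ℝ} (hD : 1 ≤ D)
    (hκ : 0 ≤ κ) (ha : ∀ k ∈ S, ‖a k‖ ≤ D) (hb : ∀ k ∈ S, ‖b k‖ ≤ D)
    (hab : ∀ k ∈ S, ‖a k - b k‖ ≤ κ) :
    ‖∏ k ∈ S, a k - ∏ k ∈ S, b k‖ ≤ S.card * D ^ S.card * κ := by
  classical
  induction S using Finset.induction_on with
  | empty => simp
  | insert k S hk ih =>
    have ih' := ih (fun j hj ↦ ha j (Finset.mem_insert_of_mem hj))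
      (fun j hj ↦ hb j (Finset.mem_insert_of_mem hj))
      (fun j hj ↦ hab j (Finset.mem_insert_of_mem hj))
    have hak := ha k (Finset.mem_insert_self k S)
    have habk := hab k (Finset.mem_insert_self k S)
    have hbS : ‖∏ j ∈ S, b j‖ ≤ D ^ S.card := by
      rw [norm_prod, ← Finset.prod_const]
      exact Finset.prod_le_prod (fun _ _ ↦ norm_nonneg _)
        fun j hj ↦ hb j (Finset.mem_insert_of_mem hj)
    have hD0 : 0 ≤ D := zero_le_one.trans hD
    rw [Finset.prod_insert hk, Finset.prod_insert hk, Finset.card_insert_of_notMem hk]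
    have e : a k * ∏ j ∈ S, a j - b k * ∏ j ∈ S, b j
        = a k * (∏ j ∈ S, a j - ∏ j ∈ S, b j) + (a k - b k) * ∏ j ∈ S, b j := by ring
    rw [e]
    calc _ ≤ D * (S.card * D ^ S.card * κ) + κ * D ^ S.card := by
          refine (norm_add_le _ _).trans ?_
          rw [norm_mul, norm_mul]
          gcongr
      _ ≤ D * (S.card * D ^ S.card * κ) + κ * D ^ (S.card + 1) := by
          gcongr
          · omega
      _ = _ := by push_cast; ring

/-! ### Cells -/

/-- Rounding down to a multiple of `1 / (q + 1)`. -/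
noncomputable def roundDown (q : ℕ) (t : ℝ) : ℝ := (⌊((q : ℝ) + 1) * t⌋ : ℝ) / (q + 1)

theorem abs_sub_roundDown_le (q : ℕ) (t : ℝ) : |t - roundDown q t| ≤ 1 / ((q : ℝ) + 1) := by
  have hq : (0 : ℝ) < (q : ℝ) + 1 := by positivity
  have h1 := Int.floor_le (((q : ℝ) + 1) * t)
  have h2 := Int.lt_floor_add_one (((q : ℝ) + 1) * t)
  have e : t - roundDown q t = (((q : ℝ) + 1) * t - ⌊((q : ℝ) + 1) * t⌋) / (q + 1) := by
    rw [roundDown]; field_simp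
  rw [e, abs_div, abs_of_pos hq]
  gcongr
  rw [abs_le]
  constructor <;> linarith

theorem tendsto_roundDown (t : ℝ) : Tendsto (fun q ↦ roundDown q t) atTop (𝓝 t) := by
  rw [tendsto_iff_norm_sub_tendsto_zero]
  refine squeeze_zero (fun _ ↦ norm_nonneg _) (fun q ↦ ?_) tendsto_one_div_add_atTop_nhds_zero_nat
  rw [norm_sub_rev]
  exact abs_sub_roundDown_le q t

/-- The left end of a cell. -/
noncomputable def cellPoint (m q : ℕ) (i : Fin (2 * m * (q + 1))) : ℝ :=
  (((i : ℕ) : ℝ) - m * (q + 1)) / (q + 1)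

/-- Division of `[-m,m)` into intervals of length `1 / (q + 1)`. -/
def cell (m q : ℕ) (i : Fin (2 * m * (q + 1))) : Set ℝ :=
  Set.Ico (cellPoint m q i) (cellPoint m q i + 1 / (q + 1))

theorem mem_cell_iff {m q : ℕ} {i : Fin (2 * m * (q + 1))} {t : ℝ} :
    t ∈ cell m q i ↔ ⌊((q : ℝ) + 1) * t⌋ = ((i : ℕ) : ℤ) - m * (q + 1) := by
  have hq : (0 : ℝ) < (q : ℝ) + 1 := by positivity
  rw [cell, cellPoint, Set.mem_Ico, Int.floor_eq_iff, ← add_div, div_le_iff₀' hq, lt_div_iff₀' hq]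
  push_cast
  rfl

theorem roundDown_of_mem_cell {m q : ℕ} {i : Fin (2 * m * (q + 1))} {t : ℝ} (h : t ∈ cell m q i) :
    roundDown q t = cellPoint m q i := by
  rw [roundDown, mem_cell_iff.1 h, cellPoint]
  push_cast
  rfl

theorem exists_mem_cell_iff {m q : ℕ} {t : ℝ} :
    (∃ i, t ∈ cell m q i) ↔ t ∈ Set.Ico (-(m : ℝ)) m := by
  have hq : (0 : ℝ) < (q : ℝ) + 1 := by positivity
  have h1 : -(m : ℝ) ≤ t ↔ (-(m * (q + 1) : ℕ) : ℤ) ≤ ⌊((q : ℝ) + 1) * t⌋ := by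
    rw [Int.le_floor]
    push_cast
    constructor <;> intro h <;> nlinarith
  have h2 : t < m ↔ ⌊((q : ℝ) + 1) * t⌋ < ((m * (q + 1) : ℕ) : ℤ) := by
    rw [Int.floor_lt]
    push_cast
    constructor <;> intro h <;> nlinarith
  simp only [Set.mem_Ico, h1, h2, mem_cell_iff]
  push_cast
  constructor
  · rintro ⟨i, hi⟩
    have := i.2
    rw [hi]
    zify at this
    constructor <;> linarith
  · rintro ⟨h, h'⟩
    refine ⟨⟨(⌊((q : ℝ) + 1) * t⌋ + m * (q + 1)).toNat, ?_⟩, ?_⟩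
    · zify
      rw [Int.toNat_of_nonneg (by linarith)]
      linarith
    · simp only
      rw [Int.toNat_of_nonneg (by linarith)]
      ring

theorem pairwise_disjoint_cell (m q : ℕ) : Pairwise (Function.onFun Disjoint (cell m q)) := by
  intro i j hij
  refine Set.disjoint_left.2 fun t hi hj ↦ hij ?_
  have := (mem_cell_iff.1 hi).symm.trans (mem_cell_iff.1 hj)
  exact Fin.ext (by exact_mod_cast sub_left_injective this)

theorem cell_subset (m q : ℕ) (i : Fin (2 * m * (q + 1))) : cell m q i ⊆ Set.Ico (-(m : ℝ)) m :=
  fun _ ht ↦ exists_mem_cell_iff.1 ⟨i, ht⟩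

open Classical in
-- Grouping by cells: a product over the points of the window, once rounded down, depends only on
-- the counts in the cells, so it is a continuous function of the observables.
theorem prod_pow_card_cell {ι M : Type*} [CommMonoid M] (m q : ℕ) (S : Finset ι) (τ : ι → ℝ)
    (f : ℝ → M) :
    ∏ i, f (cellPoint m q i) ^ (S.filter fun k ↦ τ k ∈ cell m q i).card
      = ∏ k ∈ S.filter fun k ↦ τ k ∈ Set.Ico (-(m : ℝ)) m, f (roundDown q (τ k)) := by
  have h1 : ∀ i, f (cellPoint m q i) ^ (S.filter fun k ↦ τ k ∈ cell m q i).card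
      = ∏ k ∈ S, if τ k ∈ cell m q i then f (roundDown q (τ k)) else 1 := by
    intro i
    rw [← Finset.prod_filter, ← Finset.prod_const]
    exact Finset.prod_congr rfl fun k hk ↦ by
      rw [roundDown_of_mem_cell (Finset.mem_filter.1 hk).2]
  rw [Finset.prod_congr rfl fun i _ ↦ h1 i, Finset.prod_comm, Finset.prod_filter]
  refine Finset.prod_congr rfl fun k _ ↦ ?_
  split_ifs with h
  · obtain ⟨i, hi⟩ := (exists_mem_cell_iff (q := q)).2 h
    rw [Finset.prod_eq_single i, if_pos hi]
    · intro j _ hj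
      rw [if_neg fun hj' ↦ Set.disjoint_left.1 (pairwise_disjoint_cell m q hj) hj' hi]
    · simp
  · exact Finset.prod_eq_one fun i _ ↦ if_neg fun hi ↦ h (exists_mem_cell_iff.1 ⟨i, hi⟩)

theorem continuousAt_linFactor {s : ℝ} (hs : s ≠ 0) : ContinuousAt linFactor s := by
  let g : C(ℂ, C(ℂ, ℂ)) := ContinuousMap.curry ⟨fun q ↦ 1 - q.2 * q.1, by fun_prop⟩
  have e : linFactor = fun s : ℝ ↦ g ((s : ℂ)⁻¹) := by
    ext s z
    simp [linFactor, g, div_eq_mul_inv]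
  rw [e]
  refine g.continuous.continuousAt.comp (ContinuousAt.inv₀ (by fun_prop) ?_)
  exact_mod_cast hs

open Classical in
/-- The product over the points of a point process in `[-m,m)`, if the intensity is positive. -/
noncomputable def poissonWindow (c : ℝ) (w : ℤ → ℝ) (m : ℕ) : C(ℂ, ℂ) :=
  if 0 < c then ∏ᶠ k ∈ w ⁻¹' Set.Ico (-(m : ℝ)) m, linFactor (w k) else 1

/-- The window contains finitely many points, none at the origin, and each rounded point tends to
the point itself. Without intensity both sides are empty products. -/
theorem tendsto_prod_linFactor_cell {γ Ω : Type*} {G : Ω → γ} {c : γ → ℝ} {w : Ω → ℤ → ℝ} {ω : Ω}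
    (m : ℕ) (hfin : 0 < c (G ω) → (w ω ⁻¹' Set.Ico (-(m : ℝ)) m).encard ≠ ⊤)
    (h0 : 0 < c (G ω) → ∀ k, w ω k ≠ 0) :
    Tendsto (fun q ↦ ∏ i, linFactor (cellPoint m q i) ^ poissonCount G c w (cell m q i) ω) atTop
      (𝓝 (poissonWindow (c (G ω)) (w ω) m)) := by
  classical
  by_cases hc : 0 < c (G ω)
  · have hf : (w ω ⁻¹' Set.Ico (-(m : ℝ)) m).Finite := Set.encard_ne_top_iff.1 (hfin hc)
    have e : ∀ q, ∏ i, linFactor (cellPoint m q i) ^ poissonCount G c w (cell m q i) ω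
        = ∏ k ∈ hf.toFinset, linFactor (roundDown q (w ω k)) := by
      intro q
      have h1 : ∀ i, poissonCount G c w (cell m q i) ω
          = (hf.toFinset.filter fun k ↦ w ω k ∈ cell m q i).card := by
        intro i
        rw [poissonCount, if_pos hc, ← Set.ncard_coe_finset]
        congr 1
        ext k
        simp only [Set.mem_preimage, Finset.coe_filter, Set.Finite.mem_toFinset, Set.mem_ofPred_eq]
        exact ⟨fun h ↦ ⟨cell_subset m q i h, h⟩, fun h ↦ h.2⟩
      simp only [h1]
      rw [prod_pow_card_cell m q hf.toFinset (w ω) linFactor]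
      refine Finset.prod_congr (Finset.filter_true_of_mem fun k hk ↦ ?_) fun _ _ ↦ rfl
      simpa using hk
    simp only [e]
    rw [poissonWindow, if_pos hc, finprod_mem_eq_finite_toFinset_prod _ hf]
    exact tendsto_finsetProd _ fun k _ ↦
      (continuousAt_linFactor (h0 hc k)).tendsto.comp (tendsto_roundDown (w ω k))
  · simp [poissonWindow, poissonCount, hc]

/-! ### Angles in a window -/

theorem volume_mul_mem {n : ℕ} (hn : 0 < n) (I : Set ℝ) :
    (n : ENNReal) * volume {t : ℝ | (n : ℝ) * t ∈ I} = volume I := by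
  have h := Real.volume_preimage_mul_left (a := n) (by positivity) I
  have e : {t : ℝ | (n : ℝ) * t ∈ I} = (fun t ↦ (n : ℝ) * t) ⁻¹' I := rfl
  rw [e, h, abs_of_nonneg (by positivity), ← mul_assoc, ENNReal.ofReal_inv_of_pos (by positivity),
    ENNReal.ofReal_natCast, ENNReal.mul_inv_cancel (by positivity) (ENNReal.natCast_ne_top n),
    one_mul]

theorem natCast_mul_uniformAngle_le {n : ℕ} (hn : 0 < n) {I : Set ℝ} :
    (n : ENNReal) * uniformAngle {t | (n : ℝ) * t ∈ I} ≤ volume I := by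
  rw [← volume_mul_mem hn I]
  gcongr
  exact Measure.restrict_le_self

theorem tendsto_natCast_mul_uniformAngle {m : ℕ} {I : Set ℝ} (hI : MeasurableSet I)
    (h : I ⊆ Set.Ico (-(m : ℝ)) m) :
    Tendsto (fun n : ℕ ↦ (n : ℝ) * uniformAngle.real {t | (n : ℝ) * t ∈ I}) atTop
      (𝓝 (volume.real I)) := by
  refine tendsto_const_nhds.congr' ?_
  -- For n ≥ 2m the rescaled set is contained in [-1/2, 1/2), where the density is one: the sequence
  -- is eventually constant.
  filter_upwards [eventually_ge_atTop (2 * m), eventually_gt_atTop 0] with n hn hn0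
  have hn' : (2 * m : ℝ) ≤ n := by exact_mod_cast hn
  have hn0' : (0 : ℝ) < n := by exact_mod_cast hn0
  have e : uniformAngle {t | (n : ℝ) * t ∈ I} = volume {t : ℝ | (n : ℝ) * t ∈ I} := by
    have hm : MeasurableSet {t : ℝ | (n : ℝ) * t ∈ I} := (measurable_id.const_mul (n : ℝ)) hI
    rw [uniformAngle, Measure.restrict_apply hm]
    congr 1
    refine Set.inter_eq_left.2 fun t ht ↦ ?_
    have ht' := h ht
    constructor <;> nlinarith [ht'.1, ht'.2]
  have h1 := volume_mul_mem hn0 I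
  rw [← e] at h1
  rw [measureReal_def, measureReal_def, ← h1, ENNReal.toReal_mul, ENNReal.toReal_natCast]

section

variable {Ω : Type*}

theorem cellCount_eq_card (x : Ω → ℕ → Point) (n : ℕ) (I : Set ℝ) (q : Ω × (Fin n → ℝ))
    [DecidablePred fun k : Fin n ↦ (n : ℝ) * q.2 k ∈ I] :
    cellCount x n I q = ((segIndices x n q.1).filter fun k ↦ (n : ℝ) * q.2 k ∈ I).card := by
  classical
  rw [cellCount, segIndices, Finset.filter_filter, Finset.card_filter]
  congr!

variable [MeasurableSpace Ω] {μ : Measure Ω} [IsProbabilityMeasure μ]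
  {p : Measure (ℕ → ℝ)} {Y : Ω → ℕ → ℝ} {x : Ω → ℕ → Point}

theorem measure_le_cellCount (hc : IsCoupling μ p Y x) {n : ℕ} (hn : 0 < n) {I : Set ℝ}
    (hI : MeasurableSet I) {N : ℕ} (hN : 0 < N) :
    model μ uniformAngle n {q | N ≤ cellCount x n I q} ≤ volume I / N := by
  have hm : Measurable fun q ↦ (cellCount x n I q : ENNReal) :=
    measurable_from_nat.comp (measurable_cellCount hc n hI)
  have h := meas_ge_le_lintegral_div (μ := model μ uniformAngle n) hm.aemeasurable
    (ε := (N : ENNReal)) (by positivity) (ENNReal.natCast_ne_top N)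
  simp only [Nat.cast_le] at h
  refine h.trans (ENNReal.div_le_div_right ?_ _)
  exact (lintegral_cellCount_le x n hI).trans (natCast_mul_uniformAngle_le hn)

theorem measurable_windowProd (hc : IsCoupling μ p Y x) (m n : ℕ) :
    Measurable (windowProd x m n) := by
  classical
  let g : C(ℂ, C(ℂ, ℂ)) := ContinuousMap.curry ⟨fun q ↦
    (1 + q.1 * (Complex.exp (2 * Complex.I * Real.pi * (q.2 / n)) - 1)) *
      Complex.exp (-(1 / 2 * (2 * Complex.I * Real.pi * (q.2 / n)))), by fun_prop⟩
  have e : windowProd x m n = fun q ↦ ∏ k : Fin n,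
      if label (x q.1 k) = none ∧ (n : ℝ) * q.2 k ∈ Set.Ico (-(m : ℝ)) m then g (rotInv (q.2 k))
      else 1 := by
    ext q z
    rw [ContinuousMap.prod_apply]
    simp only [windowProd, segIndices, Finset.filter_filter, ContinuousMap.coe_mk]
    rw [Finset.prod_filter]
    refine Finset.prod_congr rfl fun k _ ↦ ?_
    split_ifs <;> rfl
  rw [e]
  refine Finset.measurable_prod _ fun k _ ↦ ?_
  refine measurable_apply_label hc n (γ := fun c t ↦
    if c = none ∧ (n : ℝ) * t ∈ Set.Ico (-(m : ℝ)) m then g (rotInv t) else 1) (fun c ↦ ?_) k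
  by_cases h : c = none
  · simp only [h, true_and]
    exact Measurable.ite ((measurable_id.const_mul (n : ℝ)) measurableSet_Ico)
      (g.continuous.measurable.comp measurable_rotInv) measurable_const
  · simp [h]

end

/-- Here v = 2iπt and w = 2iπz/n, so w / v = z / (n t). The lower bound η on |n t| keeps this ratio
bounded as n grows. -/
theorem eventually_norm_window_factor_sub_le {η : ℝ} (hη : 0 < η) (m : ℕ) {A : ℝ} (hA : 0 ≤ A)
    {κ : ℝ} (hκ : 0 < κ) : ∀ᶠ n : ℕ in atTop, ∀ t : ℝ, η ≤ |n * t| → |n * t| ≤ m → ∀ z : ℂ, ‖z‖ ≤ A →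
      ‖(1 + rotInv t * (Complex.exp (2 * Complex.I * Real.pi * (z / n)) - 1)) *
        Complex.exp (-(1 / 2 * (2 * Complex.I * Real.pi * (z / n)))) - (1 - z / (n * t : ℝ))‖ ≤ κ := by
  have hpi := Real.pi_pos
  filter_upwards [eventually_gt_atTop 0,
    (tendsto_const_div_atTop_nhds_zero_nat (2 * Real.pi * m)).eventually_le_const
      (by norm_num : (0 : ℝ) < 1 / 2),
    (tendsto_const_div_atTop_nhds_zero_nat (2 * Real.pi * A)).eventually_le_const one_pos,
    (tendsto_const_div_atTop_nhds_zero_nat (5 * (1 + A / η) * (2 * Real.pi * A))).eventually_le_const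
      hκ] with n hn h1 h2 h3 t ht htm z hz
  have hn' : (0 : ℝ) < n := by exact_mod_cast hn
  have ht0 : t ≠ 0 := by
    rintro rfl
    simp only [mul_zero, abs_zero] at ht
    linarith
  have htn : |(n : ℝ) * t| = n * |t| := by rw [abs_mul, abs_of_pos hn']
  rw [htn] at ht htm
  have hvn : ‖2 * Complex.I * Real.pi * (t : ℂ)‖ = 2 * Real.pi * |t| := by
    simp [abs_of_pos hpi]
  have hwn : ‖2 * Complex.I * Real.pi * (z / n)‖ ≤ 2 * Real.pi * A / n := by
    rw [norm_two_pi_I_mul_div]; gcongr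
  have hv0 : 2 * Complex.I * Real.pi * (t : ℂ) ≠ 0 := by
    rw [← norm_pos_iff, hvn]
    have := abs_pos.2 ht0
    positivity
  have h := norm_factor_sub_le (v := 2 * Complex.I * Real.pi * (t : ℂ))
    (w := 2 * Complex.I * Real.pi * (z / n)) (C := A / η) ?_ hv0 (hwn.trans h2) ?_
  · rw [← coe_rot] at h
    have e : 2 * Complex.I * Real.pi * (z / n) / (2 * Complex.I * Real.pi * (t : ℂ))
        = z / (n * t : ℝ) := by
      rw [mul_div_mul_left _ _ (left_ne_zero_of_mul hv0), div_div]
      push_cast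
      rfl
    rw [e] at h
    refine (h.trans ?_).trans h3
    rw [mul_div_assoc]
    gcongr
  · rw [hvn]
    refine le_trans ?_ h1
    rw [le_div_iff₀ hn']
    nlinarith
  · rw [hvn]
    refine hwn.trans ?_
    rw [div_le_iff₀ hn', div_mul_eq_mul_div, div_mul_eq_mul_div, le_div_iff₀ hη]
    calc 2 * Real.pi * A * η ≤ 2 * Real.pi * A * (n * |t|) := by gcongr
      _ = _ := by ring

theorem abs_inv_roundDown_sub_le {η : ℝ} (hη : 0 < η) {q : ℕ} (hq : 1 / ((q : ℝ) + 1) ≤ η / 2)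
    {t : ℝ} (ht : η ≤ |t|) : η / 2 ≤ |roundDown q t| ∧
      |1 / t - 1 / roundDown q t| ≤ 2 / η ^ 2 * (1 / ((q : ℝ) + 1)) := by
  have h1 := abs_sub_roundDown_le q t
  have h2 := abs_sub_abs_le_abs_sub t (roundDown q t)
  have h3 : η / 2 ≤ |roundDown q t| := by linarith
  refine ⟨h3, ?_⟩
  have ht0 : t ≠ 0 := abs_pos.1 (hη.trans_le ht)
  have hs0 : roundDown q t ≠ 0 := abs_pos.1 ((half_pos hη).trans_le h3)
  have e : 1 / t - 1 / roundDown q t = (roundDown q t - t) / (t * roundDown q t) := by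
    field_simp
  rw [e, abs_div, abs_mul, abs_sub_comm]
  calc |t - roundDown q t| / (|t| * |roundDown q t|) ≤ 1 / ((q : ℝ) + 1) / (η * (η / 2)) := by
        gcongr
    _ = _ := by field_simp

/-! ### Convergence of the product over the circles and over a window -/

theorem exists_norm_circleClip_le (m : ℕ) (A : ℝ) : ∃ B, ∀ e : (Fin m → ℝ) × (Fin m → Circle),
    (∀ j, e.1 j ∈ Set.Icc (0 : ℝ) 1) → ∀ z : ℂ, ‖z‖ ≤ A → ‖circleClip m e z‖ ≤ B := by
  have hK : IsCompact (((Set.univ.pi fun _ : Fin m ↦ Set.Icc (0 : ℝ) 1) ×ˢ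
      (Set.univ : Set (Fin m → Circle))) ×ˢ Metric.closedBall (0 : ℂ) A) :=
    ((isCompact_univ_pi fun _ ↦ isCompact_Icc).prod isCompact_univ).prod (isCompact_closedBall 0 A)
  have hcont : Continuous fun q : ((Fin m → ℝ) × (Fin m → Circle)) × ℂ ↦ circleClip m q.1 q.2 := by
    have := (circleClip m).continuous
    fun_prop
  obtain ⟨B, hB⟩ := hK.exists_bound_of_continuousOn hcont.continuousOn
  refine ⟨B, fun e he z hz ↦ hB (e, z) ⟨⟨fun j _ ↦ he j, trivial⟩, ?_⟩⟩
  simpa using hz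

theorem norm_expMul_le {s A : ℝ} (hs : s ∈ Set.Icc (0 : ℝ) 1) {z : ℂ} (hz : ‖z‖ ≤ A) :
    ‖expMul (Complex.I * Real.pi * s) z‖ ≤ Real.exp (Real.pi * A) := by
  have hpi := Real.pi_pos
  simp only [expMul, ContinuousMap.coe_mk]
  refine (Complex.norm_exp_le_exp_norm _).trans (Real.exp_le_exp.2 ?_)
  rw [norm_mul, norm_mul, norm_mul, Complex.norm_I, one_mul, Complex.norm_real, Complex.norm_real,
    Real.norm_eq_abs, Real.norm_eq_abs, abs_of_pos hpi, abs_of_nonneg hs.1]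
  have h1 : Real.pi * s ≤ Real.pi := mul_le_of_le_one_right hpi.le hs.2
  have := norm_nonneg z
  gcongr

section

variable {Ω Ω' : Type*} [MeasurableSpace Ω] [MeasurableSpace Ω']
  {μ : Measure Ω} [IsProbabilityMeasure μ] {μ' : Measure Ω'} [IsProbabilityMeasure μ']
  {p : Measure (ℕ → ℝ)} {Y : Ω → ℕ → ℝ} {x : Ω → ℕ → Point} {y : Ω' → ℕ → ℝ} {u : Ω' → ℕ → ℂ}
  {w : Ω' → ℤ → ℝ}

/-- The intensity as a function of the perimeters. -/
noncomputable def intensity (g : (ℕ → ℝ) × (ℕ → ℂ)) : ℝ := 1 - ∑' j, g.1 j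

theorem measurable_intensity : Measurable intensity :=
  measurable_const.sub (measurable_tsum_nat.comp measurable_fst)

/-- Up to probability ε, no point of the segment has a rescaled angle in (-η, η), of length ε / 2,
and fewer than M points fall in the window, by Markov's inequality. Then there is a bounded number
of factors, each uniformly close to the linear factor at the rounded point, and a telescoping
estimate compares the products. -/
theorem cell_product_approx (hc : IsCoupling μ p Y x) (m R : ℕ) (A : ℝ) {δ ε : ℝ} (hδ : 0 < δ)
    (hε : 0 < ε) : ∀ᶠ q : ℕ in atTop, ∀ᶠ n : ℕ in atTop, model μ uniformAngle n
      {ω | ¬ ∀ z, ‖z‖ ≤ A →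
        ‖(circleClip m (circleData x m n ω) *
          (expMul (Complex.I * Real.pi * ((pointCount x n none ω.1 : ℝ) / n : ℝ)) *
            windowProd x R n ω)) z
          - obsMap (Complex.I * Real.pi) (cellPoint R q) (modelObs x m (cell R q) n ω) z‖ ≤ δ}
      ≤ ENNReal.ofReal ε := by
  classical
  obtain ⟨B, hB⟩ := exists_norm_circleClip_le m A
  obtain ⟨M, hM⟩ : ∃ M : ℕ, 2 * R / M ≤ ε / 2 ∧ 0 < M := by
    have h := tendsto_const_div_atTop_nhds_zero_nat (2 * R : ℝ)
    exact ((h.eventually_le_const (half_pos hε)).and (eventually_gt_atTop 0)).exists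
  obtain ⟨hM1, hM0⟩ := hM
  set η := ε / 4 with hη
  have hη0 : 0 < η := by positivity
  set A' := |A| with hA'
  have hA0 : 0 ≤ A' := abs_nonneg A
  set D := 2 + 2 * A' / η with hD
  have hD1 : 1 ≤ D := by
    have : 0 ≤ 2 * A' / η := by positivity
    linarith
  -- Bound for the circle and exponential factors times the telescoping constant; the added 1 keeps
  -- it positive.
  set E := |B| * Real.exp (Real.pi * A') * (M * D ^ M) + 1 with hE
  have hE0 : 0 < E := by positivity
  set κ := min 1 (δ / E) with hκ
  have hκ0 : 0 < κ := lt_min one_pos (by positivity)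
  have ht1 := tendsto_one_div_add_atTop_nhds_zero_nat (𝕜 := ℝ)
  have ht2 : Tendsto (fun q : ℕ ↦ A' * (2 / η ^ 2 * (1 / ((q : ℝ) + 1)))) atTop (𝓝 0) := by
    simpa using (ht1.const_mul (2 / η ^ 2)).const_mul A'
  filter_upwards [ht1.eventually_le_const (half_pos hη0),
    ht2.eventually_le_const (half_pos hκ0)] with q hq1 hq2
  filter_upwards [eventually_gt_atTop 0, eventually_norm_window_factor_sub_le hη0 R hA0
    (half_pos hκ0)] with n hn0 hn
  have hsub : {ω | ¬ ∀ z, ‖z‖ ≤ A →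
        ‖(circleClip m (circleData x m n ω) *
          (expMul (Complex.I * Real.pi * ((pointCount x n none ω.1 : ℝ) / n : ℝ)) *
            windowProd x R n ω)) z
          - obsMap (Complex.I * Real.pi) (cellPoint R q) (modelObs x m (cell R q) n ω) z‖ ≤ δ}
      ⊆ {ω | 1 ≤ cellCount x n (Set.Ioo (-η) η) ω} ∪
        {ω | M ≤ cellCount x n (Set.Ico (-(R : ℝ)) R) ω} := by
    intro ω hω
    by_contra hgood
    refine hω fun z hz ↦ ?_
    simp only [Set.mem_union, Set.mem_ofPred_eq, not_or, not_le] at hgood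
    obtain ⟨hg1, hg2⟩ := hgood
    rw [cellCount_eq_card] at hg1 hg2
    set S := segIndices x n ω.1 with hS
    set S₁ := S.filter fun k ↦ (n : ℝ) * ω.2 k ∈ Set.Ico (-(R : ℝ)) R with hS₁
    have hz' : ‖z‖ ≤ A' := hz.trans (le_abs_self A)
    have hfar : ∀ k ∈ S₁, η ≤ |(n : ℝ) * ω.2 k| ∧ |(n : ℝ) * ω.2 k| ≤ R := by
      intro k hk
      have hk' := Finset.mem_filter.1 hk
      refine ⟨?_, abs_le.2 ⟨hk'.2.1, hk'.2.2.le⟩⟩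
      by_contra! h
      exact absurd hg1 (not_lt.2 (Finset.card_pos.2
        ⟨k, Finset.mem_filter.2 ⟨hk'.1, abs_lt.1 h⟩⟩))
    let a : Fin n → ℂ := fun k ↦
      (1 + rotInv (ω.2 k) * (Complex.exp (2 * Complex.I * Real.pi * (z / n)) - 1)) *
        Complex.exp (-(1 / 2 * (2 * Complex.I * Real.pi * (z / n))))
    let b : Fin n → ℂ := fun k ↦ linFactor (roundDown q (n * ω.2 k)) z
    have hab : ∀ k ∈ S₁, ‖a k - b k‖ ≤ κ := by
      intro k hk
      obtain ⟨h1, h2⟩ := hfar k hk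
      have h3 := hn (ω.2 k) h1 h2 z hz'
      have h4 := (abs_inv_roundDown_sub_le hη0 hq1 h1).2
      have e : a k - b k = (a k - (1 - z / (n * ω.2 k : ℝ)))
          - z * ((1 / (n * ω.2 k : ℝ) - 1 / roundDown q (n * ω.2 k) : ℝ) : ℂ) := by
        simp only [b, linFactor_apply]
        push_cast
        ring
      rw [e]
      refine (norm_sub_le _ _).trans ?_
      rw [norm_mul, Complex.norm_real, Real.norm_eq_abs]
      have h5 : ‖z‖ * |1 / (n * ω.2 k : ℝ) - 1 / roundDown q (n * ω.2 k)| ≤ κ / 2 :=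
        (mul_le_mul hz' h4 (abs_nonneg _) hA0).trans hq2
      have h3' : ‖a k - (1 - z / (n * ω.2 k : ℝ))‖ ≤ κ / 2 := h3
      linarith
    have hbD : ∀ k ∈ S₁, ‖b k‖ ≤ D - 1 := by
      intro k hk
      have h4 := (abs_inv_roundDown_sub_le hη0 hq1 (hfar k hk).1).1
      simp only [b, linFactor_apply]
      refine (norm_sub_le _ _).trans ?_
      rw [norm_one, norm_div, Complex.norm_real, Real.norm_eq_abs]
      have : ‖z‖ / |roundDown q (n * ω.2 k)| ≤ A' / (η / 2) := by gcongr
      have e : A' / (η / 2) = 2 * A' / η := by field_simp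
      rw [e] at this
      linarith
    have haD : ∀ k ∈ S₁, ‖a k‖ ≤ D := by
      intro k hk
      have h1 := norm_add_le (a k - b k) (b k)
      rw [sub_add_cancel] at h1
      have := hab k hk
      have := hbD k hk
      have : κ ≤ 1 := min_le_left _ _
      linarith
    have hprod := norm_prod_sub_prod_le S₁ hD1 hκ0.le haD
      (fun k hk ↦ (hbD k hk).trans (by linarith)) hab
    have e1 : obsMap (Complex.I * Real.pi) (cellPoint R q) (modelObs x m (cell R q) n ω) z
        = circleClip m (circleData x m n ω) z *
          (expMul (Complex.I * Real.pi * ((pointCount x n none ω.1 : ℝ) / n : ℝ)) z *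
            ∏ k ∈ S₁, b k) := by
      have h1 : ∏ i, linFactor (cellPoint R q i) ^ cellCount x n (cell R q i) ω
          = ∏ k ∈ S₁, linFactor (roundDown q (n * ω.2 k)) := by
        simp only [cellCount_eq_card]
        exact prod_pow_card_cell R q S (fun k ↦ (n : ℝ) * ω.2 k) linFactor
      simp only [obsMap, modelObs, h1, ContinuousMap.mul_apply, ContinuousMap.prod_apply]
      rfl
    have e2 : windowProd x R n ω z = ∏ k ∈ S₁, a k := rfl
    rw [e1, ContinuousMap.mul_apply, ContinuousMap.mul_apply, e2, ← mul_sub, ← mul_sub, norm_mul,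
      norm_mul]
    have hc1 : ‖circleClip m (circleData x m n ω) z‖ ≤ |B| :=
      (hB _ (fun j ↦ labelCount_div_mem _ _) z hz).trans (le_abs_self B)
    have hc2 := norm_expMul_le (A := A') (labelCount_div_mem (labels (x ω.1) n) none) hz'
    have hcard : S₁.card ≤ M := hg2.le
    have hc3 : ‖∏ k ∈ S₁, a k - ∏ k ∈ S₁, b k‖ ≤ M * D ^ M * κ := by
      refine hprod.trans ?_
      have := pow_le_pow_right₀ hD1 hcard
      have : (S₁.card : ℝ) ≤ M := by exact_mod_cast hcard
      gcongr
    calc _ ≤ |B| * (Real.exp (Real.pi * A') * (M * D ^ M * κ)) := by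
          refine mul_le_mul hc1 (mul_le_mul hc2 hc3 (norm_nonneg _) (Real.exp_pos _).le)
            (by positivity) (abs_nonneg B)
      _ = (E - 1) * κ := by rw [hE]; ring
      _ ≤ E * (δ / E) := by
          refine mul_le_mul (by linarith) (min_le_right _ _) hκ0.le hE0.le
      _ = δ := by field_simp
  refine (measure_mono hsub).trans ((measure_union_le _ _).trans ?_)
  refine (add_le_add (measure_le_cellCount hc hn0 measurableSet_Ioo one_pos)
    (measure_le_cellCount hc hn0 measurableSet_Ico hM0)).trans ?_
  rw [Real.volume_Ioo, Real.volume_Ico, Nat.cast_one, div_one, ← ENNReal.ofReal_natCast M,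
    ← ENNReal.ofReal_div_of_pos (by exact_mod_cast hM0),
    ← ENNReal.ofReal_add (by linarith) (by rw [sub_neg_eq_add]; positivity)]
  refine ENNReal.ofReal_le_ofReal ?_
  have e : ((R : ℝ) - -R) / M = 2 * R / M := by ring
  rw [e]
  linarith

/-- At fixed m and R, the cell approximation is a continuous function of the jointly convergent
observables; the mesh 1 / (q + 1) is refined after n has tended to infinity. -/
theorem tendstoInDistribution_window (hc : IsCoupling μ p Y x) (hp : ∀ᵐ l ∂p, l ∈ nabla)
    (hlim : IsLimitData μ' p y u)
    (hw : IsPoissonPoints μ' (fun ω ↦ (y ω, u ω)) intensity w)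
    (h0 : ∀ᵐ ω ∂μ', 0 < intensity (y ω, u ω) → ∀ k, w ω k ≠ 0) (m R : ℕ) :
    TendstoInDistribution (fun n q ↦ circleClip m (circleData x m n q) *
        (expMul (Complex.I * Real.pi * ((pointCount x n none q.1 : ℝ) / n : ℝ)) *
          windowProd x R n q)) atTop
      (fun ω ↦ circleClip m (fun j ↦ y ω j, fun j ↦ limitCircle (y ω j) (u ω j)) *
        (expMul (Complex.I * Real.pi * (1 - (∑' j, y ω j : ℝ))) *
          poissonWindow (intensity (y ω, u ω)) (w ω) R))
      (fun n ↦ model μ uniformAngle n) μ' := by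
  have hG : Measurable fun ω ↦ (y ω, u ω) := hlim.measurable_y.prodMk hlim.measurable_u
  have hcell : ∀ q i, MeasurableSet (cell R q i) := fun q i ↦ measurableSet_Ico
  have hbdd : ∀ q i, Bornology.IsBounded (cell R q i) := fun q i ↦ Metric.isBounded_Ico _ _
  refine tendstoInDistribution_of_approx
    (Xm := fun q n ↦ obsMap (Complex.I * Real.pi) (cellPoint R q) ∘ modelObs x m (cell R q) n)
    (Zm := fun q ↦ obsMap (Complex.I * Real.pi) (cellPoint R q) ∘ limitObs y u m fun ω i ↦
      poissonCount (fun ω ↦ (y ω, u ω)) intensity w (cell R q i) ω) (fun n ↦ ?_) (fun q ↦ ?_) ?_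
    fun A δ ε hδ hε ↦ cell_product_approx hc m R A hδ hε
  · refine Measurable.aemeasurable ?_
    have h1 : Measurable fun q : Ω × (Fin n → ℝ) ↦ (pointCount x n none q.1 : ℝ) / n :=
      (measurable_from_nat.comp ((measurable_pointCount hc n none).comp
        measurable_fst)).div_const _
    have h2 : Measurable fun q : Ω × (Fin n → ℝ) ↦
        Complex.I * Real.pi * (((pointCount x n none q.1 : ℝ) / n : ℝ) : ℂ) :=
      (Complex.measurable_ofReal.comp h1).const_mul _
    have h3 : Measurable fun (q : Ω × (Fin n → ℝ)) (j : Fin m) ↦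
        (pointCount x n (some (j : ℕ)) q.1 : ℝ) / n :=
      measurable_pi_lambda _ fun j ↦ (measurable_from_nat.comp
        ((measurable_pointCount hc n (some (j : ℕ))).comp measurable_fst)).div_const _
    have h4 : Measurable (circleData x m n) :=
      h3.prodMk (measurable_pi_lambda _ fun j ↦ measurable_circleWeight hc n j)
    exact ((circleClip m).continuous.measurable.comp h4).mul
      ((expMulMap.continuous.measurable.comp h2).mul (measurable_windowProd hc R n))
  · refine TendstoInDistribution.continuous_comp (continuous_obsMap _ _) ?_
    refine tendstoInDistribution_modelObs (ν := uniformAngle) hc hp hlim (hcell q)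
      (pairwise_disjoint_cell R q) (lam := fun i ↦ volume.real (cell R q i))
      (fun i ↦ measureReal_nonneg)
      (fun i ↦ tendsto_natCast_mul_uniformAngle (hcell q i) (cell_subset R q i)) (fun k ↦ ?_)
      (measurable_pi_lambda _ fun i ↦
        hw.measurable_poissonCount hG measurable_intensity (hcell q i)) fun ψ hψ hψ1 t ↦ ?_
    · filter_upwards [hp] with l hl h
      exact norm_one_add_sum_fourierCoeffOf_uniformAngle_lt k hl h
    · refine hw.integral_mul_exp_counts hG measurable_intensity (hcell q) (hbdd q)
        (pairwise_disjoint_cell R q) ?_ hψ hψ1 t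
      filter_upwards [hlim.ae_y hp] with ω hω
      exact sub_nonneg.2 hω.2.2.2
  · filter_upwards [h0, hw.ae_encard_ne_top hG measurable_intensity
      (measurableSet_Ico (a := -(R : ℝ)) (b := R)) (Metric.isBounded_Ico _ _)] with ω h1 h2
    have h3 := tendsto_prod_linFactor_cell (G := fun ω ↦ (y ω, u ω)) (c := intensity) (w := w) R h2 h1
    refine ((h3.const_mul _).const_mul _).congr fun q ↦ ?_
    simp only [Function.comp, obsMap, limitObs]
    push_cast
    rfl

/-- Convergence of the model with uniform angles, from the ones of the product over the circles and
of the product over the points of the Poisson process. -/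
theorem tendstoInDistribution_modelXi_uniformAngle (hc : IsCoupling μ p Y x)
    (hp : ∀ᵐ l ∂p, l ∈ nabla) (hdecay : HasExponentialDecay p) (hlim : IsLimitData μ' p y u)
    (hw : IsPoissonPoints μ' (fun ω ↦ (y ω, u ω)) intensity w)
    (h0 : ∀ᵐ ω ∂μ', 0 < intensity (y ω, u ω) → ∀ k, w ω k ≠ 0) {F G : Ω' → C(ℂ, ℂ)}
    (hF : ∀ᵐ ω ∂μ', Tendsto (fun m : ℕ ↦ circleClip m (fun j ↦ y ω j,
      fun j ↦ limitCircle (y ω j) (u ω j))) atTop (𝓝 (F ω)))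
    {R : ℕ → ℕ} (hR : Tendsto R atTop atTop)
    (hG : ∀ᵐ ω ∂μ', Tendsto (fun m ↦ poissonWindow (intensity (y ω, u ω)) (w ω) (R m)) atTop
      (𝓝 (G ω))) :
    TendstoInDistribution (fun n ↦ modelXi Y x n) atTop
      (fun ω ↦ F ω * expMul (Complex.I * Real.pi * (1 - (∑' j, y ω j : ℝ))) * G ω)
      (fun n ↦ model μ uniformAngle n) μ' := by
  refine tendstoInDistribution_modelXi hc hp (hasSmallDivisors_uniformAngle hc hp hdecay)
    (fun m ↦ tendstoInDistribution_window hc hp hlim hw h0 m (R m)) ?_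
    fun A δ ε hδ hε ↦ hR.eventually (segProd_approx hc A hδ hε)
  filter_upwards [hF, hG] with ω h1 h2
  rw [mul_assoc (F ω)]
  exact h1.mul (h2.const_mul _)

end

/-! ### Infinite products -/

theorem exists_tendsto_prod_one_add {f : ℕ → C(ℂ, ℂ)}
    (hf : ∀ A : ℝ, ∃ b : ℕ → ℝ, Summable b ∧ ∀ᶠ n in atTop, ∀ z : ℂ, ‖z‖ ≤ A → ‖f n z‖ ≤ b n) :
    ∃ F : C(ℂ, ℂ), Tendsto (fun N ↦ ∏ i ∈ Finset.range N, (1 + f i)) atTop (𝓝 F) := by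
  have h : TendstoLocallyUniformly (fun N z ↦ ∏ i ∈ Finset.range N, (1 + f i z))
      (fun z ↦ ∏' i, (1 + f i z)) atTop := by
    rw [tendstoLocallyUniformly_iff_forall_isCompact]
    intro K hK
    obtain ⟨A, hA⟩ := hK.isBounded.exists_norm_le
    obtain ⟨b, hb, hfb⟩ := hf A
    refine (Summable.hasProdUniformlyOn_nat_one_add hK hb ?_
      fun n ↦ (f n).continuous.continuousOn).tendstoUniformlyOn_finsetRange
    filter_upwards [hfb] with n hn z hz using hn z (hA z hz)
  have hcont : Continuous fun z ↦ ∏' i, (1 + f i z) :=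
    h.continuous (Frequently.of_forall fun N ↦ by fun_prop)
  refine ⟨⟨_, hcont⟩, ContinuousMap.tendsto_iff_tendstoLocallyUniformly.2 ?_⟩
  simpa [ContinuousMap.prod_apply] using h

/-! ### The product over the circles -/

theorem uniformCircle_norm_one_sub_lt (δ : ℝ) :
    uniformCircle {z | ‖1 - z‖ < δ} ≤ ENNReal.ofReal δ := by
  have hm : Measurable fun t ↦ (rot t : ℂ) := measurable_circle_coe.comp measurable_rot
  have hS : MeasurableSet {z : ℂ | ‖1 - z‖ < δ} :=
    measurableSet_lt (by fun_prop) measurable_const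
  rw [← map_rot_uniformAngle, Measure.map_apply hm hS]
  have h1 : uniformAngle ((fun t ↦ (rot t : ℂ)) ⁻¹' {z | ‖1 - z‖ < δ})
      ≤ uniformAngle (Set.Icc (-(δ / 2)) (δ / 2)) := by
    refine measure_mono_ae ?_
    filter_upwards [ae_abs_le_uniformAngle, ae_rot_ne_one] with t ht h1 h2
    have h3 : ‖1 - (rot t : ℂ)‖ < δ := h2
    have ht0 : t ≠ 0 := fun h ↦ h1 (by rw [h, rot]; simp)
    have h4 := norm_rotInv_le ht ht0
    have h5 : 0 < ‖1 - (rot t : ℂ)‖ := by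
      rw [norm_pos_iff, sub_ne_zero, Ne, eq_comm, Circle.coe_eq_one]
      exact h1
    rw [rotInv, norm_inv, ← one_div, one_div_le_one_div h5 (by positivity)] at h4
    exact abs_le.1 (by linarith)
  refine h1.trans ((Measure.restrict_le_self _).trans ?_)
  rw [Real.volume_Icc, sub_neg_eq_add, add_halves]

theorem ae_uniformCircle : ∀ᵐ z ∂uniformCircle, ‖z‖ = 1 ∧ z ≠ 1 := by
  have hm : Measurable fun t ↦ (rot t : ℂ) := measurable_circle_coe.comp measurable_rot
  have hS : MeasurableSet {z : ℂ | ‖z‖ = 1 ∧ z ≠ 1} :=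
    (measurableSet_eq_fun measurable_norm measurable_const).inter (measurableSet_singleton 1).compl
  rw [← map_rot_uniformAngle]
  refine (ae_map_iff hm.aemeasurable hS).2 ?_
  filter_upwards [ae_rot_ne_one] with t ht
  exact ⟨Circle.norm_coe _, by rwa [Ne, Circle.coe_eq_one]⟩

section

variable {Ω : Type*} [MeasurableSpace Ω] {μ : Measure Ω}
  {p : Measure (ℕ → ℝ)} {y : Ω → ℕ → ℝ} {u : Ω → ℕ → ℂ}

theorem IsLimitData.measurable_u_apply (h : IsLimitData μ p y u) (j : ℕ) :
    Measurable fun ω ↦ u ω j := (measurable_pi_apply j).comp h.measurable_u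

/-- Borel–Cantelli: the probability of being closer to one than 4 / (j+1)² is at most this number,
which is summable. -/
theorem IsLimitData.ae_norm_one_sub (h : IsLimitData μ p y u) : ∀ᵐ ω ∂μ,
    (∀ j, ‖u ω j‖ = 1 ∧ u ω j ≠ 1) ∧ ∀ᶠ j : ℕ in atTop, 4 / ((j : ℝ) + 1) ^ 2 ≤ ‖1 - u ω j‖ := by
  have h1 : ∀ᵐ ω ∂μ, ∀ j, ‖u ω j‖ = 1 ∧ u ω j ≠ 1 := ae_all_iff.2 fun j ↦
    ae_of_ae_map (h.measurable_u_apply j).aemeasurable (by rw [h.law_u j]; exact ae_uniformCircle)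
  have h2 : ∑' j : ℕ, μ {ω | ‖1 - u ω j‖ < 4 / ((j : ℝ) + 1) ^ 2} ≠ ⊤ := by
    have hle : ∀ j : ℕ, μ {ω | ‖1 - u ω j‖ < 4 / ((j : ℝ) + 1) ^ 2}
        ≤ ENNReal.ofReal (4 / ((j : ℝ) + 1) ^ 2) := fun j ↦ by
      refine le_of_eq_of_le ?_ (uniformCircle_norm_one_sub_lt _)
      rw [← h.law_u j, Measure.map_apply (h.measurable_u_apply j)
        (measurableSet_lt (by fun_prop) measurable_const)]
      rfl
    refine ne_top_of_le_ne_top ?_ (ENNReal.tsum_le_tsum hle)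
    rw [← ENNReal.ofReal_tsum_of_nonneg (fun j ↦ by positivity) summable_four_div_sq]
    exact ENNReal.ofReal_ne_top
  filter_upwards [h1, ae_eventually_notMem h2] with ω h1 h2
  exact ⟨h1, h2.mono fun j hj ↦ not_lt.1 hj⟩

/-- The factors of the product over the circles, minus one. -/
noncomputable def circleFactor (t : ℝ) (v : ℂ) : C(ℂ, ℂ) :=
  ⟨fun z ↦ (Complex.exp (2 * Complex.I * Real.pi * z * t) - 1) / (1 - v), by fun_prop⟩

theorem prod_circleFactor_apply {y : ℕ → ℝ} {u : ℕ → ℂ} (hu : ∀ j, u j ≠ 1) (N : ℕ) (z : ℂ) :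
    (∏ j ∈ Finset.range N, (1 + circleFactor (y j) (u j))) z = circlePartialProd y u N z := by
  rw [ContinuousMap.prod_apply, circlePartialProd]
  refine Finset.prod_congr rfl fun j _ ↦ ?_
  have := sub_ne_zero.2 (hu j).symm
  simp only [ContinuousMap.add_apply, ContinuousMap.one_apply, circleFactor, ContinuousMap.coe_mk]
  field_simp
  ring

/-- The product over the circles converges, and is approximated by the truncated products. -/
theorem IsLimitData.exists_tendsto_circle (h : IsLimitData μ p y u) (hp : ∀ᵐ l ∂p, l ∈ nabla)
    (hdecay : HasExponentialDecay p) :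
    ∃ F : Ω → C(ℂ, ℂ), ∀ᵐ ω ∂μ,
      TendstoLocallyUniformly (circlePartialProd (y ω) (u ω)) (F ω) atTop ∧
      Tendsto (fun m : ℕ ↦ circleClip m (fun j ↦ y ω j, fun j ↦ limitCircle (y ω j) (u ω j))) atTop
        (𝓝 (F ω)) := by
  suffices hex : ∀ᵐ ω ∂μ, ∃ F : C(ℂ, ℂ),
      TendstoLocallyUniformly (circlePartialProd (y ω) (u ω)) F atTop ∧
      Tendsto (fun m : ℕ ↦ circleClip m (fun j ↦ y ω j, fun j ↦ limitCircle (y ω j) (u ω j))) atTop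
        (𝓝 F) from Filter.skolem.1 hex
  obtain ⟨r, hr, hdec⟩ := hdecay
  filter_upwards [h.ae_y hp, h.ae_y hdec, h.ae_norm_one_sub] with ω hy hyr hu
  obtain ⟨C, hC0, hC⟩ := hyr
  obtain ⟨F, hF⟩ := exists_tendsto_prod_one_add (f := fun j ↦ circleFactor (y ω j) (u ω j))
    fun A ↦ by
      set B := 2 * Real.pi * |A| * Real.exp (2 * Real.pi * |A|) with hB
      have hB0 : 0 ≤ B := by have := Real.pi_pos; positivity
      refine ⟨fun j ↦ ((j : ℝ) + 1) ^ 2 * (B * C * r ^ (j + 1)),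
        summable_sq_mul_geometric hr.1 hr.2 _, ?_⟩
      filter_upwards [hu.2] with j hj z hz
      have h1 := norm_exp_mul_sub_one_le (hz.trans (le_abs_self A)) (hy.1 j)
      have h2 : (1 : ℝ) / ((j : ℝ) + 1) ^ 2 ≤ ‖1 - u ω j‖ := le_trans (by gcongr; norm_num) hj
      simp only [circleFactor, ContinuousMap.coe_mk, norm_div]
      calc _ ≤ (B * y ω j) / (1 / ((j : ℝ) + 1) ^ 2) := by
            have := (hy.1 j).1
            gcongr
        _ = B * y ω j * ((j : ℝ) + 1) ^ 2 := by field_simp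
        _ ≤ B * (C * r ^ (j + 1)) * ((j : ℝ) + 1) ^ 2 := by gcongr; exact hC j
        _ = _ := by ring
  have hne : ∀ j, u ω j ≠ 1 := fun j ↦ (hu.1 j).2
  refine ⟨F, ?_, hF.congr' ?_⟩
  · rw [ContinuousMap.tendsto_iff_tendstoLocallyUniformly] at hF
    refine hF.congr fun N z ↦ prod_circleFactor_apply hne N z
  -- For m large no factor is clipped: for j ≥ J because (j+1)² ≤ (m+1)³, and for the finitely many
  -- j < J because the clipping level tends to zero.
  · obtain ⟨J, hJ⟩ := eventually_atTop.1 hu.2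
    have hsmall : ∀ᶠ m : ℕ in atTop, ∀ j < J, 1 / (((m + 1) ^ 3 : ℕ) : ℝ) ≤ ‖1 - u ω j‖ := by
      have ht : Tendsto (fun m : ℕ ↦ 1 / (((m + 1) ^ 3 : ℕ) : ℝ)) atTop (𝓝 0) :=
        (tendsto_one_div_atTop_nhds_zero_nat (𝕜 := ℝ)).comp
          ((tendsto_pow_atTop three_ne_zero).comp (tendsto_add_atTop_nat 1))
      have := (Set.finite_lt_nat J).eventually_all (l := atTop)
        (p := fun j (m : ℕ) ↦ 1 / (((m + 1) ^ 3 : ℕ) : ℝ) ≤ ‖1 - u ω j‖)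
      refine this.2 fun j _ ↦ ht.eventually_le_const ?_
      exact norm_pos_iff.2 (sub_ne_zero.2 (hne j).symm)
    filter_upwards [hsmall] with m hm
    ext z
    rw [ContinuousMap.prod_apply, circleClip_apply, Finset.prod_range]
    refine Finset.prod_congr rfl fun j _ ↦ ?_
    simp only [ContinuousMap.add_apply, ContinuousMap.one_apply, circleFactor, ContinuousMap.coe_mk]
    by_cases h0 : y ω j = 0
    · simp [h0]
    · have e : ((limitCircle (y ω j) (u ω j) : Circle) : ℂ) = u ω j := by
        rw [limitCircle, if_neg h0]
        exact congrArg (fun v : Circle ↦ (v : ℂ))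
          (toCircle_coe ⟨u ω j, mem_sphere_zero_iff_norm.2 (hu.1 j).1⟩)
      rw [e, clippedInv_eq_inv (by positivity), div_eq_mul_inv]
      by_cases hjJ : (j : ℕ) < J
      · exact hm j hjJ
      · refine le_trans ?_ (hJ j (not_lt.1 hjJ))
        have hjm : (j : ℝ) + 1 ≤ m + 1 := by
          have := j.2.le
          have : ((j : ℕ) : ℝ) ≤ m := by exact_mod_cast this
          linarith
        push_cast
        have h3 : ((j : ℝ) + 1) ^ 2 ≤ ((m : ℝ) + 1) ^ 3 := by
          calc ((j : ℝ) + 1) ^ 2 ≤ ((m : ℝ) + 1) ^ 2 := by gcongr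
            _ ≤ ((m : ℝ) + 1) ^ 3 := pow_le_pow_right₀ (by linarith [Nat.cast_nonneg (α := ℝ) m])
              (by norm_num)
        have h4 := one_div_le_one_div_of_le (by positivity) h3
        refine h4.trans ?_
        gcongr
        norm_num

end

/-! ### Deviations of the counts of a Poisson process -/

/-- The variance of a Poisson law. The recursion P(N+1) (N+1) = r P(N) gives the factorial moments r
and r². -/
theorem hasSum_sq_poisson (r : NNReal) :
    HasSum (fun N : ℕ ↦ Real.exp (-r) * r ^ N / N.factorial * ((N : ℝ) - r) ^ 2) r := by
  set P : ℕ → ℝ := fun N ↦ Real.exp (-r) * r ^ N / N.factorial with hP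
  have h0 : HasSum P 1 := hasSum_one_poissonMeasure r
  have hsucc : ∀ N : ℕ, P (N + 1) * ((N : ℝ) + 1) = r * P N := fun N ↦ by
    simp only [hP, Nat.factorial_succ, pow_succ]
    push_cast
    field_simp
  have h1 : HasSum (fun N : ℕ ↦ P N * N) r := by
    have h := h0.mul_left (r : ℝ)
    have e : (fun N ↦ (r : ℝ) * P N) = fun N ↦ P (N + 1) * ((N + 1 : ℕ) : ℝ) := funext fun N ↦ by
      rw [← hsucc]; push_cast; ring
    rw [e] at h
    simpa using (hasSum_nat_add_iff (f := fun N : ℕ ↦ P N * N) 1).1 h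
  have h2 : HasSum (fun N : ℕ ↦ P N * (N * ((N : ℝ) - 1))) (r * r) := by
    have h := h1.mul_left (r : ℝ)
    have e : (fun N : ℕ ↦ (r : ℝ) * (P N * N))
        = fun N ↦ P (N + 1) * (((N + 1 : ℕ) : ℝ) * (((N + 1 : ℕ) : ℝ) - 1)) := funext fun N ↦ by
      rw [← mul_assoc, ← hsucc]; push_cast; ring
    rw [e] at h
    simpa using (hasSum_nat_add_iff (f := fun N : ℕ ↦ P N * (N * ((N : ℝ) - 1))) 1).1 h
  have h := (h2.add (h1.mul_left (1 - 2 * (r : ℝ)))).add (h0.mul_left ((r : ℝ) ^ 2))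
  convert h using 1
  · ext N; ring
  · ring

theorem poissonMeasure_le_abs_sub (r : NNReal) {s : ℝ} (hs : 0 < s) :
    poissonMeasure r {N : ℕ | s ≤ |(N : ℝ) - r|} ≤ ENNReal.ofReal (r / s ^ 2) := by
  have h := hasSum_sq_poisson r
  have hint : Integrable (fun N : ℕ ↦ ((N : ℝ) - r) ^ 2) (poissonMeasure r) := by
    rw [integrable_poissonMeasure_iff]
    refine h.summable.congr fun N ↦ ?_
    rw [Real.norm_of_nonneg (sq_nonneg _)]
  have hi : ∫ N : ℕ, ((N : ℝ) - r) ^ 2 ∂poissonMeasure r = r := by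
    rw [integral_poissonMeasure]
    exact h.tsum_eq
  have h1 := mul_meas_ge_le_integral_of_nonneg (ae_of_all _ fun N : ℕ ↦ sq_nonneg ((N : ℝ) - r))
    hint (s ^ 2)
  rw [hi] at h1
  have e : {N : ℕ | s ≤ |(N : ℝ) - r|} = {N : ℕ | s ^ 2 ≤ ((N : ℝ) - r) ^ 2} := by
    ext N
    simp only [Set.mem_ofPred_eq]
    rw [← sq_abs ((N : ℝ) - r)]
    exact (pow_le_pow_iff_left₀ hs.le (abs_nonneg _) two_ne_zero).symm
  rw [e, ← ofReal_measureReal]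
  exact ENNReal.ofReal_le_ofReal ((le_div_iff₀' (by positivity)).2 h1)

section

variable {Ω γ : Type*} [MeasurableSpace Ω] [MeasurableSpace γ] {μ : Measure Ω}
  [IsProbabilityMeasure μ] {G : Ω → γ} {c : γ → ℝ} {w : Ω → ℤ → ℝ}

theorem IsPoissonPoints.measure_le_abs_sub (h : IsPoissonPoints μ G c w) (hG : Measurable G)
    (hc : Measurable c) (hc01 : ∀ᵐ ω ∂μ, c (G ω) ∈ Set.Icc (0 : ℝ) 1) {B : Set ℝ}
    (hB : MeasurableSet B) (hBb : Bornology.IsBounded B) {s : ℝ} (hs : 0 < s) :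
    μ {ω | s ≤ |(poissonCount G c w B ω : ℝ) - c (G ω) * volume.real B|}
      ≤ ENNReal.ofReal (volume.real B / s ^ 2) := by
  have : IsProbabilityMeasure (μ.map G) := Measure.isProbabilityMeasure_map hG.aemeasurable
  have hmap := h.map_counts hG hc (B := fun _ : Fin 1 ↦ B) (fun _ ↦ hB) (fun _ ↦ hBb)
    fun i j hij ↦ absurd (Subsingleton.elim i j) hij
  let S : Set (γ × (Fin 1 → ℕ)) := {q | s ≤ |(q.2 0 : ℝ) - c q.1 * volume.real B|}
  have hN : Measurable fun q : γ × (Fin 1 → ℕ) ↦ (q.2 0 : ℝ) :=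
    measurable_from_nat.comp ((measurable_pi_apply 0).comp measurable_snd)
  have hS : MeasurableSet S := measurableSet_le measurable_const
    (hN.sub ((hc.comp measurable_fst).mul_const _)).abs
  have hm : Measurable fun ω ↦ (G ω, fun _ : Fin 1 ↦ poissonCount G c w B ω) :=
    hG.prodMk (measurable_pi_lambda _ fun _ ↦ h.measurable_poissonCount hG hc hB)
  have e : μ {ω | s ≤ |(poissonCount G c w B ω : ℝ) - c (G ω) * volume.real B|}
      = μ.map (fun ω ↦ (G ω, fun _ : Fin 1 ↦ poissonCount G c w B ω)) S := by
    rw [Measure.map_apply hm hS]; rfl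
  rw [e, hmap, Measure.compProd_apply hS]
  have hc01' : ∀ᵐ g ∂μ.map G, c g ∈ Set.Icc (0 : ℝ) 1 :=
    (ae_map_iff hG.aemeasurable (hc measurableSet_Icc)).2 hc01
  refine (lintegral_mono_ae (g := fun _ ↦ ENNReal.ofReal (volume.real B / s ^ 2)) ?_).trans (by simp)
  filter_upwards [hc01'] with g hg
  rw [poissonKernel_apply]
  set r := (c g).toNNReal * (volume B).toNNReal with hr
  have hrv : (r : ℝ) = c g * volume.real B := by
    rw [hr, NNReal.coe_mul, Real.coe_toNNReal _ hg.1]; rfl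
  have h1 := (measurePreserving_eval (fun _ : Fin 1 ↦ poissonMeasure r) 0).measure_preimage
    (s := {N : ℕ | s ≤ |(N : ℝ) - r|}) (MeasurableSet.of_discrete).nullMeasurableSet
  have h2 : Prod.mk g ⁻¹' S = Function.eval (0 : Fin 1) ⁻¹' {N : ℕ | s ≤ |(N : ℝ) - r|} := by
    ext N
    simp only [S, Set.mem_preimage, Set.mem_ofPred_eq, hrv, Function.eval]
  rw [h2]
  refine (le_of_eq h1).trans ((poissonMeasure_le_abs_sub r hs).trans (ENNReal.ofReal_le_ofReal ?_))
  rw [hrv]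
  gcongr
  exact mul_le_of_le_one_left measureReal_nonneg hg.2

/-- The origin has Lebesgue measure zero, so the count there is almost surely zero. The labelling
alone would allow w 0 = 0. -/
theorem IsPoissonPoints.ae_ne_zero (h : IsPoissonPoints μ G c w) (hG : Measurable G)
    (hc : Measurable c) (hc01 : ∀ᵐ ω ∂μ, c (G ω) ∈ Set.Icc (0 : ℝ) 1) :
    ∀ᵐ ω ∂μ, 0 < c (G ω) → ∀ k, w ω k ≠ 0 := by
  have h1 := h.measure_le_abs_sub hG hc hc01 (measurableSet_singleton 0)
    Bornology.isBounded_singleton one_pos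
  have hv : volume.real {(0 : ℝ)} = 0 := by simp [measureReal_def]
  rw [hv] at h1
  simp only [mul_zero, sub_zero, zero_div, ENNReal.ofReal_zero, nonpos_iff_eq_zero] at h1
  have h2 : ∀ᵐ ω ∂μ, ¬ (1 : ℝ) ≤ |(poissonCount G c w {0} ω : ℝ)| := by
    rw [ae_iff]
    simpa [Nat.one_le_iff_ne_zero] using h1
  filter_upwards [h2, h.ae_encard_ne_top hG hc (measurableSet_singleton 0)
    Bornology.isBounded_singleton] with ω h2 h3 hpos k hk
  have hfin : (w ω ⁻¹' {0}).Finite := Set.encard_ne_top_iff.1 (h3 hpos)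
  have h4 : 0 < (w ω ⁻¹' {0}).ncard := (Set.ncard_pos hfin).2 ⟨k, hk⟩
  refine h2 ?_
  rw [poissonCount, if_pos hpos, Nat.abs_cast]
  exact_mod_cast h4

/-- The numbers of points at distance at most `m ^ 4` of the origin. -/
theorem IsPoissonPoints.ae_eventually_counts (h : IsPoissonPoints μ G c w) (hG : Measurable G)
    (hc : Measurable c) (hc01 : ∀ᵐ ω ∂μ, c (G ω) ∈ Set.Icc (0 : ℝ) 1) {B : ℕ → Set ℝ}
    (hB : ∀ m, MeasurableSet (B m)) (hBb : ∀ m, Bornology.IsBounded (B m))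
    (hv : ∀ m : ℕ, volume.real (B m) = (m : ℝ) ^ 4) :
    ∀ᵐ ω ∂μ, ∀ᶠ m : ℕ in atTop, |(poissonCount G c w (B m) ω : ℝ) - c (G ω) * (m : ℝ) ^ 4|
      ≤ (m : ℝ) ^ 3 := by
  have h1 : ∑' m : ℕ, μ {ω | ((m + 1 : ℕ) : ℝ) ^ 3 ≤ |(poissonCount G c w (B (m + 1)) ω : ℝ)
      - c (G ω) * ((m + 1 : ℕ) : ℝ) ^ 4|} ≠ ⊤ := by
    -- Chebyshev's inequality gives m⁴ / (m³)² = m⁻², which is summable: this is the reason for the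
    -- scale m⁴.
    have hle : ∀ m : ℕ, μ {ω | ((m + 1 : ℕ) : ℝ) ^ 3 ≤ |(poissonCount G c w (B (m + 1)) ω : ℝ)
        - c (G ω) * ((m + 1 : ℕ) : ℝ) ^ 4|} ≤ ENNReal.ofReal (4 / ((m : ℝ) + 1) ^ 2) := fun m ↦ by
      have h2 := h.measure_le_abs_sub hG hc hc01 (hB (m + 1)) (hBb (m + 1))
        (s := ((m + 1 : ℕ) : ℝ) ^ 3) (by positivity)
      rw [hv] at h2
      refine h2.trans (ENNReal.ofReal_le_ofReal ?_)
      push_cast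
      rw [show ((m : ℝ) + 1) ^ 4 / (((m : ℝ) + 1) ^ 3) ^ 2 = 1 / ((m : ℝ) + 1) ^ 2 by field_simp]
      gcongr
      norm_num
    refine ne_top_of_le_ne_top ?_ (ENNReal.tsum_le_tsum hle)
    rw [← ENNReal.ofReal_tsum_of_nonneg (fun j ↦ by positivity) summable_four_div_sq]
    exact ENNReal.ofReal_ne_top
  filter_upwards [ae_eventually_notMem h1] with ω hω
  rw [← map_add_atTop_eq_nat 1, eventually_map]
  exact hω.mono fun m hm ↦ (not_le.1 hm).le

end

/-! ### The product over the points of a Poisson process -/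

theorem exists_between_counts {n : ℕ → ℕ} (hn : Tendsto n atTop atTop) {M k : ℕ} (hM : n M ≤ k) :
    ∃ m ≥ M, n m ≤ k ∧ k + 1 ≤ n (m + 1) := by
  have hex : ∃ j, k < n (M + j) := by
    obtain ⟨m, hm, hmM⟩ := ((hn.eventually_gt_atTop k).and (eventually_ge_atTop M)).exists
    exact ⟨m - M, by rwa [Nat.add_sub_cancel' hmM]⟩
  classical
  have h0 : Nat.find hex ≠ 0 := fun h ↦ by
    have := Nat.find_spec hex
    rw [h, add_zero] at this
    omega
  obtain ⟨j, hj⟩ := Nat.exists_eq_succ_of_ne_zero h0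
  refine ⟨M + j, by omega, not_lt.1 (Nat.find_min hex (by omega)), ?_⟩
  have := Nat.find_spec hex
  rw [hj] at this
  exact this

/-- Points with regular counts are regularly spaced. -/
theorem exists_eventually_abs_inv_sub_le {c : ℝ} (hc0 : 0 < c) (hc1 : c ≤ 1) {n : ℕ → ℕ} {v : ℕ → ℝ}
    (hn : ∀ᶠ m : ℕ in atTop, |(n m : ℝ) - c * (m : ℝ) ^ 4| ≤ 2 * (m : ℝ) ^ 3)
    (h1 : ∀ m k : ℕ, n m ≤ k → (m : ℝ) ^ 4 ≤ v k)
    (h2 : ∀ m k : ℕ, k + 1 ≤ n m → v k ≤ (m : ℝ) ^ 4) :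
    ∃ K > 0, ∀ᶠ k : ℕ in atTop, 0 < v k ∧ |1 / v k - c / k| ≤ K / (k : ℝ) ^ (5 / 4 : ℝ) := by
  obtain ⟨M₀, hM₀⟩ := eventually_atTop.1 hn
  obtain ⟨M₁, hM₁⟩ := exists_nat_ge (4 / c)
  have hlow : ∀ m : ℕ, max M₀ (max M₁ 1) ≤ m → 1 ≤ (m : ℝ) ∧ 4 * (m : ℝ) ^ 3 ≤ c * (m : ℝ) ^ 4 := by
    intro m hm
    have hm1 : (1 : ℝ) ≤ m := by exact_mod_cast (le_max_right _ _).trans ((le_max_right _ _).trans hm)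
    have hm2 : (M₁ : ℝ) ≤ m := by exact_mod_cast (le_max_left _ _).trans ((le_max_right _ _).trans hm)
    have h3 : 4 ≤ c * m := (div_le_iff₀' hc0).1 (hM₁.trans hm2)
    have h4 := mul_le_mul_of_nonneg_right h3 (by positivity : (0 : ℝ) ≤ (m : ℝ) ^ 3)
    exact ⟨hm1, by linarith [show c * (m : ℝ) ^ 4 = c * m * (m : ℝ) ^ 3 by ring]⟩
  have hninf : Tendsto n atTop atTop := by
    have ht : Tendsto (fun m ↦ (n m : ℝ)) atTop atTop := by
      refine tendsto_atTop_mono' atTop ?_ tendsto_natCast_atTop_atTop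
      filter_upwards [eventually_ge_atTop (max M₀ (max M₁ 1))] with m hm
      obtain ⟨h3, h4⟩ := hlow m hm
      have h5 := (abs_le.1 (hM₀ m ((le_max_left _ _).trans hm))).1
      have : (m : ℝ) ≤ (m : ℝ) ^ 3 := le_self_pow₀ h3 (by norm_num)
      linarith
    exact tendsto_natCast_atTop_iff.1 ht
  -- With t the integer scale of k: |k - c v_k| ≤ 31 t³, v_k ≥ t⁴ and k ≥ c t⁴ / 2 bound the
  -- difference by 62 / (c t⁵), and k^(5/4) ≤ 243 t⁵.
  refine ⟨62 * 243 / c, by positivity, ?_⟩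
  filter_upwards [eventually_ge_atTop (n (max M₀ (max M₁ 1)))] with k hk
  -- The index k lies between two consecutive counts, so v_k lies between m⁴ and (m+1)⁴ while k is
  -- close to c m⁴.
  obtain ⟨m, hmM, hmk, hkm⟩ := exists_between_counts hninf hk
  obtain ⟨hx1, hx4⟩ := hlow m hmM
  have e1 := (abs_le.1 (hM₀ m ((le_max_left _ _).trans hmM))).1
  have e2 := (abs_le.1 (hM₀ (m + 1) (((le_max_left _ _).trans hmM).trans (Nat.le_succ m)))).2
  have e3 := h1 m k hmk
  have e4 := h2 (m + 1) k hkm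
  have hmk' : (n m : ℝ) ≤ k := by exact_mod_cast hmk
  have hkm' : (k : ℝ) + 1 ≤ n (m + 1) := by exact_mod_cast hkm
  push_cast at e2 e4
  set t : ℝ := (m : ℝ) with ht
  have ht0 : 0 < t := by linarith
  have hp3 : 0 < t ^ 3 := by positivity
  have hp1 : t ≤ t ^ 3 := le_self_pow₀ hx1 (by norm_num)
  have hp2 : t ^ 2 ≤ t ^ 3 := pow_le_pow_right₀ hx1 (by norm_num)
  have hp0 : 1 ≤ t ^ 3 := one_le_pow₀ hx1
  have hp4 : t ^ 3 ≤ t ^ 4 := pow_le_pow_right₀ hx1 (by norm_num)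
  have e5 : (t + 1) ^ 4 ≤ t ^ 4 + 15 * t ^ 3 := by nlinarith
  have e6 : (t + 1) ^ 3 ≤ 8 * t ^ 3 := by nlinarith
  have hk1 : c * t ^ 4 / 2 ≤ k := by linarith
  have hk0 : (0 : ℝ) < k := lt_of_lt_of_le (by positivity) hk1
  have hv0 : 0 < v k := lt_of_lt_of_le (by positivity) e3
  refine ⟨hv0, ?_⟩
  have hdiff : |(k : ℝ) - c * v k| ≤ 31 * t ^ 3 := by
    have h3 := mul_le_mul_of_nonneg_left e3 hc0.le
    have h4 := mul_le_mul_of_nonneg_left (e4.trans e5) hc0.le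
    have h5 := mul_le_mul_of_nonneg_left e5 hc0.le
    have h6 := mul_le_of_le_one_left hp3.le hc1
    rw [abs_le]
    constructor <;> linarith
  have hkt : (k : ℝ) ^ (5 / 4 : ℝ) ≤ 243 * t ^ 5 := by
    have h3 : (k : ℝ) ≤ (3 * t) ^ 4 := by
      have := mul_le_of_le_one_left (show 0 ≤ (t + 1) ^ 4 by positivity) hc1
      nlinarith
    calc (k : ℝ) ^ (5 / 4 : ℝ) ≤ ((3 * t) ^ 4) ^ (5 / 4 : ℝ) :=
          Real.rpow_le_rpow hk0.le h3 (by norm_num)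
      _ = (3 * t) ^ 5 := by
          rw [← Real.rpow_natCast, ← Real.rpow_mul (by positivity), ← Real.rpow_natCast]
          norm_num
      _ = 243 * t ^ 5 := by ring
  have e7 : 1 / v k - c / k = (k - c * v k) / (v k * k) := by field_simp
  rw [e7, abs_div, abs_of_pos (mul_pos hv0 hk0)]
  calc |(k : ℝ) - c * v k| / (v k * k) ≤ 31 * t ^ 3 / (t ^ 4 * (c * t ^ 4 / 2)) := by gcongr
    _ = 62 * 243 / c / (243 * t ^ 5) := by field_simp; ring
    _ ≤ _ := by gcongr

/-- A finite set of integers closed downwards is an initial segment, determined by its cardinality.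
This converts counts in intervals into bounds on labelled points. -/
theorem lt_ncard_iff {P : ℕ → Prop} (hP : ∀ k j, j ≤ k → P k → P j) (hfin : {k | P k}.Finite)
    (k : ℕ) : P k ↔ k < {k | P k}.ncard := by
  constructor
  · intro h
    have h1 := Set.ncard_le_ncard (s := (Finset.range (k + 1) : Set ℕ)) (t := {k | P k})
      (fun j hj ↦ hP k j (by simpa [Nat.lt_succ_iff] using hj) h) hfin
    rw [Set.ncard_coe_finset, Finset.card_range] at h1
    omega
  · intro h
    by_contra hk
    have h1 := Set.ncard_le_ncard (s := {k | P k}) (t := (Finset.range k : Set ℕ))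
      (fun j hj ↦ by
        simp only [Finset.coe_range, Set.mem_Iio]
        by_contra! hkj
        exact hk (hP j k hkj hj)) (Finset.finite_toSet _)
    rw [Set.ncard_coe_finset, Finset.card_range] at h1
    omega

theorem tendsto_one_of_norm_sub_le {R : ℕ → C(ℂ, ℂ)}
    (h : ∀ A : ℝ, ∃ b : ℕ → ℝ, Tendsto b atTop (𝓝 0) ∧
      ∀ᶠ m in atTop, ∀ z : ℂ, ‖z‖ ≤ A → ‖R m z - 1‖ ≤ b m) : Tendsto R atTop (𝓝 1) := by
  rw [ContinuousMap.tendsto_iff_forall_isCompact_tendstoUniformlyOn]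
  intro K hK
  obtain ⟨A, hA⟩ := hK.isBounded.exists_norm_le
  obtain ⟨b, hb, hRb⟩ := h A
  rw [Metric.tendstoUniformlyOn_iff]
  intro ε hε
  filter_upwards [hRb, hb.eventually_lt_const hε] with m h1 h2 z hz
  rw [dist_comm, dist_eq_norm]
  exact (h1 z (hA z hz)).trans_lt h2

theorem poissonPartialProd_eq (w : ℤ → ℝ) (N : ℕ) (z : ℂ) :
    poissonPartialProd w N z = ∏ k ∈ Finset.Icc (-(N : ℤ)) N, linFactor (w k) z := by
  induction N with
  | zero => simp [poissonPartialProd, linFactor_apply]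
  | succ N ih =>
    have e : Finset.Icc (-((N + 1 : ℕ) : ℤ)) ((N + 1 : ℕ) : ℤ)
        = insert ((N + 1 : ℕ) : ℤ) (insert (-((N + 1 : ℕ) : ℤ)) (Finset.Icc (-(N : ℤ)) N)) := by
      ext k
      simp only [Finset.mem_Icc, Finset.mem_insert]
      omega
    rw [e, Finset.prod_insert, Finset.prod_insert, ← ih, poissonPartialProd, poissonPartialProd,
      Finset.prod_Icc_succ_top (by omega), linFactor_apply, linFactor_apply]
    · ring
    · simp only [Finset.mem_Icc]; omega
    · simp only [Finset.mem_Icc, Finset.mem_insert]; omega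

theorem poissonPartialProd_eq_range (w : ℤ → ℝ) (N : ℕ) (z : ℂ) :
    poissonPartialProd w N z = (linFactor (w 0) * ∏ i ∈ Finset.range N,
      (1 + (linFactor (w (i + 1 : ℕ)) * linFactor (w (-(i + 1 : ℕ))) - 1))) z := by
  simp only [add_sub_cancel, ContinuousMap.mul_apply, ContinuousMap.prod_apply]
  induction N with
  | zero => simp [poissonPartialProd, linFactor_apply]
  | succ N ih =>
    rw [Finset.prod_range_succ, ← mul_assoc, ← ih, poissonPartialProd, poissonPartialProd,
      Finset.prod_Icc_succ_top (by omega), linFactor_apply, linFactor_apply, mul_assoc]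

theorem one_div_le_of_abs_sub_le {c K v : ℝ} {k : ℕ} (hc1 : c ≤ 1) (hK : 0 < K) (hk : 1 ≤ k)
    (h : |1 / v - c / k| ≤ K / (k : ℝ) ^ (5 / 4 : ℝ)) : 1 / v ≤ (1 + K) / k := by
  have hk1 : (1 : ℝ) ≤ k := by exact_mod_cast hk
  have h1 : (k : ℝ) ≤ (k : ℝ) ^ (5 / 4 : ℝ) := Real.self_le_rpow_of_one_le hk1 (by norm_num)
  have h2 : K / (k : ℝ) ^ (5 / 4 : ℝ) ≤ K / k := by gcongr
  have h3 : c / k ≤ 1 / k := by gcongr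
  have := (abs_le.1 h).2
  rw [add_div]
  linarith

/-- (1 - z/s)(1 + z/t) - 1 = -z (1/s - 1/t) - z² / (s t): the pairing cancels the leading parts of
1/s and 1/t, and the last term is of order k⁻². -/
theorem norm_linFactor_mul_sub_one_le {s t K A : ℝ} {k : ℕ} (hK : 0 < K) (hk : 1 ≤ k)
    (hs : 0 < s) (ht : 0 < t) (hs1 : 1 / s ≤ K / k) (ht1 : 1 / t ≤ K / k)
    (hst : |1 / s - 1 / t| ≤ K / (k : ℝ) ^ (5 / 4 : ℝ)) {z : ℂ} (hz : ‖z‖ ≤ A) :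
    ‖(linFactor s * linFactor (-t) - 1) z‖ ≤ (A * K + A ^ 2 * K ^ 2) * (1 / (k : ℝ) ^ (5 / 4 : ℝ)) := by
  have hk1 : (1 : ℝ) ≤ k := by exact_mod_cast hk
  have hA : 0 ≤ A := (norm_nonneg z).trans hz
  have e : (linFactor s * linFactor (-t) - 1) z
      = -z * ((1 / s - 1 / t : ℝ) : ℂ) - z ^ 2 * ((1 / s * (1 / t) : ℝ) : ℂ) := by
    simp only [ContinuousMap.sub_apply, ContinuousMap.mul_apply, ContinuousMap.one_apply,
      linFactor_apply]
    push_cast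
    have h1 : (s : ℂ) ≠ 0 := by exact_mod_cast hs.ne'
    have h2 : (t : ℂ) ≠ 0 := by exact_mod_cast ht.ne'
    field_simp
    ring
  have h1 : (k : ℝ) ^ (5 / 4 : ℝ) ≤ (k : ℝ) ^ 2 := by
    rw [← Real.rpow_two]
    exact Real.rpow_le_rpow_of_exponent_le hk1 (by norm_num)
  rw [e]
  refine (norm_sub_le _ _).trans ?_
  rw [norm_mul, norm_mul, norm_neg, norm_pow, Complex.norm_real, Complex.norm_real,
    Real.norm_eq_abs, Real.norm_of_nonneg (by positivity)]
  calc ‖z‖ * |1 / s - 1 / t| + ‖z‖ ^ 2 * (1 / s * (1 / t))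
      ≤ A * (K / (k : ℝ) ^ (5 / 4 : ℝ)) + A ^ 2 * (K / k * (K / k)) := by gcongr
    _ = A * (K / (k : ℝ) ^ (5 / 4 : ℝ)) + A ^ 2 * (K ^ 2 / (k : ℝ) ^ 2) := by ring
    _ ≤ A * (K / (k : ℝ) ^ (5 / 4 : ℝ)) + A ^ 2 * (K ^ 2 / (k : ℝ) ^ (5 / 4 : ℝ)) := by gcongr
    _ = _ := by ring

theorem norm_prod_linFactor_sub_one_le {S : Finset ℤ} {w : ℤ → ℝ} {A ρ : ℝ}
    (h : ∀ k ∈ S, 1 / |w k| ≤ ρ) {z : ℂ} (hz : ‖z‖ ≤ A) :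
    ‖(∏ k ∈ S, linFactor (w k)) z - 1‖ ≤ Real.exp (A * (S.card * ρ)) - 1 := by
  have hA : 0 ≤ A := (norm_nonneg z).trans hz
  have h1 := Finset.norm_prod_one_add_sub_one_le S fun k ↦ -(z / w k)
  rw [ContinuousMap.prod_apply]
  simp only [linFactor_apply, sub_eq_add_neg (1 : ℂ)] at h1 ⊢
  refine h1.trans (sub_le_sub_right (Real.exp_le_exp.2 ?_) 1)
  calc ∑ k ∈ S, ‖-(z / (w k : ℂ))‖ ≤ ∑ _k ∈ S, A * ρ := by
        refine Finset.sum_le_sum fun k hk ↦ ?_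
        rw [norm_neg, norm_div, Complex.norm_real, Real.norm_eq_abs, div_eq_mul_one_div]
        have := h k hk
        gcongr
    _ = A * (S.card * ρ) := by rw [Finset.sum_const, nsmul_eq_mul]; ring

section

variable {c : ℝ} {w : ℤ → ℝ}

theorem lt_iff_lt_ncard (hw : StrictMono w) (hneg : w (-1) < 0) (hpos : 0 ≤ w 0) {t : ℝ}
    (hfin : (w ⁻¹' Set.Ico (-t) t).Finite) (ht : 0 ≤ t) (k : ℕ) :
    w k < t ↔ k < (w ⁻¹' Set.Ico 0 t).ncard := by
  have hnn : ∀ j : ℕ, 0 ≤ w j := fun j ↦ hpos.trans (hw.monotone (by omega))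
  have e : w ⁻¹' Set.Ico 0 t = (fun j : ℕ ↦ (j : ℤ)) '' {j : ℕ | w j < t} := by
    ext i
    simp only [Set.mem_preimage, Set.mem_Ico, Set.mem_image, Set.mem_ofPred_eq]
    constructor
    · rintro ⟨h1, h2⟩
      have hi : 0 ≤ i := by
        by_contra! h
        exact absurd h1 (not_le.2 ((hw.monotone (by omega : i ≤ -1)).trans_lt hneg))
      exact ⟨i.toNat, by rwa [Int.toNat_of_nonneg hi], Int.toNat_of_nonneg hi⟩
    · rintro ⟨j, hj, rfl⟩
      exact ⟨hnn j, hj⟩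
  have hfin' : {j : ℕ | w j < t}.Finite := by
    refine Set.Finite.of_finite_image (f := fun j : ℕ ↦ (j : ℤ)) ?_ Nat.cast_injective.injOn
    rw [← e]
    exact hfin.subset (Set.preimage_mono (Set.Ico_subset_Ico_left (by linarith)))
  rw [e, Set.ncard_image_of_injective _ Nat.cast_injective]
  exact lt_ncard_iff (P := fun j : ℕ ↦ w j < t)
    (fun k j hjk h ↦ (hw.monotone (by exact_mod_cast hjk)).trans_lt h) hfin' k

theorem neg_le_iff_lt_ncard (hw : StrictMono w) (hneg : w (-1) < 0) (hpos : 0 ≤ w 0) {t : ℝ}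
    (hfin : (w ⁻¹' Set.Ico (-t) t).Finite) (ht : 0 ≤ t) (k : ℕ) :
    -t ≤ w (-(k + 1 : ℕ)) ↔ k < (w ⁻¹' Set.Ico (-t) 0).ncard := by
  have hinj : Function.Injective fun j : ℕ ↦ -((j + 1 : ℕ) : ℤ) := fun i j h ↦ by
    simp only at h; omega
  have e : w ⁻¹' Set.Ico (-t) 0 = (fun j : ℕ ↦ -((j + 1 : ℕ) : ℤ)) ''
      {j : ℕ | -t ≤ w (-(j + 1 : ℕ))} := by
    ext i
    simp only [Set.mem_preimage, Set.mem_Ico, Set.mem_image, Set.mem_ofPred_eq]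
    constructor
    · rintro ⟨h1, h2⟩
      have hi : i < 0 := by
        by_contra! h
        exact absurd h2 (not_lt.2 (hpos.trans (hw.monotone h)))
      have hi' : -(((-i - 1).toNat + 1 : ℕ) : ℤ) = i := by omega
      exact ⟨(-i - 1).toNat, by rwa [hi'], hi'⟩
    · rintro ⟨j, hj, rfl⟩
      exact ⟨hj, (hw.monotone (by omega)).trans_lt hneg⟩
  have hfin' : {j : ℕ | -t ≤ w (-(j + 1 : ℕ))}.Finite := by
    refine Set.Finite.of_finite_image (f := fun j : ℕ ↦ -((j + 1 : ℕ) : ℤ)) ?_ hinj.injOn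
    rw [← e]
    exact hfin.subset (Set.preimage_mono (Set.Ico_subset_Ico_right ht))
  rw [e, Set.ncard_image_of_injective _ hinj]
  exact lt_ncard_iff (P := fun j : ℕ ↦ -t ≤ w (-(j + 1 : ℕ)))
    (fun k j hjk h ↦ h.trans (hw.monotone (by push_cast; omega))) hfin' k

theorem poissonWindow_eq (hc0 : 0 < c) (hw : StrictMono w) (hneg : w (-1) < 0) (hpos : 0 ≤ w 0)
    {m : ℕ} (hfin : (w ⁻¹' Set.Ico (-(m : ℝ)) m).Finite) :
    poissonWindow c w m = ∏ k ∈ Finset.Ico (-((w ⁻¹' Set.Ico (-(m : ℝ)) 0).ncard : ℤ))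
      (w ⁻¹' Set.Ico 0 (m : ℝ)).ncard, linFactor (w k) := by
  have hm : (0 : ℝ) ≤ m := by positivity
  suffices h : w ⁻¹' Set.Ico (-(m : ℝ)) m =
      (Finset.Ico (-((w ⁻¹' Set.Ico (-(m : ℝ)) 0).ncard : ℤ)) (w ⁻¹' Set.Ico 0 (m : ℝ)).ncard :
        Set ℤ) by
    rw [poissonWindow, if_pos hc0, h, finprod_mem_coe_finset]
  ext k
  rw [Finset.coe_Ico, Set.mem_preimage, Set.mem_Ico, Set.mem_Ico]
  rcases le_or_gt 0 k with hk | hk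
  · obtain ⟨j, rfl⟩ := Int.eq_ofNat_of_zero_le hk
    have h1 := lt_iff_lt_ncard hw hneg hpos hfin hm j
    have h2 : 0 ≤ w j := hpos.trans (hw.monotone hk)
    constructor
    · rintro ⟨_, h⟩
      exact ⟨by omega, by exact_mod_cast h1.1 h⟩
    · rintro ⟨_, h⟩
      exact ⟨by linarith, h1.2 (by exact_mod_cast h)⟩
  · obtain ⟨j, rfl⟩ : ∃ j : ℕ, k = -((j + 1 : ℕ) : ℤ) := ⟨(-k - 1).toNat, by omega⟩
    have h1 := neg_le_iff_lt_ncard hw hneg hpos hfin hm j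
    have h2 : w (-((j + 1 : ℕ) : ℤ)) < 0 := (hw.monotone (by omega)).trans_lt hneg
    constructor
    · rintro ⟨h, _⟩
      have := h1.1 h
      exact ⟨by omega, by omega⟩
    · rintro ⟨h, _⟩
      exact ⟨h1.2 (by omega), by linarith⟩

/-- Both 1 / w_k and -1 / w_{-k} are c / k + O(k^{-5/4}), so the paired factors form an absolutely
convergent product. The window of radius m⁴ contains the labels of [-nm, np), which is a symmetric
range plus at most 3 m³ labels of modulus at least c m⁴ / 2. The corresponding factors are 1 +
O(m⁻⁴), so their product tends to one and the window products have the same limit as the symmetric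
ones. -/
theorem exists_tendsto_poissonWindow (hc0 : 0 < c) (hc1 : c ≤ 1) (hw : StrictMono w)
    (hneg : w (-1) < 0) (hpos : 0 ≤ w 0)
    (hfin : ∀ m : ℕ, (w ⁻¹' Set.Ico (-(m : ℝ)) m).Finite)
    (hp : ∀ᶠ m : ℕ in atTop,
      |((w ⁻¹' Set.Ico 0 (((m ^ 4 : ℕ) : ℝ))).ncard : ℝ) - c * (m : ℝ) ^ 4| ≤ (m : ℝ) ^ 3)
    (hn : ∀ᶠ m : ℕ in atTop,
      |((w ⁻¹' Set.Ico (-((m ^ 4 : ℕ) : ℝ)) 0).ncard : ℝ) - c * (m : ℝ) ^ 4| ≤ (m : ℝ) ^ 3) :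
    ∃ G : C(ℂ, ℂ), TendstoLocallyUniformly (poissonPartialProd w) G atTop ∧
      Tendsto (fun m : ℕ ↦ poissonWindow c w (m ^ 4)) atTop (𝓝 G) := by
  set np : ℕ → ℕ := fun m ↦ (w ⁻¹' Set.Ico 0 (((m ^ 4 : ℕ) : ℝ))).ncard with hnp
  set nm : ℕ → ℕ := fun m ↦ (w ⁻¹' Set.Ico (-((m ^ 4 : ℕ) : ℝ)) 0).ncard with hnm
  have hP : ∀ m k : ℕ, w k < (m : ℝ) ^ 4 ↔ k < np m := fun m k ↦ by
    rw [hnp, ← lt_iff_lt_ncard hw hneg hpos (hfin (m ^ 4)) (by positivity)]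
    push_cast
    rfl
  have hM : ∀ m k : ℕ, -(m : ℝ) ^ 4 ≤ w (-(k + 1 : ℕ)) ↔ k < nm m := fun m k ↦ by
    rw [hnm, ← neg_le_iff_lt_ncard hw hneg hpos (hfin (m ^ 4)) (by positivity)]
    push_cast
    rfl
  obtain ⟨K, hK, hKv⟩ := exists_eventually_abs_inv_sub_le hc0 hc1 (n := np) (v := fun k ↦ w k)
    (hp.mono fun m h ↦ h.trans (by linarith [show (0 : ℝ) ≤ (m : ℝ) ^ 3 by positivity]))
    (fun m k h ↦ not_lt.1 fun h' ↦ absurd ((hP m k).1 h') (not_lt.2 h))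
    fun m k h ↦ ((hP m k).2 h).le
  -- The negative points are labelled from -1, so k = 0 is an extra index, with value -w 0 ≤ 0. It
  -- shifts the counts by one, which the tolerance 2 m³ absorbs.
  obtain ⟨K', hK', hKv'⟩ := exists_eventually_abs_inv_sub_le hc0 hc1 (n := fun m ↦ nm m + 1)
    (v := fun k ↦ -w (-(k : ℤ))) (by
      filter_upwards [hn, eventually_ge_atTop 1] with m h hm
      have h1 : (1 : ℝ) ≤ (m : ℝ) ^ 3 := one_le_pow₀ (by exact_mod_cast hm)
      rw [abs_le] at h ⊢
      push_cast
      constructor <;> linarith [h.1, h.2])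
    (fun m k h ↦ by
      obtain ⟨j, rfl⟩ : ∃ j, k = j + 1 := ⟨k - 1, by omega⟩
      have h1 := not_le.1 fun h' ↦ absurd ((hM m j).1 h') (by omega)
      linarith)
    fun m k h ↦ by
      rcases Nat.eq_zero_or_pos k with rfl | hk
      · have : (0 : ℝ) ≤ (m : ℝ) ^ 4 := by positivity
        simpa using by linarith
      · obtain ⟨j, rfl⟩ : ∃ j, k = j + 1 := ⟨k - 1, by omega⟩
        have := (hM m j).2 (by omega)
        linarith
  set K₀ := 2 + K + K' with hK₀
  have hreg : ∀ᶠ k : ℕ in atTop, 1 ≤ k ∧ 0 < w k ∧ 0 < -w (-(k : ℤ)) ∧ 1 / w k ≤ K₀ / k ∧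
      1 / -w (-(k : ℤ)) ≤ K₀ / k ∧
      |1 / w k - 1 / -w (-(k : ℤ))| ≤ K₀ / (k : ℝ) ^ (5 / 4 : ℝ) := by
    filter_upwards [hKv, hKv', eventually_ge_atTop 1] with k h1 h2 hk
    refine ⟨hk, h1.1, h2.1, (one_div_le_of_abs_sub_le hc1 hK hk h1.2).trans (by gcongr; linarith),
      (one_div_le_of_abs_sub_le hc1 hK' hk h2.2).trans (by gcongr; linarith), ?_⟩
    have e := abs_sub_le (1 / w k) (c / k) (1 / -w (-(k : ℤ)))
    rw [abs_sub_comm (c / (k : ℝ))] at e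
    refine (e.trans (add_le_add h1.2 h2.2)).trans ?_
    rw [← add_div]
    gcongr
    linarith
  obtain ⟨H, hH⟩ := exists_tendsto_prod_one_add
    (f := fun i : ℕ ↦ linFactor (w (i + 1 : ℕ)) * linFactor (w (-(i + 1 : ℕ))) - 1) fun A ↦ by
      refine ⟨fun i ↦ (A * K₀ + A ^ 2 * K₀ ^ 2) * (1 / ((i + 1 : ℕ) : ℝ) ^ (5 / 4 : ℝ)), ?_, ?_⟩
      · exact ((summable_nat_add_iff 1).2
          (Real.summable_one_div_nat_rpow.2 (by norm_num))).mul_left _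
      · filter_upwards [(tendsto_add_atTop_nat 1).eventually hreg] with i hi z hz
        obtain ⟨h1, h2, h3, h4, h5, h6⟩ := hi
        have := norm_linFactor_mul_sub_one_le (by positivity) h1 h2 h3 h4 h5 h6 hz
        rwa [neg_neg] at this
  have hPP := hH.const_mul (linFactor (w 0))
  refine ⟨linFactor (w 0) * H, ?_, ?_⟩
  · rw [ContinuousMap.tendsto_iff_tendstoLocallyUniformly] at hPP
    exact hPP.congr fun N z ↦ (poissonPartialProd_eq_range w N z).symm
  -- The largest symmetric range [-N, N] contained in [-nm, np).
  set N : ℕ → ℕ := fun m ↦ min (np m - 1) (nm m) with hN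
  set S : ℕ → Finset ℤ := fun m ↦ Finset.Ico (-(nm m : ℤ)) (np m) with hS
  obtain ⟨m₀, hm₀⟩ := exists_nat_ge (4 / c)
  have hbig : ∀ᶠ m : ℕ in atTop, 1 ≤ np m ∧ c * (m : ℝ) ^ 4 / 2 ≤ N m ∧
      ((S m \ Finset.Icc (-(N m : ℤ)) (N m)).card : ℝ) ≤ 3 * (m : ℝ) ^ 3 := by
    filter_upwards [hp, hn, eventually_ge_atTop 1, eventually_ge_atTop m₀] with m h1 h2 hm1 hmm
    have hm1' : (1 : ℝ) ≤ m := by exact_mod_cast hm1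
    have h3 : 1 ≤ (m : ℝ) ^ 3 := one_le_pow₀ hm1'
    have h4 : 4 * (m : ℝ) ^ 3 ≤ c * (m : ℝ) ^ 4 := by
      have h5 : 4 ≤ c * m := (div_le_iff₀' hc0).1 (hm₀.trans (by exact_mod_cast hmm))
      have h6 := mul_le_mul_of_nonneg_right h5 (by positivity : (0 : ℝ) ≤ (m : ℝ) ^ 3)
      linarith [show c * (m : ℝ) ^ 4 = c * m * (m : ℝ) ^ 3 by ring]
    rw [abs_le] at h1 h2
    change _ ≤ (np m : ℝ) - _ ∧ (np m : ℝ) - _ ≤ _ at h1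
    change _ ≤ (nm m : ℝ) - _ ∧ (nm m : ℝ) - _ ≤ _ at h2
    have hnp1 : 1 ≤ np m := by
      have : (0 : ℝ) < np m := by linarith
      exact_mod_cast this
    refine ⟨hnp1, ?_, ?_⟩
    · rw [hN, Nat.cast_min, Nat.cast_sub hnp1]
      push_cast
      exact le_min (by linarith) (by linarith)
    · have hsub : Finset.Icc (-(N m : ℤ)) (N m) ⊆ S m := fun k hk ↦ by
        simp only [hS, hN, Finset.mem_Icc, Finset.mem_Ico] at hk ⊢
        omega
      rw [Finset.card_sdiff_of_subset hsub]
      simp only [hS, Int.card_Ico, Int.card_Icc]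
      rcases le_total (np m - 1) (nm m) with h | h
      · have e : ((np m : ℤ) - -(nm m : ℤ)).toNat - ((N m : ℤ) + 1 - -(N m : ℤ)).toNat
            = nm m + 1 - np m := by simp only [hN, min_eq_left h]; omega
        rw [e, Nat.cast_sub (by omega)]
        push_cast
        linarith
      · have e : ((np m : ℤ) - -(nm m : ℤ)).toNat - ((N m : ℤ) + 1 - -(N m : ℤ)).toNat
            = np m - 1 - nm m := by simp only [hN, min_eq_right h]; omega
        rw [e, Nat.cast_sub h, Nat.cast_sub hnp1]
        push_cast
        linarith
  have hNinf : Tendsto N atTop atTop := by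
    have ht : Tendsto (fun m ↦ (N m : ℝ)) atTop atTop := by
      refine tendsto_atTop_mono' atTop (hbig.mono fun m h ↦ h.2.1) ?_
      exact (((tendsto_pow_atTop four_ne_zero).comp tendsto_natCast_atTop_atTop).const_mul_atTop
        hc0).atTop_div_const two_pos
    exact tendsto_natCast_atTop_iff.1 ht
  have hrest : Tendsto (fun m ↦ ∏ k ∈ S m \ Finset.Icc (-(N m : ℤ)) (N m), linFactor (w k)) atTop
      (𝓝 1) := by
    refine tendsto_one_of_norm_sub_le fun A ↦
      ⟨fun m ↦ Real.exp (|A| * (6 * K₀ / c) / m) - 1, ?_, ?_⟩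
    · have := (tendsto_const_div_atTop_nhds_zero_nat (|A| * (6 * K₀ / c))).rexp
      simpa using this.sub_const 1
    · obtain ⟨k₀, hk₀⟩ := eventually_atTop.1 hreg
      filter_upwards [hbig, hNinf.eventually_ge_atTop k₀, eventually_ge_atTop 1] with m h1 h2 hm z hz
      have hm' : (0 : ℝ) < m := by exact_mod_cast hm
      have hN0 : (0 : ℝ) < N m := lt_of_lt_of_le (by positivity) h1.2.1
      refine (norm_prod_linFactor_sub_one_le (ρ := K₀ / N m) (fun k hk ↦ ?_)
        (hz.trans (le_abs_self A))).trans (sub_le_sub_right (Real.exp_le_exp.2 ?_) 1)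
      · have hk2 := (Finset.mem_sdiff.1 hk).2
        rw [Finset.mem_Icc, not_and_or, not_le, not_le] at hk2
        have hkN : N m ≤ k.natAbs := by omega
        obtain ⟨_, h3, h4, h5, h6, _⟩ := hk₀ k.natAbs (h2.trans hkN)
        have hle : K₀ / (k.natAbs : ℝ) ≤ K₀ / N m := by gcongr
        rcases Int.natAbs_eq k with hk' | hk'
        · rw [hk', abs_of_pos h3]
          exact h5.trans hle
        · rw [hk', abs_of_neg (neg_pos.1 h4)]
          exact h6.trans hle
      · rw [mul_div_assoc]
        gcongr
        calc ((S m \ Finset.Icc (-(N m : ℤ)) (N m)).card : ℝ) * (K₀ / N m)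
            ≤ 3 * (m : ℝ) ^ 3 * (K₀ / (c * (m : ℝ) ^ 4 / 2)) := by
              have := h1.2.1
              have := h1.2.2
              gcongr
          _ = _ := by field_simp; ring
  have hprod := hrest.mul (hPP.comp hNinf)
  rw [one_mul] at hprod
  refine hprod.congr' ?_
  filter_upwards [hbig] with m hm
  have hsub : Finset.Icc (-(N m : ℤ)) (N m) ⊆ S m := fun k hk ↦ by
    have := hm.1
    simp only [hS, hN, Finset.mem_Icc, Finset.mem_Ico] at hk ⊢
    omega
  rw [poissonWindow_eq hc0 hw hneg hpos (hfin (m ^ 4)), ← Finset.prod_sdiff hsub]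
  congr 1
  ext z
  rw [Function.comp, ← poissonPartialProd_eq_range, poissonPartialProd_eq, ContinuousMap.prod_apply]

end

/-! ### Almost sure convergence of the product over the Poisson points -/

section

variable {Ω : Type*} [MeasurableSpace Ω] {μ : Measure Ω}
  {p : Measure (ℕ → ℝ)} {y : Ω → ℕ → ℝ} {u : Ω → ℕ → ℂ} {w : Ω → ℤ → ℝ}

theorem IsLimitData.ae_intensity_mem (h : IsLimitData μ p y u) (hp : ∀ᵐ l ∂p, l ∈ nabla) :
    ∀ᵐ ω ∂μ, intensity (y ω, u ω) ∈ Set.Icc (0 : ℝ) 1 := by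
  filter_upwards [h.ae_y hp] with ω hω
  exact ⟨sub_nonneg.2 hω.2.2.2, sub_le_self _ (tsum_nonneg fun j ↦ (hω.1 j).1)⟩

theorem IsPoissonPoints.exists_tendsto [IsProbabilityMeasure μ] (h : IsLimitData μ p y u) (hp : ∀ᵐ l ∂p, l ∈ nabla)
    (hw : IsPoissonPoints μ (fun ω ↦ (y ω, u ω)) intensity w) :
    ∃ G : Ω → C(ℂ, ℂ), ∀ᵐ ω ∂μ,
      ((∑' j, y ω j < 1 → TendstoLocallyUniformly (poissonPartialProd (w ω)) (G ω) atTop) ∧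
        (∑' j, y ω j = 1 → G ω = 1)) ∧
      Tendsto (fun m : ℕ ↦ poissonWindow (intensity (y ω, u ω)) (w ω) (m ^ 4)) atTop
        (𝓝 (G ω)) := by
  have hG : Measurable fun ω ↦ (y ω, u ω) := h.measurable_y.prodMk h.measurable_u
  have hc := measurable_intensity
  have hc01 := h.ae_intensity_mem hp
  suffices hex : ∀ᵐ ω ∂μ, ∃ G : C(ℂ, ℂ),
      ((∑' j, y ω j < 1 → TendstoLocallyUniformly (poissonPartialProd (w ω)) G atTop) ∧
        (∑' j, y ω j = 1 → G = 1)) ∧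
      Tendsto (fun m : ℕ ↦ poissonWindow (intensity (y ω, u ω)) (w ω) (m ^ 4)) atTop (𝓝 G)
    from Filter.skolem.1 hex
  filter_upwards [hc01, hw.labelling,
    ae_all_iff.2 fun m : ℕ ↦ hw.ae_encard_ne_top hG hc (B := Set.Ico (-(m : ℝ)) m)
      measurableSet_Ico (Metric.isBounded_Ico _ _),
    hw.ae_eventually_counts hG hc hc01 (B := fun m ↦ Set.Ico 0 ((m ^ 4 : ℕ) : ℝ))
      (fun _ ↦ measurableSet_Ico) (fun _ ↦ Metric.isBounded_Ico _ _) (fun m ↦ by simp),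
    hw.ae_eventually_counts hG hc hc01 (B := fun m ↦ Set.Ico (-((m ^ 4 : ℕ) : ℝ)) 0)
      (fun _ ↦ measurableSet_Ico) (fun _ ↦ Metric.isBounded_Ico _ _) (fun m ↦ by simp)]
    with ω h01 hlab hfin hpc hnc
  rcases h01.1.eq_or_lt with h0 | h0
  · have hs : ∑' j, y ω j = 1 := (sub_eq_zero.1 h0.symm).symm
    refine ⟨1, ⟨fun h ↦ absurd hs h.ne, fun _ ↦ rfl⟩, ?_⟩
    simp only [poissonWindow, ← h0, lt_irrefl, if_false, tendsto_const_nhds]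
  · obtain ⟨hmono, hneg, hpos⟩ := hlab h0
    simp only [poissonCount, if_pos h0] at hpc hnc
    obtain ⟨G, hG1, hG2⟩ := exists_tendsto_poissonWindow h0 h01.2 hmono hneg hpos
      (fun m ↦ Set.encard_ne_top_iff.1 (hfin m h0)) hpc hnc
    exact ⟨G, ⟨fun _ ↦ hG1, fun hs ↦ absurd (sub_pos.1 h0) hs.not_lt⟩, hG2⟩

end

end RandomPerm

theorem theorem2 {Ω Ω' : Type*} [MeasurableSpace Ω] [MeasurableSpace Ω']
    (μ : Measure Ω) [IsProbabilityMeasure μ] (μ' : Measure Ω') [IsProbabilityMeasure μ']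
    -- a distribution on `∇` with exponential decay
    (p : Measure (ℕ → ℝ)) (hp : ∀ᵐ l ∂p, l ∈ RandomPerm.nabla)
    (hdecay : RandomPerm.HasExponentialDecay p)
    -- the coupling that generates the permutations `circlePerm (Y ω) (x ω) n`
    (Y : Ω → ℕ → ℝ) (x : Ω → ℕ → RandomPerm.Point) (hcoupling : RandomPerm.IsCoupling μ p Y x)
    -- the variables entering the limits
    (y : Ω' → ℕ → ℝ) (u : Ω' → ℕ → ℂ) (hlim : RandomPerm.IsLimitData μ' p y u) :
    -- the first product converges to a random continuous function `F`
    ∃ F : Ω' → C(ℂ, ℂ),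
      (∀ᵐ ω ∂μ', TendstoLocallyUniformly
        (RandomPerm.circlePartialProd (y ω) (u ω)) (F ω) atTop) ∧
      -- (i)
      (∀ M : (n : ℕ) → Ω → Matrix (Fin n) (Fin n) ℂ,
        (∀ n, RandomPerm.IsRandomModifiedPermMatrix μ
          (fun ω ↦ RandomPerm.circlePerm (Y ω) (x ω) n) (M n)) →
        ∀ w : Ω' → ℤ → ℝ,
          RandomPerm.IsPoissonPoints μ' (fun ω ↦ (y ω, u ω)) (fun g ↦ 1 - ∑' j, g.1 j) w →
        ∃ G : Ω' → C(ℂ, ℂ),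
          (∀ᵐ ω ∂μ', (∑' j, y ω j < 1 → TendstoLocallyUniformly
              (RandomPerm.poissonPartialProd (w ω)) (G ω) atTop) ∧
            (∑' j, y ω j = 1 → G ω = 1)) ∧
          TendstoInDistribution (fun n ω ↦ RandomPerm.xiTilde (M n ω)) atTop
            (fun ω ↦ F ω *
              RandomPerm.expMul (Complex.I * Real.pi * (1 - (∑' j, y ω j : ℝ))) * G ω)
            (fun _ ↦ μ) μ') ∧
      -- (ii)
      ((∀ᵐ l ∂p, ∀ k, ∑ j ∈ Finset.range k, l j < 1) →
        ∀ α : ℝ, Irrational α → RandomPerm.IsFiniteType α →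
          TendstoInDistribution
            (fun n ω ↦ RandomPerm.xiShift α
              (RandomPerm.permMatrix (RandomPerm.circlePerm (Y ω) (x ω) n))) atTop
            (fun ω ↦ F ω *
              RandomPerm.expMul (Complex.I * Real.pi * (1 - (∑' j, y ω j : ℝ)) *
                (1 - Complex.I / (Real.tan (Real.pi * α) : ℝ))))
            (fun _ ↦ μ) μ') := by
  obtain ⟨F, hF⟩ := hlim.exists_tendsto_circle hp hdecay
  refine ⟨F, hF.mono fun ω h ↦ h.1, fun M hM w hw ↦ ?_, fun hlt α hα hft ↦ ?_⟩
  · obtain ⟨G, hG⟩ := RandomPerm.IsPoissonPoints.exists_tendsto hlim hp hw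
    refine ⟨G, hG.mono fun ω h ↦ h.1, RandomPerm.tendstoInDistribution_xiTilde_of_model hcoupling
      -- The windows grow along m⁴, the scale on which the counts are controlled almost surely.
      (RandomPerm.tendstoInDistribution_modelXi_uniformAngle hcoupling hp hdecay hlim hw ?_
        (hF.mono fun ω h ↦ h.2) (R := fun m ↦ m ^ 4) (tendsto_pow_atTop four_ne_zero)
        (hG.mono fun ω h ↦ h.2)) hM⟩
    exact hw.ae_ne_zero (hlim.measurable_y.prodMk hlim.measurable_u)
      RandomPerm.measurable_intensity (hlim.ae_intensity_mem hp)
  · exact RandomPerm.tendstoInDistribution_xiShift_of_model hcoupling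
      (RandomPerm.tendstoInDistribution_modelXi_dirac hcoupling hp hdecay hlim hlt hα hft
        (hF.mono fun ω h ↦ h.2))
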